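/- Let $\mathbb{T}=\mathbb{R}/\mathbb{Z}\cong[0,1]$. Let $\gamma_n>0$, $\gamma_n\to\infty$, and put $p_n(r)=r^{\gamma_n}$, $\lambda_n(r)=r^2p_n'(r)$ and $\pi_n(r)=\frac{\gamma_n}{\gamma_n+1}r^{\gamma_n+1}$ (so $\pi_n'(r)=rp_n'(r)$). A global regular solution of $$\partial_t\rho_n+\partial_x(\rho_nu_n)=0,\qquad \partial_t(\rho_nu_n)+\partial_x(\rho_nu_n^2)-\partial_x(\lambda_n(\rho_n)\partial_xu_n)=0\quad\text{in }\mathbb{T}\times[0,\infty) \tag{1}$$ is a classical solution $(\rho_n,u_n)$ with $\rho_n\in C([0,T];H^4(\mathbb{T}))$ and $u_n\in C([0,T];H^4(\mathbb{T}))\cap L^2(0,T;H^5(\mathbb{T}))$ for every $T>0$. Write $w_n=u_n+\partial_xp_n(\rho_n)$, $w_n^0=u_n^0+\partial_xp_n(\rho_n^0)$ and $\pi_n=\pi_n(\rho_n)$. Let $C$, $\underline\rho^0>0$ and $\hat\rho<1$ be constants. Then for every $T>0$ there are constants $\underline\rho_T>0$ and $K_T$, depending only on $C,\underline\rho^0,\hat\rho$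 and $T$, such that the following holds for every such sequence $(\gamma_n)$, all initial data $(\rho_n^0,u_n^0)\in H^4(\mathbb{T})\times H^4(\mathbb{T})$ with $$\underline\rho^0\le\rho_n^0(x)\le1+\tfrac1{\gamma_n}\ \ (x\in\mathbb{T}),\qquad \big\|\sqrt{\rho_n^0}\,u_n^0\big\|_{L^2}+\big\|\sqrt{\rho_n^0}\,w_n^0\big\|_{L^2}\le C,$$ $$\operatorname*{ess\,sup}_{x\in\mathbb{T}}\partial_xw_n^0+\|\partial_xw_n^0\|_{L^2}\le C,\qquad \int_{\mathbb{T}}\rho_n^0\,dx\le\hat\rho,$$ for all $n$, and the global regular solutions $(\rho_n,u_n)$ of (1) with initial data $(\rho_n^0,u_n^0)$. (i) For every $T>0$ and all sufficiently large $n$, $$\rho_n(x,t)\ge\underline\rho_T\ \ (x\in\mathbb{T},\,t\in[0,T]),\qquad \|w_n\|_{L^\infty(0,T;H^1(\mathbb{T}))}\le K_T,\qquad \|\pi_n\|_{L^\infty(0,T;H^1(\mathbb{T}))}\le K_T .$$ (ii) Suppose in addition that $\rho_n^0\rightharpoonup\rho^0$ and $w_n^0\rightharpoonup w^0$ weakly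 in $L^1(\mathbb{T})$. Then there are a subsequence (not relabelled) and functions $\rho,w,\pi$ on $\mathbb{T}\times[0,\infty)$ such that for every $T>0$: * $\rho_n\rightharpoonup^*\rho$ weakly-$*$ in $L^\infty((0,T)\times\mathbb{T})$; $w_n\rightharpoonup^*w$ and $\pi_n\rightharpoonup^*\pi$ weakly-$*$ in $L^\infty(0,T;H^1(\mathbb{T}))$; and $w_n\to w$ uniformly on $\mathbb{T}\times[0,T]$; * for all $\phi\in C^\infty([0,T]\times\mathbb{T})$ and $t\in[0,T]$, $$-\int_0^t\!\!\int_{\mathbb{T}}\rho\,\partial_t\phi\,dxds+\int_{\mathbb{T}}\big(\rho\phi(x,t)-\rho^0(x)\phi(x,0)\big)dx-\int_0^t\!\!\int_{\mathbb{T}}\pi\,\partial_x^2\phi\,dxds=\int_0^t\!\!\int_{\mathbb{T}}\rho w\,\partial_x\phi\,dxds,$$ $$-\int_0^t\!\!\int_{\mathbb{T}}\rho w\,\partial_t\phi\,dxds+\int_{\mathbb{T}}\big(\rho w\phi(x,t)-\rho^0w^0(x)\phi(x,0)\big)dx+\int_0^t\!\!\int_{\mathbb{T}}(w\,\partial_x\pi-\rho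 w^2)\partial_x\phi\,dxds=0;$$ * $\underline\rho_T\le\rho\le1$, $(1-\rho)\pi=0$ and $\pi\ge0$ almost everywhere in $(0,T)\times\mathbb{T}$ (the bounds on $\rho(\cdot,t)$ hold for every $t\in[0,T]$); * $\rho\in C_{\mathrm{weak}}([0,T];L^p(\mathbb{T}))\cap L^\infty((0,T)\times\mathbb{T})$ for every $p\in[1,\infty)$, $w\in C([0,T];H^1(\mathbb{T}))$ and $\pi\in L^\infty(0,T;H^1(\mathbb{T}))$. -/

import Mathlib

open MeasureTheory Set Filter Topology
open scoped ContDiff ENNReal NNReal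

namespace AwRascle

noncomputable section

/-! Functions on the torus `𝕋 = ℝ / ℤ` (identified with `[0,1]`) are represented by 1-periodic
functions on `ℝ`, and space-time functions by `f : ℝ → ℝ → ℝ`, `f t x`. -/

/-- Lebesgue measure on one period cell, i.e. on the torus. -/
def torusMeasure : Measure ℝ := volume.restrict (Ioc (0 : ℝ) 1)

/-- Lebesgue measure on the time interval `(0,T)`. -/
def timeMeasure (T : ℝ) : Measure ℝ := volume.restrict (Ioc (0 : ℝ) T)

/-- Lebesgue measure on `(0,T) × 𝕋`. -/
def cylMeasure (T : ℝ) : Measure (ℝ × ℝ) := (timeMeasure T).prod torusMeasure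

/-! ### Sobolev spaces on the torus -/

/-- `g` is the weak derivative of `f` on the torus: integration by parts holds against all smooth
periodic functions (so there are no boundary terms at the end points of the period cell). -/
structure IsWeakDeriv (f g : ℝ → ℝ) : Prop where
  integrable_left : Integrable f torusMeasure
  integrable_right : Integrable g torusMeasure
  parts : ∀ φ : ℝ → ℝ, ContDiff ℝ ∞ φ → Function.Periodic φ 1 →
    ∫ x, f x * deriv φ x ∂torusMeasure = - ∫ x, g x * φ x ∂torusMeasure

/-- `D 0 = f, D 1, …, D k` are the weak derivatives of `f`, and all of them are in `L²(𝕋)`. -/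
structure IsSobolevJet (k : ℕ) (f : ℝ → ℝ) (D : ℕ → ℝ → ℝ) : Prop where
  zero : D 0 = f
  memLp : ∀ j ≤ k, MemLp (D j) 2 torusMeasure
  step : ∀ j < k, IsWeakDeriv (D j) (D (j + 1))

/-- `f ∈ H^k(𝕋)`. -/
def MemSobolev (k : ℕ) (f : ℝ → ℝ) : Prop :=
  Function.Periodic f 1 ∧ ∃ D : ℕ → ℝ → ℝ, IsSobolevJet k f D

/-- `f ∈ C([0,T]; H^k(𝕋))`: at each time `f t ∈ H^k(𝕋)`, and all the derivatives up to order `k`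
are continuous in time with values in `L²(𝕋)`. -/
def ContSobolev (k : ℕ) (T : ℝ) (f : ℝ → ℝ → ℝ) : Prop :=
  (∀ t ∈ Icc 0 T, Function.Periodic (f t) 1) ∧
  ∃ D : ℕ → ℝ → ℝ → ℝ,
    (∀ t ∈ Icc 0 T, IsSobolevJet k (f t) (fun j => D j t)) ∧
    ∀ j ≤ k, ∀ t₀ ∈ Icc 0 T,
      Tendsto (fun t => eLpNorm (fun x => D j t x - D j t₀ x) 2 torusMeasure)
        (𝓝[Icc 0 T] t₀) (𝓝 0)

/-- `f ∈ L²(0,T; H^k(𝕋))`: for almost every time `f t ∈ H^k(𝕋)`, and all the derivatives up to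
order `k` are in `L²((0,T) × 𝕋)`. -/
def SqIntegrableSobolev (k : ℕ) (T : ℝ) (f : ℝ → ℝ → ℝ) : Prop :=
  ∃ D : ℕ → ℝ → ℝ → ℝ,
    (∀ᵐ t ∂timeMeasure T, IsSobolevJet k (f t) (fun j => D j t)) ∧
    ∀ j ≤ k, MemLp (Function.uncurry (D j)) 2 (cylMeasure T)

/-- `g = ∂ₓ f` weakly in space, for (jointly measurable) functions on `(0,T) × 𝕋`. -/
structure IsSpaceDeriv (T : ℝ) (f g : ℝ → ℝ → ℝ) : Prop where
  meas_left : AEStronglyMeasurable (Function.uncurry f) (cylMeasure T)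
  meas_right : AEStronglyMeasurable (Function.uncurry g) (cylMeasure T)
  weakDeriv : ∀ᵐ t ∂timeMeasure T, IsWeakDeriv (f t) (g t)

/-- `f ∈ L^∞(0,T; H¹(𝕋))`, where `g = ∂ₓ f`. -/
def MemLinftyH1 (T : ℝ) (f g : ℝ → ℝ → ℝ) : Prop :=
  IsSpaceDeriv T f g ∧
  ∃ K : ℝ≥0, ∀ᵐ t ∂timeMeasure T,
    eLpNorm (f t) 2 torusMeasure ≤ K ∧ eLpNorm (g t) 2 torusMeasure ≤ K

/-- `f ∈ C_weak([0,T]; L^p(𝕋))`. -/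
def ContWeakLp (p : ℝ≥0∞) (T : ℝ) (f : ℝ → ℝ → ℝ) : Prop :=
  (∀ t ∈ Icc 0 T, MemLp (f t) p torusMeasure) ∧
  ∀ q : ℝ≥0∞, p.HolderConjugate q → ∀ ψ : ℝ → ℝ, MemLp ψ q torusMeasure →
    ContinuousOn (fun t => ∫ x, f t x * ψ x ∂torusMeasure) (Icc 0 T)

/-- The `L²(𝕋)` norm of a (continuous) function. -/
def l2Norm (f : ℝ → ℝ) : ℝ := Real.sqrt (∫ x, f x ^ 2 ∂torusMeasure)

/-- The `H¹(𝕋)` norm of a `C¹` function. -/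
def h1Norm (f : ℝ → ℝ) : ℝ := Real.sqrt (∫ x, (f x ^ 2 + deriv f x ^ 2) ∂torusMeasure)

/-! ### Modes of convergence -/

/-- Weak convergence in `L¹(𝕋)`. -/
def TendstoWeakL1 (F : ℕ → ℝ → ℝ) (f : ℝ → ℝ) : Prop :=
  (∀ n, Integrable (F n) torusMeasure) ∧ Integrable f torusMeasure ∧
  ∀ ψ : ℝ → ℝ, MemLp ψ ⊤ torusMeasure →
    Tendsto (fun n => ∫ x, F n x * ψ x ∂torusMeasure) atTop
      (𝓝 (∫ x, f x * ψ x ∂torusMeasure))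

/-- Weak-* convergence in `L^∞((0,T) × 𝕋)`. -/
def TendstoWeakStarLinfty (T : ℝ) (F : ℕ → ℝ → ℝ → ℝ) (f : ℝ → ℝ → ℝ) : Prop :=
  ∀ g : ℝ × ℝ → ℝ, Integrable g (cylMeasure T) →
    Tendsto (fun n => ∫ z, F n z.1 z.2 * g z ∂cylMeasure T) atTop
      (𝓝 (∫ z, f z.1 z.2 * g z ∂cylMeasure T))

/-- Weak-* convergence in `L^∞(0,T; L²(𝕋))`, tested with all of `L¹(0,T; L²(𝕋))`. -/
def TendstoWeakStarLinftyL2 (T : ℝ) (F : ℕ → ℝ → ℝ → ℝ) (f : ℝ → ℝ → ℝ) : Prop :=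
  ∀ g : ℝ → ℝ → ℝ, AEStronglyMeasurable (Function.uncurry g) (cylMeasure T) →
    ∫⁻ t, eLpNorm (g t) 2 torusMeasure ∂timeMeasure T < ⊤ →
    Tendsto (fun n => ∫ z, F n z.1 z.2 * g z.1 z.2 ∂cylMeasure T) atTop
      (𝓝 (∫ z, f z.1 z.2 * g z.1 z.2 ∂cylMeasure T))

/-- Weak-* convergence in `L^∞(0,T; H¹(𝕋))`: the functions and their space derivatives converge
weakly-* in `L^∞(0,T; L²(𝕋))` (every element of `L¹(0,T; H⁻¹(𝕋))` is of the form `g + ∂ₓ h` with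
`g, h ∈ L¹(0,T; L²(𝕋))`). -/
def TendstoWeakStarLinftyH1 (T : ℝ) (F : ℕ → ℝ → ℝ → ℝ) (f : ℝ → ℝ → ℝ) : Prop :=
  ∃ (F' : ℕ → ℝ → ℝ → ℝ) (f' : ℝ → ℝ → ℝ),
    (∀ n, MemLinftyH1 T (F n) (F' n)) ∧ MemLinftyH1 T f f' ∧
    TendstoWeakStarLinftyL2 T F f ∧ TendstoWeakStarLinftyL2 T F' f'

/-! ### The system for fixed `γ` -/

/-- The offset potential `p(r) = r^γ`. -/
def offset (γ r : ℝ) : ℝ := r ^ γ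

/-- `λ(r) = r² p'(r) = r² · γ r^(γ-1)`. -/
def viscosity (γ r : ℝ) : ℝ := r ^ 2 * (γ * r ^ (γ - 1))

/-- `π(r) = γ / (γ+1) · r^(γ+1)`, the primitive of `r p'(r) = γ r^γ` vanishing at `0`. -/
def potential (γ r : ℝ) : ℝ := γ / (γ + 1) * r ^ (γ + 1)

/-- The desired velocity `w = u + ∂ₓ p(ρ)` of a density-velocity pair on the torus. -/
def desiredVelocity (γ : ℝ) (ρ u : ℝ → ℝ) (x : ℝ) : ℝ :=
  u x + deriv (fun y => offset γ (ρ y)) x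

/-- Regular solutions on `[0,T]` of
`∂ₜρ + ∂ₓ(ρu) = 0`, `∂ₜ(ρu) + ∂ₓ(ρu²) - ∂ₓ(λ(ρ) ∂ₓu) = 0`.
The elements of `H⁴(𝕋)` are taken in their continuous (hence `C³`) representatives, and the
equations hold classically, with one-sided time derivatives at the end points. -/
structure IsRegularSolution (γ T : ℝ) (ρ u : ℝ → ℝ → ℝ) : Prop where
  continuous_density : ∀ t ∈ Icc 0 T, Continuous (ρ t)
  continuous_velocity : ∀ t ∈ Icc 0 T, Continuous (u t)
  density_reg : ContSobolev 4 T ρ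
  velocity_reg : ContSobolev 4 T u
  velocity_reg' : SqIntegrableSobolev 5 T u
  mass : ∀ t ∈ Icc 0 T, ∀ x : ℝ,
    HasDerivWithinAt (fun s => ρ s x) (- deriv (fun y => ρ t y * u t y) x) (Icc 0 T) t
  momentum : ∀ t ∈ Icc 0 T, ∀ x : ℝ,
    HasDerivWithinAt (fun s => ρ s x * u s x)
      (- deriv (fun y => ρ t y * u t y ^ 2) x
        + deriv (fun y => viscosity γ (ρ t y) * deriv (u t) y) x) (Icc 0 T) t

/-- `(ρ, u)` is a global regular solution with initial data `(ρ₀, u₀)`. -/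
structure IsGlobalRegularSolution (γ : ℝ) (ρ₀ u₀ : ℝ → ℝ) (ρ u : ℝ → ℝ → ℝ) : Prop where
  density_init : ρ 0 = ρ₀
  velocity_init : u 0 = u₀
  regular : ∀ T : ℝ, 0 < T → IsRegularSolution γ T ρ u

/-- The bounds on the initial data `(ρ₀, u₀)` (continuous representatives of elements of `H⁴(𝕋)`)
at the exponent `γ`, with constants `C`, `r₀` and `m`. -/
structure AdmissibleData (C r₀ m γ : ℝ) (ρ₀ u₀ : ℝ → ℝ) : Prop where
  continuous_density : Continuous ρ₀
  continuous_velocity : Continuous u₀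
  density_reg : MemSobolev 4 ρ₀
  velocity_reg : MemSobolev 4 u₀
  lower : ∀ x, r₀ ≤ ρ₀ x
  upper : ∀ x, ρ₀ x ≤ 1 + 1 / γ
  energy : l2Norm (fun x => Real.sqrt (ρ₀ x) * u₀ x)
    + l2Norm (fun x => Real.sqrt (ρ₀ x) * desiredVelocity γ ρ₀ u₀ x) ≤ C
  slope : essSup (deriv (desiredVelocity γ ρ₀ u₀)) torusMeasure
    + l2Norm (deriv (desiredVelocity γ ρ₀ u₀)) ≤ C
  mean : ∫ x, ρ₀ x ∂torusMeasure ≤ m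

/-! ### The hard-congestion system -/

/-- `(ρ, w, π)`, with `πx = ∂ₓπ`, is a weak solution on `[0,T]` of the hard-congestion system in
`w`-form with initial data `(ρ₀, w₀)` and density bounded below by `r`. The test functions are the
smooth functions on `[0,T] × 𝕋`. -/
structure IsHardCongestionSolution (T r : ℝ) (ρ₀ w₀ : ℝ → ℝ) (ρ w π πx : ℝ → ℝ → ℝ) : Prop where
  density_periodic : ∀ t, Function.Periodic (ρ t) 1
  potential_periodic : ∀ t, Function.Periodic (π t) 1
  density_reg : ∀ p : ℝ≥0∞, 1 ≤ p → p ≠ ⊤ → ContWeakLp p T ρ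
  density_bdd : MemLp (Function.uncurry ρ) ⊤ (cylMeasure T)
  velocity_reg : ContSobolev 1 T w
  velocity_cont : ContinuousOn (Function.uncurry w) (Icc 0 T ×ˢ univ)
  potential_reg : MemLinftyH1 T π πx
  mass : ∀ φ : ℝ → ℝ → ℝ, ContDiff ℝ ∞ (Function.uncurry φ) →
    (∀ t, Function.Periodic (φ t) 1) → ∀ t ∈ Icc 0 T,
    - (∫ s in (0 : ℝ)..t, ∫ x, ρ s x * deriv (fun τ => φ τ x) s ∂torusMeasure)
      + (∫ x, (ρ t x * φ t x - ρ₀ x * φ 0 x) ∂torusMeasure)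
      - (∫ s in (0 : ℝ)..t, ∫ x, π s x * deriv (deriv (φ s)) x ∂torusMeasure)
      = ∫ s in (0 : ℝ)..t, ∫ x, ρ s x * w s x * deriv (φ s) x ∂torusMeasure
  momentum : ∀ φ : ℝ → ℝ → ℝ, ContDiff ℝ ∞ (Function.uncurry φ) →
    (∀ t, Function.Periodic (φ t) 1) → ∀ t ∈ Icc 0 T,
    - (∫ s in (0 : ℝ)..t, ∫ x, ρ s x * w s x * deriv (fun τ => φ τ x) s ∂torusMeasure)
      + (∫ x, (ρ t x * w t x * φ t x - ρ₀ x * w₀ x * φ 0 x) ∂torusMeasure)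
      + (∫ s in (0 : ℝ)..t,
          ∫ x, (w s x * πx s x - ρ s x * w s x ^ 2) * deriv (φ s) x ∂torusMeasure)
      = 0
  lower : ∀ t ∈ Icc 0 T, ∀ᵐ x ∂torusMeasure, r ≤ ρ t x
  upper : ∀ t ∈ Icc 0 T, ∀ᵐ x ∂torusMeasure, ρ t x ≤ 1
  switching : ∀ᵐ z ∂cylMeasure T, (1 - ρ z.1 z.2) * π z.1 z.2 = 0
  nonneg : ∀ᵐ z ∂cylMeasure T, 0 ≤ π z.1 z.2

end

end AwRascle

/-!
The viscosity `λ(ρ) = ρ² p'(ρ)` is exactly the one for which the desired velocity `w = u + ∂ₓp(ρ)`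
is transported by `u` (`SmoothFlow.transported_w`). Hence the slope per unit mass `∂ₓw / ρ` is
transported as well, which keeps its upper bound and its weighted `L²` norm.

*Uniform bounds.* At a spatial minimum of `ρ`, where `∂ₓ²p ≥ 0`, one has `∂ₓu ≤ ∂ₓw ≤ (C/r₀) ρ`;
by comparison with an ordinary differential equation the density stays above
`r₀ / (1 + (C + r₀) t)` (`Bounded.density_ge`). The energies `∫ ρu²` (dissipated) and `∫ ρw²`
(conserved) control `√ρ ∂ₓp` in `L²`. Since the mean density is less than one, the potential `π`
is at most one somewhere, and `∂ₓπ = ρ ∂ₓp` bounds it everywhere (`Bounded.pot_le`). Therefore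
`ρ ≤ 1 + O(1/γ)` and `(1 - ρ) π = O(1/γ)`.

*Compactness.* Three functions have uniform Hölder bounds on the space-time cylinder: `w`, the
mass coordinate `M` with `∂ₓM = ρ` and `∂ₜM = -ρu`, and the time integral `Q` of the potential. A
subsequence converges locally uniformly (`exists_flowLimit`); the limit density and potential are
`ρ = ∂ₓM` and `π = ∂ₜQ`. The products of `ρ_n` and `∂ₓπ_n` with functions of `w_n` are products of
weakly and of uniformly convergent sequences, so that the equations, written with `ρu = ρw - ∂ₓπ`,
pass to the limit (`FlowLimit.balance`). In `∫∫ ρ_n π_n` an integration by parts replaces `ρ_n` by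
`M_n`, so that `(1 - ρ) π = 0` in the limit (`FlowLimit.switching`).

*Strong continuity of `w` in `H¹`.* Weak continuity is inherited from the approximations, and what
is needed is that the energy `∫ (∂ₓw)²` is continuous. Let `N` be the normalised mass coordinate
of the limit. For functions `h` on the circle, `∫ ρ h(N)` and `∫ ∂ₓw h(N)` do not depend on time,
and `∫ h(N)` is Lipschitz in time. The latter holds because the variation of `u_n` is at most
`2 / (γ_n t) + O(1)` (`SmoothFlow.integral_abs_u₁_le`), where the first term vanishes in the
limit: in Lagrangian coordinates the mass equation is a diffusion with a homogeneous nonlinearity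
of degree `-(γ+1)`, and the generator `1 - (γ + 2) t ∂ₓu` of its scaling symmetry satisfies a
linear equation that contracts the `L¹` norm. Writing the energy as the supremum over `h` of
`2 ∫ ∂ₓw h(N) - ∫ h(N)²` and truncating `h`, the energy at one time is compared with the energy at
another (`FlowLimit.energy_le`), which together with the weak continuity yields strong continuity.
-/

namespace AwRascle

/-! ### Regularity of functions with weak derivatives on the torus -/

instance : IsProbabilityMeasure torusMeasure := ⟨by simp [torusMeasure]⟩

instance (T : ℝ) : IsFiniteMeasure (timeMeasure T) := by unfold timeMeasure; infer_instance

instance (T : ℝ) : IsFiniteMeasure (cylMeasure T) := by unfold cylMeasure; infer_instance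

theorem integral_torus (f : ℝ → ℝ) : ∫ x, f x ∂torusMeasure = ∫ x in (0 : ℝ)..1, f x :=
  (intervalIntegral.integral_of_le zero_le_one).symm

theorem integrable_torus_iff {f : ℝ → ℝ} :
    Integrable f torusMeasure ↔ IntervalIntegrable f volume 0 1 :=
  (intervalIntegrable_iff_integrableOn_Ioc_of_le zero_le_one).symm

theorem ae_torus_iff {P : ℝ → Prop} :
    (∀ᵐ x ∂torusMeasure, P x) ↔ ∀ᵐ x, x ∈ Ioc (0 : ℝ) 1 → P x :=
  ae_restrict_iff' measurableSet_Ioc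

theorem integrable_torus_of_continuous {f : ℝ → ℝ} (hf : Continuous f) :
    Integrable f torusMeasure :=
  integrable_torus_iff.2 (hf.intervalIntegrable 0 1)

theorem memLp_torus_of_continuous {f : ℝ → ℝ} (hf : Continuous f) (p : ℝ≥0∞) :
    MemLp f p torusMeasure := by
  obtain ⟨K, hK⟩ := isCompact_Icc.exists_bound_of_continuousOn (hf.continuousOn (s := Icc 0 1))
  refine MemLp.of_bound hf.aestronglyMeasurable K ?_
  filter_upwards [ae_torus_iff.2 (.of_forall fun x hx => hx)] with x hx
  exact hK x (Ioc_subset_Icc_self hx)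

/-- Continuous periodic functions that agree almost everywhere on the torus are equal. -/
theorem eq_of_ae_eq_torus {f g : ℝ → ℝ} (hf : Continuous f) (hg : Continuous g)
    (pf : Function.Periodic f 1) (pg : Function.Periodic g 1) (h : f =ᵐ[torusMeasure] g) :
    f = g := by
  have h1 : EqOn f g (Ioo 0 1) := by
    refine Measure.eqOn_Ioo_of_ae_eq (μ := volume) (a := 0) (b := 1) ?_ hf.continuousOn
      hg.continuousOn
    exact ae_mono (Measure.restrict_mono Ioo_subset_Ioc_self le_rfl) h
  have h2 : EqOn f g (Icc 0 1) := by
    have := h1.closure hf hg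
    rwa [closure_Ioo zero_ne_one] at this
  funext x
  have hx := h2 (show Int.fract x ∈ Icc (0 : ℝ) 1 from ⟨Int.fract_nonneg x, (Int.fract_lt_one x).le⟩)
  have e1 := pf.sub_zsmul_eq ⌊x⌋ (x := x)
  have e2 := pg.sub_zsmul_eq ⌊x⌋ (x := x)
  simp only [zsmul_eq_mul, mul_one, Int.self_sub_floor] at e1 e2
  rw [← e1, ← e2, hx]

theorem comp_fract_eq {f : ℝ → ℝ} (pf : Function.Periodic f 1) (x : ℝ) : f (Int.fract x) = f x := by
  have e1 := pf.sub_zsmul_eq ⌊x⌋ (x := x)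
  simpa only [zsmul_eq_mul, mul_one, Int.self_sub_floor] using e1

theorem periodic_comp_fract (f : ℝ → ℝ) : Function.Periodic (fun x => f (Int.fract x)) 1 := by
  intro x; simp

/-- The periodic extension of a smooth function supported in the open period cell is smooth. -/
theorem contDiff_comp_fract {ψ : ℝ → ℝ} (hψ : ContDiff ℝ ∞ ψ) (hs : tsupport ψ ⊆ Ioo 0 1) :
    ContDiff ℝ ∞ fun x => ψ (Int.fract x) := by
  have hz : ∀ x, x ∉ Ioo (0 : ℝ) 1 → ψ x = 0 := fun x hx =>
    image_eq_zero_of_notMem_tsupport fun h => hx (hs h)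
  refine contDiff_iff_contDiffAt.2 fun x₀ => ?_
  set n : ℝ := (⌊x₀⌋ : ℝ) with hn
  have h1 : ContDiffAt ℝ ∞ (fun x => ψ (x - n) + ψ (x - n + 1)) x₀ := by
    apply ContDiff.contDiffAt
    fun_prop
  refine h1.congr_of_eventuallyEq ?_
  have hx₀ : x₀ ∈ Ioo (n - 1) (n + 1) :=
    ⟨by have := Int.floor_le x₀; linarith, Int.lt_floor_add_one x₀⟩
  filter_upwards [isOpen_Ioo.mem_nhds hx₀] with x hx
  rcases le_or_gt n x with h | h
  · have hf : ⌊x⌋ = ⌊x₀⌋ := Int.floor_eq_iff.2 ⟨h, hx.2⟩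
    have : Int.fract x = x - n := by rw [Int.fract, hf]
    rw [this, hz (x - n + 1) (fun h' => by linarith [h'.2]), add_zero]
  · have hf : ⌊x⌋ = ⌊x₀⌋ - 1 := Int.floor_eq_iff.2
      ⟨by push_cast; exact hx.1.le, by push_cast; linarith⟩
    have : Int.fract x = x - n + 1 := by rw [Int.fract, hf]; push_cast; ring
    rw [this, hz (x - n) (fun h' => by linarith [h'.1]), zero_add]

theorem ae_comp_fract (f : ℝ → ℝ) : (fun x => f (Int.fract x)) =ᵐ[torusMeasure] f := by
  have h1 : ∀ᵐ x : ℝ, x ≠ 1 := by simp [ae_iff, measure_singleton]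
  refine ae_torus_iff.2 ?_
  filter_upwards [h1] with x hx hx'
  rw [Int.fract_eq_self.2 ⟨hx'.1.le, lt_of_le_of_ne hx'.2 hx⟩]

/-- The primitive of a smooth periodic function with mean zero is smooth and periodic. -/
theorem exists_periodic_primitive {ψ : ℝ → ℝ} (hψ : ContDiff ℝ ∞ ψ) (pψ : Function.Periodic ψ 1)
    (h0 : ∫ x in (0 : ℝ)..1, ψ x = 0) :
    ∃ φ : ℝ → ℝ, ContDiff ℝ ∞ φ ∧ Function.Periodic φ 1 ∧ deriv φ = ψ := by
  have hd : ∀ x, HasDerivAt (fun x => ∫ y in (0 : ℝ)..x, ψ y) (ψ x) x := fun x =>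
    intervalIntegral.integral_hasDerivAt_right (hψ.continuous.intervalIntegrable _ _)
      (hψ.continuous.stronglyMeasurableAtFilter _ _) hψ.continuous.continuousAt
  have hde : deriv (fun x => ∫ y in (0 : ℝ)..x, ψ y) = ψ := funext fun x => (hd x).deriv
  refine ⟨fun x => ∫ y in (0 : ℝ)..x, ψ y, ?_, fun x => ?_, hde⟩
  · rw [contDiff_infty_iff_deriv, hde]
    exact ⟨fun x => (hd x).differentiableAt, hψ⟩
  · have := intervalIntegral.integral_add_adjacent_intervals
      (hψ.continuous.intervalIntegrable (μ := volume) 0 x)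
      (hψ.continuous.intervalIntegrable (μ := volume) x (x + 1))
    have h2 := pψ.intervalIntegral_add_eq x 0
    rw [zero_add, h0] at h2
    simp only
    rw [← this, h2, add_zero]

theorem absolutelyContinuousOnInterval_of_contDiff {φ : ℝ → ℝ} (hφ : ContDiff ℝ ∞ φ) (a b : ℝ) :
    AbsolutelyContinuousOnInterval φ a b :=
  ((hφ.of_le (by simp)).contDiffOn (n := 1)).absolutelyContinuousOnInterval

theorem IsWeakDeriv.integral_eq_zero {f g : ℝ → ℝ} (h : IsWeakDeriv f g) :
    ∫ x in (0 : ℝ)..1, g x = 0 := by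
  have := h.parts (fun _ => 1) contDiff_const (fun _ => rfl)
  simpa [integral_torus] using this

/-- Lemma of du Bois-Reymond on the torus. -/
theorem IsWeakDeriv.ae_eq_primitive {f g : ℝ → ℝ} (h : IsWeakDeriv f g) :
    ∃ c, ∀ᵐ x ∂torusMeasure, f x = c + ∫ y in (0 : ℝ)..x, g y := by
  have hg := integrable_torus_iff.1 h.integrable_right
  have hf := integrable_torus_iff.1 h.integrable_left
  have hG := hg.absolutelyContinuousOnInterval_intervalIntegral (c := 0) (by simp)
  set G : ℝ → ℝ := fun x => ∫ y in (0 : ℝ)..x, g y with hGdef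
  have hGi : IntervalIntegrable G volume 0 1 := hG.continuousOn.intervalIntegrable
  have hdG : ∀ᵐ x, x ∈ Ioc (0 : ℝ) 1 → deriv G x = g x := by
    have := hg.ae_hasDerivAt_integral
    filter_upwards [this] with x hx hx'
    have hx2 : x ∈ uIcc (0 : ℝ) 1 := by
      rw [uIcc_of_le zero_le_one]; exact Ioc_subset_Icc_self hx'
    exact (hx hx2 0 (by simp)).deriv
  set k : ℝ → ℝ := fun x => f x - G x with hk
  have hki : IntervalIntegrable k volume 0 1 := hf.sub hGi
  -- `k` is orthogonal to derivatives of periodic functions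
  have horth : ∀ φ : ℝ → ℝ, ContDiff ℝ ∞ φ → Function.Periodic φ 1 →
      ∫ x in (0 : ℝ)..1, k x * deriv φ x = 0 := by
    intro φ hφ pφ
    have hdφ : Continuous (deriv φ) := hφ.continuous_deriv (by simp)
    have e1 := h.parts φ hφ pφ
    rw [integral_torus, integral_torus] at e1
    have e2 := hG.integral_mul_deriv_eq_deriv_mul (absolutelyContinuousOnInterval_of_contDiff hφ 0 1)
    have e3 : ∫ x in (0 : ℝ)..1, deriv G x * φ x = ∫ x in (0 : ℝ)..1, g x * φ x := by
      refine intervalIntegral.integral_congr_ae ?_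
      rw [uIoc_of_le zero_le_one]
      filter_upwards [hdG] with x hx hx'
      rw [hx hx']
    have hG1 : G 1 = 0 := h.integral_eq_zero
    have hG0 : G 0 = 0 := by simp [hGdef]
    rw [e3, hG1, hG0] at e2
    have : ∫ x in (0 : ℝ)..1, k x * deriv φ x
        = (∫ x in (0 : ℝ)..1, f x * deriv φ x) - ∫ x in (0 : ℝ)..1, G x * deriv φ x := by
      rw [← intervalIntegral.integral_sub]
      · refine intervalIntegral.integral_congr fun x _ => ?_
        simp only [hk]; ring
      · exact hf.mul_continuousOn hdφ.continuousOn
      · exact hGi.mul_continuousOn hdφ.continuousOn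
    rw [this, e1, e2]; ring
  set c : ℝ := ∫ x in (0 : ℝ)..1, k x with hc
  refine ⟨c, ?_⟩
  have hloc : LocallyIntegrableOn (fun x => k x - c) (Ioo 0 1) volume := by
    have : IntegrableOn (fun x => k x - c) (Ioc 0 1) volume :=
      (intervalIntegrable_iff_integrableOn_Ioc_of_le zero_le_one).1 (hki.sub (by simp))
    exact (this.mono_set Ioo_subset_Ioc_self).locallyIntegrableOn
  have key := isOpen_Ioo.ae_eq_zero_of_integral_contDiff_smul_eq_zero hloc (fun ψ hψ _ hs => by
    have hz : ∀ x, x ∉ Ioo (0 : ℝ) 1 → ψ x = 0 := fun x hx =>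
      image_eq_zero_of_notMem_tsupport fun h => hx (hs h)
    set m : ℝ := ∫ x in (0 : ℝ)..1, ψ x with hm
    have hfr : ∀ x ∈ uIcc (0 : ℝ) 1, ψ (Int.fract x) = ψ x := by
      intro x hx
      rw [uIcc_of_le zero_le_one] at hx
      rcases eq_or_lt_of_le hx.2 with h1 | h1
      · rw [h1, Int.fract_one, hz 0 (by simp), hz 1 (by simp)]
      · rw [Int.fract_eq_self.2 ⟨hx.1, h1⟩]
    obtain ⟨φ, h1, h2, h3⟩ := exists_periodic_primitive
      (ψ := fun x => ψ (Int.fract x) - m) ((contDiff_comp_fract hψ hs).sub contDiff_const)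
      (fun x => by simp) (by
        rw [intervalIntegral.integral_congr (g := fun x => ψ x - m)
          (fun x hx => by simp only [hfr x hx])]
        rw [intervalIntegral.integral_sub (hψ.continuous.intervalIntegrable _ _) (by simp)]
        simp [hm])
    have e := horth φ h1 h2
    rw [h3, intervalIntegral.integral_congr (g := fun x => k x * ψ x - m * k x)
      (fun x hx => by simp only [hfr x hx]; ring), intervalIntegral.integral_sub
      (hki.mul_continuousOn hψ.continuous.continuousOn) (hki.const_mul m),
      intervalIntegral.integral_const_mul] at e
    have e2 : ∫ x, ψ x • (k x - c) = ∫ x in (0 : ℝ)..1, ψ x • (k x - c) := by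
      rw [intervalIntegral.integral_of_le zero_le_one, ← setIntegral_eq_integral_of_forall_compl_eq_zero]
      intro x hx
      rw [hz x (fun h' => hx (Ioo_subset_Ioc_self h')), zero_smul]
    rw [e2, intervalIntegral.integral_congr (g := fun x => k x * ψ x - c * ψ x)
      (fun x hx => by simp only [smul_eq_mul]; ring), intervalIntegral.integral_sub
      (hki.mul_continuousOn hψ.continuous.continuousOn)
      ((hψ.continuous.intervalIntegrable _ _).const_mul c), intervalIntegral.integral_const_mul]
    linarith)
  have h1 : ∀ᵐ x : ℝ, x ≠ 1 := by simp [ae_iff, measure_singleton]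
  refine ae_torus_iff.2 ?_
  filter_upwards [key, h1] with x hx hx1 hx'
  have := hx ⟨hx'.1, lt_of_le_of_ne hx'.2 hx1⟩
  simp only [hk] at this
  linarith

theorem IsWeakDeriv.congr {f g f' g' : ℝ → ℝ} (h : IsWeakDeriv f g) (hf : f =ᵐ[torusMeasure] f')
    (hg : g =ᵐ[torusMeasure] g') : IsWeakDeriv f' g' where
  integrable_left := h.integrable_left.congr hf
  integrable_right := h.integrable_right.congr hg
  parts φ h1 h2 := by
    have e1 : ∫ x, f x * deriv φ x ∂torusMeasure = ∫ x, f' x * deriv φ x ∂torusMeasure :=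
      integral_congr_ae (hf.mono fun x hx => by simp only [hx])
    have e2 : ∫ x, g x * φ x ∂torusMeasure = ∫ x, g' x * φ x ∂torusMeasure :=
      integral_congr_ae (hg.mono fun x hx => by simp only [hx])
    rw [← e1, ← e2]
    exact h.parts φ h1 h2

theorem IsWeakDeriv.sub {f g f' g' : ℝ → ℝ} (h : IsWeakDeriv f g) (h' : IsWeakDeriv f' g') :
    IsWeakDeriv (fun x => f x - f' x) (fun x => g x - g' x) where
  integrable_left := h.integrable_left.sub h'.integrable_left
  integrable_right := h.integrable_right.sub h'.integrable_right
  parts φ h1 h2 := by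
    have c1 : Continuous (deriv φ) := h1.continuous_deriv (by simp)
    have key : ∀ {a b : ℝ → ℝ}, Integrable a torusMeasure → Continuous b →
        Integrable (fun x => a x * b x) torusMeasure := fun ha hb =>
      integrable_torus_iff.2 ((integrable_torus_iff.1 ha).mul_continuousOn hb.continuousOn)
    simp only [sub_mul]
    rw [integral_sub (key h.integrable_left c1) (key h'.integrable_left c1),
      integral_sub (key h.integrable_right h1.continuous) (key h'.integrable_right h1.continuous),
      h.parts φ h1 h2, h'.parts φ h1 h2]
    ring

/-- A function with an integrable weak derivative has a continuous periodic representative. -/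
theorem IsWeakDeriv.exists_continuous {f g : ℝ → ℝ} (h : IsWeakDeriv f g) :
    ∃ d : ℝ → ℝ, Continuous d ∧ Function.Periodic d 1 ∧ d =ᵐ[torusMeasure] f := by
  obtain ⟨c, hc⟩ := h.ae_eq_primitive
  set e : ℝ → ℝ := fun x => g (Int.fract x) with he
  have pe : Function.Periodic e 1 := periodic_comp_fract g
  have hei : ∀ a b, IntervalIntegrable e volume a b := by
    have : IntervalIntegrable e volume 0 (0 + 1) := by
      rw [zero_add]
      exact integrable_torus_iff.1 (h.integrable_right.congr (ae_comp_fract g).symm)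
    exact fun a b => pe.intervalIntegrable one_ne_zero this a b
  have hcongr : ∀ x ∈ Icc (0 : ℝ) 1, ∫ y in (0 : ℝ)..x, e y = ∫ y in (0 : ℝ)..x, g y := by
    intro x hx
    refine intervalIntegral.integral_congr_ae ?_
    rw [uIoc_of_le hx.1]
    filter_upwards [ae_torus_iff.1 (ae_comp_fract g)] with y hy hy'
    exact hy ⟨hy'.1, hy'.2.trans hx.2⟩
  refine ⟨fun x => c + ∫ y in (0 : ℝ)..x, e y, ?_, fun x => ?_, ?_⟩
  · exact continuous_const.add (intervalIntegral.continuous_primitive hei 0)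
  · have h1 := intervalIntegral.integral_add_adjacent_intervals (hei 0 x) (hei x (x + 1))
    have h2 := pe.intervalIntegral_add_eq x 0
    rw [zero_add, hcongr 1 (by simp), h.integral_eq_zero] at h2
    simp only
    rw [← h1, h2, add_zero]
  · filter_upwards [hc, ae_torus_iff.2 (.of_forall fun x hx => hx)] with x hx hx'
    rw [hx, hcongr x (Ioc_subset_Icc_self hx')]

/-- A continuous function is the primitive of its weak derivative on the period cell. -/
theorem IsWeakDeriv.eq_primitive {d g : ℝ → ℝ} (h : IsWeakDeriv d g) (hd : Continuous d)
    {x : ℝ} (hx : x ∈ Icc (0 : ℝ) 1) : d x = d 0 + ∫ y in (0 : ℝ)..x, g y := by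
  obtain ⟨c, hc⟩ := h.ae_eq_primitive
  have hg := integrable_torus_iff.1 h.integrable_right
  have hG := hg.absolutelyContinuousOnInterval_intervalIntegral (c := 0) (by simp)
  have hGc := hG.continuousOn
  rw [uIcc_of_le zero_le_one] at hGc
  have key := Measure.eqOn_Icc_of_ae_eq (μ := volume) (a := (0 : ℝ)) (b := 1) zero_ne_one (f := d)
    (g := fun x => c + ∫ y in (0 : ℝ)..x, g y)
    (by rw [Measure.restrict_congr_set Ioc_ae_eq_Icc.symm]; exact hc)
    hd.continuousOn (continuousOn_const.add hGc)
  have h0 := key (show (0 : ℝ) ∈ Icc (0 : ℝ) 1 by simp)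
  have hx' := key hx
  simp only [intervalIntegral.integral_same, add_zero] at h0
  rw [hx', h0]

/-- If a weak derivative is continuous, it is a classical derivative. -/
theorem IsWeakDeriv.hasDerivAt {d e : ℝ → ℝ} (h : IsWeakDeriv d e) (hd : Continuous d)
    (he : Continuous e) (pd : Function.Periodic d 1) (pe : Function.Periodic e 1) (x : ℝ) :
    HasDerivAt d (e x) x := by
  have hE : ∀ x, HasDerivAt (fun x => d 0 + ∫ y in (0 : ℝ)..x, e y) (e x) x := fun x =>
    (intervalIntegral.integral_hasDerivAt_right (he.intervalIntegrable _ _)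
      (he.stronglyMeasurableAtFilter _ _) he.continuousAt).const_add _
  have : d = fun x => d 0 + ∫ y in (0 : ℝ)..x, e y := by
    refine eq_of_ae_eq_torus hd (continuous_iff_continuousAt.2 fun x => (hE x).continuousAt) pd ?_ ?_
    · intro x
      have h1 := intervalIntegral.integral_add_adjacent_intervals
        (he.intervalIntegrable (μ := volume) 0 x) (he.intervalIntegrable (μ := volume) x (x + 1))
      have h2 := pe.intervalIntegral_add_eq x 0
      rw [zero_add, h.integral_eq_zero] at h2
      simp only
      rw [← h1, h2, add_zero]
    · exact ae_torus_iff.2 (.of_forall fun x hx => h.eq_primitive hd (Ioc_subset_Icc_self hx))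
  rw [this]
  simpa using hE x

/-- The embedding of `W^{1,1}(𝕋)` into the bounded functions. -/
theorem IsWeakDeriv.abs_le {d g : ℝ → ℝ} (h : IsWeakDeriv d g) (hd : Continuous d)
    (pd : Function.Periodic d 1) (x : ℝ) :
    |d x| ≤ (∫ y, |d y| ∂torusMeasure) + ∫ y, |g y| ∂torusMeasure := by
  rw [← comp_fract_eq pd x]
  set x' := Int.fract x
  have hx' : x' ∈ Icc (0 : ℝ) 1 := ⟨Int.fract_nonneg x, (Int.fract_lt_one x).le⟩
  have hg := integrable_torus_iff.1 h.integrable_right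
  have hgab : ∀ a ∈ Icc (0 : ℝ) 1, ∀ b ∈ Icc (0 : ℝ) 1, IntervalIntegrable g volume a b :=
    fun a ha b hb => hg.mono_set (by rw [uIcc_of_le zero_le_one]; exact uIcc_subset_Icc ha hb)
  have key : ∀ y ∈ Ioc (0 : ℝ) 1, |d x'| ≤ |d y| + ∫ z, |g z| ∂torusMeasure := by
    intro y hy
    have hy' := Ioc_subset_Icc_self hy
    have e : d x' - d y = ∫ z in y..x', g z := by
      rw [h.eq_primitive hd hx', h.eq_primitive hd hy']
      have := intervalIntegral.integral_add_adjacent_intervals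
        (hgab 0 (by simp) y hy') (hgab y hy' x' hx')
      linarith
    have e2 : |∫ z in y..x', g z| ≤ ∫ z, |g z| ∂torusMeasure := by
      have e3 := intervalIntegral.norm_integral_le_integral_norm_uIoc (f := g) (a := y) (b := x')
        (μ := volume)
      refine e3.trans ?_
      refine setIntegral_mono_set h.integrable_right.norm (.of_forall fun z => norm_nonneg _)
        (LE.le.eventuallyLE ?_)
      exact Ioc_subset_Ioc (le_min hy'.1 hx'.1) (max_le hy'.2 hx'.2)
    have := abs_add_le (d y) (d x' - d y)
    rw [add_sub_cancel, e] at this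
    linarith
  have hi : Integrable (fun y => |d y| + ∫ z, |g z| ∂torusMeasure) torusMeasure :=
    (integrable_torus_of_continuous hd.abs).add (integrable_const _)
  have := integral_mono_ae (μ := torusMeasure) (integrable_const |d x'|) hi
    (ae_torus_iff.2 (.of_forall fun y hy => key y hy))
  rw [integral_add (integrable_torus_of_continuous hd.abs) (integrable_const _)] at this
  simpa using this

theorem integral_abs_le_eLpNorm {g : ℝ → ℝ} (hg : MemLp g 2 torusMeasure) :
    ∫ x, |g x| ∂torusMeasure ≤ (eLpNorm g 2 torusMeasure).toReal := by
  have h1 : ∫ x, |g x| ∂torusMeasure = (eLpNorm g 1 torusMeasure).toReal := by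
    rw [eLpNorm_one_eq_lintegral_enorm, ← integral_norm_eq_lintegral_enorm hg.1]; rfl
  rw [h1]
  exact ENNReal.toReal_mono hg.2.ne
    (eLpNorm_le_eLpNorm_of_exponent_le one_le_two hg.1)

theorem IsSobolevJet.iterate_deriv {k : ℕ} {f : ℝ → ℝ} {D : ℕ → ℝ → ℝ} (h : IsSobolevJet (k + 1) f D)
    (hf : Continuous f) (pf : Function.Periodic f 1) (j : ℕ) (hj : j ≤ k) :
    Continuous (deriv^[j] f) ∧ Function.Periodic (deriv^[j] f) 1 ∧ deriv^[j] f =ᵐ[torusMeasure] D j ∧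
      (j < k → ∀ x, HasDerivAt (deriv^[j] f) (deriv^[j + 1] f x) x) := by
  -- a continuous representative of the next weak derivative is the classical derivative
  have step : ∀ j < k, Continuous (deriv^[j] f) → Function.Periodic (deriv^[j] f) 1 →
      deriv^[j] f =ᵐ[torusMeasure] D j → Continuous (deriv^[j + 1] f) ∧
      Function.Periodic (deriv^[j + 1] f) 1 ∧ deriv^[j + 1] f =ᵐ[torusMeasure] D (j + 1) ∧
      ∀ x, HasDerivAt (deriv^[j] f) (deriv^[j + 1] f x) x := by
    intro j hj hc hp hae
    obtain ⟨e, he, pe, hee⟩ := (h.step (j + 1) (by lia)).exists_continuous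
    have hd := ((h.step j (by lia)).congr hae.symm hee.symm).hasDerivAt hc he hp pe
    have : deriv^[j + 1] f = e := by
      rw [Function.iterate_succ_apply']
      exact funext fun x => (hd x).deriv
    rw [this]
    exact ⟨he, pe, hee, hd⟩
  have main : Continuous (deriv^[j] f) ∧ Function.Periodic (deriv^[j] f) 1 ∧
      deriv^[j] f =ᵐ[torusMeasure] D j := by
    induction j with
    | zero =>
      refine ⟨hf, pf, ?_⟩
      rw [h.zero]
      exact EventuallyEq.rfl
    | succ j ih =>
      obtain ⟨a, b, c⟩ := ih (by lia)
      obtain ⟨a', b', c', -⟩ := step j (by lia) a b c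
      exact ⟨a', b', c'⟩
  obtain ⟨a, b, c⟩ := main
  exact ⟨a, b, c, fun hj' => (step j hj' a b c).2.2.2⟩

/-- The Sobolev embedding `C([0,T]; H^{k+1}(𝕋)) ⊂ C([0,T]; C^k(𝕋))`. -/
theorem ContSobolev.continuousOn_iterate_deriv {k : ℕ} {T : ℝ} {f : ℝ → ℝ → ℝ}
    (h : ContSobolev (k + 1) T f) (hf : ∀ t ∈ Icc 0 T, Continuous (f t)) (j : ℕ) (hj : j ≤ k) :
    ContinuousOn (fun z : ℝ × ℝ => deriv^[j] (f z.1) z.2) (Icc 0 T ×ˢ univ) := by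
  obtain ⟨pf, D, hD, hDc⟩ := h
  have hr := fun t ht => (hD t ht).iterate_deriv (hf t ht) (pf t ht) j hj
  -- the time differences are bounded through the embedding of `W^{1,1}`
  have hsup : ∀ t ∈ Icc 0 T, ∀ s ∈ Icc 0 T, ∀ x, |deriv^[j] (f t) x - deriv^[j] (f s) x| ≤
      (eLpNorm (fun x => D j t x - D j s x) 2 torusMeasure).toReal
      + (eLpNorm (fun x => D (j + 1) t x - D (j + 1) s x) 2 torusMeasure).toReal := by
    intro t ht s hs x
    obtain ⟨c1, p1, a1, -⟩ := hr t ht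
    obtain ⟨c2, p2, a2, -⟩ := hr s hs
    have hw := (((hD t ht).step j (by lia)).congr a1.symm EventuallyEq.rfl).sub
      (((hD s hs).step j (by lia)).congr a2.symm EventuallyEq.rfl)
    have hb := hw.abs_le (c1.sub c2) (fun x => by simp only [p1 x, p2 x]) x
    refine hb.trans (add_le_add ?_ ?_)
    · refine le_trans (le_of_eq ?_) (integral_abs_le_eLpNorm
        (((hD t ht).memLp j (by lia)).sub ((hD s hs).memLp j (by lia))))
      refine integral_congr_ae ?_
      filter_upwards [a1, a2] with y h1 h2
      simp only [h1, h2]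
    · exact integral_abs_le_eLpNorm
        (((hD t ht).memLp (j + 1) (by lia)).sub ((hD s hs).memLp (j + 1) (by lia)))
  rintro ⟨s, y⟩ ⟨hs, -⟩
  obtain ⟨cs, -, -, -⟩ := hr s hs
  have hlim : Tendsto (fun t => (eLpNorm (fun x => D j t x - D j s x) 2 torusMeasure).toReal
      + (eLpNorm (fun x => D (j + 1) t x - D (j + 1) s x) 2 torusMeasure).toReal)
      (𝓝[Icc 0 T] s) (𝓝 0) := by
    have h1 := (ENNReal.tendsto_toReal ENNReal.zero_ne_top).comp (hDc j (by lia) s hs)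
    have h2 := (ENNReal.tendsto_toReal ENNReal.zero_ne_top).comp (hDc (j + 1) (by lia) s hs)
    simpa using h1.add h2
  have hfst : Tendsto Prod.fst (𝓝[Icc 0 T ×ˢ univ] (s, y)) (𝓝[Icc 0 T] s) := by
    rw [nhdsWithin_prod_eq]; exact tendsto_fst
  have hsnd : Tendsto Prod.snd (𝓝[Icc 0 T ×ˢ univ] (s, y)) (𝓝 y) :=
    continuous_snd.continuousAt.tendsto.mono_left nhdsWithin_le_nhds
  have hd : Tendsto (fun z : ℝ × ℝ => deriv^[j] (f z.1) z.2 - deriv^[j] (f s) z.2)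
      (𝓝[Icc 0 T ×ˢ univ] (s, y)) (𝓝 0) := by
    refine squeeze_zero_norm' ?_ (hlim.comp hfst)
    filter_upwards [self_mem_nhdsWithin] with z hz
    exact hsup z.1 hz.1 s hs z.2
  have := hd.add ((cs.tendsto y).comp hsnd)
  simpa [ContinuousWithinAt] using this

/-! ### Calculus for functions on the space-time cylinder -/

/-- Continuous functions of `(t, x)` that are 1-periodic in `x`. -/
structure ContPeriodic (f : ℝ → ℝ → ℝ) : Prop where
  cont : Continuous fun z : ℝ × ℝ => f z.1 z.2
  per : ∀ t, Function.Periodic (f t) 1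

namespace ContPeriodic

variable {f g : ℝ → ℝ → ℝ}

theorem add (hf : ContPeriodic f) (hg : ContPeriodic g) : ContPeriodic fun t x => f t x + g t x :=
  ⟨hf.cont.add hg.cont, fun t x => by simp only [hf.per t x, hg.per t x]⟩

theorem sub (hf : ContPeriodic f) (hg : ContPeriodic g) : ContPeriodic fun t x => f t x - g t x :=
  ⟨hf.cont.sub hg.cont, fun t x => by simp only [hf.per t x, hg.per t x]⟩

theorem mul (hf : ContPeriodic f) (hg : ContPeriodic g) : ContPeriodic fun t x => f t x * g t x :=
  ⟨hf.cont.mul hg.cont, fun t x => by simp only [hf.per t x, hg.per t x]⟩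

theorem neg (hf : ContPeriodic f) : ContPeriodic fun t x => - f t x :=
  ⟨hf.cont.neg, fun t x => by simp only [hf.per t x]⟩

theorem of_time {c : ℝ → ℝ} (hc : Continuous c) : ContPeriodic fun t _ => c t :=
  ⟨hc.comp continuous_fst, fun _ _ => rfl⟩

theorem const (c : ℝ) : ContPeriodic fun _ _ => c := of_time continuous_const

theorem comp (hf : ContPeriodic f) {φ : ℝ → ℝ} (hφ : Continuous φ) :
    ContPeriodic fun t x => φ (f t x) :=
  ⟨hφ.comp hf.cont, fun t x => by simp only [hf.per t x]⟩

theorem div (hf : ContPeriodic f) (hg : ContPeriodic g) (h0 : ∀ t x, g t x ≠ 0) :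
    ContPeriodic fun t x => f t x / g t x :=
  ⟨hf.cont.div hg.cont fun z => h0 z.1 z.2, fun t x => by simp only [hf.per t x, hg.per t x]⟩

theorem pow (hf : ContPeriodic f) (n : ℕ) : ContPeriodic fun t x => f t x ^ n :=
  ⟨hf.cont.pow n, fun t x => by simp only [hf.per t x]⟩

theorem abs (hf : ContPeriodic f) : ContPeriodic fun t x => |f t x| :=
  ⟨hf.cont.abs, fun t x => by simp only [hf.per t x]⟩

theorem cont_x (hf : ContPeriodic f) (t : ℝ) : Continuous (f t) :=
  hf.cont.comp (by fun_prop : Continuous fun x : ℝ => (t, x))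

theorem cont_t (hf : ContPeriodic f) (x : ℝ) : Continuous fun t => f t x :=
  hf.cont.comp (by fun_prop : Continuous fun t : ℝ => (t, x))

theorem ii (hf : ContPeriodic f) (t a b : ℝ) : IntervalIntegrable (f t) volume a b :=
  (hf.cont_x t).intervalIntegrable a b

theorem cont_integral (hf : ContPeriodic f) (a b : ℝ) : Continuous fun t => ∫ x in a..b, f t x :=
  intervalIntegral.continuous_parametric_intervalIntegral_of_continuous' hf.cont a b

/-- Boundedness on finite time intervals. -/
theorem exists_bound (hf : ContPeriodic f) (T : ℝ) :
    ∃ K, 0 ≤ K ∧ ∀ t ∈ Icc (0 : ℝ) T, ∀ x, |f t x| ≤ K := by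
  obtain ⟨K, hK⟩ := (isCompact_Icc.prod isCompact_Icc).exists_bound_of_continuousOn
    (hf.cont.continuousOn (s := Icc 0 T ×ˢ Icc 0 1))
  refine ⟨max K 0, le_max_right _ _, fun t ht x => ?_⟩
  rw [← comp_fract_eq (hf.per t) x]
  exact (hK (t, Int.fract x) ⟨ht, Int.fract_nonneg x, (Int.fract_lt_one x).le⟩).trans
    (le_max_left _ _)

/-- The integral of an `x`-derivative over the torus vanishes. -/
theorem integral_deriv_eq_zero (hf : ContPeriodic f) (hg : ContPeriodic g) {t : ℝ}
    (h : ∀ x, HasDerivAt (f t) (g t x) x) : ∫ x in (0 : ℝ)..1, g t x = 0 := by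
  rw [intervalIntegral.integral_eq_sub_of_hasDerivAt (fun x _ => h x) (hg.ii t 0 1)]
  have := hf.per t 0
  rw [zero_add] at this
  rw [this, sub_self]

end ContPeriodic

/-- `f'` is the time derivative of `f` at all positive times. -/
def IsTimeDeriv (f f' : ℝ → ℝ → ℝ) : Prop :=
  ∀ t > 0, ∀ x, HasDerivAt (fun s => f s x) (f' t x) t

/-- `f₁` is the space derivative of `f`. -/
def IsXDeriv (f f₁ : ℝ → ℝ → ℝ) : Prop := ∀ t x, HasDerivAt (f t) (f₁ t x) x

theorem IsTimeDeriv.sub_eq_integral {f f' : ℝ → ℝ → ℝ} (h : IsTimeDeriv f f')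
    (hf : Continuous fun z : ℝ × ℝ => f z.1 z.2) (hf' : Continuous fun z : ℝ × ℝ => f' z.1 z.2)
    {s t : ℝ} (hs : 0 ≤ s) (hst : s ≤ t) (x : ℝ) : f t x - f s x = ∫ τ in s..t, f' τ x := by
  refine (intervalIntegral.integral_eq_sub_of_hasDerivAt_of_le (f := fun τ => f τ x) hst
    ?_ ?_ ?_).symm
  · exact (hf.comp (by fun_prop : Continuous fun t : ℝ => (t, x))).continuousOn
  · exact fun τ hτ => h τ (hs.trans_lt hτ.1) x
  · exact (hf'.comp (by fun_prop : Continuous fun t : ℝ => (t, x))).intervalIntegrable _ _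

theorem integral_integral_swap_continuous {f : ℝ → ℝ → ℝ}
    (hf : Continuous fun z : ℝ × ℝ => f z.1 z.2) (s t a b : ℝ) :
    ∫ x in a..b, ∫ τ in s..t, f τ x = ∫ τ in s..t, ∫ x in a..b, f τ x := by
  refine intervalIntegral_intervalIntegral_swap (F := fun x τ => f τ x) ?_
  have h1 : IntegrableOn (fun z : ℝ × ℝ => f z.2 z.1) (uIcc a b ×ˢ uIcc s t) :=
    ContinuousOn.integrableOn_compact (isCompact_uIcc.prod isCompact_uIcc)
      (hf.comp continuous_swap).continuousOn
  exact h1.mono_set (prod_mono uIoc_subset_uIcc uIoc_subset_uIcc)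

/-- Evolution of the integral over a space interval. -/
theorem IsTimeDeriv.integral_sub {f f' : ℝ → ℝ → ℝ} (h : IsTimeDeriv f f')
    (hf : Continuous fun z : ℝ × ℝ => f z.1 z.2) (hf' : Continuous fun z : ℝ × ℝ => f' z.1 z.2)
    {s t : ℝ} (hs : 0 ≤ s) (hst : s ≤ t) (a b : ℝ) :
    (∫ x in a..b, f t x) - ∫ x in a..b, f s x = ∫ τ in s..t, ∫ x in a..b, f' τ x := by
  have hc : ∀ t, Continuous (f t) := fun t => hf.comp (by fun_prop : Continuous fun x : ℝ => (t, x))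
  rw [← intervalIntegral.integral_sub ((hc t).intervalIntegrable _ _)
    ((hc s).intervalIntegrable _ _), ← integral_integral_swap_continuous hf']
  exact intervalIntegral.integral_congr fun x _ => h.sub_eq_integral hf hf' hs hst x

/-- Symmetry of mixed derivatives: if `∂ₜf = h`, then `∂ₜ∂ₓf = ∂ₓh`. -/
theorem IsTimeDeriv.deriv_x {f f₁ h h₁ : ℝ → ℝ → ℝ} (ht : IsTimeDeriv f h) (hf : ContPeriodic f)
    (hf₁ : ContPeriodic f₁) (hh : ContPeriodic h) (hh₁ : ContPeriodic h₁) (fx : IsXDeriv f f₁)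
    (hx : IsXDeriv h h₁) : IsTimeDeriv f₁ h₁ := by
  have key : ∀ t ≥ 0, ∀ x, f₁ t x = f₁ 0 x + ∫ τ in (0 : ℝ)..t, h₁ τ x := by
    intro t ht0 x
    -- both sides are continuous in `x` and have the same integrals over all intervals
    have hI : Continuous fun x => ∫ τ in (0 : ℝ)..t, h₁ τ x :=
      intervalIntegral.continuous_parametric_intervalIntegral_of_continuous'
        (f := fun x τ => h₁ τ x) (hh₁.cont.comp continuous_swap) 0 t
    have hc : Continuous fun x => f₁ 0 x + ∫ τ in (0 : ℝ)..t, h₁ τ x := (hf₁.cont_x 0).add hI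
    have e : ∀ y, ∫ x in (0 : ℝ)..y, (f₁ 0 x + ∫ τ in (0 : ℝ)..t, h₁ τ x) = f t y - f t 0 := by
      intro y
      rw [intervalIntegral.integral_add (hf₁.ii 0 0 y) (hI.intervalIntegrable _ _),
        integral_integral_swap_continuous hh₁.cont,
        intervalIntegral.integral_eq_sub_of_hasDerivAt (fun x _ => fx 0 x) (hf₁.ii 0 0 y)]
      have : ∀ τ, ∫ x in (0 : ℝ)..y, h₁ τ x = h τ y - h τ 0 := fun τ =>
        intervalIntegral.integral_eq_sub_of_hasDerivAt (fun x _ => hx τ x) (hh₁.ii τ 0 y)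
      simp only [this]
      rw [intervalIntegral.integral_sub ((hh.cont_t y).intervalIntegrable _ _)
        ((hh.cont_t 0).intervalIntegrable _ _), ← ht.sub_eq_integral hf.cont hh.cont le_rfl ht0 y,
        ← ht.sub_eq_integral hf.cont hh.cont le_rfl ht0 0]
      ring
    have d1 : HasDerivAt (fun y => f t y - f t 0) (f₁ 0 x + ∫ τ in (0 : ℝ)..t, h₁ τ x) x := by
      have := intervalIntegral.integral_hasDerivAt_right (hc.intervalIntegrable 0 x)
        (hc.stronglyMeasurableAtFilter _ _) hc.continuousAt
      exact this.congr_of_eventuallyEq (.of_forall fun y => (e y).symm)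
    exact ((fx t x).sub_const _).unique d1
  intro t ht0 x
  have d2 := (intervalIntegral.integral_hasDerivAt_right ((hh₁.cont_t x).intervalIntegrable 0 t)
    ((hh₁.cont_t x).stronglyMeasurableAtFilter _ _) (hh₁.cont_t x).continuousAt).const_add (f₁ 0 x)
  refine d2.congr_of_eventuallyEq ?_
  filter_upwards [lt_mem_nhds ht0] with s hs
  exact key s hs.le x

/-- A minimum principle: a function which is nonnegative initially and has a positive time
derivative at its negative spatial minima stays nonnegative. -/
theorem ContPeriodic.nonneg_of_min {f : ℝ → ℝ → ℝ} (hf : ContPeriodic f) (h0 : ∀ x, 0 ≤ f 0 x)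
    {t : ℝ} (h : ∀ s > 0, s ≤ t → ∀ x, f s x < 0 → (∀ y, f s x ≤ f s y) →
      ∃ d > 0, HasDerivAt (fun s => f s x) d s) (ht : 0 ≤ t) (x : ℝ) : 0 ≤ f t x := by
  by_contra! hneg
  obtain ⟨⟨t₀, x₀⟩, ⟨ht₀, hx₀⟩, hmin⟩ := (isCompact_Icc.prod isCompact_Icc).exists_isMinOn
    (s := Icc (0 : ℝ) t ×ˢ Icc (0 : ℝ) 1) ⟨(0, 0), by simp [ht]⟩ hf.cont.continuousOn
  have hle : ∀ s ∈ Icc 0 t, ∀ y, f t₀ x₀ ≤ f s y := by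
    intro s hs y
    rw [← comp_fract_eq (hf.per s) y]
    exact hmin (a := (s, Int.fract y)) ⟨hs, Int.fract_nonneg y, (Int.fract_lt_one y).le⟩
  have hn : f t₀ x₀ < 0 := (hle t ⟨ht, le_rfl⟩ x).trans_lt hneg
  have ht₀' : 0 < t₀ := by
    refine lt_of_le_of_ne ht₀.1 fun h' => ?_
    have := h0 x₀
    simp only [← h'] at hn
    linarith
  obtain ⟨d, hd, hder⟩ := h t₀ ht₀' ht₀.2 x₀ hn (hle t₀ ht₀)
  have hs : Tendsto (slope (fun s => f s x₀) t₀) (𝓝[<] t₀) (𝓝 d) :=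
    (hasDerivAt_iff_tendsto_slope.1 hder).mono_left
      (nhdsWithin_mono _ fun y hy => ne_of_lt hy)
  have : d ≤ 0 := by
    refine le_of_tendsto hs ?_
    filter_upwards [Ioo_mem_nhdsLT ht₀'] with s hs
    rw [slope_def_field]
    exact div_nonpos_of_nonneg_of_nonpos
      (sub_nonneg.2 (hle s ⟨hs.1.le, hs.2.le.trans ht₀.2⟩ x₀)) (by linarith [hs.2])
  linarith

/-- Necessary conditions at a minimum. -/
theorem deriv_eq_zero_and_nonneg_of_min {g g₁ g₂ : ℝ → ℝ} (h1 : ∀ x, HasDerivAt g (g₁ x) x)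
    (h2 : ∀ x, HasDerivAt g₁ (g₂ x) x) {x : ℝ} (hx : ∀ y, g x ≤ g y) : g₁ x = 0 ∧ 0 ≤ g₂ x := by
  have hmin : IsLocalMin g x := .of_forall hx
  have e1 : g₁ x = 0 := hmin.hasDerivAt_eq_zero (h1 x)
  refine ⟨e1, ?_⟩
  by_contra! hneg
  have hd : deriv g = g₁ := funext fun y => (h1 y).deriv
  have hmax : IsLocalMax g x := isLocalMax_of_deriv_deriv_neg
    (by rw [hd, (h2 x).deriv]; exact hneg) (by rw [hd, e1]) (h1 x).continuousAt
  have hconst : g =ᶠ[𝓝 x] fun _ => g x := by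
    filter_upwards [hmax] with y hy
    exact le_antisymm hy (hx y)
  have : g₁ =ᶠ[𝓝 x] fun _ => 0 := by
    rw [← hd]
    have := hconst.deriv
    simpa using this
  have := this.deriv_eq
  rw [(h2 x).deriv] at this
  simp at this
  linarith

/-! ### Smooth solutions and their a priori estimates -/

/-- A smooth solution with positive density, together with the space derivatives of the density
`ρ`, of the offset `p = ρ^γ` and of the velocity `u` that the estimates use. All functions are
defined and continuous on `ℝ × ℝ`; the equations are required at positive times. -/
structure SmoothFlow (γ : ℝ) where
  ρ : ℝ → ℝ → ℝ
  ρ₁ : ℝ → ℝ → ℝ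
  p : ℝ → ℝ → ℝ
  p₁ : ℝ → ℝ → ℝ
  p₂ : ℝ → ℝ → ℝ
  p₃ : ℝ → ℝ → ℝ
  u : ℝ → ℝ → ℝ
  u₁ : ℝ → ℝ → ℝ
  u₂ : ℝ → ℝ → ℝ
  u₃ : ℝ → ℝ → ℝ
  one_le : 1 ≤ γ
  cρ : ContPeriodic ρ
  cρ₁ : ContPeriodic ρ₁
  cp : ContPeriodic p
  cp₁ : ContPeriodic p₁
  cp₂ : ContPeriodic p₂
  cp₃ : ContPeriodic p₃
  cu : ContPeriodic u
  cu₁ : ContPeriodic u₁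
  cu₂ : ContPeriodic u₂
  cu₃ : ContPeriodic u₃
  pos : ∀ t x, 0 < ρ t x
  p_eq : ∀ t x, p t x = ρ t x ^ γ
  xρ : IsXDeriv ρ ρ₁
  xp : IsXDeriv p p₁
  xp₁ : IsXDeriv p₁ p₂
  xp₂ : IsXDeriv p₂ p₃
  xu : IsXDeriv u u₁
  xu₁ : IsXDeriv u₁ u₂
  xu₂ : IsXDeriv u₂ u₃
  tρ : IsTimeDeriv ρ fun t x => -(ρ₁ t x * u t x + ρ t x * u₁ t x)
  tm : IsTimeDeriv (fun t x => ρ t x * u t x) fun t x =>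
    -(ρ₁ t x * u t x ^ 2 + 2 * ρ t x * u t x * u₁ t x)
      + (γ * (ρ₁ t x * p t x + ρ t x * p₁ t x) * u₁ t x + γ * ρ t x * p t x * u₂ t x)

namespace SmoothFlow

variable {γ : ℝ} (F : SmoothFlow γ)

theorem p_pos (t x : ℝ) : 0 < F.p t x := by
  rw [F.p_eq]; exact Real.rpow_pos_of_pos (F.pos t x) γ

theorem γ_pos (_ : SmoothFlow γ) : 0 < γ := lt_of_lt_of_le one_pos (SmoothFlow.one_le ‹_›)

/-- The chain rule for `p = ρ^γ`, free of division. -/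
theorem rel (t x : ℝ) : F.ρ t x * F.p₁ t x = γ * F.p t x * F.ρ₁ t x := by
  have h := (F.xρ t x).rpow_const (p := γ) (Or.inl (F.pos t x).ne')
  have h2 : HasDerivAt (F.p t) (F.ρ₁ t x * γ * F.ρ t x ^ (γ - 1)) x :=
    h.congr_of_eventuallyEq (.of_forall fun y => F.p_eq t y)
  rw [(F.xp t x).unique h2, F.p_eq, Real.rpow_sub_one (F.pos t x).ne']
  have := (F.pos t x).ne'
  field_simp

theorem tp : IsTimeDeriv F.p fun t x => -(F.u t x * F.p₁ t x + γ * F.p t x * F.u₁ t x) := by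
  intro t ht x
  have h := (F.tρ t ht x).rpow_const (p := γ) (Or.inl (F.pos t x).ne')
  have h2 := h.congr_of_eventuallyEq (f₁ := fun s => F.p s x) (.of_forall fun s => F.p_eq s x)
  refine HasDerivAt.congr_deriv (h2) ?_
  have hp := (F.pos t x).ne'
  rw [Real.rpow_sub_one hp, ← F.p_eq]
  field_simp
  linear_combination (F.u t x) * F.rel t x

theorem cγ (_ : SmoothFlow γ) : ContPeriodic fun _ _ => γ := ContPeriodic.const γ

theorem tp₁ : IsTimeDeriv F.p₁ fun t x => -(F.u₁ t x * F.p₁ t x + F.u t x * F.p₂ t x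
    + γ * F.p₁ t x * F.u₁ t x + γ * F.p t x * F.u₂ t x) := by
  refine F.tp.deriv_x F.cp F.cp₁ ?_ ?_ F.xp ?_
  · exact ((F.cu.mul F.cp₁).add ((F.cγ.mul F.cp).mul F.cu₁)).neg
  · exact ((((F.cu₁.mul F.cp₁).add (F.cu.mul F.cp₂)).add ((F.cγ.mul F.cp₁).mul F.cu₁)).add
      ((F.cγ.mul F.cp).mul F.cu₂)).neg
  · intro t x
    refine HasDerivAt.congr_deriv ((((F.xu t x).mul (F.xp₁ t x)).add
      (((F.xp t x).const_mul γ).mul (F.xu₁ t x))).neg) ?_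
    ring

theorem tu : IsTimeDeriv F.u fun t x =>
    -(F.u t x * F.u₁ t x) + (1 + γ) * F.p₁ t x * F.u₁ t x + γ * F.p t x * F.u₂ t x := by
  intro t ht x
  have hp := (F.pos t x).ne'
  have h := (F.tm t ht x).div (F.tρ t ht x) hp
  have h2 := h.congr_of_eventuallyEq (f₁ := fun s => F.u s x)
    (.of_forall fun s => (mul_div_cancel_left₀ _ (F.pos s x).ne').symm)
  refine HasDerivAt.congr_deriv (h2) ?_
  field_simp
  linear_combination (-F.u₁ t x) * F.rel t x

theorem tu₁ : IsTimeDeriv F.u₁ fun t x =>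
    -(F.u₁ t x ^ 2 + F.u t x * F.u₂ t x)
      + (1 + γ) * (F.p₂ t x * F.u₁ t x + F.p₁ t x * F.u₂ t x)
      + (γ * F.p₁ t x * F.u₂ t x + γ * F.p t x * F.u₃ t x) := by
  have cc : ContPeriodic fun _ _ => 1 + γ := ContPeriodic.const _
  refine F.tu.deriv_x F.cu F.cu₁ ?_ ?_ F.xu ?_
  · exact (((F.cu.mul F.cu₁).neg).add ((cc.mul F.cp₁).mul F.cu₁)).add ((F.cγ.mul F.cp).mul F.cu₂)
  · exact ((((F.cu₁.pow 2).add (F.cu.mul F.cu₂)).neg).add (cc.mul ((F.cp₂.mul F.cu₁).add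
      (F.cp₁.mul F.cu₂)))).add (((F.cγ.mul F.cp₁).mul F.cu₂).add ((F.cγ.mul F.cp).mul F.cu₃))
  · intro t x
    refine HasDerivAt.congr_deriv (((((F.xu t x).mul (F.xu₁ t x)).neg).add (((F.xp₁ t x).const_mul (1 + γ)).mul
      (F.xu₁ t x))).add (((F.xp t x).const_mul γ).mul (F.xu₂ t x))) ?_
    ring

/-- The desired velocity `w = u + ∂ₓp`. -/
def w (t x : ℝ) : ℝ := F.u t x + F.p₁ t x

/-- The slope `∂ₓw`. -/
def w₁ (t x : ℝ) : ℝ := F.u₁ t x + F.p₂ t x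

/-- The second derivative `∂ₓ²w`. -/
def w₂ (t x : ℝ) : ℝ := F.u₂ t x + F.p₃ t x

theorem cw : ContPeriodic F.w := F.cu.add F.cp₁

theorem cw₁ : ContPeriodic F.w₁ := F.cu₁.add F.cp₂

theorem cw₂ : ContPeriodic F.w₂ := F.cu₂.add F.cp₃

theorem xw : IsXDeriv F.w F.w₁ := fun t x => (F.xu t x).add (F.xp₁ t x)

theorem xw₁ : IsXDeriv F.w₁ F.w₂ := fun t x => (F.xu₁ t x).add (F.xp₂ t x)

/-- A quantity transported by the velocity: `∂ₜg + u ∂ₓg = 0`, where `g₁ = ∂ₓg`. -/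
structure Transported (g g₁ : ℝ → ℝ → ℝ) : Prop where
  cg : ContPeriodic g
  cg₁ : ContPeriodic g₁
  xg : IsXDeriv g g₁
  tg : IsTimeDeriv g fun t x => -(F.u t x * g₁ t x)

/-- The viscosity is exactly the one for which the desired velocity is transported. -/
theorem transported_w : F.Transported F.w F.w₁ where
  cg := F.cw
  cg₁ := F.cw₁
  xg := F.xw
  tg t ht x := by
    refine HasDerivAt.congr_deriv ((F.tu t ht x).add (F.tp₁ t ht x)) ?_
    simp only [w₁]; ring

theorem tw₁ : IsTimeDeriv F.w₁ fun t x => -(F.u₁ t x * F.w₁ t x + F.u t x * F.w₂ t x) := by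
  refine F.transported_w.tg.deriv_x F.cw F.cw₁ (F.cu.mul F.cw₁).neg
    ((F.cu₁.mul F.cw₁).add (F.cu.mul F.cw₂)).neg F.xw fun t x => ?_
  exact ((F.xu t x).mul (F.xw₁ t x)).neg

/-- The slope of `w` per unit mass is transported. -/
theorem transported_slope : F.Transported (fun t x => F.w₁ t x / F.ρ t x)
    fun t x => (F.w₂ t x * F.ρ t x - F.w₁ t x * F.ρ₁ t x) / F.ρ t x ^ 2 where
  cg := F.cw₁.div F.cρ fun t x => (F.pos t x).ne'
  cg₁ := ((F.cw₂.mul F.cρ).sub (F.cw₁.mul F.cρ₁)).div (F.cρ.pow 2)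
    fun t x => pow_ne_zero _ (F.pos t x).ne'
  xg t x := (F.xw₁ t x).div (F.xρ t x) (F.pos t x).ne'
  tg t ht x := by
    have hp := (F.pos t x).ne'
    refine HasDerivAt.congr_deriv ((F.tw₁ t ht x).div (F.tρ t ht x) hp) ?_
    field_simp
    ring

theorem Transported.comp {F} {g g₁ : ℝ → ℝ → ℝ} (hg : SmoothFlow.Transported (γ := γ) F g g₁)
    {φ φ' : ℝ → ℝ} (hφ : ∀ y, HasDerivAt φ (φ' y) y) (hφ' : Continuous φ') :
    F.Transported (fun t x => φ (g t x)) fun t x => φ' (g t x) * g₁ t x where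
  cg := hg.cg.comp (continuous_iff_continuousAt.2 fun y => (hφ y).continuousAt)
  cg₁ := (hg.cg.comp hφ').mul hg.cg₁
  xg t x := (hφ (g t x)).comp x (hg.xg t x)
  tg t ht x := by
    refine HasDerivAt.congr_deriv ((hφ (g t x)).comp t (hg.tg t ht x)) ?_
    ring

theorem Transported.sq {F} {g g₁ : ℝ → ℝ → ℝ} (hg : SmoothFlow.Transported (γ := γ) F g g₁) :
    F.Transported (fun t x => g t x ^ 2) fun t x => 2 * g t x * g₁ t x :=
  hg.comp (φ := fun y => y ^ 2) (φ' := fun y => 2 * y) (fun y => by simpa using hasDerivAt_pow 2 y)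
    (by fun_prop)

theorem transported_const (c : ℝ) : F.Transported (fun _ _ => c) fun _ _ => 0 where
  cg := ContPeriodic.const c
  cg₁ := ContPeriodic.const 0
  xg t x := hasDerivAt_const x c
  tg t ht x := by simpa using hasDerivAt_const t c

/-- The mass integral of a transported quantity is conserved. -/
theorem Transported.integral_eq {F} {g g₁ : ℝ → ℝ → ℝ}
    (hg : SmoothFlow.Transported (γ := γ) F g g₁) {s t : ℝ} (hs : 0 ≤ s) (hst : s ≤ t) :
    ∫ x in (0 : ℝ)..1, F.ρ t x * g t x = ∫ x in (0 : ℝ)..1, F.ρ s x * g s x := by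
  have ht : IsTimeDeriv (fun t x => F.ρ t x * g t x) fun t x =>
      -(F.ρ₁ t x * (F.u t x * g t x) + F.ρ t x * (F.u₁ t x * g t x + F.u t x * g₁ t x)) := by
    intro t ht x
    refine HasDerivAt.congr_deriv ((F.tρ t ht x).mul (hg.tg t ht x)) ?_
    ring
  have c1 := ((F.cρ₁.mul (F.cu.mul hg.cg)).add (F.cρ.mul ((F.cu₁.mul hg.cg).add
      (F.cu.mul hg.cg₁)))).neg
  have h := ht.integral_sub (F.cρ.mul hg.cg).cont c1.cont hs hst 0 1
  have hz : ∀ τ, ∫ x in (0 : ℝ)..1, -(F.ρ₁ τ x * (F.u τ x * g τ x)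
      + F.ρ τ x * (F.u₁ τ x * g τ x + F.u τ x * g₁ τ x)) = 0 := fun τ =>
    (F.cρ.mul (F.cu.mul hg.cg)).neg.integral_deriv_eq_zero c1 fun x =>
      ((F.xρ τ x).mul ((F.xu τ x).mul (hg.xg τ x))).neg
  simp only [hz, intervalIntegral.integral_zero] at h
  linarith

/-- The dissipation of the kinetic energy. -/
theorem integral_energy_le {t : ℝ} (ht : 0 ≤ t) :
    ∫ x in (0 : ℝ)..1, F.ρ t x * F.u t x ^ 2 ≤ ∫ x in (0 : ℝ)..1, F.ρ 0 x * F.u 0 x ^ 2 := by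
  -- the time derivative is `∂ₓ(-ρu³ + 2γρp u∂ₓu) - 2γρp (∂ₓu)²`
  have cc : ∀ c : ℝ, ContPeriodic fun _ _ => c := ContPeriodic.const
  have hd : IsTimeDeriv (fun t x => F.ρ t x * F.u t x ^ 2) fun t x =>
      (-(F.ρ₁ t x * F.u t x ^ 3 + F.ρ t x * (3 * F.u t x ^ 2 * F.u₁ t x))
        + 2 * ((1 + γ) * F.ρ t x * F.p₁ t x * (F.u t x * F.u₁ t x)
        + γ * F.ρ t x * F.p t x * (F.u₁ t x * F.u₁ t x + F.u t x * F.u₂ t x)))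
        - 2 * γ * F.ρ t x * F.p t x * F.u₁ t x ^ 2 := by
    intro t ht x
    refine HasDerivAt.congr_deriv ((F.tρ t ht x).mul ((F.tu t ht x).pow 2)) ?_
    simp only
    push_cast
    ring
  have c1 : ContPeriodic fun t x =>
      (-(F.ρ₁ t x * F.u t x ^ 3 + F.ρ t x * (3 * F.u t x ^ 2 * F.u₁ t x))
        + 2 * ((1 + γ) * F.ρ t x * F.p₁ t x * (F.u t x * F.u₁ t x)
        + γ * F.ρ t x * F.p t x * (F.u₁ t x * F.u₁ t x + F.u t x * F.u₂ t x))) :=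
    (((F.cρ₁.mul (F.cu.pow 3)).add (F.cρ.mul (((cc 3).mul (F.cu.pow 2)).mul F.cu₁))).neg).add
      ((cc 2).mul (((((cc (1 + γ)).mul F.cρ).mul F.cp₁).mul (F.cu.mul F.cu₁)).add
        ((((cc γ).mul F.cρ).mul F.cp).mul ((F.cu₁.mul F.cu₁).add (F.cu.mul F.cu₂)))))
  have c2 : ContPeriodic fun t x => 2 * γ * F.ρ t x * F.p t x * F.u₁ t x ^ 2 :=
    (((cc (2 * γ)).mul F.cρ).mul F.cp).mul (F.cu₁.pow 2)
  have h := hd.integral_sub (F.cρ.mul (F.cu.pow 2)).cont (c1.sub c2).cont le_rfl ht 0 1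
  have c0 : ContPeriodic fun t x => -(F.ρ t x * F.u t x ^ 3)
      + 2 * (γ * F.ρ t x * F.p t x * (F.u t x * F.u₁ t x)) :=
    (F.cρ.mul (F.cu.pow 3)).neg.add ((cc 2).mul ((((cc γ).mul F.cρ).mul F.cp).mul
      (F.cu.mul F.cu₁)))
  have hz : ∀ τ, ∫ x in (0 : ℝ)..1,
      (-(F.ρ₁ τ x * F.u τ x ^ 3 + F.ρ τ x * (3 * F.u τ x ^ 2 * F.u₁ τ x))
        + 2 * ((1 + γ) * F.ρ τ x * F.p₁ τ x * (F.u τ x * F.u₁ τ x)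
        + γ * F.ρ τ x * F.p τ x * (F.u₁ τ x * F.u₁ τ x + F.u τ x * F.u₂ τ x))) = 0 := by
    intro τ
    refine c0.integral_deriv_eq_zero c1 fun x => ?_
    refine HasDerivAt.congr_deriv (((F.xρ τ x).mul ((F.xu τ x).pow 3)).neg.add (((((F.xρ τ x).const_mul γ).mul
      (F.xp τ x)).mul ((F.xu τ x).mul (F.xu₁ τ x))).const_mul 2)) ?_
    simp only [Pi.pow_apply, Pi.mul_apply]
    push_cast
    linear_combination (-2 * F.u τ x * F.u₁ τ x) * F.rel τ x
  have hinner : ∀ τ, ∫ x in (0 : ℝ)..1,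
      ((-(F.ρ₁ τ x * F.u τ x ^ 3 + F.ρ τ x * (3 * F.u τ x ^ 2 * F.u₁ τ x))
        + 2 * ((1 + γ) * F.ρ τ x * F.p₁ τ x * (F.u τ x * F.u₁ τ x)
        + γ * F.ρ τ x * F.p τ x * (F.u₁ τ x * F.u₁ τ x + F.u τ x * F.u₂ τ x)))
        - 2 * γ * F.ρ τ x * F.p τ x * F.u₁ τ x ^ 2)
      = - ∫ x in (0 : ℝ)..1, 2 * γ * F.ρ τ x * F.p τ x * F.u₁ τ x ^ 2 := by
    intro τ
    rw [intervalIntegral.integral_sub (c1.ii τ 0 1) (c2.ii τ 0 1), hz, zero_sub]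
  have hnn : 0 ≤ ∫ τ in (0 : ℝ)..t, ∫ x in (0 : ℝ)..1,
      2 * γ * F.ρ τ x * F.p τ x * F.u₁ τ x ^ 2 := by
    refine intervalIntegral.integral_nonneg ht fun τ _ => ?_
    refine intervalIntegral.integral_nonneg zero_le_one fun x _ => ?_
    have := F.γ_pos
    have := F.pos τ x
    have := F.p_pos τ x
    positivity
  simp only [hinner, intervalIntegral.integral_neg] at h
  linarith

end SmoothFlow

/-- The oscillation of a periodic `C¹` function is at most the `L¹` norm of its derivative. -/
theorem sub_le_integral_abs {g g₁ : ℝ → ℝ} (hg : Function.Periodic g 1) (hc : Continuous g₁)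
    (h : ∀ x, HasDerivAt g (g₁ x) x) (x y : ℝ) : |g x - g y| ≤ ∫ z in (0 : ℝ)..1, |g₁ z| := by
  rw [← comp_fract_eq hg x, ← comp_fract_eq hg y]
  set x' := Int.fract x
  set y' := Int.fract y
  have hx : x' ∈ Icc (0 : ℝ) 1 := ⟨Int.fract_nonneg x, (Int.fract_lt_one x).le⟩
  have hy : y' ∈ Icc (0 : ℝ) 1 := ⟨Int.fract_nonneg y, (Int.fract_lt_one y).le⟩
  rw [← intervalIntegral.integral_eq_sub_of_hasDerivAt (fun z _ => h z)
    (hc.intervalIntegrable (μ := volume) y' x')]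
  refine (intervalIntegral.norm_integral_le_integral_norm_uIoc (f := g₁) (μ := volume)).trans ?_
  rw [intervalIntegral.integral_of_le zero_le_one]
  refine setIntegral_mono_set ?_ (.of_forall fun z => norm_nonneg _) (LE.le.eventuallyLE ?_)
  · exact integrable_torus_of_continuous hc.abs
  · exact Ioc_subset_Ioc (le_min hy.1 hx.1) (max_le hy.2 hx.2)

namespace SmoothFlow

variable {γ : ℝ} (F : SmoothFlow γ)

/-- The potential `π(ρ) = γ/(γ+1) ρ^(γ+1)`. -/
noncomputable def pot (t x : ℝ) : ℝ := γ / (γ + 1) * (F.ρ t x * F.p t x)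

/-- The derivative `∂ₓπ = ρ ∂ₓp`. -/
def pot₁ (t x : ℝ) : ℝ := F.ρ t x * F.p₁ t x

theorem cpot : ContPeriodic F.pot := (ContPeriodic.const _).mul (F.cρ.mul F.cp)

theorem cpot₁ : ContPeriodic F.pot₁ := F.cρ.mul F.cp₁

theorem pot_pos (t x : ℝ) : 0 < F.pot t x := by
  have := F.γ_pos
  have := F.pos t x
  have := F.p_pos t x
  unfold pot
  positivity

theorem xpot : IsXDeriv F.pot F.pot₁ := by
  intro t x
  refine HasDerivAt.congr_deriv (((F.xρ t x).mul (F.xp t x)).const_mul (γ / (γ + 1))) ?_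
  have := F.γ_pos
  have h := F.rel t x
  simp only [pot₁]
  field_simp
  linear_combination -h

theorem mass_eq {t : ℝ} (ht : 0 ≤ t) :
    ∫ x in (0 : ℝ)..1, F.ρ t x = ∫ x in (0 : ℝ)..1, F.ρ 0 x := by
  have := (F.transported_const 1).integral_eq le_rfl ht
  simpa using this

/-- The bounds on the initial state. -/
structure Bounded (C r₀ m : ℝ) : Prop where
  C_nonneg : 0 ≤ C
  r₀_pos : 0 < r₀
  m_lt : m < 1
  lower : ∀ x, r₀ ≤ F.ρ 0 x
  energy_u : ∫ x in (0 : ℝ)..1, F.ρ 0 x * F.u 0 x ^ 2 ≤ C ^ 2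
  energy_w : ∫ x in (0 : ℝ)..1, F.ρ 0 x * F.w 0 x ^ 2 ≤ C ^ 2
  slope : ∀ x, F.w₁ 0 x ≤ C
  slope_sq : ∫ x in (0 : ℝ)..1, F.w₁ 0 x ^ 2 ≤ C ^ 2
  mean : ∫ x in (0 : ℝ)..1, F.ρ 0 x ≤ m

end SmoothFlow

/-- The lower bound of the density at time `t`. -/
noncomputable def densityBound (C r₀ t : ℝ) : ℝ := r₀ / (1 + (C + r₀) * t)

/-- A bound for the potential. -/
def potBound (C : ℝ) : ℝ := 2 + 2 * C ^ 2

theorem two_le_potBound (C : ℝ) : 2 ≤ potBound C := by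
  unfold potBound; nlinarith [sq_nonneg C]

theorem integral_abs_le_one_add_sq {g : ℝ → ℝ} (hg : Continuous g) :
    ∫ x in (0 : ℝ)..1, |g x| ≤ 1 + ∫ x in (0 : ℝ)..1, g x ^ 2 := by
  have i2 : IntervalIntegrable (fun x => g x ^ 2) volume 0 1 := (hg.pow 2).intervalIntegrable _ _
  have : ∫ x in (0 : ℝ)..1, |g x| ≤ ∫ x in (0 : ℝ)..1, (1 + g x ^ 2) := by
    refine intervalIntegral.integral_mono_on zero_le_one (hg.abs.intervalIntegrable _ _)
      ((by simp : IntervalIntegrable (fun _ => (1 : ℝ)) volume 0 1).add i2) fun x _ => ?_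
    nlinarith [sq_abs (g x), sq_nonneg (|g x| - 1), abs_nonneg (g x)]
  rw [intervalIntegral.integral_add (by simp) i2] at this
  simpa using this

namespace SmoothFlow.Bounded

variable {γ C r₀ m : ℝ} {F : SmoothFlow γ} (h : F.Bounded C r₀ m)

include h

/-- The slope per unit mass keeps its upper bound; the term `ε t` makes the comparison strict. -/
theorem slope_le {t : ℝ} (ht : 0 ≤ t) (x : ℝ) : F.w₁ t x ≤ C / r₀ * F.ρ t x := by
  have hV := F.transported_slope
  have key : ∀ ε > 0, F.w₁ t x / F.ρ t x ≤ C / r₀ + ε * t := by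
    intro ε hε
    have hc : ContPeriodic fun t x => (C / r₀ + ε * t) - F.w₁ t x / F.ρ t x :=
      (ContPeriodic.of_time (by fun_prop)).sub hV.cg
    refine sub_nonneg.1 (hc.nonneg_of_min ?_ ?_ ht x)
    · intro y
      have h1 := h.slope y
      have h2 := h.lower y
      have h3 := h.r₀_pos
      have h4 := h.C_nonneg
      rw [mul_zero, add_zero, sub_nonneg, div_le_div_iff₀ (F.pos 0 y) h3]
      nlinarith
    · intro s hs _ y _ hmin
      have hx := (hV.xg s y).const_sub (C / r₀ + ε * s)
      have h0 := IsLocalMin.hasDerivAt_eq_zero (.of_forall hmin) hx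
      have ht := (((hasDerivAt_id s).const_mul ε).const_add (C / r₀)).sub (hV.tg s hs y)
      refine ⟨ε, hε, HasDerivAt.congr_deriv ht ?_⟩
      beta_reduce
      rw [neg_eq_zero.1 h0]
      simp
  have : F.w₁ t x / F.ρ t x ≤ C / r₀ := by
    refine le_of_forall_pos_le_add fun ε hε => ?_
    have h1 := key (ε / (t + 1)) (by positivity)
    refine h1.trans ?_
    gcongr
    rw [div_mul_eq_mul_div, div_le_iff₀ (by positivity)]
    nlinarith
  rwa [div_le_iff₀ (F.pos t x)] at this

/-- The lower bound of the density: at a spatial minimum the degenerate diffusion helps, and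
the slope of `w` is controlled by the density from above. -/
theorem density_ge {t : ℝ} (ht : 0 ≤ t) (x : ℝ) : densityBound C r₀ t ≤ F.ρ t x := by
  have hr := h.r₀_pos
  have hC := h.C_nonneg
  have hb : Continuous fun t : ℝ => r₀ / (1 + (C + r₀) * max t 0) := by
    refine Continuous.div (by fun_prop) (by fun_prop) fun t => ?_
    have : 0 ≤ max t 0 := le_max_right _ _
    positivity
  have hc : ContPeriodic fun t x => F.ρ t x - r₀ / (1 + (C + r₀) * max t 0) :=
    F.cρ.sub (ContPeriodic.of_time hb)
  have main := hc.nonneg_of_min ?_ ?_ ht x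
  · rw [sub_nonneg, max_eq_left ht] at main
    exact main
  · intro y
    simpa using h.lower y
  · intro s hs _ y hneg hmin
    rw [max_eq_left hs.le, sub_neg] at hneg
    have hden : 0 < 1 + (C + r₀) * s := by positivity
    have hρmin : ∀ z, F.ρ s y ≤ F.ρ s z := fun z => by linarith [hmin z]
    have hpmin : ∀ z, F.p s y ≤ F.p s z := fun z => by
      rw [F.p_eq, F.p_eq]
      exact Real.rpow_le_rpow (F.pos s y).le (hρmin z) F.γ_pos.le
    have e1 := IsLocalMin.hasDerivAt_eq_zero (.of_forall hρmin) (F.xρ s y)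
    have e2 := (deriv_eq_zero_and_nonneg_of_min (F.xp s) (F.xp₁ s) hpmin).2
    have hbd : HasDerivAt (fun s : ℝ => r₀ / (1 + (C + r₀) * max s 0))
        (-(r₀ * (C + r₀)) / (1 + (C + r₀) * s) ^ 2) s := by
      have h1 : HasDerivAt (fun s : ℝ => r₀ / (1 + (C + r₀) * s))
          (-(r₀ * (C + r₀)) / (1 + (C + r₀) * s) ^ 2) s := by
        refine HasDerivAt.congr_deriv ((hasDerivAt_const s r₀).div
          (((hasDerivAt_id s).const_mul (C + r₀)).const_add 1) hden.ne') ?_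
        simp
      refine h1.congr_of_eventuallyEq ?_
      filter_upwards [lt_mem_nhds hs] with τ hτ
      rw [max_eq_left hτ.le]
    refine ⟨_, ?_, (F.tρ s hs y).sub hbd⟩
    have hw := h.slope_le hs.le y
    have hp := F.pos s y
    simp only [w₁] at hw
    beta_reduce
    rw [e1]
    -- `ρ < b` and `∂ₓu ≤ ∂ₓw ≤ (C/r₀) ρ`, while `b' = -(C/r₀ + 1) b²`
    set b := r₀ / (1 + (C + r₀) * s) with hbdef
    have hb0 : 0 < b := by positivity
    have e3 : -(r₀ * (C + r₀)) / (1 + (C + r₀) * s) ^ 2 = -((C / r₀ + 1) * b ^ 2) := by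
      rw [hbdef]; field_simp
    rw [e3]
    have hc0 : 0 ≤ C / r₀ := by positivity
    have h1 : F.ρ s y * F.u₁ s y ≤ F.ρ s y * (C / r₀ * F.ρ s y) := by
      refine mul_le_mul_of_nonneg_left ?_ hp.le
      linarith
    have h2 : F.ρ s y * (C / r₀ * F.ρ s y) ≤ C / r₀ * b ^ 2 := by
      have : F.ρ s y * F.ρ s y ≤ b ^ 2 := by nlinarith
      nlinarith
    nlinarith

theorem energy_w_le {t : ℝ} (ht : 0 ≤ t) :
    ∫ x in (0 : ℝ)..1, F.ρ t x * F.w t x ^ 2 ≤ C ^ 2 :=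
  (F.transported_w.sq.integral_eq le_rfl ht).trans_le h.energy_w

theorem energy_p_le {t : ℝ} (ht : 0 ≤ t) :
    ∫ x in (0 : ℝ)..1, F.ρ t x * F.p₁ t x ^ 2 ≤ 4 * C ^ 2 := by
  have h1 := h.energy_w_le ht
  have h2 := (F.integral_energy_le ht).trans h.energy_u
  have i1 := (F.cρ.mul (F.cw.pow 2)).ii t 0 1
  have i2 := (F.cρ.mul (F.cu.pow 2)).ii t 0 1
  have h3 : ∫ x in (0 : ℝ)..1, F.ρ t x * F.p₁ t x ^ 2 ≤
      ∫ x in (0 : ℝ)..1, (2 * (F.ρ t x * F.w t x ^ 2) + 2 * (F.ρ t x * F.u t x ^ 2)) := by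
    refine intervalIntegral.integral_mono_on zero_le_one ((F.cρ.mul (F.cp₁.pow 2)).ii t 0 1)
      ((i1.const_mul 2).add (i2.const_mul 2)) fun x _ => ?_
    have := F.pos t x
    simp only [w]
    nlinarith [mul_nonneg this.le (sq_nonneg (2 * F.u t x + F.p₁ t x))]
  rw [intervalIntegral.integral_add (i1.const_mul 2) (i2.const_mul 2),
    intervalIntegral.integral_const_mul, intervalIntegral.integral_const_mul] at h3
  linarith

/-- The uniform bound on the potential: it is at most `1` where the density is below its mean. -/
theorem pot_le {t : ℝ} (ht : 0 ≤ t) (x : ℝ) : F.pot t x ≤ potBound C := by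
  have hm := F.mass_eq ht
  have hmean := h.mean
  have hlt := h.m_lt
  obtain ⟨x₀, -, hx₀⟩ := isCompact_Icc.exists_isMinOn (s := Icc (0 : ℝ) 1) ⟨0, by simp⟩
    (F.cρ.cont_x t).continuousOn
  have h1 : F.ρ t x₀ ≤ ∫ y in (0 : ℝ)..1, F.ρ t y := by
    have := intervalIntegral.integral_mono_on (μ := volume) zero_le_one (f := fun _ => F.ρ t x₀)
      (g := F.ρ t) (by simp) (F.cρ.ii t 0 1) fun y hy => hx₀ hy
    simpa using this
  have hγ := F.γ_pos
  have h2 : F.pot t x₀ ≤ 1 := by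
    have hp : F.p t x₀ ≤ 1 := by
      rw [F.p_eq]; exact Real.rpow_le_one (F.pos t x₀).le (by linarith) hγ.le
    have hq : γ / (γ + 1) ≤ 1 := by rw [div_le_one (by linarith)]; linarith
    have hr : F.ρ t x₀ * F.p t x₀ ≤ 1 := by
      have := F.pos t x₀
      have := F.p_pos t x₀
      nlinarith
    have := F.pos t x₀
    have := F.p_pos t x₀
    unfold pot
    exact mul_le_one₀ hq (by positivity) hr
  have h3 := sub_le_integral_abs (F.cpot.per t) (F.cpot₁.cont_x t) (F.xpot t) x x₀
  have h4 : ∫ z in (0 : ℝ)..1, |F.pot₁ t z| ≤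
      ∫ z in (0 : ℝ)..1, (1 / 2 * F.ρ t z + 1 / 2 * (F.ρ t z * F.p₁ t z ^ 2)) := by
    refine intervalIntegral.integral_mono_on zero_le_one (F.cpot₁.abs.ii t 0 1)
      (((F.cρ.ii t 0 1).const_mul _).add (((F.cρ.mul (F.cp₁.pow 2)).ii t 0 1).const_mul _))
      fun z _ => ?_
    have := F.pos t z
    simp only [pot₁, abs_mul, abs_of_pos this]
    nlinarith [mul_nonneg this.le (sq_nonneg (|F.p₁ t z| - 1)), sq_abs (F.p₁ t z)]
  rw [intervalIntegral.integral_add ((F.cρ.ii t 0 1).const_mul _)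
    (((F.cρ.mul (F.cp₁.pow 2)).ii t 0 1).const_mul _), intervalIntegral.integral_const_mul,
    intervalIntegral.integral_const_mul] at h4
  have h5 := h.energy_p_le ht
  have h6 := (abs_le.1 h3).2
  unfold potBound
  linarith

theorem rpow_le {t : ℝ} (ht : 0 ≤ t) (x : ℝ) : F.ρ t x * F.p t x ≤ 2 * potBound C := by
  have h1 := h.pot_le ht x
  have hγ := F.one_le
  have := F.pos t x
  have := F.p_pos t x
  have h2 : 1 / 2 ≤ γ / (γ + 1) := by rw [div_le_div_iff₀ two_pos (by linarith)]; linarith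
  unfold pot at h1
  nlinarith [mul_le_mul_of_nonneg_right h2 (by positivity : 0 ≤ F.ρ t x * F.p t x)]

theorem density_le {t : ℝ} (ht : 0 ≤ t) (x : ℝ) : F.ρ t x ≤ 2 * potBound C := by
  have h1 := h.rpow_le ht x
  have h2 := two_le_potBound C
  rcases le_total (F.ρ t x) 1 with h3 | h3
  · linarith
  · have : 1 ≤ F.p t x := by rw [F.p_eq]; exact Real.one_le_rpow h3 F.γ_pos.le
    nlinarith

theorem pot₁_sq_le {t : ℝ} (ht : 0 ≤ t) :
    ∫ x in (0 : ℝ)..1, F.pot₁ t x ^ 2 ≤ 2 * potBound C * (4 * C ^ 2) := by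
  have h1 : ∫ x in (0 : ℝ)..1, F.pot₁ t x ^ 2 ≤
      ∫ x in (0 : ℝ)..1, 2 * potBound C * (F.ρ t x * F.p₁ t x ^ 2) := by
    refine intervalIntegral.integral_mono_on zero_le_one ((F.cpot₁.pow 2).ii t 0 1)
      (((F.cρ.mul (F.cp₁.pow 2)).ii t 0 1).const_mul _) fun x _ => ?_
    have h1 := F.pos t x
    have h2 := h.density_le ht x
    have : F.pot₁ t x ^ 2 = F.ρ t x * (F.ρ t x * F.p₁ t x ^ 2) := by simp only [pot₁]; ring
    rw [this]
    gcongr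
  rw [intervalIntegral.integral_const_mul] at h1
  refine h1.trans ?_
  have := two_le_potBound C
  gcongr
  exact h.energy_p_le ht

theorem w₁_sq_le {t : ℝ} (ht : 0 ≤ t) :
    ∫ x in (0 : ℝ)..1, F.w₁ t x ^ 2 ≤ 2 * potBound C * (C ^ 2 / r₀) := by
  have hr := h.r₀_pos
  have h0 := F.transported_slope.sq.integral_eq le_rfl ht
  have cc : ∀ t, IntervalIntegrable (fun x => F.ρ t x * (F.w₁ t x / F.ρ t x) ^ 2) volume 0 1 :=
    fun t => (F.cρ.mul (F.transported_slope.cg.pow 2)).ii t 0 1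
  have e : ∀ t x, F.w₁ t x ^ 2 = F.ρ t x * (F.ρ t x * (F.w₁ t x / F.ρ t x) ^ 2) := by
    intro t x
    have := (F.pos t x).ne'
    field_simp
  have h1 : ∫ x in (0 : ℝ)..1, F.ρ 0 x * (F.w₁ 0 x / F.ρ 0 x) ^ 2 ≤ C ^ 2 / r₀ := by
    have h2 : ∫ x in (0 : ℝ)..1, F.ρ 0 x * (F.w₁ 0 x / F.ρ 0 x) ^ 2 ≤
        ∫ x in (0 : ℝ)..1, F.w₁ 0 x ^ 2 * r₀⁻¹ := by
      refine intervalIntegral.integral_mono_on zero_le_one (cc 0)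
        (((F.cw₁.pow 2).ii 0 0 1).mul_const _) fun x _ => ?_
      rw [e 0 x, ← div_eq_mul_inv, le_div_iff₀ hr, mul_comm]
      have := F.pos 0 x
      have := h.lower x
      gcongr
    rw [intervalIntegral.integral_mul_const] at h2
    refine h2.trans ?_
    rw [div_eq_mul_inv]
    gcongr
    exact h.slope_sq
  have h3 : ∫ x in (0 : ℝ)..1, F.w₁ t x ^ 2 ≤
      ∫ x in (0 : ℝ)..1, 2 * potBound C * (F.ρ t x * (F.w₁ t x / F.ρ t x) ^ 2) := by
    refine intervalIntegral.integral_mono_on zero_le_one ((F.cw₁.pow 2).ii t 0 1)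
      ((cc t).const_mul _) fun x _ => ?_
    rw [e t x]
    have := F.pos t x
    have := h.density_le ht x
    gcongr
  rw [intervalIntegral.integral_const_mul, h0] at h3
  refine h3.trans ?_
  have := two_le_potBound C
  gcongr

theorem densityBound_pos {T : ℝ} (hT : 0 ≤ T) : 0 < densityBound C r₀ T := by
  have := h.r₀_pos
  have := h.C_nonneg
  unfold densityBound
  positivity

theorem densityBound_le {t T : ℝ} (ht : t ∈ Icc 0 T) (x : ℝ) :
    densityBound C r₀ T ≤ F.ρ t x := by
  refine le_trans ?_ (h.density_ge ht.1 x)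
  have := h.r₀_pos
  have := h.C_nonneg
  have h1 := ht.1
  have h2 := ht.2
  unfold densityBound
  gcongr

theorem sq_le_of_weighted {g : ℝ → ℝ → ℝ} (hg : ContPeriodic g) {K t T : ℝ} (ht : t ∈ Icc 0 T)
    (hK : ∫ x in (0 : ℝ)..1, F.ρ t x * g t x ^ 2 ≤ K) :
    ∫ x in (0 : ℝ)..1, g t x ^ 2 ≤ K / densityBound C r₀ T := by
  have hr := h.densityBound_pos (ht.1.trans ht.2)
  rw [le_div_iff₀ hr, ← intervalIntegral.integral_mul_const]
  refine le_trans ?_ hK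
  refine intervalIntegral.integral_mono_on zero_le_one (((hg.pow 2).ii t 0 1).mul_const _)
    ((F.cρ.mul (hg.pow 2)).ii t 0 1) fun x _ => ?_
  rw [mul_comm]
  have := h.densityBound_le ht x
  gcongr

theorem w_sq_le {t T : ℝ} (ht : t ∈ Icc 0 T) :
    ∫ x in (0 : ℝ)..1, F.w t x ^ 2 ≤ C ^ 2 / densityBound C r₀ T :=
  h.sq_le_of_weighted F.cw ht (h.energy_w_le ht.1)

theorem u_sq_le {t T : ℝ} (ht : t ∈ Icc 0 T) :
    ∫ x in (0 : ℝ)..1, F.u t x ^ 2 ≤ C ^ 2 / densityBound C r₀ T :=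
  h.sq_le_of_weighted F.cu ht ((F.integral_energy_le ht.1).trans h.energy_u)

theorem w₁_abs_le {t : ℝ} (ht : 0 ≤ t) :
    ∫ x in (0 : ℝ)..1, |F.w₁ t x| ≤ 1 + 2 * potBound C * (C ^ 2 / r₀) :=
  (integral_abs_le_one_add_sq (F.cw₁.cont_x t)).trans (by linarith [h.w₁_sq_le ht])

end SmoothFlow.Bounded

/-! ### The homogeneity estimate for the velocity gradient -/

/-- The elementary inequalities behind the `L¹` estimate: `q = √(Y² + δ²)` is a regularised
absolute value, and the completion of a square absorbs the diffusion. -/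
theorem regularised_dissipation_le {γ δ Y Y₁ p p₁ u₁ w₁ q K : ℝ} (hγ : 0 < γ) (hδ : 0 < δ)
    (hp : 0 < p) (hq : 0 < q) (hq2 : q ^ 2 = Y ^ 2 + δ ^ 2)
    (hK : |u₁| + (1 + γ) ^ 2 * p₁ ^ 2 / (4 * γ * p) ≤ K) :
    u₁ * (q - Y * (Y / q)) - (Y₁ * q - Y * (Y * Y₁ / q)) / q ^ 2 * ((1 + γ) * p₁ * Y + γ * p * Y₁)
      - (γ + 1) * (Y * w₁ / q) ≤ δ * K + (γ + 1) * |w₁| := by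
  have hYq : |Y| ≤ q := abs_le_of_sq_le_sq (by nlinarith) hq.le
  have hδq : δ ≤ q := by nlinarith [sq_nonneg Y]
  have a1 : u₁ * (q - Y * (Y / q)) ≤ δ * |u₁| := by
    have e : q - Y * (Y / q) = δ ^ 2 / q := by field_simp; linarith
    rw [e]
    have : δ ^ 2 / q ≤ δ := by rw [div_le_iff₀ hq]; nlinarith
    calc u₁ * (δ ^ 2 / q) ≤ |u₁| * (δ ^ 2 / q) := by
          gcongr; exact le_abs_self _
      _ ≤ |u₁| * δ := by gcongr
      _ = δ * |u₁| := mul_comm _ _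
  have a3 : -((γ + 1) * (Y * w₁ / q)) ≤ (γ + 1) * |w₁| := by
    have : |Y * w₁ / q| ≤ |w₁| := by
      rw [abs_div, abs_mul, abs_of_pos hq, div_le_iff₀ hq, mul_comm]
      gcongr
    have h2 := neg_le_abs (Y * w₁ / q)
    nlinarith
  have a2 : -((Y₁ * q - Y * (Y * Y₁ / q)) / q ^ 2 * ((1 + γ) * p₁ * Y + γ * p * Y₁))
      ≤ δ * ((1 + γ) ^ 2 * p₁ ^ 2 / (4 * γ * p)) := by
    have e : (Y₁ * q - Y * (Y * Y₁ / q)) / q ^ 2 = δ ^ 2 / q ^ 3 * Y₁ := by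
      field_simp
      linear_combination Y₁ * hq2
    rw [e]
    have b1 : -(Y₁ * ((1 + γ) * p₁ * Y + γ * p * Y₁)) ≤
        (1 + γ) ^ 2 * p₁ ^ 2 / (4 * γ * p) * Y ^ 2 := by
      rw [div_mul_eq_mul_div, le_div_iff₀ (by positivity)]
      nlinarith [sq_nonneg ((1 + γ) * p₁ * Y + 2 * γ * p * Y₁)]
    have b2 : δ ^ 2 / q ^ 3 * Y ^ 2 ≤ δ := by
      rw [div_mul_eq_mul_div, div_le_iff₀ (by positivity)]
      have c1 : Y ^ 2 ≤ q ^ 2 := by nlinarith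
      have c2 : δ ^ 2 * Y ^ 2 ≤ δ * q * q ^ 2 := by
        have : δ ^ 2 ≤ δ * q := by nlinarith
        gcongr
      nlinarith
    have h3 : 0 ≤ δ ^ 2 / q ^ 3 := by positivity
    have h4 : 0 ≤ (1 + γ) ^ 2 * p₁ ^ 2 / (4 * γ * p) := by positivity
    calc -(δ ^ 2 / q ^ 3 * Y₁ * ((1 + γ) * p₁ * Y + γ * p * Y₁))
        = δ ^ 2 / q ^ 3 * -(Y₁ * ((1 + γ) * p₁ * Y + γ * p * Y₁)) := by ring
      _ ≤ δ ^ 2 / q ^ 3 * ((1 + γ) ^ 2 * p₁ ^ 2 / (4 * γ * p) * Y ^ 2) := by gcongr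
      _ = (δ ^ 2 / q ^ 3 * Y ^ 2) * ((1 + γ) ^ 2 * p₁ ^ 2 / (4 * γ * p)) := by ring
      _ ≤ δ * ((1 + γ) ^ 2 * p₁ ^ 2 / (4 * γ * p)) := by gcongr
  have : δ * |u₁| + δ * ((1 + γ) ^ 2 * p₁ ^ 2 / (4 * γ * p)) ≤ δ * K := by
    rw [← mul_add]; gcongr
  linarith

namespace SmoothFlow

variable {γ : ℝ} (F : SmoothFlow γ)

/-- The generator of the scaling symmetry of the Lagrangian form `∂ₜτ = ∂ₘw - ∂ₘ²π(1/τ)` of the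
mass equation (`π(1/τ)` is homogeneous of degree `-(γ+1)` in `τ`), in Eulerian coordinates. -/
def scal (t x : ℝ) : ℝ := 1 - (γ + 2) * t * F.u₁ t x

theorem cscal : ContPeriodic F.scal :=
  (ContPeriodic.const 1).sub ((ContPeriodic.of_time (c := fun t => (γ + 2) * t) (by fun_prop)).mul
    F.cu₁)

/-- `∂ₜY + ∂ₓ(uY) = ∂ₓ((1+γ) ∂ₓp Y + γ p ∂ₓY) - (γ+1) ∂ₓw` for the scaling generator `Y`. -/
theorem tscal : IsTimeDeriv F.scal fun t x =>
    -(F.u₁ t x * F.scal t x + F.u t x * (-((γ + 2) * t) * F.u₂ t x))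
      + ((1 + γ) * (F.p₂ t x * F.scal t x + F.p₁ t x * (-((γ + 2) * t) * F.u₂ t x))
        + γ * (F.p₁ t x * (-((γ + 2) * t) * F.u₂ t x) + F.p t x * (-((γ + 2) * t) * F.u₃ t x)))
      - (γ + 1) * F.w₁ t x := by
  intro t ht x
  have h1 := (((hasDerivAt_id t).const_mul (γ + 2)).mul (F.tu₁ t ht x)).const_sub 1
  refine HasDerivAt.congr_deriv h1 ?_
  simp only [id, w₁, scal]
  ring

/-- The `L¹` estimate for the scaling generator, from the `L¹` contraction of its equation. -/
theorem integral_abs_scal_le {K : ℝ} (hK : ∀ t ≥ 0, ∫ x in (0 : ℝ)..1, |F.w₁ t x| ≤ K) {t : ℝ}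
    (ht : 0 ≤ t) : ∫ x in (0 : ℝ)..1, |F.scal t x| ≤ 1 + (γ + 1) * K * t := by
  have hγ := F.γ_pos
  have cc : ∀ c : ℝ, ContPeriodic fun _ _ => c := ContPeriodic.const
  have cY := F.cscal
  have ct : ContPeriodic fun t _ => -((γ + 2) * t) := ContPeriodic.of_time (by fun_prop)
  set Y := F.scal with hY
  set Y₁ : ℝ → ℝ → ℝ := fun t x => -((γ + 2) * t) * F.u₂ t x with hY₁
  set Y₂ : ℝ → ℝ → ℝ := fun t x => -((γ + 2) * t) * F.u₃ t x with hY₂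
  have cY₁ : ContPeriodic Y₁ := ct.mul F.cu₂
  have cY₂ : ContPeriodic Y₂ := ct.mul F.cu₃
  have xY : IsXDeriv Y Y₁ := fun t x => HasDerivAt.congr_deriv
    (((F.xu₁ t x).const_mul ((γ + 2) * t)).const_sub 1) (by simp only [hY₁]; ring)
  have xY₁ : IsXDeriv Y₁ Y₂ := fun t x => (F.xu₂ t x).const_mul _
  have cJ : ContPeriodic fun t x => (1 + γ) * F.p₁ t x * Y t x + γ * F.p t x * Y₁ t x :=
    (((cc _).mul F.cp₁).mul cY).add (((cc _).mul F.cp).mul cY₁)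
  have cJ₁ : ContPeriodic fun t x => (1 + γ) * (F.p₂ t x * Y t x + F.p₁ t x * Y₁ t x)
      + γ * (F.p₁ t x * Y₁ t x + F.p t x * Y₂ t x) :=
    ((cc _).mul ((F.cp₂.mul cY).add (F.cp₁.mul cY₁))).add
      ((cc _).mul ((F.cp₁.mul cY₁).add (F.cp.mul cY₂)))
  have cM : ContPeriodic fun t x => |F.u₁ t x| + (1 + γ) ^ 2 * F.p₁ t x ^ 2 / (4 * γ * F.p t x) :=
    F.cu₁.abs.add (((cc _).mul (F.cp₁.pow 2)).div ((cc (4 * γ)).mul F.cp)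
      fun t x => by have := F.p_pos t x; positivity)
  obtain ⟨M, -, hM⟩ := cM.exists_bound t
  have key : ∀ δ > 0, ∫ x in (0 : ℝ)..1, |Y t x| ≤ 1 + (γ + 1) * K * t + δ * (1 + M * t) := by
    intro δ hδ
    have hpos : ∀ t x, 0 < Y t x ^ 2 + δ ^ 2 := fun t x => by positivity
    set q : ℝ → ℝ → ℝ := fun t x => √(Y t x ^ 2 + δ ^ 2) with hq
    have hq0 : ∀ t x, 0 < q t x := fun t x => Real.sqrt_pos.2 (hpos t x)
    have hq2 : ∀ t x, q t x ^ 2 = Y t x ^ 2 + δ ^ 2 := fun t x => Real.sq_sqrt (hpos t x).le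
    have cq : ContPeriodic q := ((cY.pow 2).add (cc (δ ^ 2))).comp Real.continuous_sqrt
    have hqd : ∀ {g : ℝ → ℝ} {g' x a : ℝ}, HasDerivAt g g' x → g x = a →
        HasDerivAt (fun y => √(g y ^ 2 + δ ^ 2)) (a * g' / √(a ^ 2 + δ ^ 2)) x := by
      intro g g' x a hg ha
      subst ha
      refine HasDerivAt.congr_deriv (((hg.pow 2).add_const (δ ^ 2)).sqrt
        (by simp only [Pi.pow_apply]; positivity)) ?_
      simp only [Pi.pow_apply]
      push_cast
      field_simp
    have xq : IsXDeriv q fun t x => Y t x * Y₁ t x / q t x := fun t x => hqd (xY t x) rfl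
    have tq : IsTimeDeriv q fun t x => Y t x * (-(F.u₁ t x * Y t x + F.u t x * Y₁ t x)
        + ((1 + γ) * (F.p₂ t x * Y t x + F.p₁ t x * Y₁ t x)
        + γ * (F.p₁ t x * Y₁ t x + F.p t x * Y₂ t x)) - (γ + 1) * F.w₁ t x) / q t x :=
      fun t ht x => hqd (F.tscal t ht x) rfl
    -- the flux `G = -uq + (Y/q) J` and the remainder `R`
    have hG : IsXDeriv (fun t x => -(F.u t x * q t x)
        + Y t x / q t x * ((1 + γ) * F.p₁ t x * Y t x + γ * F.p t x * Y₁ t x)) fun t x =>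
        -(F.u₁ t x * q t x + F.u t x * (Y t x * Y₁ t x / q t x))
        + ((Y₁ t x * q t x - Y t x * (Y t x * Y₁ t x / q t x)) / q t x ^ 2
            * ((1 + γ) * F.p₁ t x * Y t x + γ * F.p t x * Y₁ t x)
          + Y t x / q t x * ((1 + γ) * (F.p₂ t x * Y t x + F.p₁ t x * Y₁ t x)
            + γ * (F.p₁ t x * Y₁ t x + F.p t x * Y₂ t x))) := by
      intro t x
      refine HasDerivAt.congr_deriv (((F.xu t x).mul (xq t x)).neg.add
        (((xY t x).div (xq t x) (hq0 t x).ne').mul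
          ((((F.xp₁ t x).const_mul (1 + γ)).mul (xY t x)).add
            (((F.xp t x).const_mul γ).mul (xY₁ t x))))) ?_
      simp only [Pi.div_apply]
      ring
    have cD : ContPeriodic fun t x =>
        (Y₁ t x * q t x - Y t x * (Y t x * Y₁ t x / q t x)) / q t x ^ 2 :=
      ((cY₁.mul cq).sub (cY.mul ((cY.mul cY₁).div cq fun t x => (hq0 t x).ne'))).div (cq.pow 2)
        fun t x => pow_ne_zero _ (hq0 t x).ne'
    have cYq : ContPeriodic fun t x => Y t x / q t x := cY.div cq fun t x => (hq0 t x).ne'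
    have cG : ContPeriodic (fun t x => -(F.u t x * q t x)
        + Y t x / q t x * ((1 + γ) * F.p₁ t x * Y t x + γ * F.p t x * Y₁ t x)) :=
      (F.cu.mul cq).neg.add (cYq.mul cJ)
    have cG₁ : ContPeriodic (fun t x =>
        -(F.u₁ t x * q t x + F.u t x * (Y t x * Y₁ t x / q t x))
        + ((Y₁ t x * q t x - Y t x * (Y t x * Y₁ t x / q t x)) / q t x ^ 2
            * ((1 + γ) * F.p₁ t x * Y t x + γ * F.p t x * Y₁ t x)
          + Y t x / q t x * ((1 + γ) * (F.p₂ t x * Y t x + F.p₁ t x * Y₁ t x)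
            + γ * (F.p₁ t x * Y₁ t x + F.p t x * Y₂ t x)))) :=
      ((F.cu₁.mul cq).add (F.cu.mul ((cY.mul cY₁).div cq fun t x => (hq0 t x).ne'))).neg.add
        ((cD.mul cJ).add (cYq.mul cJ₁))
    have cR : ContPeriodic fun t x => F.u₁ t x * (q t x - Y t x * (Y t x / q t x))
        - (Y₁ t x * q t x - Y t x * (Y t x * Y₁ t x / q t x)) / q t x ^ 2
          * ((1 + γ) * F.p₁ t x * Y t x + γ * F.p t x * Y₁ t x)
        - (γ + 1) * (Y t x * F.w₁ t x / q t x) :=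
      ((F.cu₁.mul (cq.sub (cY.mul cYq))).sub (cD.mul cJ)).sub
        ((cc _).mul ((cY.mul F.cw₁).div cq fun t x => (hq0 t x).ne'))
    have tq' := tq.integral_sub cq.cont
      (((cY.mul (((((F.cu₁.mul cY).add (F.cu.mul cY₁)).neg).add cJ₁).sub
        ((cc (γ + 1)).mul F.cw₁))).div cq fun t x => (hq0 t x).ne').cont) le_rfl ht 0 1
    have split : ∀ τ, ∫ x in (0 : ℝ)..1, Y τ x * (-(F.u₁ τ x * Y τ x + F.u τ x * Y₁ τ x)
        + ((1 + γ) * (F.p₂ τ x * Y τ x + F.p₁ τ x * Y₁ τ x)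
        + γ * (F.p₁ τ x * Y₁ τ x + F.p τ x * Y₂ τ x)) - (γ + 1) * F.w₁ τ x) / q τ x
        = ∫ x in (0 : ℝ)..1, (F.u₁ τ x * (q τ x - Y τ x * (Y τ x / q τ x))
        - (Y₁ τ x * q τ x - Y τ x * (Y τ x * Y₁ τ x / q τ x)) / q τ x ^ 2
          * ((1 + γ) * F.p₁ τ x * Y τ x + γ * F.p τ x * Y₁ τ x)
        - (γ + 1) * (Y τ x * F.w₁ τ x / q τ x)) := by
      intro τ
      have h0 := cG.integral_deriv_eq_zero cG₁ (t := τ) (hG τ)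
      have h1 := intervalIntegral.integral_add (cR.ii τ 0 1) (cG₁.ii τ 0 1)
      rw [h0, add_zero] at h1
      rw [← h1]
      refine intervalIntegral.integral_congr fun x _ => ?_
      ring
    have hR : ∀ τ ∈ Icc 0 t, ∫ x in (0 : ℝ)..1,
        (F.u₁ τ x * (q τ x - Y τ x * (Y τ x / q τ x))
        - (Y₁ τ x * q τ x - Y τ x * (Y τ x * Y₁ τ x / q τ x)) / q τ x ^ 2
          * ((1 + γ) * F.p₁ τ x * Y τ x + γ * F.p τ x * Y₁ τ x)
        - (γ + 1) * (Y τ x * F.w₁ τ x / q τ x)) ≤ δ * M + (γ + 1) * K := by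
      intro τ hτ
      have i1 : IntervalIntegrable (fun x => δ * M + (γ + 1) * |F.w₁ τ x|) volume 0 1 :=
        ((cc (δ * M)).add ((cc (γ + 1)).mul F.cw₁.abs)).ii τ 0 1
      refine (intervalIntegral.integral_mono_on zero_le_one (cR.ii τ 0 1) i1 fun x _ =>
        regularised_dissipation_le hγ hδ (F.p_pos τ x) (hq0 τ x) (hq2 τ x)
          ((le_abs_self _).trans (hM τ hτ x))).trans ?_
      rw [intervalIntegral.integral_add (by simp) ((F.cw₁.abs.ii τ 0 1).const_mul _),
        intervalIntegral.integral_const, intervalIntegral.integral_const_mul]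
      have := hK τ hτ.1
      simp only [sub_zero, one_smul]
      gcongr
    simp only [split] at tq'
    have hI : ∫ τ in (0 : ℝ)..t, ∫ x in (0 : ℝ)..1,
        (F.u₁ τ x * (q τ x - Y τ x * (Y τ x / q τ x))
        - (Y₁ τ x * q τ x - Y τ x * (Y τ x * Y₁ τ x / q τ x)) / q τ x ^ 2
          * ((1 + γ) * F.p₁ τ x * Y τ x + γ * F.p τ x * Y₁ τ x)
        - (γ + 1) * (Y τ x * F.w₁ τ x / q τ x)) ≤ (δ * M + (γ + 1) * K) * t := by
      have := intervalIntegral.integral_mono_on (μ := volume) ht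
        ((cR.cont_integral 0 1).intervalIntegrable 0 t) (by simp) hR
      refine this.trans (le_of_eq ?_)
      simp only [intervalIntegral.integral_const, sub_zero, smul_eq_mul]
      ring
    have h0 : ∫ x in (0 : ℝ)..1, q 0 x ≤ 1 + δ := by
      have : ∀ x, q 0 x ≤ 1 + δ := by
        intro x
        refine Real.sqrt_le_iff.2 ⟨by linarith, ?_⟩
        simp only [hY, scal]
        nlinarith
      have := intervalIntegral.integral_mono_on (μ := volume) zero_le_one (cq.ii 0 0 1)
        (by simp : IntervalIntegrable (fun _ => 1 + δ) volume 0 1) fun x _ => this x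
      simpa using this
    have h1 : ∫ x in (0 : ℝ)..1, |Y t x| ≤ ∫ x in (0 : ℝ)..1, q t x := by
      refine intervalIntegral.integral_mono_on zero_le_one (cY.abs.ii t 0 1) (cq.ii t 0 1)
        fun x _ => ?_
      exact abs_le_of_sq_le_sq (by nlinarith [hq2 t x]) (hq0 t x).le
    nlinarith
  refine le_of_forall_pos_le_add fun ε hε => ?_
  have hM0 : 0 ≤ M := (abs_nonneg _).trans (hM 0 ⟨le_rfl, ht⟩ 0)
  refine (key (ε / (1 + M * t)) (by positivity)).trans (le_of_eq ?_)
  have : 1 + M * t ≠ 0 := by positivity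
  field_simp

/-- Uniform bound on the variation of the velocity at positive times. -/
theorem integral_abs_u₁_le {K : ℝ} (hK : ∀ t ≥ 0, ∫ x in (0 : ℝ)..1, |F.w₁ t x| ≤ K) {t : ℝ}
    (ht : 0 < t) : ∫ x in (0 : ℝ)..1, |F.u₁ t x| ≤ 2 / (γ * t) + K := by
  have hγ := F.γ_pos
  have hK0 : 0 ≤ K := le_trans (intervalIntegral.integral_nonneg zero_le_one fun _ _ => abs_nonneg _)
    (hK 0 le_rfl)
  have h1 := F.integral_abs_scal_le hK ht.le
  have h2 : ∫ x in (0 : ℝ)..1, (γ + 2) * t * |F.u₁ t x| ≤ ∫ x in (0 : ℝ)..1, (1 + |F.scal t x|) := by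
    refine intervalIntegral.integral_mono_on zero_le_one ((F.cu₁.abs.ii t 0 1).const_mul _)
      ((by simp : IntervalIntegrable (fun _ => (1 : ℝ)) volume 0 1).add (F.cscal.abs.ii t 0 1))
      fun x _ => ?_
    have e : (γ + 2) * t * |F.u₁ t x| = |1 - F.scal t x| := by
      simp only [scal, sub_sub_cancel, abs_mul, abs_of_pos ht]
      rw [abs_of_pos (by linarith : 0 < γ + 2)]
    rw [e]
    simpa using abs_sub 1 (F.scal t x)
  rw [intervalIntegral.integral_add (by simp) (F.cscal.abs.ii t 0 1),
    intervalIntegral.integral_const_mul] at h2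
  simp only [intervalIntegral.integral_const, sub_zero, one_smul] at h2
  have h3 : (γ + 2) * t * ∫ x in (0 : ℝ)..1, |F.u₁ t x| ≤ (γ + 2) * t * (2 / (γ * t) + K) := by
    have e : (γ + 2) * t * (2 / (γ * t) + K) = 2 + 4 / γ + (γ + 2) * t * K := by
      field_simp; ring
    rw [e]
    have : 0 ≤ 4 / γ := by positivity
    nlinarith [mul_nonneg ht.le hK0]
  exact le_of_mul_le_mul_left h3 (by positivity)

end SmoothFlow

/-! ### From regular solutions to smooth flows -/

theorem continuous_comp_max {f : ℝ → ℝ → ℝ}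
    (h : ∀ T > 0, ContinuousOn (fun z : ℝ × ℝ => f z.1 z.2) (Icc 0 T ×ˢ univ)) :
    Continuous fun z : ℝ × ℝ => f (max z.1 0) z.2 := by
  refine continuous_iff_continuousAt.2 fun z => ?_
  set T := max z.1 0 + 1 with hT
  have hT0 : 0 < T := by have := le_max_right z.1 0; linarith
  have hmap : ContinuousOn (fun z : ℝ × ℝ => ((max z.1 0, z.2) : ℝ × ℝ)) (Iio T ×ˢ univ) :=
    Continuous.continuousOn (by fun_prop)
  have := (h T hT0).comp hmap fun y hy => ⟨⟨le_max_right _ _, max_le hy.1.le hT0.le⟩, mem_univ _⟩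
  refine this.continuousAt ((isOpen_Iio.prod isOpen_univ).mem_nhds ⟨?_, mem_univ _⟩)
  have := le_max_left z.1 0
  simp only [mem_Iio]
  linarith

theorem hasDerivAt_comp_max {f : ℝ → ℝ} {d t : ℝ} (ht : 0 < t)
    (h : HasDerivWithinAt f d (Icc 0 (t + 1)) t) : HasDerivAt (fun s => f (max s 0)) d t := by
  refine (h.hasDerivAt (Icc_mem_nhds ht (by linarith))).congr_of_eventuallyEq ?_
  filter_upwards [lt_mem_nhds ht] with s hs
  rw [max_eq_left hs.le]

/-- The continuity equation preserves the positivity of the density. -/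
theorem pos_of_continuity_equation {ρ ρ₁ u u₁ : ℝ → ℝ → ℝ} (cρ : ContPeriodic ρ)
    (cu₁ : ContPeriodic u₁) (xρ : IsXDeriv ρ ρ₁)
    (tρ : IsTimeDeriv ρ fun t x => -(ρ₁ t x * u t x + ρ t x * u₁ t x)) {r : ℝ} (hr : 0 < r)
    (h0 : ∀ x, r ≤ ρ 0 x) {t : ℝ} (ht : 0 ≤ t) (x : ℝ) : 0 < ρ t x := by
  obtain ⟨M, hM0, hM⟩ := cu₁.exists_bound t
  set k := M + 1 with hk
  have ce : ContPeriodic fun t _ => Real.exp (-(k * t)) := ContPeriodic.of_time (by fun_prop)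
  have de : ∀ s, HasDerivAt (fun s => Real.exp (-(k * s))) (-k * Real.exp (-(k * s))) s := by
    intro s
    refine HasDerivAt.congr_deriv ((((hasDerivAt_id s).const_mul k).neg).exp) ?_
    simp only [id, Pi.neg_apply]
    ring
  have hnn : ∀ s ∈ Icc 0 t, ∀ x, 0 ≤ ρ s x := by
    intro s hs x
    have := (ce.mul cρ).nonneg_of_min (t := s) ?_ ?_ hs.1 x
    · exact nonneg_of_mul_nonneg_right this (Real.exp_pos _)
    · intro y
      exact mul_nonneg (Real.exp_pos _).le (hr.le.trans (h0 y))
    · intro τ hτ hτs y hneg hmin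
      have hE := Real.exp_pos (-(k * τ))
      have hmin' : ∀ z, ρ τ y ≤ ρ τ z := fun z => le_of_mul_le_mul_left (hmin z) hE
      have e1 := IsLocalMin.hasDerivAt_eq_zero (.of_forall hmin') (xρ τ y)
      have hρ : ρ τ y < 0 := by
        by_contra! hcon
        have := mul_nonneg hE.le hcon
        linarith
      refine ⟨_, ?_, (de τ).mul (tρ τ hτ y)⟩
      have hu := abs_le.1 (hM τ ⟨hτ.le, hτs.trans hs.2⟩ y)
      beta_reduce
      rw [e1]
      have : -k * Real.exp (-(k * τ)) * ρ τ y + Real.exp (-(k * τ)) * -(0 * u τ y + ρ τ y * u₁ τ y)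
          = Real.exp (-(k * τ)) * ((k + u₁ τ y) * (-ρ τ y)) := by ring
      rw [this]
      refine mul_pos hE (mul_pos ?_ (by linarith))
      rw [hk]; linarith [hu.1]
  have main := (cρ.sub ((ContPeriodic.const r).mul ce)).nonneg_of_min (t := t) ?_ ?_ ht x
  · have := Real.exp_pos (-(k * t))
    have := mul_pos hr this
    linarith
  · intro y
    have := h0 y
    simpa using this
  · intro τ hτ hτs y hneg hmin
    have hmin' : ∀ z, ρ τ y ≤ ρ τ z := fun z => by linarith [hmin z]
    have e1 := IsLocalMin.hasDerivAt_eq_zero (.of_forall hmin') (xρ τ y)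
    refine ⟨_, ?_, (tρ τ hτ y).sub ((de τ).const_mul r)⟩
    have hu := abs_le.1 (hM τ ⟨hτ.le, hτs⟩ y)
    have hρ := hnn τ ⟨hτ.le, hτs⟩ y
    have hE := mul_pos hr (Real.exp_pos (-(k * τ)))
    beta_reduce
    rw [e1]
    have : ρ τ y * u₁ τ y ≤ ρ τ y * M := mul_le_mul_of_nonneg_left hu.2 hρ
    nlinarith

section construction

variable {γ : ℝ} {ρ₀ u₀ : ℝ → ℝ} {ρ u : ℝ → ℝ → ℝ}

theorem contPeriodic_iterate_deriv {f : ℝ → ℝ → ℝ} (h : ∀ T > 0, ContSobolev 4 T f)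
    (hc : ∀ T > 0, ∀ t ∈ Icc 0 T, Continuous (f t)) (j : ℕ) (hj : j ≤ 3) :
    ContPeriodic fun t x => deriv^[j] (f (max t 0)) x := by
  refine ⟨continuous_comp_max (f := fun t x => deriv^[j] (f t) x) fun T hT =>
    (h T hT).continuousOn_iterate_deriv (hc T hT) j hj, fun t => ?_⟩
  have hT : 0 < max t 0 + 1 := by have := le_max_right t 0; linarith
  have hm : max t 0 ∈ Icc 0 (max t 0 + 1) := ⟨le_max_right _ _, by linarith⟩
  obtain ⟨pf, D, hD, -⟩ := h _ hT
  exact ((hD _ hm).iterate_deriv (hc _ hT _ hm) (pf _ hm) j hj).2.1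

theorem isXDeriv_iterate_deriv {f : ℝ → ℝ → ℝ} (h : ∀ T > 0, ContSobolev 4 T f)
    (hc : ∀ T > 0, ∀ t ∈ Icc 0 T, Continuous (f t)) (j : ℕ) (hj : j < 3) :
    IsXDeriv (fun t x => deriv^[j] (f (max t 0)) x) fun t x => deriv^[j + 1] (f (max t 0)) x := by
  intro t
  have hT : 0 < max t 0 + 1 := by have := le_max_right t 0; linarith
  have hm : max t 0 ∈ Icc 0 (max t 0 + 1) := ⟨le_max_right _ _, by linarith⟩
  obtain ⟨pf, D, hD, -⟩ := h _ hT
  exact ((hD _ hm).iterate_deriv (hc _ hT _ hm) (pf _ hm) j hj.le).2.2.2 hj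

/-- A global regular solution with positive initial density is, for `t ≥ 0`, a smooth flow. -/
theorem IsGlobalRegularSolution.exists_smoothFlow (S : IsGlobalRegularSolution γ ρ₀ u₀ ρ u)
    (hγ : 1 ≤ γ) {r : ℝ} (hr : 0 < r) (h0 : ∀ x, r ≤ ρ₀ x) :
    ∃ F : SmoothFlow γ, ∀ t ≥ 0, F.ρ t = ρ t ∧ F.u t = u t ∧
      F.w t = desiredVelocity γ (ρ t) (u t) := by
  have hρS := fun T hT => (S.regular T hT).density_reg
  have huS := fun T hT => (S.regular T hT).velocity_reg
  have hρc := fun T hT => (S.regular T hT).continuous_density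
  have huc := fun T hT => (S.regular T hT).continuous_velocity
  set R : ℕ → ℝ → ℝ → ℝ := fun j t x => deriv^[j] (ρ (max t 0)) x with hR
  set U : ℕ → ℝ → ℝ → ℝ := fun j t x => deriv^[j] (u (max t 0)) x with hU
  have cR : ∀ j ≤ 3, ContPeriodic (R j) := contPeriodic_iterate_deriv hρS hρc
  have cU : ∀ j ≤ 3, ContPeriodic (U j) := contPeriodic_iterate_deriv huS huc
  have xR : ∀ j < 3, IsXDeriv (R j) (R (j + 1)) := isXDeriv_iterate_deriv hρS hρc
  have xU : ∀ j < 3, IsXDeriv (U j) (U (j + 1)) := isXDeriv_iterate_deriv huS huc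
  have tR : IsTimeDeriv (R 0) fun t x => -(R 1 t x * U 0 t x + R 0 t x * U 1 t x) := by
    intro t ht x
    have h1 := hasDerivAt_comp_max ht ((S.regular (t + 1) (by linarith)).mass t
      ⟨ht.le, by linarith⟩ x)
    refine HasDerivAt.congr_deriv h1 ?_
    have h2 := ((xR 0 (by simp) t x).mul (xU 0 (by simp) t x)).deriv
    have e : (fun y => ρ t y * u t y) = R 0 t * U 0 t := by
      funext y; simp [hR, hU, max_eq_left ht.le]
    rw [e, h2]
  have hpos : ∀ t x, 0 < R 0 t x := by
    intro t x
    have hinit : ∀ x, r ≤ R 0 0 x := fun x => by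
      simp only [hR, max_self, Function.iterate_zero, id, S.density_init]; exact h0 x
    rcases le_total 0 t with ht | ht
    · exact pos_of_continuity_equation (cR 0 (by simp)) (cU 1 (by simp)) (xR 0 (by simp)) tR hr
        hinit ht x
    · have := hinit x
      simp only [hR, max_self, max_eq_right ht] at this ⊢
      linarith
  have hne : ∀ t x, R 0 t x ≠ 0 := fun t x => (hpos t x).ne'
  have c0 := cR 0 (by simp)
  have c1 := cR 1 (by simp)
  have c2 := cR 2 (by simp)
  have c3 := cR 3 (by simp)
  have x0 : IsXDeriv (R 0) (R 1) := xR 0 (by simp)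
  have x1 : IsXDeriv (R 1) (R 2) := xR 1 (by simp)
  have x2 : IsXDeriv (R 2) (R 3) := xR 2 (by simp)
  have y0 : IsXDeriv (U 0) (U 1) := xU 0 (by simp)
  have y1 : IsXDeriv (U 1) (U 2) := xU 1 (by simp)
  have y2 : IsXDeriv (U 2) (U 3) := xU 2 (by simp)
  -- the logarithmic derivative of the density and its derivatives
  set q : ℝ → ℝ → ℝ := fun t x => R 1 t x / R 0 t x with hq
  set q₁ : ℝ → ℝ → ℝ := fun t x => (R 2 t x * R 0 t x - R 1 t x * R 1 t x) / R 0 t x ^ 2 with hq₁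
  set q₂ : ℝ → ℝ → ℝ := fun t x =>
    ((R 3 t x * R 0 t x - R 1 t x * R 2 t x) * R 0 t x ^ 2
      - (R 2 t x * R 0 t x - R 1 t x * R 1 t x) * (2 * R 0 t x * R 1 t x)) / (R 0 t x ^ 2) ^ 2
    with hq₂
  have cq : ContPeriodic q := c1.div c0 hne
  have cq₁ : ContPeriodic q₁ :=
    ((c2.mul c0).sub (c1.mul c1)).div (c0.pow 2) fun t x => pow_ne_zero _ (hne t x)
  have cq₂ : ContPeriodic q₂ :=
    ((((c3.mul c0).sub (c1.mul c2)).mul (c0.pow 2)).sub (((c2.mul c0).sub (c1.mul c1)).mul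
      (((ContPeriodic.const 2).mul c0).mul c1))).div ((c0.pow 2).pow 2)
      fun t x => pow_ne_zero _ (pow_ne_zero _ (hne t x))
  have xq : IsXDeriv q q₁ := fun t x => (x1 t x).div (x0 t x) (hne t x)
  have xq₁ : IsXDeriv q₁ q₂ := by
    intro t x
    refine HasDerivAt.congr_deriv ((((x2 t x).mul (x0 t x)).sub ((x1 t x).mul (x1 t x))).div
      ((x0 t x).pow 2) (pow_ne_zero _ (hne t x))) ?_
    simp only [hq₂, Pi.sub_apply, Pi.mul_apply]
    push_cast
    ring
  set p : ℝ → ℝ → ℝ := fun t x => R 0 t x ^ γ with hp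
  have cp : ContPeriodic p := c0.comp (Real.continuous_rpow_const (by linarith))
  have cγ : ContPeriodic fun _ _ => γ := ContPeriodic.const γ
  have xp : IsXDeriv p fun t x => γ * (p t x * q t x) := by
    intro t x
    refine HasDerivAt.congr_deriv ((x0 t x).rpow_const (p := γ) (Or.inl (hne t x))) ?_
    rw [Real.rpow_sub_one (hne t x)]
    have := hne t x
    simp only [hp, hq]
    field_simp
  set p₁ : ℝ → ℝ → ℝ := fun t x => γ * (p t x * q t x) with hp₁
  set p₂ : ℝ → ℝ → ℝ := fun t x => γ * (p₁ t x * q t x + p t x * q₁ t x) with hp₂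
  set p₃ : ℝ → ℝ → ℝ := fun t x => γ * ((p₂ t x * q t x + p₁ t x * q₁ t x)
    + (p₁ t x * q₁ t x + p t x * q₂ t x)) with hp₃
  have cp₁ : ContPeriodic p₁ := cγ.mul (cp.mul cq)
  have cp₂ : ContPeriodic p₂ := cγ.mul ((cp₁.mul cq).add (cp.mul cq₁))
  have cp₃ : ContPeriodic p₃ := cγ.mul (((cp₂.mul cq).add (cp₁.mul cq₁)).add
    ((cp₁.mul cq₁).add (cp.mul cq₂)))
  have xp₁ : IsXDeriv p₁ p₂ := fun t x => ((xp t x).mul (xq t x)).const_mul γ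
  have xp₂ : IsXDeriv p₂ p₃ := fun t x =>
    (((xp₁ t x).mul (xq t x)).add ((xp t x).mul (xq₁ t x))).const_mul γ
  have tm : IsTimeDeriv (fun t x => R 0 t x * U 0 t x) fun t x =>
      -(R 1 t x * U 0 t x ^ 2 + 2 * R 0 t x * U 0 t x * U 1 t x)
      + (γ * (R 1 t x * p t x + R 0 t x * p₁ t x) * U 1 t x + γ * R 0 t x * p t x * U 2 t x) := by
    intro t ht x
    have h1 := hasDerivAt_comp_max ht ((S.regular (t + 1) (by linarith)).momentum t
      ⟨ht.le, by linarith⟩ x)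
    refine HasDerivAt.congr_deriv h1 ?_
    have h2 := ((x0 t x).mul ((y0 t x).pow 2)).deriv
    have e : (fun y => ρ t y * u t y ^ 2) = R 0 t * U 0 t ^ 2 := by
      funext y; simp [hR, hU, max_eq_left ht.le]
    have h3 := ((((x0 t x).const_mul γ).mul (xp t x)).mul (y1 t x)).deriv
    have e' : (fun y => viscosity γ (ρ t y) * deriv (u t) y)
        = (fun y => γ * R 0 t y) * p t * U 1 t := by
      funext y
      have hy := hne t y
      have a1 : ρ t y = R 0 t y := by simp [hR, max_eq_left ht.le]
      have a2 : deriv (u t) y = U 1 t y := by simp [hU, max_eq_left ht.le]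
      simp only [viscosity, a1, a2, Real.rpow_sub_one hy, Pi.mul_apply, hp]
      field_simp
    rw [e, e', h2, h3]
    simp only [Pi.mul_apply, Pi.pow_apply]
    push_cast
    ring
  refine ⟨{ ρ := R 0, ρ₁ := R 1, p := p, p₁ := p₁, p₂ := p₂, p₃ := p₃
            u := U 0, u₁ := U 1, u₂ := U 2, u₃ := U 3, one_le := hγ
            cρ := c0, cρ₁ := c1, cp := cp, cp₁ := cp₁, cp₂ := cp₂, cp₃ := cp₃
            cu := cU 0 (by simp), cu₁ := cU 1 (by simp), cu₂ := cU 2 (by simp)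
            cu₃ := cU 3 (by simp), pos := hpos, p_eq := fun t x => rfl
            xρ := x0, xp := xp, xp₁ := xp₁, xp₂ := xp₂, xu := y0, xu₁ := y1, xu₂ := y2
            tρ := tR, tm := tm }, fun t ht => ⟨?_, ?_, ?_⟩⟩
  · simp [hR, max_eq_left ht]
  · simp [hU, max_eq_left ht]
  · funext x
    have e : (fun y => offset γ (ρ t y)) = p t := by
      funext y; simp [offset, hp, hR, max_eq_left ht]
    simp only [desiredVelocity, SmoothFlow.w, e, (xp t x).deriv]
    simp [hU, max_eq_left ht]

end construction

theorem SmoothFlow.pot_eq {γ : ℝ} (F : SmoothFlow γ) (t x : ℝ) :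
    F.pot t x = potential γ (F.ρ t x) := by
  rw [potential, Real.rpow_add_one (F.pos t x).ne', ← F.p_eq, SmoothFlow.pot, mul_comm (F.p t x)]

theorem integral_sq_le_of_l2Norm_le {f : ℝ → ℝ} {C : ℝ} (h : l2Norm f ≤ C) :
    ∫ x in (0 : ℝ)..1, f x ^ 2 ≤ C ^ 2 := by
  rw [← integral_torus]
  exact Real.sqrt_le_left (le_trans (Real.sqrt_nonneg _) h) |>.1 h

theorem le_essSup_torus {f : ℝ → ℝ} (hf : Continuous f) :
    ∀ᵐ x ∂torusMeasure, f x ≤ essSup f torusMeasure := by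
  refine ae_le_essSup ?_
  obtain ⟨K, hK⟩ := isCompact_Icc.exists_bound_of_continuousOn (hf.continuousOn (s := Icc 0 1))
  refine ⟨K, ?_⟩
  rw [eventually_map]
  exact ae_torus_iff.2 (.of_forall fun x hx =>
    (le_abs_self _).trans (hK x (Ioc_subset_Icc_self hx)))

/-- Admissible data give the bounds for the a priori estimates. -/
theorem AdmissibleData.bounded {γ C r₀ m : ℝ} {ρ₀ u₀ : ℝ → ℝ} {F : SmoothFlow γ}
    (A : AdmissibleData C r₀ m γ ρ₀ u₀) (hr₀ : 0 < r₀) (hm : m < 1) (e1 : F.ρ 0 = ρ₀)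
    (e2 : F.u 0 = u₀) (e3 : F.w 0 = desiredVelocity γ ρ₀ u₀) : F.Bounded C r₀ m := by
  have hd : deriv (desiredVelocity γ ρ₀ u₀) = F.w₁ 0 := by
    rw [← e3]; exact funext fun x => (F.xw 0 x).deriv
  have hE := A.energy
  have hS := A.slope
  rw [hd] at hS
  rw [← e3, ← e1, ← e2] at hE
  have n1 : 0 ≤ l2Norm fun x => √(F.ρ 0 x) * F.u 0 x := Real.sqrt_nonneg _
  have n2 : 0 ≤ l2Norm fun x => √(F.ρ 0 x) * F.w 0 x := Real.sqrt_nonneg _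
  have n3 : 0 ≤ l2Norm (F.w₁ 0) := Real.sqrt_nonneg _
  have hess := le_essSup_torus (F.cw₁.cont_x 0)
  have n4 : 0 ≤ essSup (F.w₁ 0) torusMeasure := by
    have h0 := F.cw.integral_deriv_eq_zero F.cw₁ (F.xw 0)
    have := integral_mono_ae (integrable_torus_of_continuous (F.cw₁.cont_x 0))
      (integrable_const _) hess
    rw [integral_torus, h0] at this
    simpa using this
  have hsq : ∀ g : ℝ → ℝ, (∫ x in (0 : ℝ)..1, (√(F.ρ 0 x) * g x) ^ 2)
      = ∫ x in (0 : ℝ)..1, F.ρ 0 x * g x ^ 2 := fun g =>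
    intervalIntegral.integral_congr fun x _ => by
      simp only [mul_pow, Real.sq_sqrt (F.pos 0 x).le]
  refine ⟨by linarith, hr₀, hm, fun x => e1 ▸ A.lower x, ?_, ?_, ?_, ?_, ?_⟩
  · rw [← hsq]
    exact integral_sq_le_of_l2Norm_le (by linarith)
  · rw [← hsq]
    exact integral_sq_le_of_l2Norm_le (by linarith)
  · have : F.w₁ 0 = fun x => min (F.w₁ 0 x) C := by
      refine eq_of_ae_eq_torus (F.cw₁.cont_x 0) ((F.cw₁.cont_x 0).min continuous_const)
        (F.cw₁.per 0) (fun x => by simp only [F.cw₁.per 0 x]) ?_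
      filter_upwards [hess] with x hx
      rw [min_eq_left (by linarith)]
    intro x
    rw [this]
    exact min_le_right _ _
  · exact integral_sq_le_of_l2Norm_le (by linarith)
  · rw [← integral_torus, e1]
    exact A.mean

/-! ### Bounded sets of `H¹(𝕋)` -/

theorem sq_integral_le {g : ℝ → ℝ} {a b : ℝ} (hab : a ≤ b) (hg : IntervalIntegrable g volume a b)
    (hg2 : IntervalIntegrable (fun x => g x ^ 2) volume a b) :
    (∫ x in a..b, g x) ^ 2 ≤ (b - a) * ∫ x in a..b, g x ^ 2 := by
  rcases hab.eq_or_lt with rfl | hab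
  · simp
  set c := (∫ x in a..b, g x) / (b - a) with hc
  have h0 : 0 ≤ ∫ x in a..b, (g x - c) ^ 2 :=
    intervalIntegral.integral_nonneg hab.le fun x _ => sq_nonneg _
  have e : ∫ x in a..b, (g x - c) ^ 2
      = (∫ x in a..b, g x ^ 2) - 2 * c * (∫ x in a..b, g x) + c ^ 2 * (b - a) := by
    have : (fun x => (g x - c) ^ 2) = fun x => g x ^ 2 - 2 * c * g x + c ^ 2 := by
      funext x; ring
    rw [this, intervalIntegral.integral_add (hg2.sub (hg.const_mul _)) (by simp),
      intervalIntegral.integral_sub hg2 (hg.const_mul _), intervalIntegral.integral_const_mul,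
      intervalIntegral.integral_const, smul_eq_mul]
    ring
  have hba : 0 < b - a := sub_pos.2 hab
  rw [e] at h0
  have hI : (∫ x in a..b, g x) = c * (b - a) := by rw [hc]; field_simp
  rw [hI] at h0 ⊢
  nlinarith

/-- Bounded sequences in `L²` have weakly convergent subsequences. -/
theorem exists_subseq_weakly_tendsto {α : Type*} [MeasurableSpace α] {μ : Measure α}
    [IsSeparable μ] {G : ℕ → α → ℝ} {K : ℝ≥0} (hG : ∀ n, MemLp (G n) 2 μ)
    (hK : ∀ n, eLpNorm (G n) 2 μ ≤ K) :
    ∃ (σ : ℕ → ℕ) (g : α → ℝ), StrictMono σ ∧ MemLp g 2 μ ∧ eLpNorm g 2 μ ≤ K ∧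
      ∀ ψ, MemLp ψ 2 μ → Tendsto (fun n => ∫ x, G (σ n) x * ψ x ∂μ) atTop
        (𝓝 (∫ x, g x * ψ x ∂μ)) := by
  have : Fact ((1 : ℝ≥0∞) ≤ 2) := ⟨one_le_two⟩
  have : Fact ((2 : ℝ≥0∞) ≠ ⊤) := ⟨by simp⟩
  set D := fun f : Lp ℝ 2 μ => StrongDual.toWeakDual (InnerProductSpace.toDual ℝ (Lp ℝ 2 μ) f)
  have inner_eq : ∀ (f : Lp ℝ 2 μ) (a ψ : α → ℝ), f =ᵐ[μ] a → ∀ hψ : MemLp ψ 2 μ,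
      inner ℝ f (hψ.toLp ψ) = ∫ x, a x * ψ x ∂μ := by
    intro f a ψ ha hψ
    rw [L2.inner_def]
    refine integral_congr_ae ?_
    filter_upwards [ha, hψ.coeFn_toLp] with x h1 h2
    rw [h1, h2]
    simp [mul_comm]
  have hmem : ∀ n, D ((hG n).toLp (G n)) ∈
      WeakDual.toStrongDual ⁻¹' Metric.closedBall (0 : StrongDual ℝ (Lp ℝ 2 μ)) K := by
    intro n
    simp only [mem_preimage, mem_closedBall_zero_iff]
    change ‖InnerProductSpace.toDual ℝ (Lp ℝ 2 μ) ((hG n).toLp (G n))‖ ≤ K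
    rw [LinearIsometryEquiv.norm_map, Lp.norm_toLp]
    exact ENNReal.toReal_le_coe_of_le_coe (hK n)
  obtain ⟨L, hL, σ, hσ, hlim⟩ := WeakDual.isSeqCompact_closedBall ℝ (Lp ℝ 2 μ) 0 K hmem
  set g := (InnerProductSpace.toDual ℝ (Lp ℝ 2 μ)).symm (WeakDual.toStrongDual L) with hg
  refine ⟨σ, g, hσ, Lp.memLp g, ?_, fun ψ hψ => ?_⟩
  · have : ‖g‖ ≤ K := by
      rw [hg, LinearIsometryEquiv.norm_map]
      simpa using hL
    rw [Lp.norm_def] at this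
    rw [← ENNReal.ofReal_coe_nnreal]
    exact (ENNReal.le_ofReal_iff_toReal_le (Lp.memLp g).2.ne K.2).2 this
  · have h := (WeakBilin.tendsto_iff_forall_eval_tendsto _ ContinuousLinearMap.coe_injective).1
      hlim (hψ.toLp ψ)
    rw [← inner_eq g g ψ (ae_eq_refl _) hψ]
    have e : ∀ n, ∫ x, G (σ n) x * ψ x ∂μ = inner ℝ ((hG (σ n)).toLp (G (σ n))) (hψ.toLp ψ) :=
      fun n => (inner_eq _ _ ψ (hG (σ n)).coeFn_toLp hψ).symm
    simp only [e]
    have e' : inner ℝ g (hψ.toLp ψ) = WeakDual.toStrongDual L (hψ.toLp ψ) := by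
      rw [hg, InnerProductSpace.toDual_symm_apply]
    rw [e']
    exact h

/-- Membership in `H¹(𝕋)` with a bound for the derivative in `L²(𝕋)`. The derivative is the
classical one, which exists almost everywhere. -/
structure H1Bounded (K : ℝ≥0) (f : ℝ → ℝ) : Prop where
  per : Function.Periodic f 1
  ac : ∀ a b, AbsolutelyContinuousOnInterval f a b
  norm_le : eLpNorm (deriv f) 2 torusMeasure ≤ K

theorem periodic_deriv {f : ℝ → ℝ} {c : ℝ} (h : Function.Periodic f c) :
    Function.Periodic (deriv f) c := fun x => by
  have : (fun y => f (y + c)) = f := funext h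
  rw [← deriv_comp_add_const, this]

theorem eLpNorm_two_le_iff {α : Type*} [MeasurableSpace α] {μ : Measure α} {g : α → ℝ}
    (hg : AEStronglyMeasurable g μ) {K : ℝ≥0} :
    eLpNorm g 2 μ ≤ K ↔ Integrable (fun x => g x ^ 2) μ ∧ ∫ x, g x ^ 2 ∂μ ≤ K ^ 2 := by
  have key : MemLp g 2 μ → (eLpNorm g 2 μ ≤ K ↔ ∫ x, g x ^ 2 ∂μ ≤ K ^ 2) := by
    intro h
    have e : eLpNorm g 2 μ = ENNReal.ofReal (Real.sqrt (∫ x, g x ^ 2 ∂μ)) := by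
      rw [h.eLpNorm_eq_integral_rpow_norm (by simp) (by simp)]
      congr 1
      simp [Real.sqrt_eq_rpow]
    rw [e, ← ENNReal.ofReal_coe_nnreal, ENNReal.ofReal_le_ofReal_iff K.coe_nonneg]
    exact Real.sqrt_le_left K.2
  constructor
  · intro h
    have hm : MemLp g 2 μ := ⟨hg, h.trans_lt ENNReal.coe_lt_top⟩
    exact ⟨hm.integrable_sq, (key hm).1 h⟩
  · rintro ⟨h1, h2⟩
    exact (key ((memLp_two_iff_integrable_sq hg).2 h1)).2 h2

namespace H1Bounded

variable {K : ℝ≥0} {f : ℝ → ℝ}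

theorem of_hasDerivAt {f₁ : ℝ → ℝ} (hp : Function.Periodic f 1) (h : ∀ x, HasDerivAt f (f₁ x) x)
    (hc : Continuous f₁) (hK : ∫ x in (0 : ℝ)..1, f₁ x ^ 2 ≤ K ^ 2) : H1Bounded K f where
  per := hp
  ac a b := by
    have hd : deriv f = f₁ := funext fun x => (h x).deriv
    have : ContDiff ℝ 1 f := contDiff_one_iff_deriv.2
      ⟨fun x => (h x).differentiableAt, hd ▸ hc⟩
    exact this.contDiffOn.absolutelyContinuousOnInterval
  norm_le := by
    have hd : deriv f = f₁ := funext fun x => (h x).deriv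
    rw [hd, eLpNorm_two_le_iff (memLp_torus_of_continuous hc 2).1]
    exact ⟨integrable_torus_of_continuous (hc.pow 2), by rwa [integral_torus]⟩

theorem continuous (h : H1Bounded K f) : Continuous f :=
  continuous_iff_continuousAt.2 fun x =>
    ((h.ac (x - 1) (x + 1)).continuousOn).continuousAt (by
      rw [uIcc_of_le (by linarith)]
      exact Icc_mem_nhds (by linarith) (by linarith))

theorem integral_deriv (h : H1Bounded K f) (a b : ℝ) : ∫ x in a..b, deriv f x = f b - f a :=
  (h.ac a b).integral_deriv_eq_sub

theorem memLp (h : H1Bounded K f) : MemLp (deriv f) 2 torusMeasure :=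
  ⟨(measurable_deriv f).aestronglyMeasurable, h.norm_le.trans_lt ENNReal.coe_lt_top⟩

theorem integral_sq_le (h : H1Bounded K f) : ∫ x in (0 : ℝ)..1, deriv f x ^ 2 ≤ K ^ 2 := by
  rw [← integral_torus]
  exact ((eLpNorm_two_le_iff h.memLp.1).1 h.norm_le).2

theorem isWeakDeriv (h : H1Bounded K f) : IsWeakDeriv f (deriv f) where
  integrable_left := integrable_torus_of_continuous h.continuous
  integrable_right := h.memLp.integrable one_le_two
  parts φ h1 h2 := by
    rw [integral_torus, integral_torus, (h.ac 0 1).integral_mul_deriv_eq_deriv_mul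
      (absolutelyContinuousOnInterval_of_contDiff h1 0 1)]
    have e1 := h.per 0
    have e2 := h2 0
    rw [zero_add] at e1 e2
    rw [e1, e2]
    ring

theorem intervalIntegrable_sq (h : H1Bounded K f) (a b : ℝ) :
    IntervalIntegrable (fun x => deriv f x ^ 2) volume a b := by
  have hp : Function.Periodic (fun x => deriv f x ^ 2) 1 := fun x => by
    simp only [periodic_deriv h.per x]
  refine hp.intervalIntegrable (t := 0) one_ne_zero ?_ a b
  rw [zero_add]
  exact integrable_torus_iff.1 h.memLp.integrable_sq

theorem abs_sub_le (h : H1Bounded K f) {x y : ℝ} (hxy : |x - y| ≤ 1) :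
    |f x - f y| ≤ K * √|x - y| := by
  wlog hle : y ≤ x generalizing x y
  · have := this (x := y) (y := x) (by rwa [abs_sub_comm]) (le_of_not_ge hle)
    rwa [abs_sub_comm, abs_sub_comm x y]
  rw [abs_of_nonneg (sub_nonneg.2 hle)] at hxy ⊢
  have h1 := sq_integral_le hle ((h.ac y x).intervalIntegrable_deriv)
    (h.intervalIntegrable_sq y x)
  rw [h.integral_deriv] at h1
  have h2 : ∫ z in y..x, deriv f z ^ 2 ≤ K ^ 2 := by
    have hp : Function.Periodic (fun x => deriv f x ^ 2) 1 := fun x => by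
      simp only [periodic_deriv h.per x]
    calc ∫ z in y..x, deriv f z ^ 2 ≤ ∫ z in y..(y + 1), deriv f z ^ 2 :=
          intervalIntegral.integral_mono_interval le_rfl hle (by linarith)
            (Eventually.of_forall fun z => sq_nonneg _) (h.intervalIntegrable_sq _ _)
      _ = ∫ z in (0 : ℝ)..(0 + 1), deriv f z ^ 2 := hp.intervalIntegral_add_eq y 0
      _ ≤ K ^ 2 := by rw [zero_add]; exact h.integral_sq_le
  refine abs_le_of_sq_le_sq ?_ (by positivity)
  rw [mul_pow, Real.sq_sqrt (sub_nonneg.2 hle)]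
  nlinarith [sub_nonneg.2 hle]

/-- Bounded subsets of `H¹(𝕋)` are closed under pointwise limits: the derivatives have a weakly
convergent subsequence, and the limit is the primitive of the weak limit. -/
theorem of_tendsto {F : ℕ → ℝ → ℝ} (hF : ∀ n, H1Bounded K (F n))
    (hlim : ∀ x, Tendsto (fun n => F n x) atTop (𝓝 (f x))) : H1Bounded K f := by
  have hp : Function.Periodic f 1 := fun x => tendsto_nhds_unique
    ((hlim (x + 1)).congr fun n => (hF n).per x) (hlim x)
  obtain ⟨σ, g, hσ, hg, hgK, hw⟩ := exists_subseq_weakly_tendsto (fun n => (hF n).memLp)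
    (fun n => (hF n).norm_le)
  have h01 : ∀ x ∈ Icc (0 : ℝ) 1, ∫ y in (0 : ℝ)..x, g y = f x - f 0 := by
    intro x hx
    have h1 := hw ((Ioc 0 x).indicator fun _ => 1)
      ((memLp_const 1).indicator measurableSet_Ioc)
    have e : ∀ k : ℝ → ℝ, ∫ y, k y * (Ioc 0 x).indicator (fun _ => (1 : ℝ)) y ∂torusMeasure
        = ∫ y in (0 : ℝ)..x, k y := by
      intro k
      have : (fun y => k y * (Ioc 0 x).indicator (fun _ => (1 : ℝ)) y) = (Ioc 0 x).indicator k := by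
        funext y
        by_cases hy : y ∈ Ioc 0 x <;> simp [hy]
      rw [this, integral_indicator measurableSet_Ioc, torusMeasure,
        Measure.restrict_restrict measurableSet_Ioc, intervalIntegral.integral_of_le hx.1,
        inter_eq_left.2 (Ioc_subset_Ioc_right hx.2)]
    simp only [e, (hF _).integral_deriv] at h1
    exact tendsto_nhds_unique h1
      (((hlim x).comp hσ.tendsto_atTop).sub ((hlim 0).comp hσ.tendsto_atTop))
  -- the weak limit, extended periodically
  set e : ℝ → ℝ := fun x => g (Int.fract x) with he
  have pe : Function.Periodic e 1 := periodic_comp_fract g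
  have hge : e =ᵐ[torusMeasure] g := ae_comp_fract g
  have heq : ∀ x ∈ Icc (0 : ℝ) 1, ∫ y in (0 : ℝ)..x, e y = f x - f 0 := by
    intro x hx
    rw [← h01 x hx]
    refine intervalIntegral.integral_congr_ae ?_
    have := (ae_restrict_iff' measurableSet_Ioc).1 hge
    filter_upwards [this] with y hy hy'
    rw [uIoc_of_le hx.1] at hy'
    exact hy ⟨hy'.1, hy'.2.trans hx.2⟩
  have hei : ∀ a b, IntervalIntegrable e volume a b := by
    refine pe.intervalIntegrable (t := 0) one_ne_zero ?_
    rw [zero_add]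
    exact integrable_torus_iff.1 ((hg.integrable one_le_two).congr hge.symm)
  have h0 : ∫ y in (0 : ℝ)..1, e y = 0 := by
    rw [heq 1 (by simp)]
    have := hp 0
    rw [zero_add] at this
    rw [this, sub_self]
  have hall : ∀ x, f x = f 0 + ∫ y in (0 : ℝ)..x, e y := by
    have hP : Function.Periodic (fun x => ∫ y in (0 : ℝ)..x, e y) 1 := by
      intro x
      have := pe.intervalIntegral_add_eq x 0
      rw [zero_add, h0] at this
      simp only
      rw [← intervalIntegral.integral_add_adjacent_intervals (hei 0 x) (hei x (x + 1)), this,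
        add_zero]
    intro x
    rw [← comp_fract_eq hp x, ← comp_fract_eq hP x,
      heq _ ⟨Int.fract_nonneg x, (Int.fract_lt_one x).le⟩]
    ring
  have hac : ∀ a b, AbsolutelyContinuousOnInterval f a b := by
    intro a b
    have h1 := (hei a b).absolutelyContinuousOnInterval_intervalIntegral (c := a) (by simp)
    have h2 : AbsolutelyContinuousOnInterval (fun _ : ℝ => f a) a b :=
      (contDiff_const (n := 1)).contDiffOn.absolutelyContinuousOnInterval
    have e3 : f = (fun _ => f a) + fun x => ∫ v in a..x, e v := by
      funext x
      simp only [Pi.add_apply]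
      rw [hall x, hall a, ← intervalIntegral.integral_add_adjacent_intervals (hei 0 a) (hei a x)]
      ring
    rw [e3]
    exact h2.add h1
  refine ⟨hp, hac, ?_⟩
  have hd : deriv f =ᵐ[torusMeasure] g := by
    refine EventuallyEq.trans ?_ hge
    have := (hei 0 1).ae_hasDerivAt_integral
    refine (ae_restrict_iff' measurableSet_Ioc).2 ?_
    filter_upwards [this] with x hx hx'
    have h1 := hx (by rw [uIcc_of_le zero_le_one]; exact Ioc_subset_Icc_self hx') 0 (by simp)
    have h2 : f = fun x => f 0 + ∫ y in (0 : ℝ)..x, e y := funext hall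
    rw [h2]
    exact (h1.const_add _).deriv
  rw [eLpNorm_congr_ae hd]
  exact hgK

end H1Bounded

/-! ### Compactness of equicontinuous families -/

/-- The diagonal argument of Arzelà and Ascoli on a separable space. -/
theorem _root_.Equicontinuous.exists_subseq_tendsto {X : Type*} [TopologicalSpace X]
    [TopologicalSpace.SeparableSpace X] [Nonempty X] {F : ℕ → X → ℝ} (hF : Equicontinuous F)
    (hb : ∀ x, ∃ B, ∀ n, |F n x| ≤ B) :
    ∃ (σ : ℕ → ℕ) (f : X → ℝ), StrictMono σ ∧ Continuous f ∧
      ∀ x, Tendsto (fun n => F (σ n) x) atTop (𝓝 (f x)) := by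
  choose B hB using hb
  set q := TopologicalSpace.denseSeq X
  obtain ⟨a, -, σ, hσ, ha⟩ := (isCompact_univ_pi fun k =>
    isCompact_Icc (a := -B (q k)) (b := B (q k))).tendsto_subseq
    (x := fun n k => F n (q k)) (fun n k _ => abs_le.1 (hB (q k) n))
  have hq : ∀ k, Tendsto (fun n => F (σ n) (q k)) atTop (𝓝 (a k)) := fun k =>
    (tendsto_pi_nhds.1 ha) k
  have hlim : ∀ x, ∃ l, Tendsto (fun n => F (σ n) x) atTop (𝓝 l) := by
    intro x
    refine cauchySeq_tendsto_of_complete (Metric.cauchySeq_iff.2 fun ε hε => ?_)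
    have h1 := Metric.equicontinuousAt_iff_right.1 (hF x) (ε / 3) (by positivity)
    obtain ⟨_, ⟨k, rfl⟩, hk⟩ := Dense.inter_nhds_nonempty (TopologicalSpace.denseRange_denseSeq X) h1
    obtain ⟨N, hN⟩ := Metric.cauchySeq_iff.1 (hq k).cauchySeq (ε / 3) (by positivity)
    refine ⟨N, fun m hm n hn => ?_⟩
    have e1 := hk (σ m)
    have e2 := hk (σ n)
    have e3 := hN m hm n hn
    have := dist_triangle4 (F (σ m) x) (F (σ m) (q k)) (F (σ n) (q k)) (F (σ n) x)
    rw [dist_comm (F (σ n) (q k))] at this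
    linarith
  choose f hf using hlim
  refine ⟨σ, f, hσ, ?_, hf⟩
  exact (tendsto_pi_nhds.2 hf).continuous_of_equicontinuous (hF.comp σ)

theorem _root_.Equicontinuous.tendstoUniformlyOn_of_isCompact {X : Type*} [TopologicalSpace X]
    {F : ℕ → X → ℝ} (hF : Equicontinuous F) {f : X → ℝ}
    (hlim : ∀ x, Tendsto (fun n => F n x) atTop (𝓝 (f x))) {K : Set X} (hK : IsCompact K) :
    TendstoUniformlyOn F f atTop K := by
  have hf : Continuous f := (tendsto_pi_nhds.2 hlim).continuous_of_equicontinuous hF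
  rw [← tendstoLocallyUniformlyOn_iff_tendstoUniformlyOn_of_compact hK]
  rw [Metric.tendstoLocallyUniformlyOn_iff]
  intro ε hε x _
  refine ⟨_, mem_nhdsWithin_of_mem_nhds (inter_mem
    (Metric.equicontinuousAt_iff_right.1 (hF x) (ε / 3) (by positivity))
    (Metric.tendsto_nhds.1 hf.continuousAt (ε / 3) (by positivity))), ?_⟩
  filter_upwards [Metric.tendsto_nhds.1 (hlim x) (ε / 3) (by positivity)] with n hn y hy
  have h1 := hy.1 n
  have h2 := hy.2
  simp only [mem_ofPred_eq] at h2
  have := dist_triangle4 (f y) (f x) (F n x) (F n y)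
  rw [dist_comm (F n x)] at hn
  linarith

/-- A modulus of continuity on `[0,T] × ℝ` (at distances at most one). -/
def HolderBound (A T : ℝ) (f : ℝ → ℝ → ℝ) : Prop :=
  ∀ t ∈ Icc 0 T, ∀ s ∈ Icc 0 T, ∀ x y, |x - y| ≤ 1 → |t - s| ≤ 1 →
    |f t x - f s y| ≤ A * (√|x - y| + √√|t - s|)

theorem equicontinuous_of_holderBound {f : ℕ → ℝ → ℝ → ℝ}
    (h : ∀ T > 0, ∃ A, ∀ n, HolderBound A T (f n)) :
    Equicontinuous fun n (z : ℝ × ℝ) => f n (max z.1 0) z.2 := by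
  intro z
  obtain ⟨A, hA⟩ := h (max z.1 0 + 1) (by positivity)
  refine Metric.equicontinuousAt_of_continuity_modulus
    (fun y => A * (√|z.2 - y.2| + √√|max z.1 0 - max y.1 0|)) ?_ _ ?_
  · have : Continuous fun y : ℝ × ℝ => A * (√|z.2 - y.2| + √√|max z.1 0 - max y.1 0|) := by
      fun_prop
    simpa using this.tendsto z
  · have h1 : ∀ᶠ y : ℝ × ℝ in 𝓝 z, |z.2 - y.2| < 1 :=
      (by fun_prop : Continuous fun y : ℝ × ℝ => |z.2 - y.2|).continuousAt.eventually_lt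
        continuousAt_const (by simp)
    have h2 : ∀ᶠ y : ℝ × ℝ in 𝓝 z, |max z.1 0 - max y.1 0| < 1 :=
      (by fun_prop : Continuous fun y : ℝ × ℝ => |max z.1 0 - max y.1 0|).continuousAt.eventually_lt
        continuousAt_const (by simp)
    filter_upwards [h1, h2] with y hy1 hy2 n
    rw [Real.dist_eq]
    refine hA n _ ⟨le_max_right _ _, by linarith⟩ _ ⟨le_max_right _ _, ?_⟩ _ _ hy1.le hy2.le
    linarith [(abs_lt.1 hy2).1]

/-- Interpolation between a Hölder bound and an `L¹` bound. -/
theorem abs_le_of_holder_of_integral {g : ℝ → ℝ} (hg : Continuous g) (hp : Function.Periodic g 1)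
    {A D h : ℝ} (hA : 0 ≤ A) (hD : ∫ x in (0 : ℝ)..1, |g x| ≤ D)
    (hH : ∀ x y, |x - y| ≤ 1 → |g x - g y| ≤ A * √|x - y|) (h0 : 0 < h) (h1 : h ≤ 1) (x : ℝ) :
    |g x| ≤ A * √h + D / h := by
  have hpa : Function.Periodic (fun x => |g x|) 1 := fun x => by simp only [hp x]
  have e1 : ∫ y in x..(x + h), |g y| ≤ D := by
    calc ∫ y in x..(x + h), |g y| ≤ ∫ y in x..(x + 1), |g y| :=
          intervalIntegral.integral_mono_interval le_rfl (by linarith) (by linarith)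
            (Eventually.of_forall fun z => abs_nonneg _) (hg.abs.intervalIntegrable _ _)
      _ = ∫ y in (0 : ℝ)..(0 + 1), |g y| := hpa.intervalIntegral_add_eq x 0
      _ ≤ D := by rwa [zero_add]
  have e2 : ∫ y in x..(x + h), (|g x| - A * √h) ≤ ∫ y in x..(x + h), |g y| := by
    refine intervalIntegral.integral_mono_on (by linarith) (by simp)
      (hg.abs.intervalIntegrable _ _) fun y hy => ?_
    have hxy : |x - y| ≤ h := abs_le.2 ⟨by linarith [hy.2], by linarith [hy.1]⟩
    have e3 := hH x y (hxy.trans h1)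
    have e4 : A * √|x - y| ≤ A * √h := by gcongr
    have e5 := abs_sub_abs_le_abs_sub (g x) (g y)
    linarith
  rw [intervalIntegral.integral_const, smul_eq_mul, add_sub_cancel_left] at e2
  have e6 : h * (|g x| - A * √h) ≤ D := e2.trans e1
  have : |g x| - A * √h ≤ D / h := by rw [le_div_iff₀ h0]; linarith
  linarith

theorem holderBound_of_integral {f : ℝ → ℝ → ℝ} {A L T : ℝ} (hA : 0 ≤ A) (hL : 0 ≤ L)
    (hc : ∀ t ∈ Icc 0 T, Continuous (f t)) (hp : ∀ t ∈ Icc 0 T, ∀ s ∈ Icc 0 T, ∀ x,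
      f t (x + 1) - f t x = f s (x + 1) - f s x)
    (hx : ∀ t ∈ Icc 0 T, ∀ x y, |x - y| ≤ 1 → |f t x - f t y| ≤ A * √|x - y|)
    (ht : ∀ s t, 0 ≤ s → s ≤ t → t ≤ T → ∫ x in (0 : ℝ)..1, |f t x - f s x| ≤ L * (t - s)) :
    HolderBound (3 * A + L) T f := by
  intro t ht' s hs' x y hxy hts
  wlog hst : s ≤ t generalizing s t x y
  · have := this s hs' t ht' y x (by rwa [abs_sub_comm]) (by rwa [abs_sub_comm])
      (le_of_not_ge hst)
    rwa [abs_sub_comm, abs_sub_comm x y, abs_sub_comm t s]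
  have h1 := hx t ht' x y hxy
  have h2 : |f t y - f s y| ≤ (2 * A + L) * √√|t - s| := by
    rcases hst.eq_or_lt with rfl | hst
    · simp
    have h3 := ht s t hs'.1 hst.le ht'.2
    rw [abs_of_pos (sub_pos.2 hst)] at hts ⊢
    set d := t - s
    have hd : 0 < d := sub_pos.2 hst
    have hsd : √d ≤ 1 := Real.sqrt_le_one.2 hts
    have h4 := abs_le_of_holder_of_integral (g := fun x => f t x - f s x) (A := 2 * A)
      (D := L * d) (h := √d) ((hc t ht').sub (hc s hs'))
      (fun x => by have := hp t ht' s hs' x; simp only; linarith) (by positivity) h3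
      (fun a b hab => by
        have e1 := hx t ht' a b hab
        have e2 := hx s hs' a b hab
        have e3 := abs_sub (f t a - f t b) (f s a - f s b)
        rw [show f t a - f s a - (f t b - f s b) = f t a - f t b - (f s a - f s b) by ring]
        linarith) (Real.sqrt_pos.2 hd) hsd y
    have h5 : L * d / √d = L * √d := by
      rw [mul_div_assoc, Real.div_sqrt]
    have h6 : √d ≤ √√d := by
      have : √d ^ 2 ≤ √d := by nlinarith [Real.sqrt_nonneg d]
      exact Real.le_sqrt_of_sq_le this
    rw [h5] at h4
    nlinarith
  have h7 := abs_sub_le (f t x) (f t y) (f s y)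
  have := Real.sqrt_nonneg |x - y|
  have := Real.sqrt_nonneg √|t - s|
  nlinarith

/-! ### Weak convergence from convergence on a generating family of sets -/

section WeakConvergence

variable {α : Type*} [mα : MeasurableSpace α] {μ : Measure α}

theorem enorm_integral_mul_le {p q : ℝ≥0∞} [p.HolderConjugate q] {f ψ : α → ℝ}
    (hf : AEStronglyMeasurable f μ) (hψ : AEStronglyMeasurable ψ μ) :
    ‖∫ x, f x * ψ x ∂μ‖ₑ ≤ eLpNorm f q μ * eLpNorm ψ p μ := by
  have : q.HolderConjugate p := .symm
  calc ‖∫ x, f x * ψ x ∂μ‖ₑ ≤ ∫⁻ x, ‖f x * ψ x‖ₑ ∂μ := enorm_integral_le_lintegral_enorm _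
    _ = eLpNorm (f • ψ) 1 μ := by rw [eLpNorm_one_eq_lintegral_enorm]; rfl
    _ ≤ eLpNorm f q μ * eLpNorm ψ p μ := eLpNorm_smul_le_mul_eLpNorm hψ hf

theorem abs_integral_mul_le {p q : ℝ≥0∞} [p.HolderConjugate q] {f ψ : α → ℝ}
    (hf : AEStronglyMeasurable f μ) (hψ : MemLp ψ p μ) {K : ℝ≥0} (hK : eLpNorm f q μ ≤ K) :
    |∫ x, f x * ψ x ∂μ| ≤ K * (eLpNorm ψ p μ).toReal := by
  have h1 := (enorm_integral_mul_le (p := p) (q := q) hf hψ.1).trans (mul_le_mul_left hK _)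
  have h2 : ENNReal.ofReal |∫ x, f x * ψ x ∂μ| ≤ K * eLpNorm ψ p μ := by
    rwa [← Real.norm_eq_abs, ofReal_norm]
  have h3 := ENNReal.toReal_mono (ENNReal.mul_ne_top ENNReal.coe_ne_top hψ.2.ne) h2
  rwa [ENNReal.toReal_ofReal (abs_nonneg _), ENNReal.toReal_mul, ENNReal.coe_toReal] at h3

/-- Functions that are bounded in `L^q` and whose integrals converge on the sets of a generating
π-system converge weakly. -/
theorem tendsto_integral_mul_of_isPiSystem [IsFiniteMeasure μ] {ι : Type*} {l : Filter ι}
    {p q : ℝ≥0∞} [p.HolderConjugate q] (hp : p ≠ ⊤) {F : ι → α → ℝ} {f : α → ℝ} {K : ℝ≥0}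
    (hFm : ∀ i, AEStronglyMeasurable (F i) μ) (hFK : ∀ i, eLpNorm (F i) q μ ≤ K)
    (hfm : AEStronglyMeasurable f μ) (hfK : eLpNorm f q μ ≤ K)
    {S : Set (Set α)} (hS : IsPiSystem S) (hgen : mα = MeasurableSpace.generateFrom S)
    (huniv : Tendsto (fun i => ∫ x, F i x ∂μ) l (𝓝 (∫ x, f x ∂μ)))
    (h : ∀ s ∈ S, Tendsto (fun i => ∫ x in s, F i x ∂μ) l (𝓝 (∫ x in s, f x ∂μ)))
    {ψ : α → ℝ} (hψ : MemLp ψ p μ) :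
    Tendsto (fun i => ∫ x, F i x * ψ x ∂μ) l (𝓝 (∫ x, f x * ψ x ∂μ)) := by
  have hp1 : 1 ≤ p := ENNReal.HolderConjugate.one_le p q
  have hq1 : 1 ≤ q := have : q.HolderConjugate p := .symm; ENNReal.HolderConjugate.one_le q p
  have : Fact (1 ≤ p) := ⟨hp1⟩
  have hFp : ∀ i, MemLp (F i) q μ := fun i => ⟨hFm i, (hFK i).trans_lt ENNReal.coe_lt_top⟩
  have hfp : MemLp f q μ := ⟨hfm, hfK.trans_lt ENNReal.coe_lt_top⟩
  have hFi : ∀ i, Integrable (F i) μ := fun i => (hFp i).integrable hq1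
  have hfi : Integrable f μ := hfp.integrable hq1
  have hmul : ∀ {g φ : α → ℝ}, MemLp g q μ → MemLp φ p μ → Integrable (fun x => g x * φ x) μ :=
    fun hg hφ => have : q.HolderConjugate p := .symm; hg.integrable_mul hφ
  -- integration against `F i` is a Lipschitz functional on `L^p`, uniformly in `i`
  have hlip : ∀ {g : α → ℝ}, AEStronglyMeasurable g μ → eLpNorm g q μ ≤ K →
      LipschitzWith K fun φ : Lp ℝ p μ => ∫ x, g x * φ x ∂μ := by
    intro g hg hK
    have hgp : MemLp g q μ := ⟨hg, hK.trans_lt ENNReal.coe_lt_top⟩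
    refine LipschitzWith.of_dist_le_mul fun φ φ' => ?_
    rw [Real.dist_eq, dist_eq_norm, ← integral_sub (hmul hgp (Lp.memLp φ)) (hmul hgp (Lp.memLp φ'))]
    have e : ∫ x, (g x * φ x - g x * φ' x) ∂μ = ∫ x, g x * (φ - φ' : Lp ℝ p μ) x ∂μ := by
      refine integral_congr_ae ?_
      filter_upwards [Lp.coeFn_sub φ φ'] with x hx
      rw [hx, Pi.sub_apply, mul_sub]
    rw [e]
    exact abs_integral_mul_le (p := p) (q := q) hg (Lp.memLp _) hK
  have hclosed : IsClosed {φ : Lp ℝ p μ | Tendsto (fun i => ∫ x, F i x * φ x ∂μ) l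
      (𝓝 (∫ x, f x * φ x ∂μ))} :=
    (LipschitzWith.uniformEquicontinuous _ K fun i =>
      hlip (hFm i) (hFK i)).equicontinuous.isClosed_setOfPred_tendsto (hlip hfm hfK).continuous
  have hind : ∀ (g : α → ℝ) {s : Set α} (hs : MeasurableSet s),
      ∫ x, g x * indicatorConstLp p hs (measure_ne_top μ s) (1 : ℝ) x ∂μ = ∫ x in s, g x ∂μ := by
    intro g s hs
    rw [← integral_indicator hs]
    refine integral_congr_ae ?_
    filter_upwards [indicatorConstLp_coeFn (p := p) (hs := hs) (hμs := measure_ne_top μ s)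
      (c := (1 : ℝ))] with x hx
    rw [hx]
    by_cases hxs : x ∈ s <;> simp [hxs]
  have hset : ∀ s, MeasurableSet s →
      Tendsto (fun i => ∫ x in s, F i x ∂μ) l (𝓝 (∫ x in s, f x ∂μ)) := by
    intro s hs
    induction s, hs using MeasurableSpace.induction_on_inter hgen hS with
    | empty => simpa using tendsto_const_nhds
    | basic s hs => exact h s hs
    | compl s hs ih =>
      have e : ∀ {g : α → ℝ}, Integrable g μ →
          ∫ x in sᶜ, g x ∂μ = (∫ x, g x ∂μ) - ∫ x in s, g x ∂μ := fun hg => by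
        rw [← integral_add_compl hs hg]; ring
      simp only [e (hFi _), e hfi]
      exact huniv.sub ih
    | iUnion s hd hs ih =>
      have hfin : ∀ n, MeasurableSet (⋃ k ∈ Finset.range n, s k) := fun n =>
        Finset.measurableSet_biUnion _ fun k _ => hs k
      have hpart : ∀ n, Tendsto (fun i => ∫ x in ⋃ k ∈ Finset.range n, s k, F i x ∂μ) l
          (𝓝 (∫ x in ⋃ k ∈ Finset.range n, s k, f x ∂μ)) := by
        intro n
        have e : ∀ {g : α → ℝ}, Integrable g μ → ∫ x in ⋃ k ∈ Finset.range n, s k, g x ∂μ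
            = ∑ k ∈ Finset.range n, ∫ x in s k, g x ∂μ := fun hg =>
          integral_biUnion_finset _ (fun k _ => hs k) (fun a _ b _ hab => hd hab)
            fun k _ => hg.integrableOn
        simp only [e (hFi _), e hfi]
        exact tendsto_finsetSum _ fun k _ => ih k
      have hlim : Tendsto (fun n => indicatorConstLp p (hfin n) (measure_ne_top μ _) (1 : ℝ)) atTop
          (𝓝 (indicatorConstLp p (MeasurableSet.iUnion hs) (measure_ne_top μ _) (1 : ℝ))) := by
        refine tendsto_indicatorConstLp_set hp ?_
        have := tendsto_measure_biUnion_Ici_zero_of_pairwise_disjoint (μ := μ)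
          (fun i => (hs i).nullMeasurableSet) hd
        refine tendsto_of_tendsto_of_tendsto_of_le_of_le tendsto_const_nhds this
          (fun _ => zero_le) fun n => measure_mono ?_
        rintro x (⟨h1, h2⟩ | ⟨h1, h2⟩)
        · simp only [mem_iUnion] at h1 h2
          obtain ⟨k, -, hk⟩ := h1
          exact absurd ⟨k, hk⟩ h2
        · simp only [mem_iUnion, Finset.mem_range, not_exists] at h1 h2
          obtain ⟨k, hk⟩ := h1
          exact mem_iUnion₂.2 ⟨k, not_lt.1 fun hlt => h2 k hlt hk, hk⟩
      have := hclosed.mem_of_tendsto hlim (Eventually.of_forall fun n => by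
        simp only [mem_ofPred_eq, hind]
        exact hpart n)
      simpa only [mem_ofPred_eq, hind] using this
  refine MemLp.induction hp (fun φ => Tendsto (fun i => ∫ x, F i x * φ x ∂μ) l
    (𝓝 (∫ x, f x * φ x ∂μ))) ?_ ?_ hclosed ?_ hψ
  · intro c s hs _
    have e : ∀ g : α → ℝ, ∫ x, g x * s.indicator (fun _ => c) x ∂μ = (∫ x in s, g x ∂μ) * c := by
      intro g
      rw [← integral_mul_const, ← integral_indicator hs]
      congr 1
      funext x
      by_cases hxs : x ∈ s <;> simp [hxs]
    simp only [e]
    exact (hset s hs).mul_const c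
  · intro φ φ' _ h1 h2 t1 t2
    have e : ∀ {g : α → ℝ}, MemLp g q μ → ∫ x, g x * (φ + φ') x ∂μ
        = (∫ x, g x * φ x ∂μ) + ∫ x, g x * φ' x ∂μ := fun hg => by
      rw [← integral_add (hmul hg h1) (hmul hg h2)]
      simp only [Pi.add_apply, mul_add]
    simp only [e (hFp _), e hfp]
    exact t1.add t2
  · intro φ φ' hae _ t
    have e : ∀ g : α → ℝ, ∫ x, g x * φ' x ∂μ = ∫ x, g x * φ x ∂μ := fun g =>
      integral_congr_ae (hae.mono fun x hx => by simp only [hx])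
    simp only [e]
    exact t

end WeakConvergence

theorem isCountablySpanning_range_Iic : IsCountablySpanning (range (Iic : ℝ → Set ℝ)) :=
  ⟨fun n : ℕ => Iic (n : ℝ), fun n => mem_range_self _, by
    refine eq_univ_of_forall fun x => ?_
    obtain ⟨n, hn⟩ := exists_nat_ge x
    exact mem_iUnion.2 ⟨n, hn⟩⟩

theorem restrict_Ioc_restrict_Iic (T x : ℝ) :
    (volume.restrict (Ioc (0 : ℝ) T)).restrict (Iic x)
      = volume.restrict (Ioc (0 : ℝ) (max 0 (min x T))) := by
  rw [Measure.restrict_restrict measurableSet_Iic]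
  congr 1
  ext y
  simp only [mem_inter_iff, mem_Iic, mem_Ioc, le_max_iff, le_min_iff]
  constructor
  · rintro ⟨h1, h2, h3⟩
    exact ⟨h2, Or.inr ⟨h1, h3⟩⟩
  · rintro ⟨h1, h2 | ⟨h2, h3⟩⟩
    · linarith
    · exact ⟨h2, h1, h3⟩

/-- Weak convergence on the torus follows from the convergence of the primitives. -/
theorem tendsto_integral_mul_torus {ι : Type*} {l : Filter ι} {p q : ℝ≥0∞} [p.HolderConjugate q]
    (hp : p ≠ ⊤) {F : ι → ℝ → ℝ} {f : ℝ → ℝ} {K : ℝ≥0}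
    (hFm : ∀ i, AEStronglyMeasurable (F i) torusMeasure)
    (hFK : ∀ i, eLpNorm (F i) q torusMeasure ≤ K)
    (hfm : AEStronglyMeasurable f torusMeasure) (hfK : eLpNorm f q torusMeasure ≤ K)
    (h : ∀ x ∈ Icc (0 : ℝ) 1, Tendsto (fun i => ∫ y in (0 : ℝ)..x, F i y) l
      (𝓝 (∫ y in (0 : ℝ)..x, f y))) {ψ : ℝ → ℝ} (hψ : MemLp ψ p torusMeasure) :
    Tendsto (fun i => ∫ x, F i x * ψ x ∂torusMeasure) l (𝓝 (∫ x, f x * ψ x ∂torusMeasure)) := by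
  refine tendsto_integral_mul_of_isPiSystem (p := p) (q := q) hp hFm hFK hfm hfK isPiSystem_Iic
    (borel_eq_generateFrom_Iic ℝ ▸ BorelSpace.measurable_eq) ?_ ?_ hψ
  · simp only [integral_torus]
    exact h 1 (by simp)
  · rintro _ ⟨x, rfl⟩
    have e : ∀ g : ℝ → ℝ, ∫ y in Iic x, g y ∂torusMeasure
        = ∫ y in (0 : ℝ)..max 0 (min x 1), g y := fun g => by
      rw [torusMeasure, restrict_Ioc_restrict_Iic,
        intervalIntegral.integral_of_le (le_max_left _ _)]
    simp only [e]
    exact h _ ⟨le_max_left _ _, max_le zero_le_one (min_le_right _ _)⟩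

/-- Weak convergence on the cylinder follows from the convergence of the integrals over
rectangles. -/
theorem tendsto_integral_mul_cyl {ι : Type*} {l : Filter ι} {p q : ℝ≥0∞} [p.HolderConjugate q]
    (hp : p ≠ ⊤) {T : ℝ} (hT : 0 ≤ T) {F : ι → ℝ × ℝ → ℝ} {f : ℝ × ℝ → ℝ} {K : ℝ≥0}
    (hFm : ∀ i, AEStronglyMeasurable (F i) (cylMeasure T))
    (hFK : ∀ i, eLpNorm (F i) q (cylMeasure T) ≤ K)
    (hfm : AEStronglyMeasurable f (cylMeasure T)) (hfK : eLpNorm f q (cylMeasure T) ≤ K)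
    (h : ∀ t ∈ Icc 0 T, ∀ x ∈ Icc (0 : ℝ) 1,
      Tendsto (fun i => ∫ s in (0 : ℝ)..t, ∫ y in (0 : ℝ)..x, F i (s, y)) l
        (𝓝 (∫ s in (0 : ℝ)..t, ∫ y in (0 : ℝ)..x, f (s, y)))) {ψ : ℝ × ℝ → ℝ}
    (hψ : MemLp ψ p (cylMeasure T)) :
    Tendsto (fun i => ∫ z, F i z * ψ z ∂cylMeasure T) l (𝓝 (∫ z, f z * ψ z ∂cylMeasure T)) := by
  have : IsFiniteMeasure (cylMeasure T) := by unfold cylMeasure; infer_instance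
  have hq1 : 1 ≤ q := have : q.HolderConjugate p := .symm; ENNReal.HolderConjugate.one_le q p
  have hi : ∀ {g : ℝ × ℝ → ℝ}, AEStronglyMeasurable g (cylMeasure T) →
      eLpNorm g q (cylMeasure T) ≤ K → Integrable g (cylMeasure T) := fun hg hK =>
    MemLp.integrable hq1 ⟨hg, hK.trans_lt ENNReal.coe_lt_top⟩
  have e : ∀ {g : ℝ × ℝ → ℝ}, Integrable g (cylMeasure T) → ∀ t x,
      ∫ z in Iic t ×ˢ Iic x, g z ∂cylMeasure T
        = ∫ s in (0 : ℝ)..max 0 (min t T), ∫ y in (0 : ℝ)..max 0 (min x 1), g (s, y) := by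
    intro g hg t x
    have h1 := hg.integrableOn (s := Iic t ×ˢ Iic x)
    rw [IntegrableOn, cylMeasure, ← Measure.prod_restrict] at h1
    rw [cylMeasure, ← Measure.prod_restrict, integral_prod _ h1, timeMeasure, torusMeasure,
      restrict_Ioc_restrict_Iic, restrict_Ioc_restrict_Iic,
      intervalIntegral.integral_of_le (le_max_left _ _)]
    simp only [intervalIntegral.integral_of_le (le_max_left (0 : ℝ) (min x 1))]
  refine tendsto_integral_mul_of_isPiSystem (p := p) (q := q) hp hFm hFK hfm hfK
    (S := image2 (· ×ˢ ·) (range Iic) (range Iic)) (isPiSystem_Iic.prod isPiSystem_Iic) ?_ ?_ ?_ hψ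
  · have h1 : MeasurableSpace.generateFrom (range (Iic : ℝ → Set ℝ)) = (inferInstance : MeasurableSpace ℝ) :=
      borel_eq_generateFrom_Iic ℝ ▸ BorelSpace.measurable_eq.symm
    exact (generateFrom_eq_prod h1 h1 isCountablySpanning_range_Iic
      isCountablySpanning_range_Iic).symm
  · have e1 : ∀ {g : ℝ × ℝ → ℝ}, Integrable g (cylMeasure T) → ∫ z, g z ∂cylMeasure T
        = ∫ s in (0 : ℝ)..T, ∫ y in (0 : ℝ)..1, g (s, y) := fun hg => by
      rw [cylMeasure, integral_prod _ hg, intervalIntegral.integral_of_le hT, timeMeasure]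
      simp only [integral_torus]
    simp only [e1 (hi (hFm _) (hFK _)), e1 (hi hfm hfK)]
    exact h T ⟨hT, le_rfl⟩ 1 (by simp)
  · rintro _ ⟨_, ⟨t, rfl⟩, _, ⟨x, rfl⟩, rfl⟩
    simp only [e (hi (hFm _) (hFK _)), e (hi hfm hfK)]
    exact h _ ⟨le_max_left _ _, max_le hT (min_le_right _ _)⟩ _
      ⟨le_max_left _ _, max_le zero_le_one (min_le_right _ _)⟩

theorem eLpNorm_two_sq {α : Type*} [MeasurableSpace α] (μ : Measure α) (g : α → ℝ) :
    eLpNorm g 2 μ ^ (2 : ℝ) = ∫⁻ x, ‖g x‖ₑ ^ (2 : ℝ) ∂μ := by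
  have := eLpNorm_nnreal_pow_eq_lintegral (μ := μ) (f := g) (p := 2) two_ne_zero
  simpa using this

theorem measurable_eLpNorm_slice {g : ℝ × ℝ → ℝ} (hg : Measurable g) :
    Measurable fun t => eLpNorm (fun x => g (t, x)) 2 torusMeasure := by
  have h : Measurable fun t => ∫⁻ x, ‖g (t, x)‖ₑ ^ (2 : ℝ) ∂torusMeasure :=
    Measurable.lintegral_prod_right' (f := fun z : ℝ × ℝ => ‖g z‖ₑ ^ (2 : ℝ))
      (hg.enorm.pow_const _)
  have e : (fun t => eLpNorm (fun x => g (t, x)) 2 torusMeasure)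
      = fun t => (∫⁻ x, ‖g (t, x)‖ₑ ^ (2 : ℝ) ∂torusMeasure) ^ ((1 : ℝ) / 2) := by
    funext t
    rw [← eLpNorm_two_sq, ← ENNReal.rpow_mul]
    simp
  rw [e]
  exact h.pow_const _

/-- Hölder's inequality for the pairing of `L^∞(0,T; L²)` and `L¹(0,T; L²)`. -/
theorem enorm_integral_mul_cyl_le {T : ℝ} {F g : ℝ × ℝ → ℝ} {K : ℝ≥0}
    (hF : AEStronglyMeasurable F (cylMeasure T)) (hg : AEStronglyMeasurable g (cylMeasure T))
    (hK : ∀ᵐ t ∂timeMeasure T, eLpNorm (fun x => F (t, x)) 2 torusMeasure ≤ K) :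
    ∫⁻ z, ‖F z * g z‖ₑ ∂cylMeasure T
      ≤ K * ∫⁻ t, eLpNorm (fun x => g (t, x)) 2 torusMeasure ∂timeMeasure T := by
  rw [← lintegral_const_mul' _ _ ENNReal.coe_ne_top, cylMeasure,
    lintegral_prod (fun z => ‖F z * g z‖ₑ) (hF.mul hg).enorm]
  refine lintegral_mono_ae ?_
  filter_upwards [hK, hF.prodMk_left, hg.prodMk_left] with t h1 h2 h3
  have : ENNReal.HolderConjugate 2 2 := inferInstance
  calc ∫⁻ x, ‖F (t, x) * g (t, x)‖ₑ ∂torusMeasure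
      = eLpNorm ((fun x => F (t, x)) • fun x => g (t, x)) 1 torusMeasure := by
        rw [eLpNorm_one_eq_lintegral_enorm]; rfl
    _ ≤ eLpNorm (fun x => F (t, x)) 2 torusMeasure * eLpNorm (fun x => g (t, x)) 2 torusMeasure :=
        eLpNorm_smul_le_mul_eLpNorm h3 h2
    _ ≤ K * eLpNorm (fun x => g (t, x)) 2 torusMeasure := mul_le_mul_left h1 _

theorem eLpNorm_cyl_le {T : ℝ} {F : ℝ × ℝ → ℝ} {K : ℝ≥0}
    (hF : AEStronglyMeasurable F (cylMeasure T))
    (hK : ∀ᵐ t ∂timeMeasure T, eLpNorm (fun x => F (t, x)) 2 torusMeasure ≤ K) :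
    eLpNorm F 2 (cylMeasure T) ≤ (K * NNReal.sqrt T.toNNReal : ℝ≥0) := by
  have h1 : ∫⁻ z, ‖F z‖ₑ ^ (2 : ℝ) ∂cylMeasure T ≤ (K : ℝ≥0∞) ^ (2 : ℝ) * ENNReal.ofReal T := by
    rw [cylMeasure, lintegral_prod _ (hF.enorm.pow_const _)]
    calc ∫⁻ t, ∫⁻ x, ‖F (t, x)‖ₑ ^ (2 : ℝ) ∂torusMeasure ∂timeMeasure T
        ≤ ∫⁻ _, (K : ℝ≥0∞) ^ (2 : ℝ) ∂timeMeasure T := by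
          refine lintegral_mono_ae (hK.mono fun t ht => ?_)
          rw [← eLpNorm_two_sq]
          exact ENNReal.rpow_le_rpow ht (by norm_num)
      _ = (K : ℝ≥0∞) ^ (2 : ℝ) * ENNReal.ofReal T := by
          simp [timeMeasure]
  rw [← eLpNorm_two_sq] at h1
  rw [← ENNReal.rpow_le_rpow_iff (z := 2) (by norm_num)]
  refine h1.trans_eq ?_
  rw [ENNReal.coe_mul, ENNReal.mul_rpow_of_nonneg _ _ (by norm_num : (0 : ℝ) ≤ 2), ENNReal.ofReal]
  congr 1
  rw [ENNReal.rpow_two, ← ENNReal.coe_pow, NNReal.sq_sqrt]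

/-- Weak-* convergence in `L^∞(0,T; L²)` follows from the uniform bound and the convergence of the
integrals over rectangles: tests in `L¹(0,T; L²)` are truncated at times of large norm. -/
theorem tendstoWeakStarLinftyL2_of_rectangles {T : ℝ} (hT : 0 ≤ T) {F : ℕ → ℝ → ℝ → ℝ}
    {f : ℝ → ℝ → ℝ} {K : ℝ≥0}
    (hFm : ∀ n, AEStronglyMeasurable (Function.uncurry (F n)) (cylMeasure T))
    (hFK : ∀ n, ∀ᵐ t ∂timeMeasure T, eLpNorm (F n t) 2 torusMeasure ≤ K)
    (hfm : AEStronglyMeasurable (Function.uncurry f) (cylMeasure T))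
    (hfK : ∀ᵐ t ∂timeMeasure T, eLpNorm (f t) 2 torusMeasure ≤ K)
    (h : ∀ t ∈ Icc 0 T, ∀ x ∈ Icc (0 : ℝ) 1,
      Tendsto (fun n => ∫ s in (0 : ℝ)..t, ∫ y in (0 : ℝ)..x, F n s y) atTop
        (𝓝 (∫ s in (0 : ℝ)..t, ∫ y in (0 : ℝ)..x, f s y))) :
    TendstoWeakStarLinftyL2 T F f := by
  intro g₀ hg₀ hgfin
  -- a measurable representative of the test function
  obtain ⟨g, hgm, hgae⟩ := hg₀
  have hgm' : Measurable g := hgm.measurable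
  set N : ℝ → ℝ≥0∞ := fun t => eLpNorm (fun x => g (t, x)) 2 torusMeasure with hN
  have hNm : Measurable N := measurable_eLpNorm_slice hgm'
  have hNfin : ∫⁻ t, N t ∂timeMeasure T < ⊤ := by
    refine lt_of_eq_of_lt (lintegral_congr_ae ?_) hgfin
    filter_upwards [Measure.ae_ae_of_ae_prod hgae] with t ht
    exact eLpNorm_congr_ae (ht.mono fun x hx => hx.symm)
  have hcongr : ∀ k : ℝ → ℝ → ℝ, ∫ z, k z.1 z.2 * g₀ z.1 z.2 ∂cylMeasure T
      = ∫ z, Function.uncurry k z * g z ∂cylMeasure T := fun k =>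
    integral_congr_ae (hgae.mono fun z hz => by
      change k z.1 z.2 * Function.uncurry g₀ z = _
      rw [hz]; rfl)
  simp only [hcongr]
  set gt : ℕ → ℝ × ℝ → ℝ := fun M => ({t | N t ≤ M} ×ˢ univ).indicator g with hgt
  have hSm : ∀ M : ℕ, MeasurableSet {t | N t ≤ M} := fun M => hNm measurableSet_Iic
  have hgtm : ∀ M, Measurable (gt M) := fun M => hgm'.indicator ((hSm M).prod .univ)
  have hslice : ∀ M t, (fun x => gt M (t, x)) = if N t ≤ M then fun x => g (t, x) else 0 := by
    intro M t
    funext x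
    by_cases ht : N t ≤ M <;> simp [hgt, ht]
  have hres : ∀ M t, (fun x => g (t, x) - gt M (t, x))
      = if N t ≤ M then 0 else fun x => g (t, x) := by
    intro M t
    funext x
    by_cases ht : N t ≤ M <;> simp [hgt, ht]
  have hgtL : ∀ M, MemLp (gt M) 2 (cylMeasure T) := by
    intro M
    refine ⟨(hgtm M).aestronglyMeasurable,
      (eLpNorm_cyl_le (K := (M : ℝ≥0)) (hgtm M).aestronglyMeasurable
        (Eventually.of_forall fun t => ?_)).trans_lt ENNReal.coe_lt_top⟩
    rw [hslice]
    split_ifs with ht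
    · simpa using ht
    · simp
  have htail : Tendsto (fun M : ℕ => ∫⁻ t, eLpNorm (fun x => g (t, x) - gt M (t, x)) 2
      torusMeasure ∂timeMeasure T) atTop (𝓝 0) := by
    rw [← lintegral_zero (μ := timeMeasure T)]
    refine tendsto_lintegral_of_dominated_convergence N
      (fun M => measurable_eLpNorm_slice (g := fun z => g z - gt M z) (hgm'.sub (hgtm M)))
      (fun M => Eventually.of_forall fun t => ?_) hNfin.ne ?_
    · simp only [hres]
      split_ifs
      · simp
      · exact le_rfl
    · filter_upwards [ae_lt_top hNm hNfin.ne] with t ht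
      obtain ⟨M₀, hM₀⟩ := ENNReal.exists_nat_gt ht.ne
      refine tendsto_const_nhds.congr' ?_
      filter_upwards [eventually_ge_atTop M₀] with M hM
      have : N t ≤ M := hM₀.le.trans (by exact_mod_cast hM)
      simp only [hres, this, if_true]
      simp
  have hconv : ∀ M, Tendsto (fun n => ∫ z, Function.uncurry (F n) z * gt M z ∂cylMeasure T) atTop
      (𝓝 (∫ z, Function.uncurry f z * gt M z ∂cylMeasure T)) := fun M =>
    tendsto_integral_mul_cyl (p := 2) (q := 2) (by simp) hT hFm
      (fun n => eLpNorm_cyl_le (hFm n) (hFK n)) hfm (eLpNorm_cyl_le hfm hfK) h (hgtL M)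
  have hint : ∀ {k : ℝ × ℝ → ℝ}, AEStronglyMeasurable k (cylMeasure T) →
      (∀ᵐ t ∂timeMeasure T, eLpNorm (fun x => k (t, x)) 2 torusMeasure ≤ K) →
      Integrable (fun z => k z * g z) (cylMeasure T) ∧
      ∀ M, Integrable (fun z => k z * gt M z) (cylMeasure T) := by
    intro k hk hK
    refine ⟨⟨hk.mul hgm'.aestronglyMeasurable, ?_⟩, fun M => ?_⟩
    · exact (enorm_integral_mul_cyl_le hk hgm'.aestronglyMeasurable hK).trans_lt
        (ENNReal.mul_lt_top ENNReal.coe_lt_top hNfin)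
    · have hk2 : MemLp k 2 (cylMeasure T) :=
        ⟨hk, (eLpNorm_cyl_le hk hK).trans_lt ENNReal.coe_lt_top⟩
      exact hk2.integrable_mul (hgtL M)
  rw [Metric.tendsto_nhds]
  intro ε hε
  -- the error of the truncation, uniformly in `n`
  obtain ⟨M, hM⟩ : ∃ M : ℕ, K * ∫⁻ t, eLpNorm (fun x => g (t, x) - gt M (t, x)) 2
      torusMeasure ∂timeMeasure T < ENNReal.ofReal (ε / 3) := by
    have h1 := ENNReal.Tendsto.const_mul htail (a := (K : ℝ≥0∞)) (Or.inr ENNReal.coe_ne_top)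
    rw [mul_zero] at h1
    exact (h1.eventually_lt_const (ENNReal.ofReal_pos.2 (by positivity))).exists
  have herr : ∀ {k : ℝ × ℝ → ℝ}, AEStronglyMeasurable k (cylMeasure T) →
      (∀ᵐ t ∂timeMeasure T, eLpNorm (fun x => k (t, x)) 2 torusMeasure ≤ K) →
      dist (∫ z, k z * g z ∂cylMeasure T) (∫ z, k z * gt M z ∂cylMeasure T) < ε / 3 := by
    intro k hk hK
    have h1 := hint hk hK
    rw [Real.dist_eq, ← integral_sub h1.1 (h1.2 M)]
    simp only [← mul_sub]
    have h2 := (enorm_integral_le_lintegral_enorm _).trans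
      (enorm_integral_mul_cyl_le (g := fun z => g z - gt M z) hk
        (hgm'.sub (hgtm M)).aestronglyMeasurable hK)
    have h3 := h2.trans_lt hM
    rw [← ofReal_norm, Real.norm_eq_abs] at h3
    exact (ENNReal.ofReal_lt_ofReal_iff (by positivity)).1 h3
  filter_upwards [Metric.tendsto_nhds.1 (hconv M) (ε / 3) (by positivity)] with n hn
  have e1 := herr (hFm n) (hFK n)
  have e2 := herr hfm hfK
  rw [dist_comm] at e2
  have := dist_triangle4 (∫ z, Function.uncurry (F n) z * g z ∂cylMeasure T)
    (∫ z, Function.uncurry (F n) z * gt M z ∂cylMeasure T)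
    (∫ z, Function.uncurry f z * gt M z ∂cylMeasure T)
    (∫ z, Function.uncurry f z * g z ∂cylMeasure T)
  linarith

/-- A bounded measurable function on the cylinder that is bounded in `H¹(𝕋)` for almost every time;
`f'` is a measurable version of its space derivative. -/
structure LinftyH1 (K : ℝ≥0) (T : ℝ) (f f' : ℝ → ℝ → ℝ) : Prop where
  meas : Measurable (Function.uncurry f)
  meas' : Measurable (Function.uncurry f')
  bound : ∀ᵐ t ∂timeMeasure T, ∀ x, |f t x| ≤ K
  h1 : ∀ᵐ t ∂timeMeasure T, H1Bounded K (f t)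
  deriv_eq : ∀ᵐ t ∂timeMeasure T, deriv (f t) =ᵐ[torusMeasure] f' t

namespace LinftyH1

variable {K : ℝ≥0} {T : ℝ} {f f' : ℝ → ℝ → ℝ}

theorem eLpNorm_le (h : LinftyH1 K T f f') :
    ∀ᵐ t ∂timeMeasure T, eLpNorm (f t) 2 torusMeasure ≤ K := by
  filter_upwards [h.bound] with t ht
  refine (eLpNorm_le_of_ae_bound (C := K) (Eventually.of_forall fun x => ?_)).trans ?_
  · simpa using ht x
  · simp

theorem eLpNorm_deriv_le (h : LinftyH1 K T f f') :
    ∀ᵐ t ∂timeMeasure T, eLpNorm (f' t) 2 torusMeasure ≤ K := by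
  filter_upwards [h.h1, h.deriv_eq] with t h1 h2
  rw [← eLpNorm_congr_ae h2]
  exact h1.norm_le

theorem memLinftyH1 (h : LinftyH1 K T f f') : MemLinftyH1 T f f' := by
  refine ⟨⟨h.meas.aestronglyMeasurable, h.meas'.aestronglyMeasurable, ?_⟩, K, ?_⟩
  · filter_upwards [h.h1, h.deriv_eq] with t h1 h2
    exact h1.isWeakDeriv.congr (ae_eq_refl _) h2
  · filter_upwards [h.eLpNorm_le, h.eLpNorm_deriv_le] with t h1 h2 using ⟨h1, h2⟩

theorem bound' (h : LinftyH1 K T f f') :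
    ∀ᵐ t, t ∈ Ioc 0 T → ∀ x, |f t x| ≤ K :=
  (ae_restrict_iff' measurableSet_Ioc).1 h.bound

theorem intervalIntegrable (h : LinftyH1 K T f f') {t : ℝ} (ht : t ∈ Icc 0 T) (x : ℝ) :
    IntervalIntegrable (fun s => f s x) volume 0 t := by
  refine (intervalIntegrable_const (c := (K : ℝ))).mono_fun'
    ((h.meas.comp (by fun_prop : Measurable fun s : ℝ => (s, x))).aestronglyMeasurable) ?_
  rw [uIoc_of_le ht.1]
  refine (ae_restrict_iff' measurableSet_Ioc).2 ?_
  filter_upwards [h.bound'] with s hs hs'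
  exact hs ⟨hs'.1, hs'.2.trans ht.2⟩ x

theorem integral_deriv (h : LinftyH1 K T f f') {t : ℝ} (ht : t ∈ Icc 0 T) {x : ℝ}
    (hx : x ∈ Icc (0 : ℝ) 1) : ∫ s in (0 : ℝ)..t, ∫ y in (0 : ℝ)..x, f' s y
      = (∫ s in (0 : ℝ)..t, f s x) - ∫ s in (0 : ℝ)..t, f s 0 := by
  rw [← intervalIntegral.integral_sub (h.intervalIntegrable ht x) (h.intervalIntegrable ht 0)]
  refine intervalIntegral.integral_congr_ae ?_
  filter_upwards [(ae_restrict_iff' measurableSet_Ioc).1 h.h1,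
    (ae_restrict_iff' measurableSet_Ioc).1 h.deriv_eq] with s h1 h2 hs
  rw [uIoc_of_le ht.1] at hs
  have hs' : s ∈ Ioc 0 T := ⟨hs.1, hs.2.trans ht.2⟩
  rw [← (h1 hs').integral_deriv]
  refine intervalIntegral.integral_congr_ae ?_
  filter_upwards [(ae_restrict_iff' measurableSet_Ioc).1 (h2 hs')] with y hy hy'
  rw [uIoc_of_le hx.1] at hy'
  exact (hy ⟨hy'.1, hy'.2.trans hx.2⟩).symm

theorem integral_swap (h : LinftyH1 K T f f') {t : ℝ} (ht : t ∈ Icc 0 T) (x : ℝ) :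
    ∫ s in (0 : ℝ)..t, ∫ y in (0 : ℝ)..x, f s y = ∫ y in (0 : ℝ)..x, ∫ s in (0 : ℝ)..t, f s y := by
  refine intervalIntegral_intervalIntegral_swap ?_
  rw [uIoc_of_le ht.1, uIoc, IntegrableOn, Measure.volume_eq_prod, ← Measure.prod_restrict]
  refine Integrable.of_bound h.meas.aestronglyMeasurable K ?_
  have h1 : ∀ᵐ s ∂volume.restrict (Ioc 0 t), ∀ x, |f s x| ≤ K := by
    refine (ae_restrict_iff' measurableSet_Ioc).2 ?_
    filter_upwards [h.bound'] with s hs hs'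
    exact hs ⟨hs'.1, hs'.2.trans ht.2⟩
  filter_upwards [Measure.quasiMeasurePreserving_fst.ae h1] with z hz
  exact hz z.2

/-- Weak-* convergence in `L^∞(0,T; H¹)` follows from the uniform bounds and the pointwise
convergence of the time integrals. -/
theorem tendsto {F F' : ℕ → ℝ → ℝ → ℝ} (hT : 0 ≤ T) (hF : ∀ n, LinftyH1 K T (F n) (F' n))
    (hf : LinftyH1 K T f f')
    (h : ∀ t ∈ Icc 0 T, ∀ x, Tendsto (fun n => ∫ s in (0 : ℝ)..t, F n s x) atTop
      (𝓝 (∫ s in (0 : ℝ)..t, f s x))) :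
    TendstoWeakStarLinftyL2 T F f ∧ TendstoWeakStarLinftyL2 T F' f' := by
  constructor
  · refine tendstoWeakStarLinftyL2_of_rectangles hT (fun n => (hF n).meas.aestronglyMeasurable)
      (fun n => (hF n).eLpNorm_le) hf.meas.aestronglyMeasurable hf.eLpNorm_le fun t ht x hx => ?_
    simp only [(hF _).integral_swap ht x, hf.integral_swap ht x]
    refine intervalIntegral.tendsto_integral_filter_of_dominated_convergence (fun _ => K * t)
      (Eventually.of_forall fun n => ?_) (Eventually.of_forall fun n => ?_) (by simp) ?_
    · have : StronglyMeasurable fun y => ∫ s in Ioc 0 t, F n s y :=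
        (hF n).meas.stronglyMeasurable.integral_prod_left'
      simp only [intervalIntegral.integral_of_le ht.1]
      exact this.aestronglyMeasurable
    · refine Eventually.of_forall fun y _ => ?_
      have := intervalIntegral.norm_integral_le_of_norm_le_const_ae (a := 0) (b := t)
        (f := fun s => F n s y) (C := K) ?_
      · simpa [abs_of_nonneg ht.1] using this
      · filter_upwards [(hF n).bound'] with s hs hs'
        rw [uIoc_of_le ht.1] at hs'
        exact hs ⟨hs'.1, hs'.2.trans ht.2⟩ y
    · exact Eventually.of_forall fun y _ => h t ht y
  · refine tendstoWeakStarLinftyL2_of_rectangles hT (fun n => (hF n).meas'.aestronglyMeasurable)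
      (fun n => (hF n).eLpNorm_deriv_le) hf.meas'.aestronglyMeasurable hf.eLpNorm_deriv_le
      fun t ht x hx => ?_
    simp only [(hF _).integral_deriv ht hx, hf.integral_deriv ht hx]
    exact (h t ht x).sub (h t ht 0)

end LinftyH1

/-! ### The Lagrangian mass coordinate -/

namespace SmoothFlow

variable {γ : ℝ} (F : SmoothFlow γ)

theorem transported_one : F.Transported (fun _ _ => 1) fun _ _ => 0 := F.transported_const 1

theorem Transported.mul {F} {f f₁ g g₁ : ℝ → ℝ → ℝ}
    (hf : SmoothFlow.Transported (γ := γ) F f f₁) (hg : F.Transported g g₁) :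
    F.Transported (fun t x => f t x * g t x) fun t x => f₁ t x * g t x + f t x * g₁ t x where
  cg := hf.cg.mul hg.cg
  cg₁ := (hf.cg₁.mul hg.cg).add (hf.cg.mul hg.cg₁)
  xg t x := (hf.xg t x).mul (hg.xg t x)
  tg t ht x := by
    refine HasDerivAt.congr_deriv ((hf.tg t ht x).mul (hg.tg t ht x)) ?_
    ring

/-- The balance law of a transported quantity, tested with a function `φ`. -/
theorem Transported.integral_mul_eq {F} {g g₁ : ℝ → ℝ → ℝ}
    (hg : SmoothFlow.Transported (γ := γ) F g g₁) {φ φt φx : ℝ → ℝ → ℝ} (cφ : ContPeriodic φ)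
    (cφt : ContPeriodic φt) (cφx : ContPeriodic φx) (tφ : IsTimeDeriv φ φt) (xφ : IsXDeriv φ φx)
    {s t : ℝ} (hs : 0 ≤ s) (hst : s ≤ t) :
    (∫ x in (0 : ℝ)..1, F.ρ t x * g t x * φ t x) - ∫ x in (0 : ℝ)..1, F.ρ s x * g s x * φ s x
      = ∫ τ in s..t, ∫ x in (0 : ℝ)..1,
        (F.ρ τ x * g τ x * φt τ x + F.ρ τ x * F.u τ x * g τ x * φx τ x) := by
  have ht : IsTimeDeriv (fun t x => F.ρ t x * g t x * φ t x) fun t x =>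
      (-(F.ρ₁ t x * (F.u t x * g t x) + F.ρ t x * (F.u₁ t x * g t x + F.u t x * g₁ t x))) * φ t x
        + F.ρ t x * g t x * φt t x := by
    intro t ht x
    refine HasDerivAt.congr_deriv (((F.tρ t ht x).mul (hg.tg t ht x)).mul (tφ t ht x)) ?_
    simp only [Pi.mul_apply]
    ring
  have cd : ContPeriodic fun t x =>
      (-(F.ρ₁ t x * (F.u t x * g t x) + F.ρ t x * (F.u₁ t x * g t x + F.u t x * g₁ t x))) * φ t x
        + F.ρ t x * g t x * φt t x :=
    (((F.cρ₁.mul (F.cu.mul hg.cg)).add (F.cρ.mul ((F.cu₁.mul hg.cg).add (F.cu.mul hg.cg₁)))).neg.mul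
      cφ).add ((F.cρ.mul hg.cg).mul cφt)
  rw [ht.integral_sub ((F.cρ.mul hg.cg).mul cφ).cont cd.cont hs hst 0 1]
  refine intervalIntegral.integral_congr fun τ _ => ?_
  have cG : ContPeriodic fun t x => F.ρ t x * F.u t x * g t x * φ t x :=
    ((F.cρ.mul F.cu).mul hg.cg).mul cφ
  have cG₁ : ContPeriodic fun t x => ((F.ρ₁ t x * F.u t x + F.ρ t x * F.u₁ t x) * g t x
      + F.ρ t x * F.u t x * g₁ t x) * φ t x + F.ρ t x * F.u t x * g t x * φx t x :=
    (((((F.cρ₁.mul F.cu).add (F.cρ.mul F.cu₁)).mul hg.cg).add ((F.cρ.mul F.cu).mul hg.cg₁)).mul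
      cφ).add (((F.cρ.mul F.cu).mul hg.cg).mul cφx)
  have h0 := cG.integral_deriv_eq_zero cG₁ (t := τ) fun x =>
    (((F.xρ τ x).mul (F.xu τ x)).mul (hg.xg τ x)).mul (xφ τ x)
  have h1 := intervalIntegral.integral_add (cd.ii τ 0 1) (cG₁.ii τ 0 1)
  rw [h0, add_zero] at h1
  rw [← h1]
  refine intervalIntegral.integral_congr fun x _ => ?_
  ring

/-- The mass between `0` and `x`, corrected by the flux through `0`: `∂ₓM = ρ` and `∂ₜM = -ρu`. -/
noncomputable def lagr (t x : ℝ) : ℝ :=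
  (∫ y in (0 : ℝ)..x, F.ρ t y) - ∫ s in (0 : ℝ)..t, F.ρ s 0 * F.u s 0

theorem clagr : Continuous fun z : ℝ × ℝ => F.lagr z.1 z.2 := by
  refine Continuous.sub ?_ ?_
  · exact intervalIntegral.continuous_parametric_intervalIntegral_of_continuous
      (f := fun (z : ℝ × ℝ) y => F.ρ z.1 y) (s := fun z : ℝ × ℝ => z.2)
      (F.cρ.cont.comp (by fun_prop : Continuous fun z : (ℝ × ℝ) × ℝ => (z.1.1, z.2)))
      continuous_snd
  · exact (intervalIntegral.continuous_primitive
      (fun a b => ((F.cρ.mul F.cu).cont_t 0).intervalIntegrable a b) 0).comp continuous_fst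

theorem xlagr : IsXDeriv F.lagr F.ρ := fun t _ =>
  (intervalIntegral.integral_hasDerivAt_right (F.cρ.ii t _ _)
    ((F.cρ.cont_x t).stronglyMeasurableAtFilter _ _) (F.cρ.cont_x t).continuousAt).sub_const _

theorem lagr_sub {s t : ℝ} (hs : 0 ≤ s) (hst : s ≤ t) (x : ℝ) :
    F.lagr t x - F.lagr s x = ∫ τ in s..t, -(F.u τ x * F.ρ τ x) := by
  have cd : ContPeriodic fun t x => -(F.ρ₁ t x * F.u t x + F.ρ t x * F.u₁ t x) :=
    ((F.cρ₁.mul F.cu).add (F.cρ.mul F.cu₁)).neg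
  have h1 := F.tρ.integral_sub F.cρ.cont cd.cont hs hst 0 x
  have h2 : ∀ τ, ∫ y in (0 : ℝ)..x, -(F.ρ₁ τ y * F.u τ y + F.ρ τ y * F.u₁ τ y)
      = -(F.u τ x * F.ρ τ x) + F.ρ τ 0 * F.u τ 0 := by
    intro τ
    rw [intervalIntegral.integral_eq_sub_of_hasDerivAt
      (fun y _ => ((F.xρ τ y).mul (F.xu τ y)).neg) (cd.ii τ 0 x)]
    simp only [Pi.neg_apply, Pi.mul_apply]
    ring
  have cu : Continuous fun τ => -(F.u τ x * F.ρ τ x) := (F.cu.mul F.cρ).neg.cont_t x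
  have cu0 : Continuous fun τ => F.ρ τ 0 * F.u τ 0 := (F.cρ.mul F.cu).cont_t 0
  simp only [h2] at h1
  rw [intervalIntegral.integral_add (cu.intervalIntegrable _ _) (cu0.intervalIntegrable _ _)] at h1
  have h3 := intervalIntegral.integral_add_adjacent_intervals (cu0.intervalIntegrable 0 s)
    (cu0.intervalIntegrable (μ := volume) s t)
  simp only [lagr]
  linarith

theorem tlagr : IsTimeDeriv F.lagr fun t x => -(F.u t x * F.ρ t x) := by
  intro t ht x
  have cu : Continuous fun τ => -(F.u τ x * F.ρ τ x) := (F.cu.mul F.cρ).neg.cont_t x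
  have h := (intervalIntegral.integral_hasDerivAt_right (cu.intervalIntegrable 0 t)
    (cu.stronglyMeasurableAtFilter _ _) cu.continuousAt).const_add (F.lagr 0 x)
  refine h.congr_of_eventuallyEq ?_
  filter_upwards [lt_mem_nhds ht] with s hs
  rw [← F.lagr_sub le_rfl hs.le]
  ring

theorem lagr_add_one (t x : ℝ) : F.lagr t (x + 1) = F.lagr t x + ∫ y in (0 : ℝ)..1, F.ρ t y := by
  have h := (F.cρ.per t).intervalIntegral_add_eq x 0
  rw [zero_add] at h
  simp only [lagr]
  rw [← h, ← intervalIntegral.integral_add_adjacent_intervals (F.cρ.ii t 0 x) (F.cρ.ii t x (x + 1))]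
  ring

theorem mass_pos (t : ℝ) : 0 < ∫ y in (0 : ℝ)..1, F.ρ t y :=
  intervalIntegral.intervalIntegral_pos_of_pos (F.cρ.ii t 0 1) (F.pos t) one_pos

/-- The mass coordinate, normalised to have period one. -/
noncomputable def nlagr (t x : ℝ) : ℝ := F.lagr t x / ∫ y in (0 : ℝ)..1, F.ρ t y

theorem cnlagr : Continuous fun z : ℝ × ℝ => F.nlagr z.1 z.2 :=
  F.clagr.div ((F.cρ.cont_integral 0 1).comp continuous_fst) fun z => (F.mass_pos z.1).ne'

theorem nlagr_add_one (t x : ℝ) : F.nlagr t (x + 1) = F.nlagr t x + 1 := by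
  rw [nlagr, lagr_add_one, add_div, div_self (F.mass_pos t).ne', nlagr]

theorem transported_comp_nlagr {h h' : ℝ → ℝ} (hp : Function.Periodic h 1)
    (hd : ∀ y, HasDerivAt h (h' y) y) (hc : Continuous h') :
    F.Transported (fun t x => h (F.nlagr t x))
      fun t x => h' (F.nlagr t x) * (F.ρ t x / ∫ y in (0 : ℝ)..1, F.ρ t y) where
  cg := by
    refine ⟨(continuous_iff_continuousAt.2 fun y => (hd y).continuousAt).comp F.cnlagr,
      fun t x => ?_⟩
    simp only [nlagr_add_one, hp (F.nlagr t x)]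
  cg₁ := by
    have hp' : Function.Periodic h' 1 := by
      have : deriv h = h' := funext fun y => (hd y).deriv
      exact this ▸ periodic_deriv hp
    refine ContPeriodic.mul ⟨hc.comp F.cnlagr, fun t x => ?_⟩
      (F.cρ.div (.of_time (F.cρ.cont_integral 0 1)) fun t _ => (F.mass_pos t).ne')
    simp only [nlagr_add_one, hp' (F.nlagr t x)]
  xg t x := (hd _).comp x ((F.xlagr t x).div_const _)
  tg t ht x := by
    have h1 : HasDerivAt (fun s => F.nlagr s x)
        (-(F.u t x * F.ρ t x) / ∫ y in (0 : ℝ)..1, F.ρ t y) t := by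
      refine ((F.tlagr t ht x).div_const _).congr_of_eventuallyEq ?_
      filter_upwards [lt_mem_nhds ht] with s hs
      rw [nlagr, F.mass_eq hs.le, F.mass_eq ht.le]
    refine HasDerivAt.congr_deriv ((hd _).comp t h1) ?_
    ring

/-- The integrals of functions of the mass coordinate change at the rate of the velocity
gradient. -/
theorem abs_integral_comp_nlagr_sub_le {h h' : ℝ → ℝ} (hp : Function.Periodic h 1)
    (hd : ∀ y, HasDerivAt h (h' y) y) (hc : Continuous h') {H : ℝ} (hH : ∀ y, |h y| ≤ H) {K : ℝ}
    (hK : ∀ t ≥ 0, ∫ x in (0 : ℝ)..1, |F.w₁ t x| ≤ K) {s t : ℝ} (hs : 0 < s) (hst : s ≤ t) :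
    |(∫ x in (0 : ℝ)..1, h (F.nlagr t x)) - ∫ x in (0 : ℝ)..1, h (F.nlagr s x)|
      ≤ H * (2 / (γ * s) + K) * (t - s) := by
  have hg := F.transported_comp_nlagr hp hd hc
  have hγ := F.γ_pos
  rw [hg.tg.integral_sub hg.cg.cont (F.cu.mul hg.cg₁).neg.cont hs.le hst 0 1]
  have hH0 : 0 ≤ H := (abs_nonneg _).trans (hH 0)
  have key : ∀ τ ∈ uIoc s t, ‖∫ x in (0 : ℝ)..1, -(F.u τ x *
      (h' (F.nlagr τ x) * (F.ρ τ x / ∫ y in (0 : ℝ)..1, F.ρ τ y)))‖ ≤ H * (2 / (γ * s) + K) := by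
    intro τ hτ
    rw [uIoc_of_le hst] at hτ
    have h0 := (F.cu.mul hg.cg).integral_deriv_eq_zero ((F.cu₁.mul hg.cg).add (F.cu.mul hg.cg₁))
      (t := τ) fun x => (F.xu τ x).mul (hg.xg τ x)
    rw [intervalIntegral.integral_add ((F.cu₁.mul hg.cg).ii τ 0 1) ((F.cu.mul hg.cg₁).ii τ 0 1)]
      at h0
    rw [intervalIntegral.integral_neg, norm_neg, Real.norm_eq_abs,
      show ∫ x in (0 : ℝ)..1, F.u τ x * (h' (F.nlagr τ x) * (F.ρ τ x / ∫ y in (0 : ℝ)..1, F.ρ τ y))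
        = -∫ x in (0 : ℝ)..1, F.u₁ τ x * h (F.nlagr τ x) by linarith, abs_neg]
    calc |∫ x in (0 : ℝ)..1, F.u₁ τ x * h (F.nlagr τ x)|
        ≤ ∫ x in (0 : ℝ)..1, |F.u₁ τ x * h (F.nlagr τ x)| :=
          intervalIntegral.abs_integral_le_integral_abs zero_le_one
      _ ≤ ∫ x in (0 : ℝ)..1, |F.u₁ τ x| * H := by
          refine intervalIntegral.integral_mono_on zero_le_one ((F.cu₁.mul hg.cg).abs.ii τ 0 1)
            ((F.cu₁.abs.ii τ 0 1).mul_const _) fun x _ => ?_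
          rw [abs_mul]
          exact mul_le_mul_of_nonneg_left (hH _) (abs_nonneg _)
      _ ≤ (2 / (γ * τ) + K) * H := by
          rw [intervalIntegral.integral_mul_const]
          exact mul_le_mul_of_nonneg_right (F.integral_abs_u₁_le hK (hs.trans hτ.1)) hH0
      _ ≤ H * (2 / (γ * s) + K) := by
          rw [mul_comm]
          have : 2 / (γ * τ) ≤ 2 / (γ * s) := by gcongr; exact hτ.1.le
          gcongr
  have := intervalIntegral.norm_integral_le_of_norm_le_const key
  rwa [abs_of_nonneg (sub_nonneg.2 hst)] at this

/-- The time integral of the potential. -/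
noncomputable def cumPot (t x : ℝ) : ℝ := ∫ s in (0 : ℝ)..t, F.pot s x

theorem ccumPot : Continuous fun z : ℝ × ℝ => F.cumPot z.1 z.2 :=
  intervalIntegral.continuous_parametric_intervalIntegral_of_continuous
    (f := fun (z : ℝ × ℝ) s => F.pot s z.2) (s := fun z : ℝ × ℝ => z.1)
    (F.cpot.cont.comp (by fun_prop : Continuous fun z : (ℝ × ℝ) × ℝ => (z.2, z.1.2)))
    continuous_fst

theorem cumPot_sub (s t x : ℝ) : F.cumPot t x - F.cumPot s x = ∫ τ in s..t, F.pot τ x := by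
  simp only [cumPot]
  have := intervalIntegral.integral_add_adjacent_intervals (μ := volume)
    ((F.cpot.cont_t x).intervalIntegrable 0 s) ((F.cpot.cont_t x).intervalIntegrable s t)
  linarith

end SmoothFlow

/-! ### Uniform moduli of continuity -/

theorem integral_abs_sub_le {f f' : ℝ → ℝ → ℝ} {L T : ℝ}
    (hf' : Continuous fun z : ℝ × ℝ => f' z.1 z.2) {s t : ℝ} (hs : 0 ≤ s) (hst : s ≤ t) (htT : t ≤ T)
    (hf : ∀ x, f t x - f s x = ∫ τ in s..t, f' τ x)
    (hL : ∀ τ ∈ Icc 0 T, ∫ x in (0 : ℝ)..1, |f' τ x| ≤ L) :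
    ∫ x in (0 : ℝ)..1, |f t x - f s x| ≤ L * (t - s) := by
  simp only [hf]
  have hI : ∀ {g : ℝ → ℝ → ℝ}, (Continuous fun z : ℝ × ℝ => g z.1 z.2) →
      Continuous fun x => ∫ τ in s..t, g τ x := fun {g} hg =>
    intervalIntegral.continuous_parametric_intervalIntegral_of_continuous'
      (f := fun x τ => g τ x) (hg.comp (g := fun z : ℝ × ℝ => g z.1 z.2) continuous_swap) s t
  calc ∫ x in (0 : ℝ)..1, |∫ τ in s..t, f' τ x|
      ≤ ∫ x in (0 : ℝ)..1, ∫ τ in s..t, |f' τ x| :=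
        intervalIntegral.integral_mono_on zero_le_one ((hI hf').abs.intervalIntegrable _ _)
          ((hI (g := fun t x => |f' t x|) hf'.abs).intervalIntegrable _ _) fun x _ =>
          intervalIntegral.abs_integral_le_integral_abs hst
    _ = ∫ τ in s..t, ∫ x in (0 : ℝ)..1, |f' τ x| :=
        integral_integral_swap_continuous (f := fun t x => |f' t x|) hf'.abs s t 0 1
    _ ≤ ∫ τ in s..t, L := by
        refine intervalIntegral.integral_mono_on hst (Continuous.intervalIntegrable
          (intervalIntegral.continuous_parametric_intervalIntegral_of_continuous'
            (f := fun t x => |f' t x|) hf'.abs 0 1) _ _) (by simp) fun τ hτ => ?_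
        exact hL τ ⟨hs.trans hτ.1, hτ.2.trans htT⟩
    _ = L * (t - s) := by simp [mul_comm]

theorem integral_abs_mul_le {f g : ℝ → ℝ} (hf : Continuous f) (hg : Continuous g) {A B : ℝ}
    (hA : ∫ x in (0 : ℝ)..1, f x ^ 2 ≤ A) (hB : ∫ x in (0 : ℝ)..1, g x ^ 2 ≤ B) :
    ∫ x in (0 : ℝ)..1, |f x * g x| ≤ A + B := by
  calc ∫ x in (0 : ℝ)..1, |f x * g x| ≤ ∫ x in (0 : ℝ)..1, (f x ^ 2 + g x ^ 2) := by
        refine intervalIntegral.integral_mono_on zero_le_one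
          ((hf.mul hg).abs.intervalIntegrable _ _)
          (((hf.pow 2).add (hg.pow 2)).intervalIntegrable _ _) fun x _ => ?_
        rw [abs_mul]
        nlinarith [sq_nonneg (|f x| - |g x|), sq_abs (f x), sq_abs (g x), sq_nonneg (f x),
          sq_nonneg (g x)]
    _ ≤ A + B := by
        have i1 : IntervalIntegrable (fun x => f x ^ 2) volume 0 1 :=
          (hf.pow 2).intervalIntegrable _ _
        have i2 : IntervalIntegrable (fun x => g x ^ 2) volume 0 1 :=
          (hg.pow 2).intervalIntegrable _ _
        rw [intervalIntegral.integral_add i1 i2]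
        exact add_le_add hA hB

/-- A common `H¹(𝕋)` bound for `w` and for the potential. -/
noncomputable def h1Bound (C r₀ : ℝ) : ℝ≥0 :=
  NNReal.sqrt (2 * potBound C * (C ^ 2 / r₀ + 4 * C ^ 2)).toNNReal

namespace SmoothFlow.Bounded

variable {γ C r₀ m : ℝ} {F : SmoothFlow γ} (h : F.Bounded C r₀ m)

include h

theorem h1Bound_sq : (h1Bound C r₀ : ℝ) ^ 2 = 2 * potBound C * (C ^ 2 / r₀ + 4 * C ^ 2) := by
  have := two_le_potBound C
  have := h.r₀_pos
  rw [h1Bound, ← NNReal.coe_pow, NNReal.sq_sqrt, Real.coe_toNNReal]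
  positivity

theorem h1Bounded_w {t : ℝ} (ht : 0 ≤ t) : H1Bounded (h1Bound C r₀) (F.w t) := by
  refine .of_hasDerivAt (F.cw.per t) (F.xw t) (F.cw₁.cont_x t) ?_
  rw [h.h1Bound_sq]
  have := two_le_potBound C
  have := h.w₁_sq_le ht
  nlinarith [sq_nonneg C]

theorem h1Bounded_pot {t : ℝ} (ht : 0 ≤ t) : H1Bounded (h1Bound C r₀) (F.pot t) := by
  refine .of_hasDerivAt (F.cpot.per t) (F.xpot t) (F.cpot₁.cont_x t) ?_
  rw [h.h1Bound_sq]
  have := two_le_potBound C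
  have := h.pot₁_sq_le ht
  have := h.r₀_pos
  have : 0 ≤ C ^ 2 / r₀ := by positivity
  nlinarith [sq_nonneg C]

theorem holderBound_w {T : ℝ} (hT : 0 ≤ T) : HolderBound (3 * h1Bound C r₀
    + (C ^ 2 / densityBound C r₀ T + 2 * potBound C * (C ^ 2 / r₀))) T F.w := by
  have hd := h.densityBound_pos hT
  have := h.r₀_pos
  have := two_le_potBound C
  refine holderBound_of_integral (NNReal.coe_nonneg _) (by positivity)
    (fun t _ => F.cw.cont_x t) (fun t _ s _ x => by rw [F.cw.per, F.cw.per]; ring)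
    (fun t ht x y hxy => (h.h1Bounded_w ht.1).abs_sub_le hxy) fun s t hs hst htT => ?_
  refine integral_abs_sub_le (f' := fun t x => -(F.u t x * F.w₁ t x)) (F.cu.mul F.cw₁).neg.cont
    hs hst htT (fun x => F.transported_w.tg.sub_eq_integral F.cw.cont (F.cu.mul F.cw₁).neg.cont
      hs hst x) fun τ hτ => ?_
  simp only [abs_neg]
  exact integral_abs_mul_le (F.cu.cont_x τ) (F.cw₁.cont_x τ) (h.u_sq_le hτ) (h.w₁_sq_le hτ.1)

theorem abs_lagr_sub_le {t : ℝ} (ht : 0 ≤ t) (x y : ℝ) :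
    |F.lagr t x - F.lagr t y| ≤ 2 * potBound C * |x - y| := by
  have := Convex.norm_image_sub_le_of_norm_hasDerivWithin_le (f := F.lagr t) (f' := F.ρ t)
    (s := univ) (C := 2 * potBound C) (x := y) (y := x)
    (fun z _ => (F.xlagr t z).hasDerivWithinAt)
    (fun z _ => by rw [Real.norm_of_nonneg (F.pos t z).le]; exact h.density_le ht z)
    convex_univ (mem_univ _) (mem_univ _)
  simpa [Real.norm_eq_abs] using this

theorem holderBound_lagr {T : ℝ} (hT : 0 ≤ T) : HolderBound (3 * (2 * potBound C)
    + (C ^ 2 / densityBound C r₀ T + (2 * potBound C) ^ 2)) T F.lagr := by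
  have hd := h.densityBound_pos hT
  have := h.r₀_pos
  have := two_le_potBound C
  refine holderBound_of_integral (by positivity) (by positivity)
    (fun t _ => F.clagr.comp (by fun_prop : Continuous fun x : ℝ => (t, x))) ?_
    (fun t ht x y hxy => (h.abs_lagr_sub_le ht.1 x y).trans ?_) fun s t hs hst htT => ?_
  · intro t ht s hs x
    rw [F.lagr_add_one, F.lagr_add_one, F.mass_eq ht.1, F.mass_eq hs.1]
    ring
  · have : |x - y| ≤ √|x - y| := Real.le_sqrt_of_sq_le (by nlinarith [abs_nonneg (x - y)])
    gcongr
  refine integral_abs_sub_le (f' := fun t x => -(F.u t x * F.ρ t x)) (F.cu.mul F.cρ).neg.cont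
    hs hst htT (fun x => F.lagr_sub hs hst x) fun τ hτ => ?_
  simp only [abs_neg]
  refine integral_abs_mul_le (F.cu.cont_x τ) (F.cρ.cont_x τ) (h.u_sq_le hτ) ?_
  have : ∫ x in (0 : ℝ)..1, F.ρ τ x ^ 2 ≤ ∫ x in (0 : ℝ)..1, (2 * potBound C) ^ 2 := by
    refine intervalIntegral.integral_mono_on zero_le_one ((F.cρ.pow 2).ii τ 0 1) (by simp)
      fun x _ => ?_
    have := h.density_le hτ.1 x
    have := F.pos τ x
    gcongr
  simpa using this

theorem cumPot_diff_le {s t : ℝ} (hs : 0 ≤ s) (hst : s ≤ t) (x : ℝ) :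
    |F.cumPot t x - F.cumPot s x| ≤ potBound C * (t - s) := by
  rw [F.cumPot_sub]
  have := intervalIntegral.norm_integral_le_of_norm_le_const (f := fun τ => F.pot τ x)
    (a := s) (b := t) (C := potBound C) fun τ hτ => by
      rw [uIoc_of_le hst] at hτ
      rw [Real.norm_of_nonneg (F.pot_pos τ x).le]
      exact h.pot_le (hs.trans hτ.1.le) x
  rwa [abs_of_nonneg (sub_nonneg.2 hst)] at this

theorem holderBound_cumPot {T : ℝ} (hT : 0 ≤ T) :
    HolderBound (3 * (h1Bound C r₀ * T) + potBound C) T F.cumPot := by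
  have := two_le_potBound C
  have hc : ∀ t, Continuous (F.cumPot t) := fun t =>
    F.ccumPot.comp (by fun_prop : Continuous fun x : ℝ => (t, x))
  refine holderBound_of_integral (by positivity) (by positivity) (fun t _ => hc t)
    (fun t _ s _ x => ?_) (fun t ht x y hxy => ?_) fun s t hs hst htT => ?_
  · simp only [cumPot, F.cpot.per _ x]
    ring
  · simp only [cumPot]
    rw [← intervalIntegral.integral_sub ((F.cpot.cont_t x).intervalIntegrable _ _)
      ((F.cpot.cont_t y).intervalIntegrable _ _)]
    have := intervalIntegral.norm_integral_le_of_norm_le_const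
      (f := fun τ => F.pot τ x - F.pot τ y) (a := 0) (b := t) (C := h1Bound C r₀ * √|x - y|)
      fun τ hτ => by
        rw [uIoc_of_le ht.1] at hτ
        exact (h.h1Bounded_pot hτ.1.le).abs_sub_le hxy
    rw [sub_zero, abs_of_nonneg ht.1] at this
    refine this.trans ?_
    have : h1Bound C r₀ * √|x - y| * t ≤ h1Bound C r₀ * √|x - y| * T := by gcongr; exact ht.2
    linarith
  · have : ∫ x in (0 : ℝ)..1, |F.cumPot t x - F.cumPot s x|
        ≤ ∫ x in (0 : ℝ)..1, potBound C * (t - s) :=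
      intervalIntegral.integral_mono_on zero_le_one
        (((hc t).sub (hc s)).abs.intervalIntegrable _ _) (by simp)
        fun x _ => h.cumPot_diff_le hs hst x
    simpa using this

end SmoothFlow.Bounded

/-! ### The limit of a sequence of flows -/

theorem H1Bounded.mono {K K' : ℝ≥0} {f : ℝ → ℝ} (h : H1Bounded K f) (hK : K ≤ K') :
    H1Bounded K' f :=
  ⟨h.per, h.ac, h.norm_le.trans (by exact_mod_cast hK)⟩

/-- A sequence of flows with common bounds for which `w`, the mass coordinate and the time integral
of the potential converge pointwise. The limits are functions on `ℝ × ℝ`, constant for `t ≤ 0`. -/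
structure FlowLimit {γ : ℕ → ℝ} (F : ∀ n, SmoothFlow (γ n)) (C r₀ m : ℝ) where
  bounded : ∀ n, (F n).Bounded C r₀ m
  tendsto_γ : Tendsto γ atTop atTop
  w : ℝ → ℝ → ℝ
  M : ℝ → ℝ → ℝ
  Q : ℝ → ℝ → ℝ
  lim_w : ∀ t x, Tendsto (fun n => (F n).w (max t 0) x) atTop (𝓝 (w t x))
  lim_M : ∀ t x, Tendsto (fun n => (F n).lagr (max t 0) x) atTop (𝓝 (M t x))
  lim_Q : ∀ t x, Tendsto (fun n => (F n).cumPot (max t 0) x) atTop (𝓝 (Q t x))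

theorem exists_bound_of_holderBound {f : ℕ → ℝ → ℝ → ℝ}
    (h : ∀ T > 0, ∃ A, ∀ n, HolderBound A T (f n)) (h0 : ∃ B, ∀ n, ∀ x, |x| ≤ 1 → |f n 0 x| ≤ B)
    (z : ℝ × ℝ) : ∃ B, ∀ n, |f n (max z.1 0) z.2| ≤ B := by
  obtain ⟨B, hB⟩ := h0
  obtain ⟨A, hA⟩ := h (max z.1 0 + 1) (by positivity)
  set t := max z.1 0
  have ht : 0 ≤ t := le_max_right _ _
  have hA0 : 0 ≤ A := by
    have := hA 0 0 ⟨le_rfl, by linarith⟩ 0 ⟨le_rfl, by linarith⟩ 1 0 (by simp) (by simp)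
    simp only [sub_zero, abs_one, Real.sqrt_one, abs_zero, Real.sqrt_zero, add_zero, mul_one] at this
    exact (abs_nonneg _).trans this
  -- the point `(0, 0)` is joined to `z` by a chain of steps of length at most one
  obtain ⟨k, hk⟩ := exists_nat_ge (max t |z.2| + 1)
  have hk0 : 0 < (k : ℝ) := by
    have := le_max_left t |z.2|
    linarith
  have hstep : ∀ j : ℕ, j ≤ k → ∀ n, |f n (t * (j / k)) (z.2 * (j / k))| ≤ B + j * (2 * A) := by
    intro j
    induction j with
    | zero => intro _ n; simpa using hB n 0 (by simp)
    | succ j ih =>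
      intro hj n
      have h1 := ih (Nat.le_of_succ_le hj) n
      have hq : ∀ i : ℕ, i ≤ k → t * (i / k : ℝ) ∈ Icc 0 (t + 1) := fun i hi => by
        have : (i / k : ℝ) ≤ 1 := by rw [div_le_one hk0]; exact_mod_cast hi
        have : 0 ≤ (i / k : ℝ) := by positivity
        exact ⟨by positivity, by nlinarith⟩
      have e : ((j + 1 : ℕ) / k : ℝ) - j / k = 1 / k := by push_cast; ring
      have d1 : |z.2 * ((j + 1 : ℕ) / k : ℝ) - z.2 * (j / k)| ≤ 1 := by
        rw [← mul_sub, e, abs_mul, abs_of_pos (by positivity : (0 : ℝ) < 1 / k), mul_one_div,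
          div_le_one hk0]
        linarith [le_max_right t |z.2|]
      have d2 : |t * ((j + 1 : ℕ) / k : ℝ) - t * (j / k)| ≤ 1 := by
        rw [← mul_sub, e, abs_mul, abs_of_pos (by positivity : (0 : ℝ) < 1 / k), mul_one_div,
          div_le_one hk0, abs_of_nonneg ht]
        linarith [le_max_left t |z.2|]
      have h2 := hA n _ (hq _ hj) _ (hq _ (Nat.le_of_succ_le hj)) _ _ d1 d2
      have s1 := Real.sqrt_le_one.2 d1
      have s2 := Real.sqrt_le_one.2 (Real.sqrt_le_one.2 d2)
      have h3 : A * (√|z.2 * ((j + 1 : ℕ) / k : ℝ) - z.2 * (j / k)|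
          + √√|t * ((j + 1 : ℕ) / k : ℝ) - t * (j / k)|) ≤ A * 2 := by
        gcongr; linarith
      have h4 := abs_sub_abs_le_abs_sub (f n (t * ((j + 1 : ℕ) / k : ℝ)) (z.2 * ((j + 1 : ℕ) / k : ℝ)))
        (f n (t * (j / k)) (z.2 * (j / k)))
      push_cast at *
      linarith
  refine ⟨B + k * (2 * A), fun n => ?_⟩
  have := hstep k le_rfl n
  rwa [div_self hk0.ne', mul_one, mul_one] at this

namespace SmoothFlow.Bounded

variable {γ C r₀ m : ℝ} {F : SmoothFlow γ} (h : F.Bounded C r₀ m)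

include h

/-- A bound for `w` on `[0,T]`. -/
theorem w_abs_le {t T : ℝ} (ht : t ∈ Icc 0 T) (x : ℝ) :
    |F.w t x| ≤ 2 + C ^ 2 / densityBound C r₀ T + 2 * potBound C * (C ^ 2 / r₀) := by
  have h1 := (h.h1Bounded_w ht.1).isWeakDeriv.abs_le (F.cw.cont_x t) (F.cw.per t) x
  have hd : deriv (F.w t) = F.w₁ t := funext fun x => (F.xw t x).deriv
  rw [integral_torus, integral_torus, hd] at h1
  have h2 := h.w₁_abs_le ht.1
  have h3 := integral_abs_le_one_add_sq (F.cw.cont_x t)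
  have h4 := h.w_sq_le ht
  linarith

/-- The congestion constraint, up to an error that vanishes as `γ → ∞`. -/
theorem density_le_one_add {t : ℝ} (ht : 0 ≤ t) (x : ℝ) :
    F.ρ t x ≤ 1 + 2 * potBound C / (γ + 1) := by
  have h1 := h.rpow_le ht x
  have hγ := F.γ_pos
  have hρ := F.pos t x
  have h2 := one_add_mul_self_le_rpow_one_add (s := F.ρ t x - 1) (by linarith) (p := γ + 1)
    (by linarith)
  rw [add_sub_cancel, Real.rpow_add_one hρ.ne', ← F.p_eq, mul_comm (F.p t x)] at h2
  have : F.ρ t x - 1 ≤ 2 * potBound C / (γ + 1) := by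
    rw [le_div_iff₀ (by linarith)]
    linarith
  linarith

/-- The potential vanishes outside of the congested region, up to an error that vanishes as
`γ → ∞`. -/
theorem abs_switching_le {t : ℝ} (ht : 0 ≤ t) (x : ℝ) :
    |(1 - F.ρ t x) * F.pot t x| ≤ (2 * potBound C) ^ 2 / (γ + 1) := by
  have h1 := h.rpow_le ht x
  have hB := two_le_potBound C
  have hγ := F.γ_pos
  have hρ := F.pos t x
  have hp := F.p_pos t x
  have h3 : F.pot t x ≤ F.ρ t x * F.p t x := by
    have : γ / (γ + 1) ≤ 1 := by rw [div_le_one (by linarith)]; linarith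
    have h0 : 0 < F.ρ t x * F.p t x := by positivity
    simp only [pot]
    nlinarith
  have h4 := F.pot_pos t x
  rw [abs_mul, abs_of_pos h4]
  rcases le_total 1 (F.ρ t x) with h5 | h5
  · rw [abs_of_nonpos (by linarith)]
    have h6 := h.density_le_one_add ht x
    calc -(1 - F.ρ t x) * F.pot t x ≤ (2 * potBound C / (γ + 1)) * (2 * potBound C) := by
          gcongr
          · linarith
          · linarith
      _ = (2 * potBound C) ^ 2 / (γ + 1) := by ring
  · rw [abs_of_nonneg (by linarith)]
    have h6 := one_add_mul_self_le_rpow_one_add (s := (F.ρ t x)⁻¹ - 1)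
      (by have : 0 < (F.ρ t x)⁻¹ := by positivity
          linarith) (p := γ + 1) (by linarith)
    rw [add_sub_cancel, Real.inv_rpow hρ.le, Real.rpow_add_one hρ.ne', ← F.p_eq] at h6
    have h7 : 1 - F.ρ t x ≤ (F.ρ t x)⁻¹ - 1 := by
      have : F.ρ t x * (F.ρ t x)⁻¹ = 1 := mul_inv_cancel₀ hρ.ne'
      have : 1 ≤ (F.ρ t x)⁻¹ := (one_le_inv₀ hρ).2 h5
      nlinarith
    have h8 : (γ + 1) * (1 - F.ρ t x) ≤ (F.p t x * F.ρ t x)⁻¹ := by nlinarith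
    have h9 : (γ + 1) * (1 - F.ρ t x) * (F.ρ t x * F.p t x) ≤ 1 := by
      have h0 : 0 < F.p t x * F.ρ t x := by positivity
      have := mul_le_mul_of_nonneg_right h8 h0.le
      rw [inv_mul_cancel₀ h0.ne'] at this
      linarith
    have h10 : (γ + 1) * ((1 - F.ρ t x) * F.pot t x) ≤ 1 := by
      have h0 : 0 ≤ (γ + 1) * (1 - F.ρ t x) := mul_nonneg (by linarith) (by linarith)
      nlinarith
    rw [le_div_iff₀ (by linarith)]
    nlinarith

end SmoothFlow.Bounded

/-- Compactness of a sequence of flows with common bounds. -/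
theorem exists_flowLimit {C r₀ m : ℝ} {γ : ℕ → ℝ} (F : ∀ n, SmoothFlow (γ n))
    (hF : ∀ n, (F n).Bounded C r₀ m) (hγ : Tendsto γ atTop atTop) :
    ∃ σ : ℕ → ℕ, StrictMono σ ∧ Nonempty (FlowLimit (fun n => F (σ n)) C r₀ m) := by
  have key : ∀ f : ℕ → ℝ → ℝ → ℝ, (∀ T > 0, ∃ A, ∀ n, HolderBound A T (f n)) →
      (∃ B, ∀ n, ∀ x, |x| ≤ 1 → |f n 0 x| ≤ B) → ∃ (σ : ℕ → ℕ) (g : ℝ × ℝ → ℝ), StrictMono σ ∧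
        Continuous g ∧ ∀ z, Tendsto (fun n => f (σ n) (max z.1 0) z.2) atTop (𝓝 (g z)) :=
    fun f h1 h2 => (equicontinuous_of_holderBound h1).exists_subseq_tendsto
      (exists_bound_of_holderBound h1 h2)
  obtain ⟨σ₁, w, hσ₁, -, hw⟩ := key (fun n => (F n).w)
    (fun T hT => ⟨_, fun n => (hF n).holderBound_w hT.le⟩)
    ⟨_, fun n x _ => (hF n).w_abs_le (T := 0) (by simp) x⟩
  obtain ⟨σ₂, M, hσ₂, -, hM⟩ := key (fun n => (F (σ₁ n)).lagr)
    (fun T hT => ⟨_, fun n => (hF (σ₁ n)).holderBound_lagr hT.le⟩)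
    ⟨2 * potBound C, fun n x hx => by
      have := (hF (σ₁ n)).abs_lagr_sub_le le_rfl x 0
      have h0 : (F (σ₁ n)).lagr 0 0 = 0 := by simp [SmoothFlow.lagr]
      rw [h0, sub_zero, sub_zero] at this
      refine this.trans ?_
      nlinarith [two_le_potBound C]⟩
  obtain ⟨σ₃, Q, hσ₃, -, hQ⟩ := key (fun n => (F (σ₁ (σ₂ n))).cumPot)
    (fun T hT => ⟨_, fun n => (hF (σ₁ (σ₂ n))).holderBound_cumPot hT.le⟩)
    ⟨0, fun n x _ => by simp [SmoothFlow.cumPot]⟩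
  refine ⟨σ₁ ∘ σ₂ ∘ σ₃, hσ₁.comp (hσ₂.comp hσ₃), ⟨⟨fun n => hF _,
    hγ.comp (hσ₁.comp (hσ₂.comp hσ₃)).tendsto_atTop, fun t x => w (t, x), fun t x => M (t, x),
    fun t x => Q (t, x), fun t x => ?_, fun t x => ?_, fun t x => ?_⟩⟩⟩
  · exact (hw (t, x)).comp (hσ₂.comp hσ₃).tendsto_atTop
  · exact (hM (t, x)).comp hσ₃.tendsto_atTop
  · exact hQ (t, x)

namespace SmoothFlow

variable {γ : ℝ} (F : SmoothFlow γ)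

theorem integral_density (t x y : ℝ) : ∫ z in x..y, F.ρ t z = F.lagr t y - F.lagr t x :=
  intervalIntegral.integral_eq_sub_of_hasDerivAt (fun z _ => F.xlagr t z) (F.cρ.ii t x y)

theorem integral_w₁ (t x y : ℝ) : ∫ z in x..y, F.w₁ t z = F.w t y - F.w t x :=
  intervalIntegral.integral_eq_sub_of_hasDerivAt (fun z _ => F.xw t z) (F.cw₁.ii t x y)

end SmoothFlow

theorem eLpNorm_top_le {α : Type*} [MeasurableSpace α] {μ : Measure α} {f : α → ℝ} {K : ℝ≥0}
    (h : ∀ᵐ x ∂μ, |f x| ≤ K) : eLpNorm f ⊤ μ ≤ K := by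
  rw [eLpNorm_exponent_top]
  refine eLpNormEssSup_le_of_ae_bound (C := K) h |>.trans ?_
  simp

namespace FlowLimit

variable {γ : ℕ → ℝ} {F : ∀ n, SmoothFlow (γ n)} {C r₀ m : ℝ} (L : FlowLimit F C r₀ m)

include L

theorem equicontinuous_w : Equicontinuous fun n (z : ℝ × ℝ) => (F n).w (max z.1 0) z.2 :=
  equicontinuous_of_holderBound fun _ hT => ⟨_, fun n => (L.bounded n).holderBound_w hT.le⟩

theorem cw : Continuous fun z : ℝ × ℝ => L.w z.1 z.2 := by
  have h : Tendsto (fun n (z : ℝ × ℝ) => (F n).w (max z.1 0) z.2) atTop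
      (𝓝 fun z => L.w z.1 z.2) := tendsto_pi_nhds.2 fun z => L.lim_w z.1 z.2
  exact h.continuous_of_equicontinuous (L.equicontinuous_w)

theorem cM : Continuous fun z : ℝ × ℝ => L.M z.1 z.2 := by
  have h : Tendsto (fun n (z : ℝ × ℝ) => (F n).lagr (max z.1 0) z.2) atTop
      (𝓝 fun z => L.M z.1 z.2) := tendsto_pi_nhds.2 fun z => L.lim_M z.1 z.2
  exact h.continuous_of_equicontinuous (equicontinuous_of_holderBound (f := fun n => (F n).lagr) fun _ hT =>
      ⟨_, fun n => (L.bounded n).holderBound_lagr hT.le⟩)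

theorem cQ : Continuous fun z : ℝ × ℝ => L.Q z.1 z.2 := by
  have h : Tendsto (fun n (z : ℝ × ℝ) => (F n).cumPot (max z.1 0) z.2) atTop
      (𝓝 fun z => L.Q z.1 z.2) := tendsto_pi_nhds.2 fun z => L.lim_Q z.1 z.2
  exact h.continuous_of_equicontinuous (equicontinuous_of_holderBound (f := fun n => (F n).cumPot) fun _ hT =>
      ⟨_, fun n => (L.bounded n).holderBound_cumPot hT.le⟩)

theorem tendsto_w {t : ℝ} (ht : 0 ≤ t) (x : ℝ) :
    Tendsto (fun n => (F n).w t x) atTop (𝓝 (L.w t x)) := by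
  simpa only [max_eq_left ht] using L.lim_w t x

theorem tendsto_M {t : ℝ} (ht : 0 ≤ t) (x : ℝ) :
    Tendsto (fun n => (F n).lagr t x) atTop (𝓝 (L.M t x)) := by
  simpa only [max_eq_left ht] using L.lim_M t x

theorem tendsto_Q {t : ℝ} (ht : 0 ≤ t) (x : ℝ) :
    Tendsto (fun n => (F n).cumPot t x) atTop (𝓝 (L.Q t x)) := by
  simpa only [max_eq_left ht] using L.lim_Q t x

theorem h1Bounded_w (t : ℝ) : H1Bounded (h1Bound C r₀) (L.w t) :=
  .of_tendsto (fun n => (L.bounded n).h1Bounded_w (le_max_right t 0)) (L.lim_w t)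

theorem r₀_pos : 0 < r₀ := (L.bounded 0).r₀_pos

theorem w_abs_le {t T : ℝ} (ht : t ∈ Icc 0 T) (x : ℝ) :
    |L.w t x| ≤ 2 + C ^ 2 / densityBound C r₀ T + 2 * potBound C * (C ^ 2 / r₀) :=
  le_of_tendsto (L.tendsto_w ht.1 x).abs
    (Eventually.of_forall fun n => (L.bounded n).w_abs_le ht x)

theorem tendstoUniformlyOn_w (T : ℝ) :
    TendstoUniformlyOn (fun n z => (F n).w z.1 z.2) (Function.uncurry L.w) atTop
      (Icc 0 T ×ˢ univ) := by
  have h := L.equicontinuous_w.tendstoUniformlyOn_of_isCompact (f := fun z => L.w z.1 z.2)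
    (fun z => L.lim_w z.1 z.2) (isCompact_Icc (a := (0 : ℝ)) (b := T) |>.prod
      (isCompact_Icc (a := (0 : ℝ)) (b := 1)))
  rw [Metric.tendstoUniformlyOn_iff] at h ⊢
  intro ε hε
  filter_upwards [h ε hε] with n hn z hz
  have := hn (z.1, Int.fract z.2) ⟨hz.1, Int.fract_nonneg _, (Int.fract_lt_one _).le⟩
  simp only [max_eq_left hz.1.1] at this
  rwa [comp_fract_eq ((F n).cw.per z.1), comp_fract_eq (L.h1Bounded_w z.1).per] at this

/-! ### The limit density -/

theorem M_sub_nonneg (t : ℝ) {x y : ℝ} (hxy : x ≤ y) : 0 ≤ L.M t y - L.M t x :=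
  ge_of_tendsto ((L.lim_M t y).sub (L.lim_M t x)) (Eventually.of_forall fun n => by
    rw [← SmoothFlow.integral_density]
    exact intervalIntegral.integral_nonneg hxy fun z _ => ((F n).pos _ z).le)

theorem tendsto_error : Tendsto (fun n => 2 * potBound C / (γ n + 1)) atTop (𝓝 0) :=
  (tendsto_const_nhds.div_atTop (tendsto_atTop_add_const_right _ _ L.tendsto_γ))

theorem M_sub_le (t : ℝ) {x y : ℝ} (hxy : x ≤ y) : L.M t y - L.M t x ≤ y - x := by
  have h : Tendsto (fun n => (1 + 2 * potBound C / (γ n + 1)) * (y - x)) atTop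
      (𝓝 ((1 + 0) * (y - x))) := (tendsto_const_nhds.add L.tendsto_error).mul_const _
  rw [add_zero, one_mul] at h
  refine le_of_tendsto_of_tendsto' ((L.lim_M t y).sub (L.lim_M t x)) h fun n => ?_
  rw [← SmoothFlow.integral_density]
  have := intervalIntegral.integral_mono_on hxy ((F n).cρ.ii (max t 0) x y)
    (g := fun _ => 1 + 2 * potBound C / (γ n + 1)) (by simp) fun z _ =>
      (L.bounded n).density_le_one_add (le_max_right t 0) z
  rwa [intervalIntegral.integral_const, smul_eq_mul, mul_comm] at this

theorem le_M_sub {t T : ℝ} (ht : t ∈ Icc 0 T) {x y : ℝ} (hxy : x ≤ y) :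
    densityBound C r₀ T * (y - x) ≤ L.M t y - L.M t x := by
  refine ge_of_tendsto ((L.tendsto_M ht.1 y).sub (L.tendsto_M ht.1 x))
    (Eventually.of_forall fun n => ?_)
  rw [← SmoothFlow.integral_density]
  have := intervalIntegral.integral_mono_on hxy (f := fun _ => densityBound C r₀ T) (by simp)
    ((F n).cρ.ii t x y) fun z _ => (L.bounded n).densityBound_le ht z
  rwa [intervalIntegral.integral_const, smul_eq_mul, mul_comm] at this

theorem lipschitz_M (t : ℝ) : LipschitzWith 1 (L.M t) := by
  refine LipschitzWith.of_dist_le_mul fun x y => ?_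
  rw [NNReal.coe_one, one_mul, Real.dist_eq, Real.dist_eq]
  rcases le_total x y with h | h
  · rw [abs_sub_comm, abs_sub_comm x, abs_of_nonneg (L.M_sub_nonneg t h),
      abs_of_nonneg (sub_nonneg.2 h)]
    exact L.M_sub_le t h
  · rw [abs_of_nonneg (L.M_sub_nonneg t h), abs_of_nonneg (sub_nonneg.2 h)]
    exact L.M_sub_le t h

/-- The total mass. -/
def mass : ℝ := L.M 0 1 - L.M 0 0

theorem tendsto_mass {t : ℝ} (ht : 0 ≤ t) :
    Tendsto (fun n => ∫ x in (0 : ℝ)..1, (F n).ρ t x) atTop (𝓝 L.mass) := by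
  have h := (L.tendsto_M le_rfl 1).sub (L.tendsto_M le_rfl 0)
  refine h.congr fun n => ?_
  rw [← SmoothFlow.integral_density, (F n).mass_eq ht]

theorem mass_pos : 0 < L.mass := by
  have h1 := L.le_M_sub (t := 0) (T := 0) (by simp) zero_le_one
  have h2 := (L.bounded 0).densityBound_pos le_rfl
  rw [sub_zero, mul_one] at h1
  exact h2.trans_le h1

theorem M_add_one (t x : ℝ) : L.M t (x + 1) = L.M t x + L.mass := by
  refine tendsto_nhds_unique (L.lim_M t (x + 1)) ?_
  refine ((L.lim_M t x).add (L.tendsto_mass (le_max_right t 0))).congr fun n => ?_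
  rw [SmoothFlow.lagr_add_one]

/-- The normalised mass coordinate. -/
noncomputable def N (t x : ℝ) : ℝ := L.M t x / L.mass

theorem tendsto_N {t : ℝ} (ht : 0 ≤ t) (x : ℝ) :
    Tendsto (fun n => (F n).nlagr t x) atTop (𝓝 (L.N t x)) :=
  (L.tendsto_M ht x).div (L.tendsto_mass ht) L.mass_pos.ne'

theorem N_add_one (t x : ℝ) : L.N t (x + 1) = L.N t x + 1 := by
  rw [N, M_add_one, add_div, div_self L.mass_pos.ne', N]

theorem cN : Continuous fun z : ℝ × ℝ => L.N z.1 z.2 := L.cM.div_const _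

/-- The limit density. -/
noncomputable def ρ (t x : ℝ) : ℝ := deriv (L.M t) x

theorem measurable_ρ : Measurable (Function.uncurry L.ρ) :=
  measurable_deriv_with_param (f := fun t x => L.M t x) L.cM

theorem measurable_ρ_slice (t : ℝ) : Measurable (L.ρ t) := measurable_deriv _

theorem periodic_ρ (t : ℝ) : Function.Periodic (L.ρ t) 1 := fun x => by
  have h : (fun y => L.M t (y + 1)) = fun y => L.M t y + L.mass := funext (L.M_add_one t)
  rw [ρ, ρ, ← deriv_comp_add_const, h, deriv_add_const]

theorem ρ_nonneg (t x : ℝ) : 0 ≤ L.ρ t x :=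
  (show Monotone (L.M t) from fun _ _ h => sub_nonneg.1 (L.M_sub_nonneg t h)).deriv_nonneg

theorem ρ_le_one (t x : ℝ) : L.ρ t x ≤ 1 := by
  have := norm_deriv_le_of_lipschitz (L.lipschitz_M t) (x₀ := x)
  exact (le_abs_self _).trans this

theorem abs_ρ_le (t x : ℝ) : |L.ρ t x| ≤ 1 := by
  rw [abs_of_nonneg (L.ρ_nonneg t x)]; exact L.ρ_le_one t x

theorem ac_M (t a b : ℝ) : AbsolutelyContinuousOnInterval (L.M t) a b :=
  (L.lipschitz_M t).lipschitzOnWith.absolutelyContinuousOnInterval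

theorem integral_ρ (t x y : ℝ) : ∫ z in x..y, L.ρ t z = L.M t y - L.M t x :=
  (L.ac_M t x y).integral_deriv_eq_sub

theorem ae_hasDerivAt_M (t : ℝ) : ∀ᵐ x, HasDerivAt (L.M t) (L.ρ t x) x := by
  filter_upwards [(L.lipschitz_M t).ae_differentiableAt] with x hx using hx.hasDerivAt

theorem le_ρ {t T : ℝ} (ht : t ∈ Icc 0 T) : ∀ᵐ x, densityBound C r₀ T ≤ L.ρ t x := by
  filter_upwards [L.ae_hasDerivAt_M t] with x hx
  have h := (hasDerivAt_iff_tendsto_slope.1 hx).mono_left (nhdsGT_le_nhdsNE x)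
  refine ge_of_tendsto h ?_
  filter_upwards [self_mem_nhdsWithin] with y hy
  rw [slope_def_field, le_div_iff₀ (sub_pos.2 hy)]
  exact L.le_M_sub ht (le_of_lt hy)

/-- A common bound for the densities. -/
theorem density_eLpNorm_le {t : ℝ} (ht : 0 ≤ t) (n : ℕ) :
    eLpNorm ((F n).ρ t) ⊤ torusMeasure ≤ (2 * potBound C).toNNReal := by
  refine eLpNorm_top_le (Eventually.of_forall fun x => ?_)
  rw [Real.coe_toNNReal _ (by linarith [two_le_potBound C]), abs_of_pos ((F n).pos t x)]
  exact (L.bounded n).density_le ht x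

theorem ρ_eLpNorm_le (t : ℝ) : eLpNorm (L.ρ t) ⊤ torusMeasure ≤ (2 * potBound C).toNNReal := by
  refine eLpNorm_top_le (Eventually.of_forall fun x => ?_)
  rw [Real.coe_toNNReal _ (by linarith [two_le_potBound C])]
  linarith [L.abs_ρ_le t x, two_le_potBound C]

/-- The densities converge weakly at every time. -/
theorem tendsto_integral_density_mul {t : ℝ} (ht : 0 ≤ t) {ψ : ℝ → ℝ}
    (hψ : MemLp ψ 1 torusMeasure) :
    Tendsto (fun n => ∫ x, (F n).ρ t x * ψ x ∂torusMeasure) atTop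
      (𝓝 (∫ x, L.ρ t x * ψ x ∂torusMeasure)) := by
  refine tendsto_integral_mul_torus (p := 1) (q := ⊤) (by simp)
    (fun n => ((F n).cρ.cont_x t).aestronglyMeasurable) (L.density_eLpNorm_le ht)
    (L.measurable_ρ_slice t).aestronglyMeasurable (L.ρ_eLpNorm_le t) (fun x _ => ?_) hψ
  simp only [SmoothFlow.integral_density, L.integral_ρ]
  exact (L.tendsto_M ht x).sub (L.tendsto_M ht 0)

theorem continuous_integral_ρ_mul {ψ : ℝ → ℝ} (hψ : MemLp ψ 1 torusMeasure) :
    Continuous fun t => ∫ x, L.ρ t x * ψ x ∂torusMeasure := by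
  refine continuous_iff_continuousAt.2 fun t₀ => ?_
  refine tendsto_integral_mul_torus (p := 1) (q := ⊤) (by simp)
    (fun t => (L.measurable_ρ_slice t).aestronglyMeasurable) L.ρ_eLpNorm_le
    (L.measurable_ρ_slice t₀).aestronglyMeasurable (L.ρ_eLpNorm_le t₀) (fun x _ => ?_) hψ
  simp only [L.integral_ρ]
  exact ((L.cM.comp (by fun_prop : Continuous fun t : ℝ => (t, x))).sub
    (L.cM.comp (by fun_prop : Continuous fun t : ℝ => (t, (0 : ℝ))))).continuousAt

/-- Weak continuity of the density in time. -/
theorem contWeakLp_ρ (p : ℝ≥0∞) (T : ℝ) : ContWeakLp p T L.ρ := by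
  refine ⟨fun t _ => ?_, fun q hq ψ hψ => ?_⟩
  · exact MemLp.of_bound (L.measurable_ρ_slice t).aestronglyMeasurable 1
      (Eventually.of_forall fun x => L.abs_ρ_le t x)
  · have : q.HolderConjugate p := .symm
    exact (L.continuous_integral_ρ_mul (hψ.mono_exponent
      (ENNReal.HolderConjugate.one_le q p))).continuousOn

/-- The densities converge weakly-* on the cylinder. -/
theorem tendsto_integral_density_mul_cyl {T : ℝ} (hT : 0 ≤ T) {g : ℝ × ℝ → ℝ}
    (hg : Integrable g (cylMeasure T)) :
    Tendsto (fun n => ∫ z, (F n).ρ z.1 z.2 * g z ∂cylMeasure T) atTop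
      (𝓝 (∫ z, L.ρ z.1 z.2 * g z ∂cylMeasure T)) := by
  have hB := two_le_potBound C
  have hpos : ∀ᵐ z ∂cylMeasure T, 0 < z.1 := by
    refine Measure.quasiMeasurePreserving_fst.ae (p := fun t => 0 < t) ?_
    filter_upwards [ae_restrict_mem measurableSet_Ioc] with t ht using ht.1
  refine tendsto_integral_mul_cyl (p := 1) (q := ⊤) (K := (2 * potBound C).toNNReal) (by simp) hT
    (F := fun n z => (F n).ρ z.1 z.2) (f := fun z => L.ρ z.1 z.2)
    (fun n => (F n).cρ.cont.aestronglyMeasurable) (fun n => ?_)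
    L.measurable_ρ.aestronglyMeasurable ?_ (fun t ht x _ => ?_) (memLp_one_iff_integrable.2 hg)
  · refine eLpNorm_top_le ?_
    filter_upwards [hpos] with z hz
    rw [Real.coe_toNNReal _ (by linarith), abs_of_pos ((F n).pos _ _)]
    exact (L.bounded n).density_le hz.le _
  · refine eLpNorm_top_le (Eventually.of_forall fun z => ?_)
    rw [Real.coe_toNNReal _ (by linarith)]
    linarith [L.abs_ρ_le z.1 z.2]
  · simp only [SmoothFlow.integral_density, L.integral_ρ]
    refine intervalIntegral.tendsto_integral_filter_of_dominated_convergence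
      (fun _ => 2 * potBound C * |x - 0|) (Eventually.of_forall fun n => ?_)
      (Eventually.of_forall fun n => Eventually.of_forall fun s hs => ?_) (by simp)
      (Eventually.of_forall fun s hs => ?_)
    · exact (((F n).clagr.comp (by fun_prop : Continuous fun t : ℝ => (t, x))).sub
        ((F n).clagr.comp (by fun_prop : Continuous fun t : ℝ => (t, (0 : ℝ))))).aestronglyMeasurable
    · rw [uIoc_of_le ht.1] at hs
      exact (L.bounded n).abs_lagr_sub_le hs.1.le x 0
    · rw [uIoc_of_le ht.1] at hs
      exact (L.tendsto_M hs.1.le x).sub (L.tendsto_M hs.1.le 0)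

end FlowLimit

/-! ### Products of weakly and strongly convergent sequences -/

theorem tendsto_integral_mul_mul {α : Type*} [MeasurableSpace α] {μ : Measure α} [IsFiniteMeasure μ]
    {F G : ℕ → α → ℝ} {f g : α → ℝ} {K : ℝ≥0} {B : ℝ}
    (hFm : ∀ n, AEStronglyMeasurable (F n) μ) (hFK : ∀ n, eLpNorm (F n) 2 μ ≤ K)
    (hw : ∀ ψ, MemLp ψ 2 μ → Tendsto (fun n => ∫ x, F n x * ψ x ∂μ) atTop (𝓝 (∫ x, f x * ψ x ∂μ)))
    (hGm : ∀ n, AEStronglyMeasurable (G n) μ) (hGB : ∀ n, ∀ᵐ x ∂μ, |G n x| ≤ B)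
    (hG : ∀ᵐ x ∂μ, Tendsto (fun n => G n x) atTop (𝓝 (g x))) :
    Tendsto (fun n => ∫ x, F n x * G n x ∂μ) atTop (𝓝 (∫ x, f x * g x ∂μ)) := by
  have hgm : AEStronglyMeasurable g μ := aestronglyMeasurable_of_tendsto_ae _ hGm hG
  have hgB : ∀ᵐ x ∂μ, |g x| ≤ B := by
    filter_upwards [hG, ae_all_iff.2 hGB] with x h1 h2
    exact le_of_tendsto h1.abs (Eventually.of_forall h2)
  have hGL : ∀ n, MemLp (G n) 2 μ := fun n => MemLp.of_bound (hGm n) B (hGB n)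
  have hgL : MemLp g 2 μ := MemLp.of_bound hgm B hgB
  have hFL : ∀ n, MemLp (F n) 2 μ := fun n => ⟨hFm n, (hFK n).trans_lt ENNReal.coe_lt_top⟩
  have hdiff : Tendsto (fun n => (eLpNorm (fun x => G n x - g x) 2 μ).toReal) atTop (𝓝 0) := by
    have h1 : Tendsto (fun n => ∫ x, (G n x - g x) ^ 2 ∂μ) atTop (𝓝 (∫ _, (0 : ℝ) ∂μ)) := by
      refine tendsto_integral_of_dominated_convergence (fun _ => (2 * B) ^ 2)
        (fun n => ((hGm n).sub hgm).pow 2) (integrable_const _) (fun n => ?_) ?_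
      · filter_upwards [hGB n, hgB] with x h1 h2
        rw [Real.norm_of_nonneg (sq_nonneg _), ← sq_abs]
        have := abs_sub (G n x) (g x)
        gcongr
        linarith
      · filter_upwards [hG] with x hx
        have := ((hx.sub_const (g x)).pow 2)
        simpa using this
    rw [integral_zero] at h1
    have h2 := h1.sqrt
    rw [Real.sqrt_zero] at h2
    refine h2.congr fun n => ?_
    have hm : MemLp (fun x => G n x - g x) 2 μ := (hGL n).sub hgL
    rw [hm.eLpNorm_eq_integral_rpow_norm (by simp) (by simp), ENNReal.toReal_ofReal (by positivity)]
    simp [Real.sqrt_eq_rpow]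
  have h1 : Tendsto (fun n => ∫ x, F n x * (G n x - g x) ∂μ) atTop (𝓝 0) := by
    refine squeeze_zero_norm (fun n => ?_) (by simpa using hdiff.const_mul (K : ℝ))
    exact abs_integral_mul_le (p := 2) (q := 2) (hFm n) ((hGL n).sub hgL) (hFK n)
  have h2 := h1.add (hw g hgL)
  rw [zero_add] at h2
  refine h2.congr fun n => ?_
  have i1 : Integrable (fun x => F n x * (G n x - g x)) μ :=
    (hFL n).integrable_mul ((hGL n).sub hgL)
  have i2 : Integrable (fun x => F n x * g x) μ := (hFL n).integrable_mul hgL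
  rw [← integral_add i1 i2]
  refine integral_congr_ae (Eventually.of_forall fun x => ?_)
  ring

/-! ### Difference quotients -/

namespace H1Bounded

variable {K : ℝ≥0} {f : ℝ → ℝ}

theorem integral_dq_sq_le (h : H1Bounded K f) {ε : ℝ} (hε : 0 < ε) :
    ∫ x in (0 : ℝ)..1, ((f (x + ε) - f x) / ε) ^ 2 ≤ ∫ x in (0 : ℝ)..1, deriv f x ^ 2 := by
  set P : ℝ → ℝ := fun x => ∫ y in (0 : ℝ)..x, deriv f y ^ 2 with hP
  have hPc : Continuous P := intervalIntegral.continuous_primitive h.intervalIntegrable_sq 0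
  have hper : Function.Periodic (fun x => deriv f x ^ 2) 1 := fun x => by
    simp only [periodic_deriv h.per x]
  have hP1 : ∀ x, P (x + 1) = P x + P 1 := by
    intro x
    have := hper.intervalIntegral_add_eq x 0
    rw [zero_add] at this
    simp only [hP]
    rw [← this, intervalIntegral.integral_add_adjacent_intervals (h.intervalIntegrable_sq _ _)
      (h.intervalIntegrable_sq _ _)]
  have hfc := h.continuous
  have hPe : Continuous fun x => P (x + ε) := hPc.comp (by fun_prop)
  have h1 : ∀ x, ((f (x + ε) - f x) / ε) ^ 2 ≤ (P (x + ε) - P x) / ε := by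
    intro x
    have := sq_integral_le (a := x) (b := x + ε) (by linarith) ((h.ac _ _).intervalIntegrable_deriv)
      (h.intervalIntegrable_sq _ _)
    rw [h.integral_deriv, add_sub_cancel_left,
      ← intervalIntegral.integral_interval_sub_left (h.intervalIntegrable_sq 0 _)
        (h.intervalIntegrable_sq 0 _)] at this
    rw [div_pow, div_le_div_iff₀ (by positivity) hε]
    nlinarith
  have h2 : ∫ x in (0 : ℝ)..1, (P (x + ε) - P x) / ε = P 1 := by
    rw [intervalIntegral.integral_div, intervalIntegral.integral_sub (hPe.intervalIntegrable _ _)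
      (hPc.intervalIntegrable _ _), intervalIntegral.integral_comp_add_right (fun x => P x)]
    have e1 : ∫ x in ε..1 + ε, P x = (∫ x in ε..1, P x) + ∫ x in (1 : ℝ)..1 + ε, P x :=
      (intervalIntegral.integral_add_adjacent_intervals (hPc.intervalIntegrable _ _)
        (hPc.intervalIntegrable _ _)).symm
    have e2 : ∫ x in (0 : ℝ)..1, P x = (∫ x in (0 : ℝ)..ε, P x) + ∫ x in ε..1, P x :=
      (intervalIntegral.integral_add_adjacent_intervals (hPc.intervalIntegrable _ _)
        (hPc.intervalIntegrable _ _)).symm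
    have e3 : ∫ x in (1 : ℝ)..1 + ε, P x = (∫ x in (0 : ℝ)..ε, P x) + ε * P 1 := by
      have e4 := intervalIntegral.integral_comp_add_right (fun x => P x) (a := 0) (b := ε) 1
      rw [zero_add, add_comm ε 1] at e4
      rw [← e4]
      simp only [hP1]
      rw [intervalIntegral.integral_add (hPc.intervalIntegrable _ _) (by simp)]
      simp
    rw [zero_add, e1, e2, e3]
    field_simp
    ring
  calc ∫ x in (0 : ℝ)..1, ((f (x + ε) - f x) / ε) ^ 2
      ≤ ∫ x in (0 : ℝ)..1, (P (x + ε) - P x) / ε :=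
        intervalIntegral.integral_mono_on zero_le_one
          (Continuous.intervalIntegrable (by fun_prop) _ _)
          (Continuous.intervalIntegrable (by fun_prop) _ _) fun x _ => h1 x
    _ = P 1 := h2

/-- The difference quotients converge weakly to the derivative. -/
theorem tendsto_dq (h : H1Bounded K f) {ψ : ℝ → ℝ} (hψ : MemLp ψ 2 torusMeasure) :
    Tendsto (fun n : ℕ => ∫ x, (f (x + 1 / (n + 1)) - f x) / (1 / (n + 1)) * ψ x ∂torusMeasure) atTop
      (𝓝 (∫ x, deriv f x * ψ x ∂torusMeasure)) := by
  have hfc := h.continuous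
  have hdc : ∀ n : ℕ, Continuous fun x => (f (x + 1 / ((n : ℝ) + 1)) - f x) / (1 / ((n : ℝ) + 1)) :=
    fun n => by fun_prop
  refine tendsto_integral_mul_torus (p := 2) (q := 2) (K := K) (by simp)
    (F := fun (n : ℕ) x => (f (x + 1 / ((n : ℝ) + 1)) - f x) / (1 / ((n : ℝ) + 1)))
    (fun n => (hdc n).aestronglyMeasurable) (fun (n : ℕ) => ?_) h.memLp.1 h.norm_le (fun x _ => ?_) hψ
  · rw [eLpNorm_two_le_iff (hdc n).aestronglyMeasurable]
    refine ⟨integrable_torus_of_continuous ((hdc n).pow 2), ?_⟩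
    rw [integral_torus]
    exact (h.integral_dq_sq_le (by positivity)).trans h.integral_sq_le
  · rw [h.integral_deriv]
    have hd : ∀ y, HasDerivAt (fun z => ∫ w in (0 : ℝ)..z, f w) (f y) y := fun y =>
      intervalIntegral.integral_hasDerivAt_right (hfc.intervalIntegrable _ _)
        (hfc.stronglyMeasurableAtFilter _ _) hfc.continuousAt
    have h0 : Tendsto (fun n : ℕ => (1 : ℝ) / (n + 1)) atTop (𝓝[≠] 0) :=
      tendsto_nhdsWithin_iff.2 ⟨tendsto_one_div_add_atTop_nhds_zero_nat,
        Eventually.of_forall fun n => by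
          have : (0 : ℝ) < 1 / ((n : ℝ) + 1) := by positivity
          exact this.ne'⟩
    have hq := fun y => (hasDerivAt_iff_tendsto_slope_zero.1 (hd y)).comp h0
    refine ((hq x).sub (hq 0)).congr fun n => ?_
    set ε : ℝ := 1 / ((n : ℝ) + 1)
    have e1 : ∫ w in ε..x + ε, f w = (∫ w in (0 : ℝ)..x + ε, f w) - ∫ w in (0 : ℝ)..ε, f w :=
      (intervalIntegral.integral_interval_sub_left (hfc.intervalIntegrable 0 _)
        (hfc.intervalIntegrable 0 _)).symm
    have hfe : Continuous fun y => f (y + ε) := by fun_prop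
    rw [intervalIntegral.integral_div, intervalIntegral.integral_sub (hfe.intervalIntegrable _ _)
      (hfc.intervalIntegrable _ _), intervalIntegral.integral_comp_add_right (fun x => f x),
      zero_add, e1]
    change ε⁻¹ * ((∫ w in (0 : ℝ)..x + ε, f w) - ∫ w in (0 : ℝ)..x, f w)
      - ε⁻¹ * ((∫ w in (0 : ℝ)..0 + ε, f w) - ∫ w in (0 : ℝ)..0, f w) = _
    rw [zero_add, intervalIntegral.integral_same]
    ring

/-- The Dirichlet energy is the supremum of its tangent functionals at continuous functions. -/
theorem exists_energy_le (h : H1Bounded K f) {ε : ℝ} (hε : 0 < ε) :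
    ∃ k : ℝ → ℝ, Continuous k ∧ Function.Periodic k 1 ∧ ∫ x, deriv f x ^ 2 ∂torusMeasure
      ≤ 2 * (∫ x, deriv f x * k x ∂torusMeasure) - (∫ x, k x ^ 2 ∂torusMeasure) + ε := by
  have hfc := h.continuous
  have h1 := h.tendsto_dq h.memLp
  have e : ∫ x, deriv f x * deriv f x ∂torusMeasure = ∫ x, deriv f x ^ 2 ∂torusMeasure := by
    simp only [pow_two]
  rw [e] at h1
  obtain ⟨n, hn⟩ := (h1.eventually_const_lt (u := (∫ x, deriv f x ^ 2 ∂torusMeasure) - ε / 2)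
    (by linarith)).exists
  refine ⟨fun x => (f (x + 1 / ((n : ℝ) + 1)) - f x) / (1 / ((n : ℝ) + 1)), by fun_prop,
    fun x => ?_, ?_⟩
  · simp only
    rw [add_right_comm, h.per, h.per]
  · have h2 := h.integral_dq_sq_le (ε := 1 / ((n : ℝ) + 1)) (by positivity)
    rw [← integral_torus, ← integral_torus] at h2
    simp only [mul_comm (deriv f _)]
    linarith

end H1Bounded

theorem _root_.Function.Periodic.exists_abs_le {h : ℝ → ℝ} (hp : Function.Periodic h 1)
    (hc : Continuous h) : ∃ B, ∀ y, |h y| ≤ B := by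
  obtain ⟨B, hB⟩ := isCompact_Icc.exists_bound_of_continuousOn (hc.continuousOn (s := Icc 0 1))
  refine ⟨B, fun y => ?_⟩
  rw [← comp_fract_eq hp y]
  exact hB _ ⟨Int.fract_nonneg y, (Int.fract_lt_one y).le⟩

/-- Continuous periodic functions are pointwise limits of bounded sequences of `C¹` functions. -/
theorem exists_smooth_approx {h : ℝ → ℝ} (hc : Continuous h) (hp : Function.Periodic h 1) {H : ℝ}
    (hH : ∀ y, |h y| ≤ H) : ∃ g g' : ℕ → ℝ → ℝ, (∀ n, Function.Periodic (g n) 1) ∧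
      (∀ n y, HasDerivAt (g n) (g' n y) y) ∧ (∀ n, Continuous (g' n)) ∧ (∀ n y, |g n y| ≤ H) ∧
      ∀ y, Tendsto (fun n => g n y) atTop (𝓝 (h y)) := by
  set P : ℝ → ℝ := fun z => ∫ w in (0 : ℝ)..z, h w
  have hd : ∀ y, HasDerivAt P (h y) y := fun y =>
    intervalIntegral.integral_hasDerivAt_right (hc.intervalIntegrable _ _)
      (hc.stronglyMeasurableAtFilter _ _) hc.continuousAt
  have he : ∀ n : ℕ, (0 : ℝ) < 1 / ((n : ℝ) + 1) := fun n => by positivity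
  have hg : ∀ (n : ℕ) y, (P (y + 1 / ((n : ℝ) + 1)) - P y) / (1 / ((n : ℝ) + 1))
      = (∫ w in (0 : ℝ)..1 / ((n : ℝ) + 1), h (w + y)) / (1 / ((n : ℝ) + 1)) := by
    intro n y
    rw [intervalIntegral.integral_comp_add_right (fun x => h x), zero_add,
      intervalIntegral.integral_interval_sub_left (hc.intervalIntegrable 0 _)
        (hc.intervalIntegrable 0 _), add_comm y]
  refine ⟨fun n y => (P (y + 1 / ((n : ℝ) + 1)) - P y) / (1 / ((n : ℝ) + 1)),
    fun n y => (h (y + 1 / ((n : ℝ) + 1)) - h y) / (1 / ((n : ℝ) + 1)), fun n y => ?_, fun n y => ?_,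
    fun n => by fun_prop, fun n y => ?_, fun y => ?_⟩
  · simp only [hg, ← add_assoc, hp _]
  · exact (((hd (y + 1 / ((n : ℝ) + 1))).comp_add_const y _).sub (hd y)).div_const _
  · simp only [hg]
    rw [abs_div, abs_of_pos (he n), div_le_iff₀ (he n)]
    have := intervalIntegral.norm_integral_le_of_norm_le_const (f := fun w => h (w + y)) (a := 0)
      (b := 1 / ((n : ℝ) + 1)) (C := H) fun w _ => hH _
    rwa [sub_zero, abs_of_pos (he n)] at this
  · have h0 : Tendsto (fun n : ℕ => (1 : ℝ) / (n + 1)) atTop (𝓝[≠] 0) :=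
      tendsto_nhdsWithin_iff.2 ⟨tendsto_one_div_add_atTop_nhds_zero_nat,
        Eventually.of_forall fun n => (he n).ne'⟩
    refine ((hasDerivAt_iff_tendsto_slope_zero.1 (hd y)).comp h0).congr fun n => ?_
    exact (div_eq_inv_mul _ _).symm

/-! ### Strong continuity of the limit velocity -/

/-- The pointwise inequality behind the energy comparison: where `|h| > Λ`, only the fraction `c`
of the square of `h` is available. -/
theorem two_mul_mul_sub_le {g h Λ c : ℝ} (hΛ : 0 ≤ Λ) (hc : 0 < c) :
    2 * (g * h) - (max (-Λ) (min Λ h)) ^ 2 - c * (h ^ 2 - (max (-Λ) (min Λ h)) ^ 2)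
      ≤ g ^ 2 + (max (|g| - c * Λ) 0) ^ 2 / c := by
  have h0 : 0 ≤ (max (|g| - c * Λ) 0) ^ 2 / c := by positivity
  -- the case of large `h ≥ 0`; negative values follow by symmetry
  have key : ∀ a q : ℝ, a ≤ |g| → 0 ≤ q →
      2 * (a * (Λ + q)) - Λ ^ 2 - c * ((Λ + q) ^ 2 - Λ ^ 2)
        ≤ a ^ 2 + (max (|g| - c * Λ) 0) ^ 2 / c := by
    intro a q ha hq
    set e := max (|g| - c * Λ) 0
    have he : a - c * Λ ≤ e := (by linarith : a - c * Λ ≤ |g| - c * Λ).trans (le_max_left _ _)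
    have h1 : 2 * (e * q) - c * q ^ 2 ≤ e ^ 2 / c := by
      rw [le_div_iff₀ hc]
      nlinarith [sq_nonneg (e - c * q)]
    have h2 : (a - c * Λ) * q ≤ e * q := mul_le_mul_of_nonneg_right he hq
    nlinarith [sq_nonneg (a - Λ)]
  rcases le_total h Λ with h1 | h1
  · rcases le_total (-Λ) h with h2 | h2
    · rw [min_eq_right h1, max_eq_right h2]
      nlinarith [sq_nonneg (g - h)]
    · rw [min_eq_right h1, max_eq_left h2]
      have := key (-g) (-h - Λ) (neg_le_abs g) (by linarith)
      nlinarith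
  · rw [min_eq_left h1, max_eq_right (by linarith)]
    have := key g (h - Λ) (le_abs_self g) (by linarith)
    rw [add_sub_cancel] at this
    linarith

namespace FlowLimit

variable {γ : ℕ → ℝ} {F : ∀ n, SmoothFlow (γ n)} {C r₀ m : ℝ} (L : FlowLimit F C r₀ m)

include L

theorem w₁_eLpNorm_le {t : ℝ} (ht : 0 ≤ t) (n : ℕ) :
    eLpNorm ((F n).w₁ t) 2 torusMeasure ≤ h1Bound C r₀ := by
  have hd : deriv ((F n).w t) = (F n).w₁ t := funext fun x => ((F n).xw t x).deriv
  rw [← hd]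
  exact ((L.bounded n).h1Bounded_w ht).norm_le

/-- The slopes converge weakly at every time. -/
theorem tendsto_integral_w₁_mul {t : ℝ} (ht : 0 ≤ t) {ψ : ℝ → ℝ} (hψ : MemLp ψ 2 torusMeasure) :
    Tendsto (fun n => ∫ x, (F n).w₁ t x * ψ x ∂torusMeasure) atTop
      (𝓝 (∫ x, deriv (L.w t) x * ψ x ∂torusMeasure)) := by
  refine tendsto_integral_mul_torus (p := 2) (q := 2) (by simp)
    (fun n => ((F n).cw₁.cont_x t).aestronglyMeasurable) (L.w₁_eLpNorm_le ht)
    (L.h1Bounded_w t).memLp.1 (L.h1Bounded_w t).norm_le (fun x _ => ?_) hψ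
  simp only [SmoothFlow.integral_w₁, (L.h1Bounded_w t).integral_deriv]
  exact (L.tendsto_w ht x).sub (L.tendsto_w ht 0)

/-- The slope is weakly continuous in time. -/
theorem continuous_integral_deriv_w_mul {ψ : ℝ → ℝ} (hψ : MemLp ψ 2 torusMeasure) :
    Continuous fun t => ∫ x, deriv (L.w t) x * ψ x ∂torusMeasure := by
  refine continuous_iff_continuousAt.2 fun t₀ => ?_
  refine tendsto_integral_mul_torus (p := 2) (q := 2) (by simp)
    (fun t => (L.h1Bounded_w t).memLp.1) (fun t => (L.h1Bounded_w t).norm_le)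
    (L.h1Bounded_w t₀).memLp.1 (L.h1Bounded_w t₀).norm_le (fun x _ => ?_) hψ
  simp only [(L.h1Bounded_w _).integral_deriv]
  exact ((L.cw.comp (by fun_prop : Continuous fun t : ℝ => (t, x))).sub
    (L.cw.comp (by fun_prop : Continuous fun t : ℝ => (t, (0 : ℝ))))).continuousAt

theorem cN_slice (t : ℝ) : Continuous (L.N t) :=
  L.cN.comp (by fun_prop : Continuous fun x : ℝ => (t, x))

/-- Passage to the limit in integrals against continuous functions of the mass coordinate. -/
theorem tendsto_integral_mul_comp_N {G : ℕ → ℝ → ℝ} {g : ℝ → ℝ} {K : ℝ≥0}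
    (hGm : ∀ n, AEStronglyMeasurable (G n) torusMeasure)
    (hGK : ∀ n, eLpNorm (G n) 2 torusMeasure ≤ K)
    (hw : ∀ ψ, MemLp ψ 2 torusMeasure →
      Tendsto (fun n => ∫ x, G n x * ψ x ∂torusMeasure) atTop (𝓝 (∫ x, g x * ψ x ∂torusMeasure)))
    {h : ℝ → ℝ} (hc : Continuous h) {H : ℝ} (hH : ∀ y, |h y| ≤ H) {t : ℝ} (ht : 0 ≤ t) :
    Tendsto (fun n => ∫ x, G n x * h ((F n).nlagr t x) ∂torusMeasure) atTop
      (𝓝 (∫ x, g x * h (L.N t x) ∂torusMeasure)) := by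
  refine tendsto_integral_mul_mul (B := H) hGm hGK hw (fun n => ?_)
    (fun n => Eventually.of_forall fun x => hH _)
    (Eventually.of_forall fun x => (hc.tendsto _).comp (L.tendsto_N ht x))
  exact (hc.comp ((F n).cnlagr.comp
    (by fun_prop : Continuous fun x : ℝ => (t, x)))).aestronglyMeasurable

theorem eLpNorm_two_density_le {t : ℝ} (ht : 0 ≤ t) (n : ℕ) :
    eLpNorm ((F n).ρ t) 2 torusMeasure ≤ (2 * potBound C).toNNReal :=
  (eLpNorm_le_eLpNorm_of_exponent_le le_top ((F n).cρ.cont_x t).aestronglyMeasurable).trans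
    (L.density_eLpNorm_le ht n)

/-- Reduction of the conservation laws to `C¹` functions of the mass coordinate. -/
theorem integral_mul_comp_N_eq {g g' : ℝ → ℝ} (hg : Integrable g torusMeasure)
    (hg' : Integrable g' torusMeasure) {s t : ℝ}
    (key : ∀ h h' : ℝ → ℝ, Function.Periodic h 1 → (∀ y, HasDerivAt h (h' y) y) → Continuous h' →
      ∫ x, g x * h (L.N t x) ∂torusMeasure = ∫ x, g' x * h (L.N s x) ∂torusMeasure)
    {h : ℝ → ℝ} (hc : Continuous h) (hp : Function.Periodic h 1) {H : ℝ} (hH : ∀ y, |h y| ≤ H) :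
    ∫ x, g x * h (L.N t x) ∂torusMeasure = ∫ x, g' x * h (L.N s x) ∂torusMeasure := by
  obtain ⟨a, a', ha1, ha2, ha3, ha4, ha5⟩ := exists_smooth_approx hc hp hH
  have hlim : ∀ {k : ℝ → ℝ}, Integrable k torusMeasure → ∀ τ, Tendsto
      (fun n => ∫ x, k x * a n (L.N τ x) ∂torusMeasure) atTop
      (𝓝 (∫ x, k x * h (L.N τ x) ∂torusMeasure)) := by
    intro k hk τ
    refine tendsto_integral_of_dominated_convergence (fun x => |k x| * H) (fun n => ?_)
      (hk.abs.mul_const H) (fun n => Eventually.of_forall fun x => ?_)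
      (Eventually.of_forall fun x => (ha5 _).const_mul _)
    · exact hk.1.mul ((continuous_iff_continuousAt.2 fun y =>
        (ha2 n y).continuousAt).comp (L.cN_slice τ)).aestronglyMeasurable
    · rw [norm_mul, Real.norm_eq_abs, Real.norm_eq_abs]
      exact mul_le_mul_of_nonneg_left (ha4 n _) (abs_nonneg _)
  refine tendsto_nhds_unique (hlim hg t) ((hlim hg' s).congr fun n => ?_)
  exact (key (a n) (a' n) (ha1 n) (ha2 n) (ha3 n)).symm

theorem integral_deriv_w_mul_comp_N_eq {s t : ℝ} (hs : 0 ≤ s) (hst : s ≤ t) {h : ℝ → ℝ}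
    (hc : Continuous h) (hp : Function.Periodic h 1) {H : ℝ} (hH : ∀ y, |h y| ≤ H) :
    ∫ x, deriv (L.w t) x * h (L.N t x) ∂torusMeasure
      = ∫ x, deriv (L.w s) x * h (L.N s x) ∂torusMeasure := by
  refine L.integral_mul_comp_N_eq ((L.h1Bounded_w t).memLp.integrable one_le_two)
    ((L.h1Bounded_w s).memLp.integrable one_le_two) (fun h h' hp hd hc' => ?_) hc hp hH
  have hc : Continuous h := continuous_iff_continuousAt.2 fun y => (hd y).continuousAt
  obtain ⟨B, hB⟩ := hp.exists_abs_le hc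
  have hlim := fun τ (hτ : 0 ≤ τ) => L.tendsto_integral_mul_comp_N
    (fun n => ((F n).cw₁.cont_x τ).aestronglyMeasurable) (L.w₁_eLpNorm_le hτ)
    (fun ψ hψ => L.tendsto_integral_w₁_mul hτ hψ) hc hB hτ
  refine tendsto_nhds_unique (hlim t (hs.trans hst)) ((hlim s hs).congr fun n => ?_)
  have e := ((F n).transported_slope.mul ((F n).transported_comp_nlagr hp hd hc')).integral_eq hs hst
  have e2 : ∀ τ x, (F n).ρ τ x * ((F n).w₁ τ x / (F n).ρ τ x * h ((F n).nlagr τ x))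
      = (F n).w₁ τ x * h ((F n).nlagr τ x) := fun τ x => by
    have := ((F n).pos τ x).ne'
    field_simp
  simp only [e2] at e
  rw [integral_torus, integral_torus, e]

theorem integral_ρ_mul_comp_N_eq {s t : ℝ} (hs : 0 ≤ s) (hst : s ≤ t) {h : ℝ → ℝ}
    (hc : Continuous h) (hp : Function.Periodic h 1) {H : ℝ} (hH : ∀ y, |h y| ≤ H) :
    ∫ x, L.ρ t x * h (L.N t x) ∂torusMeasure = ∫ x, L.ρ s x * h (L.N s x) ∂torusMeasure := by
  have hi : ∀ τ, Integrable (L.ρ τ) torusMeasure := fun τ =>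
    Integrable.of_bound (L.measurable_ρ_slice τ).aestronglyMeasurable 1
      (Eventually.of_forall fun x => L.abs_ρ_le τ x)
  refine L.integral_mul_comp_N_eq (hi t) (hi s) (fun h h' hp hd hc' => ?_) hc hp hH
  have hc : Continuous h := continuous_iff_continuousAt.2 fun y => (hd y).continuousAt
  obtain ⟨B, hB⟩ := hp.exists_abs_le hc
  have hlim := fun τ (hτ : 0 ≤ τ) => L.tendsto_integral_mul_comp_N
    (fun n => ((F n).cρ.cont_x τ).aestronglyMeasurable) (L.eLpNorm_two_density_le hτ)
    (fun ψ hψ => L.tendsto_integral_density_mul hτ (hψ.mono_exponent one_le_two)) hc hB hτ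
  refine tendsto_nhds_unique (hlim t (hs.trans hst)) ((hlim s hs).congr fun n => ?_)
  rw [integral_torus, integral_torus,
    ((F n).transported_comp_nlagr hp hd hc').integral_eq hs hst]

/-- The limit flow is Lipschitz in time in the Lagrangian description. -/
theorem abs_integral_comp_N_sub_le {s t : ℝ} (hs : 0 ≤ s) (hst : s ≤ t) {h : ℝ → ℝ}
    (hc : Continuous h) (hp : Function.Periodic h 1) {H : ℝ} (hH : ∀ y, |h y| ≤ H) :
    |(∫ x, h (L.N t x) ∂torusMeasure) - ∫ x, h (L.N s x) ∂torusMeasure|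
      ≤ H * (1 + 2 * potBound C * (C ^ 2 / r₀)) * (t - s) := by
  -- for `C¹` functions and positive times, the bound passes to the limit
  have h1 : ∀ h h' : ℝ → ℝ, Function.Periodic h 1 → (∀ y, HasDerivAt h (h' y) y) → Continuous h' →
      (∀ y, |h y| ≤ H) → ∀ s, 0 < s → s ≤ t →
      |(∫ x, h (L.N t x) ∂torusMeasure) - ∫ x, h (L.N s x) ∂torusMeasure|
        ≤ H * (1 + 2 * potBound C * (C ^ 2 / r₀)) * (t - s) := by
    intro h h' hp hd hc' hH s hs hst
    have hc : Continuous h := continuous_iff_continuousAt.2 fun y => (hd y).continuousAt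
    have hlim : ∀ τ, 0 ≤ τ → Tendsto (fun n => ∫ x, h ((F n).nlagr τ x) ∂torusMeasure) atTop
        (𝓝 (∫ x, h (L.N τ x) ∂torusMeasure)) := fun τ hτ => by
      have := L.tendsto_integral_mul_comp_N (G := fun _ _ => 1) (g := fun _ => 1) (K := 1)
        (fun n => aestronglyMeasurable_const) (fun n => (eLpNorm_le_of_ae_bound (C := 1)
          (Eventually.of_forall fun x => by simp)).trans (by simp))
        (fun ψ _ => tendsto_const_nhds) hc hH hτ
      simpa using this
    have hγ : Tendsto (fun n => 2 / (γ n * s)) atTop (𝓝 0) :=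
      tendsto_const_nhds.div_atTop (L.tendsto_γ.atTop_mul_const hs)
    have hr := ((hγ.add_const (1 + 2 * potBound C * (C ^ 2 / r₀))).const_mul H).mul_const (t - s)
    rw [zero_add] at hr
    refine le_of_tendsto_of_tendsto' ((hlim t (hs.le.trans hst)).sub (hlim s hs.le)).abs hr fun n => ?_
    rw [integral_torus, integral_torus]
    exact (F n).abs_integral_comp_nlagr_sub_le hp hd hc' hH
      (fun τ hτ => (L.bounded n).w₁_abs_le hτ) hs hst
  obtain ⟨a, a', ha1, ha2, ha3, ha4, ha5⟩ := exists_smooth_approx hc hp hH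
  have hlim : ∀ τ, Tendsto (fun n => ∫ x, a n (L.N τ x) ∂torusMeasure) atTop
      (𝓝 (∫ x, h (L.N τ x) ∂torusMeasure)) := fun τ =>
    tendsto_integral_of_dominated_convergence (fun _ => H)
      (fun n => ((continuous_iff_continuousAt.2 fun y => (ha2 n y).continuousAt).comp
        (L.cN_slice τ)).aestronglyMeasurable) (integrable_const _)
      (fun n => Eventually.of_forall fun x => ha4 n _) (Eventually.of_forall fun x => ha5 _)
  have h2 : ∀ s, 0 < s → s ≤ t →
      |(∫ x, h (L.N t x) ∂torusMeasure) - ∫ x, h (L.N s x) ∂torusMeasure|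
        ≤ H * (1 + 2 * potBound C * (C ^ 2 / r₀)) * (t - s) := fun s hs hst =>
    le_of_tendsto ((hlim t).sub (hlim s)).abs (Eventually.of_forall fun n =>
      h1 _ _ (ha1 n) (ha2 n) (ha3 n) (ha4 n) s hs hst)
  rcases hst.eq_or_lt with rfl | hst
  · simp
  -- the initial time is reached by continuity
  have hcont : Continuous fun s => ∫ x, h (L.N s x) ∂torusMeasure := by
    simp only [integral_torus]
    exact intervalIntegral.continuous_parametric_intervalIntegral_of_continuous'
      (f := fun s x => h (L.N s x)) (hc.comp L.cN) 0 1
  have hl : Tendsto (fun σ => |(∫ x, h (L.N t x) ∂torusMeasure) - ∫ x, h (L.N σ x) ∂torusMeasure|)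
      (𝓝[>] s) (𝓝 |(∫ x, h (L.N t x) ∂torusMeasure) - ∫ x, h (L.N s x) ∂torusMeasure|) :=
    (continuous_const.sub hcont).abs.continuousAt.mono_left nhdsWithin_le_nhds
  have hr : Tendsto (fun σ => H * (1 + 2 * potBound C * (C ^ 2 / r₀)) * (t - σ)) (𝓝[>] s)
      (𝓝 (H * (1 + 2 * potBound C * (C ^ 2 / r₀)) * (t - s))) :=
    (by fun_prop : Continuous fun σ => H * (1 + 2 * potBound C * (C ^ 2 / r₀)) *
      (t - σ)).continuousAt.mono_left nhdsWithin_le_nhds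
  refine le_of_tendsto_of_tendsto hl hr ?_
  filter_upwards [self_mem_nhdsWithin, mem_nhdsWithin_of_mem_nhds (gt_mem_nhds hst)] with σ h3 h4
  exact h2 σ (hs.trans_lt h3) (le_of_lt h4)

/-- Continuous periodic functions of `x` are continuous periodic functions of the mass
coordinate. -/
theorem exists_comp_N_eq {t : ℝ} (ht : 0 ≤ t) {k : ℝ → ℝ} (hk : Continuous k)
    (hp : Function.Periodic k 1) :
    ∃ h : ℝ → ℝ, Continuous h ∧ Function.Periodic h 1 ∧ ∀ x, h (L.N t x) = k x := by
  have hm := L.mass_pos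
  have hd := (L.bounded 0).densityBound_pos ht
  have hmono : StrictMono (L.N t) := fun x y hxy => by
    have := L.le_M_sub (T := t) ⟨ht, le_rfl⟩ hxy.le
    have h0 : 0 < densityBound C r₀ t * (y - x) := mul_pos hd (sub_pos.2 hxy)
    exact div_lt_div_of_pos_right (by linarith) hm
  have hint : ∀ j : ℤ, L.N t j = L.N t 0 + j := by
    intro j
    induction j using Int.induction_on with
    | zero => simp
    | succ i ih => push_cast at ih ⊢; rw [L.N_add_one, ih]; ring
    | pred i ih =>
      push_cast at ih ⊢
      have := L.N_add_one t (-(i : ℝ) - 1)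
      rw [sub_add_cancel, ih] at this
      linarith
  have hsurj : Function.Surjective (L.N t) := by
    refine (L.cN_slice t).surjective ?_ ?_
    · refine tendsto_atTop_atTop_of_monotone hmono.monotone fun b => ?_
      obtain ⟨j, hj⟩ := exists_int_ge (b - L.N t 0)
      exact ⟨j, by rw [hint]; linarith⟩
    · refine tendsto_atBot_atBot_of_monotone hmono.monotone fun b => ?_
      obtain ⟨j, hj⟩ := exists_int_le (b - L.N t 0)
      exact ⟨j, by rw [hint]; linarith⟩
  set e := hmono.orderIsoOfSurjective _ hsurj with he
  have hes : ∀ x, e.symm (L.N t x) = x := fun x => e.symm_apply_apply x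
  refine ⟨fun y => k (e.symm y), hk.comp e.symm.continuous, fun y => ?_, fun x => by simp only [hes]⟩
  obtain ⟨x, rfl⟩ := hsurj y
  simp only
  rw [← L.N_add_one, hes, hes, hp]

end FlowLimit

namespace FlowLimit

variable {γ : ℕ → ℝ} {F : ∀ n, SmoothFlow (γ n)} {C r₀ m : ℝ} (L : FlowLimit F C r₀ m)

include L

/-- The Dirichlet energy at time `t` exceeds that at time `s` by at most a term that is small for
large `Λ`, and a term that is small for small `|t - s|`. -/
theorem energy_le {s t T Λ : ℝ} (hs : s ∈ Icc 0 T) (ht : t ∈ Icc 0 T) (hΛ : 0 ≤ Λ) :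
    ∫ x, deriv (L.w t) x ^ 2 ∂torusMeasure ≤ (∫ x, deriv (L.w s) x ^ 2 ∂torusMeasure)
      + (∫ x, (max (|deriv (L.w s) x| - densityBound C r₀ T * Λ) 0) ^ 2 ∂torusMeasure)
        / densityBound C r₀ T + Λ ^ 2 * (1 + 2 * potBound C * (C ^ 2 / r₀)) * |t - s| := by
  have hc := (L.bounded 0).densityBound_pos (hs.1.trans hs.2)
  set c := densityBound C r₀ T
  refine le_of_forall_pos_le_add fun ε hε => ?_
  obtain ⟨k, hkc, hkp, hk⟩ := (L.h1Bounded_w t).exists_energy_le hε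
  obtain ⟨h, hhc, hhp, hhk⟩ := L.exists_comp_N_eq ht.1 hkc hkp
  obtain ⟨B, hB⟩ := hhp.exists_abs_le hhc
  simp only [← hhk] at hk
  -- `h` truncated at height `Λ`, and the excess of its square
  set hΛ' : ℝ → ℝ := fun y => max (-Λ) (min Λ (h y)) with hΛdef
  have ctr : Continuous hΛ' := by fun_prop
  have ptr : Function.Periodic hΛ' 1 := fun y => by simp only [hΛdef, hhp y]
  have btr : ∀ y, |hΛ' y| ≤ Λ := fun y =>
    abs_le.2 ⟨le_max_left _ _, max_le (by linarith) (min_le_left _ _)⟩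
  have btr2 : ∀ y, |hΛ' y ^ 2| ≤ Λ ^ 2 := fun y => by
    rw [abs_pow]; exact pow_le_pow_left₀ (abs_nonneg _) (btr y) 2
  have csq : Continuous fun y => h y ^ 2 - hΛ' y ^ 2 := by fun_prop
  have psq : Function.Periodic (fun y => h y ^ 2 - hΛ' y ^ 2) 1 := fun y => by
    simp only [hhp y, ptr y]
  obtain ⟨B', hB'⟩ := psq.exists_abs_le csq
  have nsq : ∀ y, 0 ≤ h y ^ 2 - hΛ' y ^ 2 := fun y => by
    have h1 : |hΛ' y| ≤ |h y| := by
      simp only [hΛdef]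
      rcases le_total (h y) Λ with h1 | h1
      · rcases le_total (-Λ) (h y) with h2 | h2
        · rw [min_eq_right h1, max_eq_right h2]
        · rw [min_eq_right h1, max_eq_left h2, abs_neg, abs_of_nonneg hΛ, abs_of_nonpos (by linarith)]
          linarith
      · rw [min_eq_left h1, max_eq_right (by linarith), abs_of_nonneg hΛ, abs_of_nonneg (by linarith)]
        exact h1
    exact sub_nonneg.2 (sq_le_sq.2 h1)
  have conserved : ∀ {g : ℝ → ℝ → ℝ}, (∀ a b, 0 ≤ a → a ≤ b → ∀ {h : ℝ → ℝ}, Continuous h →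
      Function.Periodic h 1 → ∀ {H : ℝ}, (∀ y, |h y| ≤ H) →
      ∫ x, g b x * h (L.N b x) ∂torusMeasure = ∫ x, g a x * h (L.N a x) ∂torusMeasure) →
      ∀ {h : ℝ → ℝ}, Continuous h → Function.Periodic h 1 → ∀ {H : ℝ}, (∀ y, |h y| ≤ H) →
      ∫ x, g t x * h (L.N t x) ∂torusMeasure = ∫ x, g s x * h (L.N s x) ∂torusMeasure := by
    intro g hg h h1 h2 H h3
    rcases le_total s t with hst | hst
    · exact hg s t hs.1 hst h1 h2 h3
    · exact (hg t s ht.1 hst h1 h2 h3).symm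
  have e1 := conserved (g := fun t => deriv (L.w t))
    (fun a b ha hab => L.integral_deriv_w_mul_comp_N_eq ha hab) hhc hhp hB
  have e2 := conserved (g := L.ρ) (fun a b ha hab => L.integral_ρ_mul_comp_N_eq ha hab) csq psq hB'
  have e3 : |(∫ x, hΛ' (L.N t x) ^ 2 ∂torusMeasure) - ∫ x, hΛ' (L.N s x) ^ 2 ∂torusMeasure|
      ≤ Λ ^ 2 * (1 + 2 * potBound C * (C ^ 2 / r₀)) * |t - s| := by
    have hc2 : Continuous fun y => hΛ' y ^ 2 := ctr.pow 2
    have hp2 : Function.Periodic (fun y => hΛ' y ^ 2) 1 := fun y => by simp only [ptr y]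
    rcases le_total s t with hst | hst
    · rw [abs_of_nonneg (sub_nonneg.2 hst)]
      exact L.abs_integral_comp_N_sub_le hs.1 hst hc2 hp2 btr2
    · rw [abs_sub_comm, abs_sub_comm t s, abs_of_nonneg (sub_nonneg.2 hst)]
      exact L.abs_integral_comp_N_sub_le ht.1 hst hc2 hp2 btr2
  have ci : ∀ {q : ℝ → ℝ}, Continuous q → ∀ τ, Integrable (fun x => q (L.N τ x)) torusMeasure :=
    fun hq τ => integrable_torus_of_continuous (hq.comp (L.cN_slice τ))
  have hρi : ∀ τ, Integrable (fun x => L.ρ τ x * (h (L.N τ x) ^ 2 - hΛ' (L.N τ x) ^ 2))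
      torusMeasure := fun τ => (ci csq τ).bdd_mul (c := 1)
        (L.measurable_ρ_slice τ).aestronglyMeasurable (Eventually.of_forall fun x => L.abs_ρ_le τ x)
  -- the excess at time `t` dominates the fraction `c` of the excess at time `s`
  have e4 : c * ∫ x, (h (L.N s x) ^ 2 - hΛ' (L.N s x) ^ 2) ∂torusMeasure
      ≤ ∫ x, (h (L.N t x) ^ 2 - hΛ' (L.N t x) ^ 2) ∂torusMeasure := by
    calc c * ∫ x, (h (L.N s x) ^ 2 - hΛ' (L.N s x) ^ 2) ∂torusMeasure
        ≤ ∫ x, L.ρ s x * (h (L.N s x) ^ 2 - hΛ' (L.N s x) ^ 2) ∂torusMeasure := by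
          rw [← integral_const_mul]
          refine integral_mono_ae ((ci csq s).const_mul c) (hρi s) ?_
          filter_upwards [ae_restrict_of_ae (L.le_ρ hs)] with x hx
          exact mul_le_mul_of_nonneg_right hx (nsq _)
      _ = ∫ x, L.ρ t x * (h (L.N t x) ^ 2 - hΛ' (L.N t x) ^ 2) ∂torusMeasure := e2.symm
      _ ≤ ∫ x, (h (L.N t x) ^ 2 - hΛ' (L.N t x) ^ 2) ∂torusMeasure := by
          refine integral_mono (hρi t) (ci csq t) fun x => ?_
          exact mul_le_of_le_one_left (nsq _) (L.ρ_le_one t x)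
  have e5 : ∫ x, h (L.N t x) ^ 2 ∂torusMeasure = (∫ x, hΛ' (L.N t x) ^ 2 ∂torusMeasure)
      + ∫ x, (h (L.N t x) ^ 2 - hΛ' (L.N t x) ^ 2) ∂torusMeasure := by
    have i0 : Integrable (fun x => hΛ' (L.N t x) ^ 2) torusMeasure := ci (ctr.pow 2) t
    rw [← integral_add i0 (ci csq t)]
    refine integral_congr_ae (Eventually.of_forall fun x => ?_)
    simp
  have hwL := (L.h1Bounded_w s).memLp
  have i1 : Integrable (fun x => deriv (L.w s) x * h (L.N s x)) torusMeasure :=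
    (hwL.integrable one_le_two).mul_bdd (c := B) (hhc.comp (L.cN_slice s)).aestronglyMeasurable
      (Eventually.of_forall fun x => hB _)
  have i2 : Integrable (fun x => (max (|deriv (L.w s) x| - c * Λ) 0) ^ 2) torusMeasure := by
    refine hwL.integrable_sq.mono' (by
      have := (measurable_deriv (L.w s)).abs
      exact (((this.sub_const _).max measurable_const).pow_const 2).aestronglyMeasurable)
      (Eventually.of_forall fun x => ?_)
    rw [Real.norm_of_nonneg (sq_nonneg _), ← sq_abs (deriv (L.w s) x)]
    have : max (|deriv (L.w s) x| - c * Λ) 0 ≤ |deriv (L.w s) x| :=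
      max_le (by have := mul_nonneg hc.le hΛ; linarith) (abs_nonneg _)
    gcongr
  -- the pointwise inequality at time `s`, integrated
  have e6 : 2 * (∫ x, deriv (L.w s) x * h (L.N s x) ∂torusMeasure)
      - (∫ x, hΛ' (L.N s x) ^ 2 ∂torusMeasure)
      - c * (∫ x, (h (L.N s x) ^ 2 - hΛ' (L.N s x) ^ 2) ∂torusMeasure)
      ≤ (∫ x, deriv (L.w s) x ^ 2 ∂torusMeasure)
        + (∫ x, (max (|deriv (L.w s) x| - c * Λ) 0) ^ 2 ∂torusMeasure) / c := by
    have i3 : Integrable (fun x => hΛ' (L.N s x) ^ 2) torusMeasure := ci (ctr.pow 2) s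
    have i4 : Integrable (fun x => 2 * (deriv (L.w s) x * h (L.N s x)) - hΛ' (L.N s x) ^ 2)
        torusMeasure := (i1.const_mul 2).sub i3
    rw [← integral_const_mul, ← integral_const_mul, ← integral_div,
      ← integral_sub (i1.const_mul 2) i3, ← integral_sub i4 ((ci csq s).const_mul c),
      ← integral_add hwL.integrable_sq (i2.div_const c)]
    refine integral_mono (i4.sub ((ci csq s).const_mul c))
      (hwL.integrable_sq.add (i2.div_const c)) fun x => ?_
    exact two_mul_mul_sub_le hΛ hc
  have := (abs_le.1 e3).1
  linarith

/-- The slope of the limit is continuous in time with values in `L²(𝕋)`: the weak continuity is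
supplemented by the upper semicontinuity of the energy. -/
theorem tendsto_eLpNorm_deriv_w {T t₀ : ℝ} (ht₀ : t₀ ∈ Icc 0 T) :
    Tendsto (fun t => eLpNorm (fun x => deriv (L.w t) x - deriv (L.w t₀) x) 2 torusMeasure)
      (𝓝[Icc 0 T] t₀) (𝓝 0) := by
  have hc := (L.bounded 0).densityBound_pos (ht₀.1.trans ht₀.2)
  set c := densityBound C r₀ T
  have hr := L.r₀_pos
  have hB := two_le_potBound C
  set A := 1 + 2 * potBound C * (C ^ 2 / r₀)
  have hA : 0 ≤ A := by positivity
  have hwL := fun t => (L.h1Bounded_w t).memLp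
  set E : ℝ → ℝ := fun t => ∫ x, deriv (L.w t) x ^ 2 ∂torusMeasure with hE
  have htail : Tendsto (fun Λ : ℕ => (∫ x, (max (|deriv (L.w t₀) x| - c * Λ) 0) ^ 2 ∂torusMeasure) / c)
      atTop (𝓝 0) := by
    have h1 : Tendsto (fun Λ : ℕ => ∫ x, (max (|deriv (L.w t₀) x| - c * Λ) 0) ^ 2 ∂torusMeasure)
        atTop (𝓝 (∫ _, (0 : ℝ) ∂torusMeasure)) := by
      refine tendsto_integral_of_dominated_convergence (fun x => deriv (L.w t₀) x ^ 2)
        (fun n => ?_) (hwL t₀).integrable_sq (fun n => Eventually.of_forall fun x => ?_)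
        (Eventually.of_forall fun x => ?_)
      · exact ((((measurable_deriv (L.w t₀)).abs.sub_const _).max
          measurable_const).pow_const 2).aestronglyMeasurable
      · rw [Real.norm_of_nonneg (sq_nonneg _), ← sq_abs (deriv (L.w t₀) x)]
        have : max (|deriv (L.w t₀) x| - c * n) 0 ≤ |deriv (L.w t₀) x| :=
          max_le (by have : 0 ≤ c * (n : ℝ) := by positivity
                     linarith) (abs_nonneg _)
        gcongr
      · obtain ⟨n₀, hn₀⟩ := exists_nat_ge (|deriv (L.w t₀) x| / c)
        refine tendsto_const_nhds.congr' ?_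
        filter_upwards [eventually_ge_atTop n₀] with n hn
        have h2 : |deriv (L.w t₀) x| / c ≤ n := hn₀.trans (by exact_mod_cast hn)
        rw [div_le_iff₀ hc] at h2
        rw [max_eq_right (by linarith)]
        simp
    rw [integral_zero] at h1
    simpa using h1.div_const c
  have hlim : Tendsto (fun t => ∫ x, (deriv (L.w t) x - deriv (L.w t₀) x) ^ 2 ∂torusMeasure)
      (𝓝[Icc 0 T] t₀) (𝓝 0) := by
    rw [Metric.tendsto_nhds]
    intro ε hε
    obtain ⟨Λ, hΛ⟩ := (htail.eventually_lt_const (show 0 < ε / 3 by positivity)).exists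
    have h2 : Tendsto (fun t => (Λ : ℝ) ^ 2 * A * |t - t₀|) (𝓝[Icc 0 T] t₀) (𝓝 0) := by
      have : Continuous fun t => (Λ : ℝ) ^ 2 * A * |t - t₀| := by fun_prop
      have h := this.tendsto t₀
      simp only [sub_self, abs_zero, mul_zero] at h
      exact h.mono_left nhdsWithin_le_nhds
    have h3 : Tendsto (fun t => ∫ x, deriv (L.w t) x * deriv (L.w t₀) x ∂torusMeasure)
        (𝓝[Icc 0 T] t₀) (𝓝 (E t₀)) := by
      have h := (L.continuous_integral_deriv_w_mul (hwL t₀)).tendsto t₀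
      simp only [← pow_two] at h
      exact h.mono_left nhdsWithin_le_nhds
    filter_upwards [h2.eventually_lt_const (show 0 < ε / 3 by positivity),
      h3.eventually_const_lt (u := E t₀ - ε / 6) (by linarith), self_mem_nhdsWithin] with t h4 h5 h6
    have h7 := L.energy_le ht₀ h6 (Nat.cast_nonneg Λ)
    have i1 := (hwL t).integrable_sq
    have i2 := (hwL t₀).integrable_sq
    have i3 : Integrable (fun x => deriv (L.w t) x * deriv (L.w t₀) x) torusMeasure :=
      (hwL t).integrable_mul (hwL t₀)
    have e : ∫ x, (deriv (L.w t) x - deriv (L.w t₀) x) ^ 2 ∂torusMeasure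
        = E t - 2 * (∫ x, deriv (L.w t) x * deriv (L.w t₀) x ∂torusMeasure) + E t₀ := by
      have i4 : Integrable (fun x => deriv (L.w t) x ^ 2
          - 2 * (deriv (L.w t) x * deriv (L.w t₀) x)) torusMeasure := i1.sub (i3.const_mul 2)
      simp only [hE]
      rw [← integral_const_mul, ← integral_sub i1 (i3.const_mul 2), ← integral_add i4 i2]
      refine integral_congr_ae (Eventually.of_forall fun x => ?_)
      simp only
      ring
    rw [Real.dist_eq, sub_zero, abs_of_nonneg (integral_nonneg fun x => sq_nonneg _), e]
    change E t ≤ E t₀ + _ + _ at h7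
    linarith
  have h1 : Tendsto (fun t => ENNReal.ofReal
      (√(∫ x, (deriv (L.w t) x - deriv (L.w t₀) x) ^ 2 ∂torusMeasure))) (𝓝[Icc 0 T] t₀) (𝓝 0) := by
    have := ENNReal.tendsto_ofReal hlim.sqrt
    rwa [Real.sqrt_zero, ENNReal.ofReal_zero] at this
  refine h1.congr fun t => ?_
  have hm : MemLp (fun x => deriv (L.w t) x - deriv (L.w t₀) x) 2 torusMeasure :=
    (hwL t).sub (hwL t₀)
  rw [hm.eLpNorm_eq_integral_rpow_norm (by simp) (by simp)]
  simp [Real.sqrt_eq_rpow]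

/-- The limit velocity is continuous in time with values in `H¹(𝕋)`. -/
theorem contSobolev_w (T : ℝ) : ContSobolev 1 T L.w := by
  refine ⟨fun t _ => (L.h1Bounded_w t).per, fun j t => if j = 0 then L.w t else deriv (L.w t),
    fun t _ => ⟨by simp, fun j hj => ?_, fun j hj => ?_⟩, fun j hj t₀ ht₀ => ?_⟩
  · simp only
    split_ifs
    · exact memLp_torus_of_continuous (L.h1Bounded_w t).continuous 2
    · exact (L.h1Bounded_w t).memLp
  · obtain rfl : j = 0 := by omega
    simpa using (L.h1Bounded_w t).isWeakDeriv
  · rcases Nat.le_one_iff_eq_zero_or_eq_one.1 hj with rfl | rfl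
    · simp only [if_true]
      -- uniform continuity on the compact set `[0,T] × [0,1]`
      have h1 : Tendsto (fun t => ∫ x in (0 : ℝ)..1, (L.w t x - L.w t₀ x) ^ 2) (𝓝 t₀)
          (𝓝 (∫ x in (0 : ℝ)..1, (L.w t₀ x - L.w t₀ x) ^ 2)) := by
        refine Continuous.tendsto (intervalIntegral.continuous_parametric_intervalIntegral_of_continuous'
          (f := fun t x => (L.w t x - L.w t₀ x) ^ 2) ?_ 0 1) t₀
        exact ((L.cw.sub (L.cw.comp (by fun_prop : Continuous fun z : ℝ × ℝ => (t₀, z.2)))).pow 2)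
      simp only [sub_self, ne_eq, OfNat.ofNat_ne_zero, not_false_eq_true, zero_pow,
        intervalIntegral.integral_zero] at h1
      have h2 := ENNReal.tendsto_ofReal h1.sqrt
      rw [Real.sqrt_zero, ENNReal.ofReal_zero] at h2
      refine (h2.mono_left nhdsWithin_le_nhds).congr fun t => ?_
      have hm : MemLp (fun x => L.w t x - L.w t₀ x) 2 torusMeasure :=
        memLp_torus_of_continuous ((L.h1Bounded_w t).continuous.sub (L.h1Bounded_w t₀).continuous) 2
      rw [hm.eLpNorm_eq_integral_rpow_norm (by simp) (by simp), ← integral_torus]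
      simp [Real.sqrt_eq_rpow]
    · simpa using L.tendsto_eLpNorm_deriv_w ht₀

end FlowLimit

/-! ### The limit potential -/

/-- A map that is approximated uniformly by convergent ones converges. -/
theorem exists_tendsto_of_approx {α : Type*} {l : Filter α} [l.NeBot] {f : α → ℝ}
    (h : ∀ ε > 0, ∃ (g : α → ℝ) (a : ℝ), Tendsto g l (𝓝 a) ∧ ∀ᶠ z in l, |f z - g z| ≤ ε) :
    ∃ a, Tendsto f l (𝓝 a) := by
  refine cauchy_map_iff_exists_tendsto.1 (Metric.cauchy_iff.2 ⟨inferInstance, fun ε hε => ?_⟩)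
  obtain ⟨g, a, hg, hfg⟩ := h (ε / 5) (by positivity)
  have h1 := (Metric.tendsto_nhds.1 hg (ε / 5) (by positivity)).and hfg
  refine ⟨f '' {z | dist (g z) a < ε / 5 ∧ |f z - g z| ≤ ε / 5}, image_mem_map h1, ?_⟩
  rintro _ ⟨y, ⟨hy, hy'⟩, rfl⟩ _ ⟨z, ⟨hz, hz'⟩, rfl⟩
  rw [Real.dist_eq, abs_lt] at *
  rw [abs_le] at hy' hz'
  constructor <;> linarith

/-- The averages in time of the potential are bounded in `H¹(𝕋)`. -/
theorem SmoothFlow.Bounded.h1Bounded_cumPot_sub {γ C r₀ m : ℝ} {F : SmoothFlow γ}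
    (h : F.Bounded C r₀ m) {s t : ℝ} (hs : 0 ≤ s) (hst : s < t) :
    H1Bounded (h1Bound C r₀) fun x => (F.cumPot t x - F.cumPot s x) / (t - s) := by
  have hts := sub_pos.2 hst
  have hc : Continuous fun x => ∫ τ in s..t, F.pot₁ τ x :=
    intervalIntegral.continuous_parametric_intervalIntegral_of_continuous'
      (f := fun x τ => F.pot₁ τ x)
      (F.cpot₁.cont.comp (by fun_prop : Continuous fun z : ℝ × ℝ => (z.2, z.1))) s t
  have hd : ∀ x, HasDerivAt (fun x => F.cumPot t x - F.cumPot s x) (∫ τ in s..t, F.pot₁ τ x) x := by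
    intro x
    have e : (fun x => F.cumPot t x - F.cumPot s x)
        = fun x => (∫ y in (0 : ℝ)..x, ∫ τ in s..t, F.pot₁ τ y) + ∫ τ in s..t, F.pot τ 0 := by
      funext x
      rw [F.cumPot_sub, integral_integral_swap_continuous F.cpot₁.cont]
      have : ∀ τ, ∫ y in (0 : ℝ)..x, F.pot₁ τ y = F.pot τ x - F.pot τ 0 := fun τ =>
        intervalIntegral.integral_eq_sub_of_hasDerivAt (fun z _ => F.xpot τ z) (F.cpot₁.ii τ 0 x)
      simp only [this]
      rw [intervalIntegral.integral_sub ((F.cpot.cont_t x).intervalIntegrable _ _)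
        ((F.cpot.cont_t 0).intervalIntegrable _ _)]
      ring
    rw [e]
    exact (intervalIntegral.integral_hasDerivAt_right (hc.intervalIntegrable _ _)
      (hc.stronglyMeasurableAtFilter _ _) hc.continuousAt).add_const _
  refine .of_hasDerivAt (fun x => ?_) (fun x => (hd x).div_const (t - s)) (hc.div_const _) ?_
  · simp only [SmoothFlow.cumPot, F.cpot.per _ x]
  have hsq : Continuous fun z : ℝ × ℝ => F.pot₁ z.1 z.2 ^ 2 := F.cpot₁.cont.pow 2
  have hc2 : Continuous fun x => ∫ τ in s..t, F.pot₁ τ x ^ 2 :=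
    intervalIntegral.continuous_parametric_intervalIntegral_of_continuous'
      (f := fun x τ => F.pot₁ τ x ^ 2)
      (hsq.comp (by fun_prop : Continuous fun z : ℝ × ℝ => (z.2, z.1))) s t
  have h1 : ∀ x, ((∫ τ in s..t, F.pot₁ τ x) / (t - s)) ^ 2
      ≤ (t - s)⁻¹ * ∫ τ in s..t, F.pot₁ τ x ^ 2 := by
    intro x
    have := sq_integral_le hst.le ((F.cpot₁.cont_t x).intervalIntegrable s t)
      (((F.cpot₁.cont_t x).pow 2).intervalIntegrable s t)
    rw [div_pow, inv_mul_eq_div, div_le_div_iff₀ (by positivity) hts]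
    nlinarith
  calc ∫ x in (0 : ℝ)..1, ((∫ τ in s..t, F.pot₁ τ x) / (t - s)) ^ 2
      ≤ ∫ x in (0 : ℝ)..1, (t - s)⁻¹ * ∫ τ in s..t, F.pot₁ τ x ^ 2 :=
        intervalIntegral.integral_mono_on zero_le_one
          (((hc.div_const _).pow 2).intervalIntegrable _ _)
          ((hc2.const_mul _).intervalIntegrable _ _) fun x _ => h1 x
    _ = (t - s)⁻¹ * ∫ τ in s..t, ∫ x in (0 : ℝ)..1, F.pot₁ τ x ^ 2 := by
        rw [intervalIntegral.integral_const_mul, integral_integral_swap_continuous hsq]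
    _ ≤ (t - s)⁻¹ * ∫ τ in s..t, (h1Bound C r₀ : ℝ) ^ 2 := by
        refine mul_le_mul_of_nonneg_left ?_ (by positivity)
        refine intervalIntegral.integral_mono_on hst.le
          ((intervalIntegral.continuous_parametric_intervalIntegral_of_continuous' hsq
            0 1).intervalIntegrable _ _) (by simp) fun τ hτ => ?_
        have := (h.h1Bounded_pot (hs.trans hτ.1)).integral_sq_le
        rwa [show deriv (F.pot τ) = F.pot₁ τ from funext fun x => (F.xpot τ x).deriv] at this
    _ = (h1Bound C r₀ : ℝ) ^ 2 := by
        rw [intervalIntegral.integral_const, smul_eq_mul, inv_mul_cancel_left₀ hts.ne']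

/-- A common bound in `L^∞(0,T; H¹(𝕋))` for the velocities and the potentials. -/
noncomputable def linftyBound (C r₀ T : ℝ) : ℝ≥0 :=
  h1Bound C r₀ + (2 + C ^ 2 / densityBound C r₀ T + 2 * potBound C * (C ^ 2 / r₀)).toNNReal
    + (potBound C).toNNReal

theorem le_linftyBound (C r₀ T : ℝ) : h1Bound C r₀ ≤ linftyBound C r₀ T ∧
    2 + C ^ 2 / densityBound C r₀ T + 2 * potBound C * (C ^ 2 / r₀) ≤ linftyBound C r₀ T ∧
    potBound C ≤ linftyBound C r₀ T := by
  have h1 := Real.le_coe_toNNReal (potBound C)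
  have h2 := Real.le_coe_toNNReal
    (2 + C ^ 2 / densityBound C r₀ T + 2 * potBound C * (C ^ 2 / r₀))
  have h3 : 0 ≤ (h1Bound C r₀ : ℝ) := NNReal.coe_nonneg _
  have h4 := NNReal.coe_nonneg (potBound C).toNNReal
  have h5 := NNReal.coe_nonneg
    (2 + C ^ 2 / densityBound C r₀ T + 2 * potBound C * (C ^ 2 / r₀)).toNNReal
  unfold linftyBound
  refine ⟨?_, ?_, ?_⟩
  · rw [add_assoc]; exact le_self_add
  · push_cast; linarith
  · push_cast; linarith

theorem SmoothFlow.Bounded.linftyH1_pot {γ C r₀ m : ℝ} {F : SmoothFlow γ}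
    (h : F.Bounded C r₀ m) (T : ℝ) : LinftyH1 (linftyBound C r₀ T) T F.pot F.pot₁ where
  meas := F.cpot.cont.measurable
  meas' := F.cpot₁.cont.measurable
  bound := by
    filter_upwards [ae_restrict_mem measurableSet_Ioc] with t ht x
    rw [abs_of_pos (F.pot_pos t x)]
    exact (h.pot_le ht.1.le x).trans (le_linftyBound C r₀ T).2.2
  h1 := by
    filter_upwards [ae_restrict_mem measurableSet_Ioc] with t ht
    exact (h.h1Bounded_pot ht.1.le).mono (le_linftyBound C r₀ T).1
  deriv_eq := Eventually.of_forall fun t => .of_forall fun x => (F.xpot t x).deriv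

theorem SmoothFlow.Bounded.linftyH1_w {γ C r₀ m : ℝ} {F : SmoothFlow γ}
    (h : F.Bounded C r₀ m) (T : ℝ) : LinftyH1 (linftyBound C r₀ T) T F.w F.w₁ where
  meas := F.cw.cont.measurable
  meas' := F.cw₁.cont.measurable
  bound := by
    filter_upwards [ae_restrict_mem measurableSet_Ioc] with t ht x
    exact (h.w_abs_le (Ioc_subset_Icc_self ht) x).trans (le_linftyBound C r₀ T).2.1
  h1 := by
    filter_upwards [ae_restrict_mem measurableSet_Ioc] with t ht
    exact (h.h1Bounded_w ht.1.le).mono (le_linftyBound C r₀ T).1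
  deriv_eq := Eventually.of_forall fun t => .of_forall fun x => (F.xw t x).deriv

namespace FlowLimit

variable {γ : ℕ → ℝ} {F : ∀ n, SmoothFlow (γ n)} {C r₀ m : ℝ} (L : FlowLimit F C r₀ m)

include L

theorem Q_sub_nonneg {s t : ℝ} (hst : s ≤ t) (x : ℝ) : 0 ≤ L.Q t x - L.Q s x := by
  refine ge_of_tendsto ((L.lim_Q t x).sub (L.lim_Q s x)) (Eventually.of_forall fun n => ?_)
  rw [(F n).cumPot_sub]
  exact intervalIntegral.integral_nonneg (max_le_max_right 0 hst) fun τ _ => ((F n).pot_pos τ x).le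

theorem Q_sub_le {s t : ℝ} (hst : s ≤ t) (x : ℝ) : L.Q t x - L.Q s x ≤ potBound C * (t - s) := by
  have hB := two_le_potBound C
  refine le_of_tendsto ((L.lim_Q t x).sub (L.lim_Q s x)) (Eventually.of_forall fun n => ?_)
  refine (le_abs_self _).trans (((L.bounded n).cumPot_diff_le (le_max_right _ _)
    (max_le_max_right 0 hst) x).trans ?_)
  refine mul_le_mul_of_nonneg_left ?_ (by linarith)
  rcases le_total s 0 with h | h <;> rcases le_total t 0 with h' | h' <;>
    simp only [max_eq_left, max_eq_right, h, h'] <;> linarith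

theorem lipschitz_Q (x : ℝ) : LipschitzWith (potBound C).toNNReal fun t => L.Q t x := by
  have hB := two_le_potBound C
  refine LipschitzWith.of_dist_le_mul fun s t => ?_
  rw [Real.coe_toNNReal _ (by linarith), Real.dist_eq, Real.dist_eq]
  rcases le_total s t with h | h
  · rw [abs_sub_comm, abs_sub_comm s, abs_of_nonneg (L.Q_sub_nonneg h x),
      abs_of_nonneg (sub_nonneg.2 h)]
    exact L.Q_sub_le h x
  · rw [abs_of_nonneg (L.Q_sub_nonneg h x), abs_of_nonneg (sub_nonneg.2 h)]
    exact L.Q_sub_le h x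

theorem Q_zero (x : ℝ) : L.Q 0 x = 0 :=
  tendsto_nhds_unique (L.tendsto_Q le_rfl x) (by simp [SmoothFlow.cumPot])

theorem periodic_Q (t : ℝ) : Function.Periodic (L.Q t) 1 := fun x =>
  tendsto_nhds_unique ((L.lim_Q t (x + 1)).congr fun n => by
    simp only [SmoothFlow.cumPot, (F n).cpot.per _ x]) (L.lim_Q t x)

/-- The limit potential: the time derivative of the limit of the time integrals. -/
noncomputable def π (t x : ℝ) : ℝ := deriv (fun s => L.Q s x) t

theorem measurable_π : Measurable (Function.uncurry L.π) :=
  (measurable_deriv_with_param (f := fun x t => L.Q t x)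
    (L.cQ.comp (by fun_prop : Continuous fun z : ℝ × ℝ => (z.2, z.1)))).comp measurable_swap

theorem periodic_π (t : ℝ) : Function.Periodic (L.π t) 1 := fun x => by
  simp only [π, L.periodic_Q _ x]

theorem π_nonneg (t x : ℝ) : 0 ≤ L.π t x :=
  (show Monotone fun s => L.Q s x from fun _ _ h => sub_nonneg.1 (L.Q_sub_nonneg h x)).deriv_nonneg

theorem abs_π_le (t x : ℝ) : |L.π t x| ≤ potBound C := by
  have := norm_deriv_le_of_lipschitz (L.lipschitz_Q x) (x₀ := t)
  rwa [Real.coe_toNNReal _ (by linarith [two_le_potBound C])] at this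

theorem integral_π (s t x : ℝ) : ∫ τ in s..t, L.π τ x = L.Q t x - L.Q s x :=
  (L.lipschitz_Q x).lipschitzOnWith.absolutelyContinuousOnInterval.integral_deriv_eq_sub

theorem h1Bounded_slope_Q {s t : ℝ} (hs : 0 ≤ s) (ht : 0 ≤ t) (hst : s ≠ t) :
    H1Bounded (h1Bound C r₀) fun x => slope (fun τ => L.Q τ x) s t := by
  wlog h : s < t generalizing s t
  · have := this ht hs hst.symm (lt_of_le_of_ne (not_lt.1 h) hst.symm)
    simpa only [slope_comm] using this
  simp only [slope_def_field]
  exact .of_tendsto (fun n => (L.bounded n).h1Bounded_cumPot_sub hs h) fun x =>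
    ((L.tendsto_Q ht x).sub (L.tendsto_Q hs x)).div_const _

/-- At almost every time the time integral of the limit potential is differentiable in time at all
points simultaneously: this holds at the rational points, and the difference quotients are
equicontinuous in space. -/
theorem ae_hasDerivAt_Q : ∀ᵐ t, 0 < t → ∀ x, HasDerivAt (fun s => L.Q s x) (L.π t x) t := by
  have h : ∀ᵐ t, ∀ q : ℚ, DifferentiableAt ℝ (fun s => L.Q s q) t :=
    ae_all_iff.2 fun q => (L.lipschitz_Q q).ae_differentiableAt
  filter_upwards [h] with t hq ht x
  suffices h : ∃ a, Tendsto (fun s => slope (fun τ => L.Q τ x) t s) (𝓝[≠] t) (𝓝 a) by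
    obtain ⟨a, ha⟩ := h
    exact (hasDerivAt_iff_tendsto_slope.2 ha).differentiableAt.hasDerivAt
  refine exists_tendsto_of_approx fun ε hε => ?_
  have h1 : ∀ᶠ y in 𝓝 x, |x - y| < 1 ∧ h1Bound C r₀ * √|x - y| < ε := by
    refine ((by fun_prop : Continuous fun y : ℝ => |x - y|).continuousAt.eventually_lt
      continuousAt_const (by simp)).and ?_
    exact (by fun_prop : Continuous fun y : ℝ => h1Bound C r₀ * √|x - y|).continuousAt.eventually_lt
      continuousAt_const (by simpa using hε)
  obtain ⟨_, ⟨q, rfl⟩, h2, h3⟩ := Rat.isDenseEmbedding_coe_real.dense.inter_nhds_nonempty h1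
  refine ⟨_, _, hasDerivAt_iff_tendsto_slope.1 (hq q).hasDerivAt, ?_⟩
  have h4 : ∀ᶠ s in 𝓝[≠] t, 0 < s := (lt_mem_nhds ht).filter_mono nhdsWithin_le_nhds
  filter_upwards [h4, self_mem_nhdsWithin] with s hs hst
  exact ((L.h1Bounded_slope_Q ht.le hs.le (Ne.symm hst)).abs_sub_le h2.le).trans h3.le

theorem ae_h1Bounded_π : ∀ᵐ t, 0 < t → H1Bounded (h1Bound C r₀) (L.π t) := by
  filter_upwards [L.ae_hasDerivAt_Q] with t ht ht0
  have h1 : Tendsto (fun n : ℕ => t + 1 / ((n : ℝ) + 1)) atTop (𝓝[≠] t) := by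
    refine tendsto_nhdsWithin_iff.2 ⟨?_, Eventually.of_forall fun n => ?_⟩
    · simpa using tendsto_one_div_add_atTop_nhds_zero_nat.const_add t
    · have : 0 < 1 / ((n : ℝ) + 1) := by positivity
      exact (by linarith : t < t + 1 / ((n : ℝ) + 1)).ne'
  refine .of_tendsto (F := fun n x => slope (fun τ => L.Q τ x) t (t + 1 / ((n : ℝ) + 1)))
    (fun n => L.h1Bounded_slope_Q ht0.le (by positivity) ?_)
    fun x => (hasDerivAt_iff_tendsto_slope.1 (ht ht0 x)).comp h1
  have : 0 < 1 / ((n : ℝ) + 1) := by positivity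
  exact (by linarith : t < t + 1 / ((n : ℝ) + 1)).ne

/-- A jointly measurable version of the space derivative of the limit potential. -/
noncomputable def πx (t x : ℝ) : ℝ :=
  liminf (fun n : ℕ => slope (L.π t) x (x + 1 / ((n : ℝ) + 1))) atTop

theorem measurable_πx : Measurable (Function.uncurry L.πx) := by
  refine Measurable.liminf fun n => ?_
  simp only [slope_def_field]
  have h : Measurable fun z : ℝ × ℝ => L.π z.1 (z.2 + 1 / ((n : ℝ) + 1)) :=
    L.measurable_π.comp (by fun_prop : Measurable fun z : ℝ × ℝ => (z.1, z.2 + 1 / ((n : ℝ) + 1)))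
  exact (h.sub L.measurable_π).div (by fun_prop)

theorem πx_eq {t x : ℝ} (h : DifferentiableAt ℝ (L.π t) x) : L.πx t x = deriv (L.π t) x := by
  have h1 : Tendsto (fun n : ℕ => x + 1 / ((n : ℝ) + 1)) atTop (𝓝[≠] x) := by
    refine tendsto_nhdsWithin_iff.2 ⟨?_, Eventually.of_forall fun n => ?_⟩
    · simpa using tendsto_one_div_add_atTop_nhds_zero_nat.const_add x
    · have : 0 < 1 / ((n : ℝ) + 1) := by positivity
      exact (by linarith : x < x + 1 / ((n : ℝ) + 1)).ne'
  exact ((hasDerivAt_iff_tendsto_slope.1 h.hasDerivAt).comp h1).liminf_eq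

theorem linftyH1_π (T : ℝ) : LinftyH1 (linftyBound C r₀ T) T L.π L.πx where
  meas := L.measurable_π
  meas' := L.measurable_πx
  bound := Eventually.of_forall fun t x => (L.abs_π_le t x).trans (le_linftyBound C r₀ T).2.2
  h1 := by
    filter_upwards [ae_restrict_of_ae L.ae_h1Bounded_π, ae_restrict_mem measurableSet_Ioc]
      with t h ht using (h ht.1).mono (le_linftyBound C r₀ T).1
  deriv_eq := by
    filter_upwards [ae_restrict_of_ae L.ae_h1Bounded_π, ae_restrict_mem measurableSet_Ioc]
      with t h ht
    refine (ae_restrict_iff' measurableSet_Ioc).2 ?_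
    filter_upwards [((h ht.1).ac 0 1).ae_differentiableAt] with x hx hx'
    rw [L.πx_eq (hx (by rw [uIcc_of_le zero_le_one]; exact Ioc_subset_Icc_self hx'))]

theorem linftyH1_w (T : ℝ) :
    LinftyH1 (linftyBound C r₀ T) T L.w fun t x => deriv (L.w t) x where
  meas := L.cw.measurable
  meas' := measurable_deriv_with_param (f := fun t x => L.w t x) L.cw
  bound := by
    filter_upwards [ae_restrict_mem measurableSet_Ioc] with t ht x
    exact (L.w_abs_le (Ioc_subset_Icc_self ht) x).trans (le_linftyBound C r₀ T).2.1
  h1 := Eventually.of_forall fun t => (L.h1Bounded_w t).mono (le_linftyBound C r₀ T).1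
  deriv_eq := Eventually.of_forall fun t => ae_eq_refl _

theorem tendsto_pot {T : ℝ} (hT : 0 ≤ T) :
    TendstoWeakStarLinftyL2 T (fun n => (F n).pot) L.π ∧
    TendstoWeakStarLinftyL2 T (fun n => (F n).pot₁) L.πx := by
  refine LinftyH1.tendsto hT (fun n => (L.bounded n).linftyH1_pot T) (L.linftyH1_π T)
    fun t ht x => ?_
  rw [L.integral_π, L.Q_zero, sub_zero]
  exact L.tendsto_Q ht.1 x

theorem tendsto_w_linftyL2 {T : ℝ} (hT : 0 ≤ T) :
    TendstoWeakStarLinftyL2 T (fun n => (F n).w) L.w ∧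
    TendstoWeakStarLinftyL2 T (fun n => (F n).w₁) fun t x => deriv (L.w t) x := by
  refine LinftyH1.tendsto hT (fun n => (L.bounded n).linftyH1_w T) (L.linftyH1_w T)
    fun t ht x => ?_
  refine intervalIntegral.tendsto_integral_filter_of_dominated_convergence
    (fun _ => (linftyBound C r₀ T : ℝ))
    (Eventually.of_forall fun n => ((F n).cw.cont_t x).aestronglyMeasurable)
    (Eventually.of_forall fun n => Eventually.of_forall fun s hs => ?_) (by simp)
    (Eventually.of_forall fun s hs => ?_)
  · rw [uIoc_of_le ht.1] at hs
    exact ((L.bounded n).w_abs_le ⟨hs.1.le, hs.2.trans ht.2⟩ x).trans (le_linftyBound C r₀ T).2.1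
  · rw [uIoc_of_le ht.1] at hs
    exact L.tendsto_w hs.1.le x

end FlowLimit

/-! ### The limit system -/

theorem ae_cyl_mem (T : ℝ) : ∀ᵐ z ∂cylMeasure T, z.1 ∈ Ioc 0 T ∧ z.2 ∈ Ioc (0 : ℝ) 1 := by
  rw [cylMeasure, timeMeasure, torusMeasure, Measure.prod_restrict]
  exact ae_restrict_mem (measurableSet_Ioc.prod measurableSet_Ioc)

theorem integral_cyl {T : ℝ} (hT : 0 ≤ T) {f : ℝ × ℝ → ℝ} (hf : Integrable f (cylMeasure T)) :
    ∫ z, f z ∂cylMeasure T = ∫ s in (0 : ℝ)..T, ∫ x, f (s, x) ∂torusMeasure := by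
  rw [intervalIntegral.integral_of_le hT]
  exact integral_prod f hf

theorem memLp_cyl_of_continuous {f : ℝ × ℝ → ℝ} (hf : Continuous f) (p : ℝ≥0∞) (T : ℝ) :
    MemLp f p (cylMeasure T) := by
  obtain ⟨K, hK⟩ := (isCompact_Icc.prod isCompact_Icc).exists_bound_of_continuousOn
    (hf.continuousOn (s := Icc 0 T ×ˢ Icc 0 1))
  refine MemLp.of_bound hf.aestronglyMeasurable K ?_
  filter_upwards [ae_cyl_mem T] with z hz
  exact hK z ⟨Ioc_subset_Icc_self hz.1, Ioc_subset_Icc_self hz.2⟩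

theorem integrable_cyl_of_continuous {f : ℝ × ℝ → ℝ} (hf : Continuous f) (T : ℝ) :
    Integrable f (cylMeasure T) :=
  memLp_one_iff_integrable.1 (memLp_cyl_of_continuous hf 1 T)

/-- Square integrable functions on the cylinder belong to `L¹(0,T; L²(𝕋))`. -/
theorem lintegral_eLpNorm_slice_lt_top {T : ℝ} {ψ : ℝ × ℝ → ℝ} (hψ : MemLp ψ 2 (cylMeasure T)) :
    ∫⁻ t, eLpNorm (fun x => ψ (t, x)) 2 torusMeasure ∂timeMeasure T < ⊤ := by
  have h1 : ∫⁻ t, eLpNorm (fun x => ψ (t, x)) 2 torusMeasure ^ (2 : ℝ) ∂timeMeasure T < ⊤ := by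
    simp only [eLpNorm_two_sq]
    have := lintegral_prod (μ := timeMeasure T) (ν := torusMeasure) (fun z => ‖ψ z‖ₑ ^ (2 : ℝ))
      (hψ.1.enorm.pow_const _)
    rw [← this, ← cylMeasure, ← eLpNorm_two_sq]
    exact ENNReal.rpow_lt_top_of_nonneg (by norm_num) hψ.2.ne
  calc ∫⁻ t, eLpNorm (fun x => ψ (t, x)) 2 torusMeasure ∂timeMeasure T
      ≤ ∫⁻ t, (1 + eLpNorm (fun x => ψ (t, x)) 2 torusMeasure ^ (2 : ℝ)) ∂timeMeasure T := by
        refine lintegral_mono fun t => ?_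
        simp only
        generalize eLpNorm (fun x => ψ (t, x)) 2 torusMeasure = a
        rcases le_total a 1 with h | h
        · exact h.trans le_self_add
        · calc a = a ^ (1 : ℝ) := (ENNReal.rpow_one a).symm
            _ ≤ a ^ (2 : ℝ) := ENNReal.rpow_le_rpow_of_exponent_le h (by norm_num)
            _ ≤ _ := le_add_self
    _ = timeMeasure T univ
        + ∫⁻ t, eLpNorm (fun x => ψ (t, x)) 2 torusMeasure ^ (2 : ℝ) ∂timeMeasure T := by
        rw [lintegral_add_left measurable_const, lintegral_const, one_mul]
    _ < ⊤ := ENNReal.add_lt_top.2 ⟨measure_lt_top _ _, h1⟩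

theorem LinftyH1.integrable {K : ℝ≥0} {T : ℝ} {f f' : ℝ → ℝ → ℝ} (h : LinftyH1 K T f f') :
    Integrable (fun z : ℝ × ℝ => f z.1 z.2) (cylMeasure T) := by
  refine Integrable.of_bound h.meas.aestronglyMeasurable K ?_
  filter_upwards [Measure.quasiMeasurePreserving_fst.ae h.bound] with z hz using hz z.2

theorem LinftyH1.memLp_deriv {K : ℝ≥0} {T : ℝ} {f f' : ℝ → ℝ → ℝ} (h : LinftyH1 K T f f') :
    MemLp (fun z : ℝ × ℝ => f' z.1 z.2) 2 (cylMeasure T) :=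
  ⟨h.meas'.aestronglyMeasurable,
    (eLpNorm_cyl_le h.meas'.aestronglyMeasurable h.eLpNorm_deriv_le).trans_lt ENNReal.coe_lt_top⟩

namespace FlowLimit

variable {γ : ℕ → ℝ} {F : ∀ n, SmoothFlow (γ n)} {C r₀ m : ℝ} (L : FlowLimit F C r₀ m)

include L

theorem tendsto_cyl_density_mul {T B : ℝ} (hT : 0 ≤ T) {G : ℕ → ℝ × ℝ → ℝ} {g : ℝ × ℝ → ℝ}
    (hGm : ∀ n, Continuous (G n)) (hGB : ∀ n, ∀ᵐ z ∂cylMeasure T, |G n z| ≤ B)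
    (hG : ∀ᵐ z ∂cylMeasure T, Tendsto (fun n => G n z) atTop (𝓝 (g z))) :
    Tendsto (fun n => ∫ z, (F n).ρ z.1 z.2 * G n z ∂cylMeasure T) atTop
      (𝓝 (∫ z, L.ρ z.1 z.2 * g z ∂cylMeasure T)) := by
  obtain ⟨K, hK⟩ : ∃ K : ℝ≥0, ∀ n,
      eLpNorm (fun z : ℝ × ℝ => (F n).ρ z.1 z.2) 2 (cylMeasure T) ≤ K := by
    refine ⟨_, fun n => eLpNorm_cyl_le (F n).cρ.cont.aestronglyMeasurable
      (K := (2 * potBound C).toNNReal) ?_⟩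
    filter_upwards [ae_restrict_mem measurableSet_Ioc] with t ht
    exact L.eLpNorm_two_density_le ht.1.le n
  have h := tendsto_integral_mul_mul (μ := cylMeasure T) (K := K) (B := B)
    (F := fun n z => (F n).ρ z.1 z.2) (G := G) (f := fun z => L.ρ z.1 z.2) (g := g)
  refine h (fun n => ?_) hK (fun ψ hψ => ?_) (fun n => ?_) hGB hG
  · exact (F n).cρ.cont.aestronglyMeasurable
  · exact L.tendsto_integral_density_mul_cyl hT (hψ.integrable one_le_two)
  · exact (hGm n).aestronglyMeasurable

theorem tendsto_cyl_pot₁_mul {T B : ℝ} (hT : 0 ≤ T) {G : ℕ → ℝ × ℝ → ℝ} {g : ℝ × ℝ → ℝ}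
    (hGm : ∀ n, Continuous (G n)) (hGB : ∀ n, ∀ᵐ z ∂cylMeasure T, |G n z| ≤ B)
    (hG : ∀ᵐ z ∂cylMeasure T, Tendsto (fun n => G n z) atTop (𝓝 (g z))) :
    Tendsto (fun n => ∫ z, (F n).pot₁ z.1 z.2 * G n z ∂cylMeasure T) atTop
      (𝓝 (∫ z, L.πx z.1 z.2 * g z ∂cylMeasure T)) := by
  obtain ⟨K, hK⟩ : ∃ K : ℝ≥0, ∀ n,
      eLpNorm (fun z : ℝ × ℝ => (F n).pot₁ z.1 z.2) 2 (cylMeasure T) ≤ K :=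
    ⟨_, fun n => eLpNorm_cyl_le (F n).cpot₁.cont.aestronglyMeasurable
      ((L.bounded n).linftyH1_pot T).eLpNorm_deriv_le⟩
  have hw : ∀ ψ, MemLp ψ 2 (cylMeasure T) →
      Tendsto (fun n => ∫ z, (F n).pot₁ z.1 z.2 * ψ z ∂cylMeasure T) atTop
        (𝓝 (∫ z, L.πx z.1 z.2 * ψ z ∂cylMeasure T)) := fun ψ hψ =>
    (L.tendsto_pot hT).2 (fun t x => ψ (t, x)) hψ.1 (lintegral_eLpNorm_slice_lt_top hψ)
  have h := tendsto_integral_mul_mul (μ := cylMeasure T) (K := K) (B := B)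
    (F := fun n z => (F n).pot₁ z.1 z.2) (G := G) (f := fun z => L.πx z.1 z.2) (g := g)
  refine h (fun n => ?_) hK hw (fun n => ?_) hGB hG
  · exact (F n).cpot₁.cont.aestronglyMeasurable
  · exact (hGm n).aestronglyMeasurable

theorem tendsto_torus_density_mul {t B : ℝ} (ht : 0 ≤ t) {G : ℕ → ℝ → ℝ} {g : ℝ → ℝ}
    (hGm : ∀ n, Continuous (G n)) (hGB : ∀ n x, |G n x| ≤ B)
    (hG : ∀ x, Tendsto (fun n => G n x) atTop (𝓝 (g x))) :
    Tendsto (fun n => ∫ x, (F n).ρ t x * G n x ∂torusMeasure) atTop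
      (𝓝 (∫ x, L.ρ t x * g x ∂torusMeasure)) :=
  tendsto_integral_mul_mul (F := fun n => (F n).ρ t)
    (fun n => ((F n).cρ.cont_x t).aestronglyMeasurable) (L.eLpNorm_two_density_le ht)
    (fun _ hψ => L.tendsto_integral_density_mul ht (hψ.mono_exponent one_le_two))
    (fun n => (hGm n).aestronglyMeasurable) (fun n => Eventually.of_forall (hGB n))
    (Eventually.of_forall hG)

/-- The balance laws pass to the limit, for transported quantities that converge pointwise. -/
theorem balance {g g₁ : ℕ → ℝ → ℝ → ℝ} (hg : ∀ n, (F n).Transported (g n) (g₁ n))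
    {f : ℝ → ℝ → ℝ} {A t : ℝ} (ht : 0 ≤ t) (hA : ∀ n, ∀ s ∈ Icc 0 t, ∀ x, |g n s x| ≤ A)
    (hf : ∀ s ∈ Icc 0 t, ∀ x, Tendsto (fun n => g n s x) atTop (𝓝 (f s x)))
    {φ φt φx : ℝ → ℝ → ℝ} (cφ : ContPeriodic φ) (cφt : ContPeriodic φt) (cφx : ContPeriodic φx)
    (tφ : IsTimeDeriv φ φt) (xφ : IsXDeriv φ φx) :
    (∫ x, L.ρ t x * (f t x * φ t x) ∂torusMeasure) - ∫ x, L.ρ 0 x * (f 0 x * φ 0 x) ∂torusMeasure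
      = (∫ z, L.ρ z.1 z.2 * (f z.1 z.2 * φt z.1 z.2) ∂cylMeasure t)
        + (∫ z, L.ρ z.1 z.2 * (L.w z.1 z.2 * f z.1 z.2 * φx z.1 z.2) ∂cylMeasure t)
        - ∫ z, L.πx z.1 z.2 * (f z.1 z.2 * φx z.1 z.2) ∂cylMeasure t := by
  have key : ∀ n, (∫ x, (F n).ρ t x * (g n t x * φ t x) ∂torusMeasure)
        - ∫ x, (F n).ρ 0 x * (g n 0 x * φ 0 x) ∂torusMeasure
      = (∫ z, (F n).ρ z.1 z.2 * (g n z.1 z.2 * φt z.1 z.2) ∂cylMeasure t)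
        + (∫ z, (F n).ρ z.1 z.2 * ((F n).w z.1 z.2 * g n z.1 z.2 * φx z.1 z.2) ∂cylMeasure t)
        - ∫ z, (F n).pot₁ z.1 z.2 * (g n z.1 z.2 * φx z.1 z.2) ∂cylMeasure t := by
    intro n
    have h := (hg n).integral_mul_eq cφ cφt cφx tφ xφ le_rfl ht
    have i1 : Integrable (fun z : ℝ × ℝ => (F n).ρ z.1 z.2 * (g n z.1 z.2 * φt z.1 z.2))
        (cylMeasure t) :=
      integrable_cyl_of_continuous ((F n).cρ.mul ((hg n).cg.mul cφt)).cont t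
    have i2 : Integrable (fun z : ℝ × ℝ => (F n).ρ z.1 z.2
        * ((F n).w z.1 z.2 * g n z.1 z.2 * φx z.1 z.2)) (cylMeasure t) :=
      integrable_cyl_of_continuous ((F n).cρ.mul (((F n).cw.mul (hg n).cg).mul cφx)).cont t
    have i3 : Integrable (fun z : ℝ × ℝ => (F n).pot₁ z.1 z.2 * (g n z.1 z.2 * φx z.1 z.2))
        (cylMeasure t) :=
      integrable_cyl_of_continuous ((F n).cpot₁.mul ((hg n).cg.mul cφx)).cont t
    have i12 : Integrable (fun z : ℝ × ℝ => (F n).ρ z.1 z.2 * (g n z.1 z.2 * φt z.1 z.2)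
        + (F n).ρ z.1 z.2 * ((F n).w z.1 z.2 * g n z.1 z.2 * φx z.1 z.2)) (cylMeasure t) :=
      i1.add i2
    have i123 : Integrable (fun z : ℝ × ℝ => (F n).ρ z.1 z.2 * (g n z.1 z.2 * φt z.1 z.2)
        + (F n).ρ z.1 z.2 * ((F n).w z.1 z.2 * g n z.1 z.2 * φx z.1 z.2)
        - (F n).pot₁ z.1 z.2 * (g n z.1 z.2 * φx z.1 z.2)) (cylMeasure t) := i12.sub i3
    rw [← integral_add i1 i2, ← integral_sub i12 i3, integral_cyl ht i123]
    simp only [integral_torus]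
    simp only [mul_assoc] at h ⊢
    rw [h]
    congr 1
    funext s
    congr 1
    funext x
    simp only [SmoothFlow.w, SmoothFlow.pot₁]
    ring
  -- the multipliers are uniformly bounded
  have hA0 : 0 ≤ A := (abs_nonneg _).trans (hA 0 0 ⟨le_rfl, ht⟩ 0)
  obtain ⟨B, hB0, hB⟩ := cφ.exists_bound t
  obtain ⟨Bt, hBt0, hBt⟩ := cφt.exists_bound t
  obtain ⟨Bx, hBx0, hBx⟩ := cφx.exists_bound t
  set W := 2 + C ^ 2 / densityBound C r₀ t + 2 * potBound C * (C ^ 2 / r₀)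
  have hW : ∀ n, ∀ s ∈ Icc 0 t, ∀ x, |(F n).w s x| ≤ W := fun n s hs x =>
    (L.bounded n).w_abs_le hs x
  have hW0 : 0 ≤ W := (abs_nonneg _).trans (hW 0 0 ⟨le_rfl, ht⟩ 0)
  have bd : ∀ {ψ : ℝ → ℝ → ℝ} {D : ℝ}, (∀ s ∈ Icc 0 t, ∀ x, |ψ s x| ≤ D) → ∀ (n : ℕ),
      ∀ s ∈ Icc 0 t, ∀ x, |g n s x * ψ s x| ≤ A * D := fun h n s hs x => by
    rw [abs_mul]; exact mul_le_mul (hA n s hs x) (h s hs x) (abs_nonneg _) hA0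
  have tor : ∀ s ∈ Icc 0 t, Tendsto (fun n => ∫ x, (F n).ρ s x * (g n s x * φ s x) ∂torusMeasure)
      atTop (𝓝 (∫ x, L.ρ s x * (f s x * φ s x) ∂torusMeasure)) := fun s hs =>
    L.tendsto_torus_density_mul hs.1 (fun n => ((hg n).cg.mul cφ).cont_x s)
      (fun n x => bd hB n s hs x) fun x => (hf s hs x).mul_const _
  have cyl : ∀ {P : ℝ → ℝ → Prop}, (∀ s ∈ Icc 0 t, ∀ x, P s x) → ∀ᵐ z ∂cylMeasure t, P z.1 z.2 :=
    fun h => by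
      filter_upwards [ae_cyl_mem t] with z hz using h _ (Ioc_subset_Icc_self hz.1) _
  refine tendsto_nhds_unique ((tor t ⟨ht, le_rfl⟩).sub (tor 0 ⟨le_rfl, ht⟩))
    (Tendsto.congr (fun n => (key n).symm) (Tendsto.sub (Tendsto.add ?_ ?_) ?_))
  · exact L.tendsto_cyl_density_mul ht (B := A * Bt) (fun n => ((hg n).cg.mul cφt).cont)
      (fun n => cyl fun s hs x => bd hBt n s hs x) (cyl fun s hs x => (hf s hs x).mul_const _)
  · refine L.tendsto_cyl_density_mul ht (B := W * A * Bx)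
      (fun n => (((F n).cw.mul (hg n).cg).mul cφx).cont)
      (fun n => cyl (P := fun s x => |(F n).w s x * g n s x * φx s x| ≤ W * A * Bx)
        fun s hs x => ?_) (cyl fun s hs x => ((L.tendsto_w hs.1 x).mul (hf s hs x)).mul_const _)
    rw [mul_assoc, abs_mul, mul_assoc W]
    exact mul_le_mul (hW n s hs x) (bd hBx n s hs x) (abs_nonneg _) hW0
  · exact L.tendsto_cyl_pot₁_mul ht (B := A * Bx) (fun n => ((hg n).cg.mul cφx).cont)
      (fun n => cyl fun s hs x => bd hBx n s hs x) (cyl fun s hs x => (hf s hs x).mul_const _)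

/-- The limit potential vanishes where the limit density is less than one. The product `ρ_n π_n` of
two weakly convergent sequences is handled by an integration by parts, since the mass coordinate
converges strongly. -/
theorem switching {T : ℝ} (hT : 0 ≤ T) :
    ∀ᵐ z ∂cylMeasure T, (1 - L.ρ z.1 z.2) * L.π z.1 z.2 = 0 := by
  have hB := two_le_potBound C
  have hπ := L.linftyH1_π T
  -- the mass coordinate, normalised to vanish at `x = 0`
  set a : ℕ → ℝ × ℝ → ℝ := fun n z => (F n).lagr z.1 z.2 - (F n).lagr z.1 0
  have ca : ∀ n, Continuous (a n) := fun n => (F n).clagr.sub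
    ((F n).clagr.comp (by fun_prop : Continuous fun z : ℝ × ℝ => (z.1, (0 : ℝ))))
  have h1 := L.tendsto_cyl_pot₁_mul hT (B := 2 * potBound C) (G := a)
    (g := fun z => L.M z.1 z.2 - L.M z.1 0) ca (fun n => by
      filter_upwards [ae_cyl_mem T] with z hz
      refine ((L.bounded n).abs_lagr_sub_le hz.1.1.le z.2 0).trans ?_
      rw [sub_zero, abs_of_pos hz.2.1]
      nlinarith [hz.2.2]) (by
      filter_upwards [ae_cyl_mem T] with z hz
      exact (L.tendsto_M hz.1.1.le _).sub (L.tendsto_M hz.1.1.le _))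
  have e1 : ∀ n, ∫ z, (F n).ρ z.1 z.2 * (F n).pot z.1 z.2 ∂cylMeasure T
      = (∫ x in (0 : ℝ)..1, (F n).ρ 0 x) * (F n).cumPot T 0
        - ∫ z, (F n).pot₁ z.1 z.2 * a n z ∂cylMeasure T := by
    intro n
    have c1 : Continuous fun z : ℝ × ℝ => (F n).ρ z.1 z.2 * (F n).pot z.1 z.2 :=
      ((F n).cρ.mul (F n).cpot).cont
    have c2 : Continuous fun z : ℝ × ℝ => (F n).pot₁ z.1 z.2 * a n z := (F n).cpot₁.cont.mul (ca n)
    have i : Integrable (fun z : ℝ × ℝ => (F n).ρ z.1 z.2 * (F n).pot z.1 z.2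
        + (F n).pot₁ z.1 z.2 * a n z) (cylMeasure T) := integrable_cyl_of_continuous (c1.add c2) T
    rw [eq_sub_iff_add_eq, ← integral_add (integrable_cyl_of_continuous c1 T)
      (integrable_cyl_of_continuous c2 T), integral_cyl hT i, SmoothFlow.cumPot,
      ← intervalIntegral.integral_const_mul]
    refine intervalIntegral.integral_congr fun s hs => ?_
    rw [uIcc_of_le hT] at hs
    simp only [integral_torus]
    have hd : ∀ x, HasDerivAt (fun x => ((F n).lagr s x - (F n).lagr s 0) * (F n).pot s x)
        ((F n).ρ s x * (F n).pot s x + (F n).pot₁ s x * a n (s, x)) x := fun x => by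
      refine HasDerivAt.congr_deriv ((((F n).xlagr s x).sub_const _).mul ((F n).xpot s x)) ?_
      simp only [a]
      ring
    have := intervalIntegral.integral_eq_sub_of_hasDerivAt (a := 0) (b := 1) (fun x _ => hd x)
      (((c1.add c2).comp (by fun_prop : Continuous fun x : ℝ => (s, x))).intervalIntegrable _ _)
    rw [← (F n).mass_eq hs.1, SmoothFlow.integral_density]
    have hp := (F n).cpot.per s 0
    rw [zero_add] at hp
    refine this.trans ?_
    simp only [hp]
    ring
  have h2 : Tendsto (fun n => ∫ z, (F n).ρ z.1 z.2 * (F n).pot z.1 z.2 ∂cylMeasure T) atTop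
      (𝓝 (L.mass * L.Q T 0 - ∫ z, L.πx z.1 z.2 * (L.M z.1 z.2 - L.M z.1 0) ∂cylMeasure T)) :=
    (((L.tendsto_mass le_rfl).mul (L.tendsto_Q hT 0)).sub h1).congr fun n => (e1 n).symm
  have iρπ : Integrable (fun z : ℝ × ℝ => L.ρ z.1 z.2 * L.π z.1 z.2) (cylMeasure T) :=
    hπ.integrable.bdd_mul (c := 1) L.measurable_ρ.aestronglyMeasurable
      (Eventually.of_forall fun z => L.abs_ρ_le _ _)
  have iπxM : Integrable (fun z : ℝ × ℝ => L.πx z.1 z.2 * (L.M z.1 z.2 - L.M z.1 0))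
      (cylMeasure T) :=
    hπ.memLp_deriv.integrable_mul (memLp_cyl_of_continuous (L.cM.sub
      (L.cM.comp (by fun_prop : Continuous fun z : ℝ × ℝ => (z.1, (0 : ℝ))))) 2 T)
  have e2 : ∫ z, L.ρ z.1 z.2 * L.π z.1 z.2 ∂cylMeasure T = L.mass * L.Q T 0
      - ∫ z, L.πx z.1 z.2 * (L.M z.1 z.2 - L.M z.1 0) ∂cylMeasure T := by
    have h3 := L.integral_π 0 T 0
    rw [L.Q_zero, sub_zero] at h3
    have i : Integrable (fun z : ℝ × ℝ => L.ρ z.1 z.2 * L.π z.1 z.2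
        + L.πx z.1 z.2 * (L.M z.1 z.2 - L.M z.1 0)) (cylMeasure T) := iρπ.add iπxM
    rw [eq_sub_iff_add_eq, ← integral_add iρπ iπxM, integral_cyl hT i, ← h3,
      ← intervalIntegral.integral_const_mul]
    refine intervalIntegral.integral_congr_ae ?_
    filter_upwards [(ae_restrict_iff' measurableSet_Ioc).1 hπ.h1,
      (ae_restrict_iff' measurableSet_Ioc).1 hπ.deriv_eq] with s g1 g2 hs
    rw [uIoc_of_le hT] at hs
    have hAC := g1 hs
    have hM : AbsolutelyContinuousOnInterval (fun x => L.M s x - L.M s 0) 0 1 :=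
      ((L.lipschitz_M s).sub (LipschitzWith.const (L.M s 0))).lipschitzOnWith.absolutelyContinuousOnInterval
    have h4 := hM.integral_deriv_mul_eq_sub (hAC.ac 0 1)
    have hp := L.periodic_π s 0
    have hm := L.M_add_one s 0
    rw [zero_add] at hp hm
    rw [hp, hm, sub_self, zero_mul, sub_zero, add_sub_cancel_left] at h4
    rw [← h4, ← integral_torus]
    refine integral_congr_ae ?_
    filter_upwards [g2 hs] with x hx
    simp only [deriv_sub_const, hx]
    rw [mul_comm (L.πx s x)]
    rfl
  have h3 : Tendsto (fun n => ∫ z, (F n).pot z.1 z.2 ∂cylMeasure T) atTop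
      (𝓝 (∫ z, L.π z.1 z.2 ∂cylMeasure T)) := by
    have h := lintegral_eLpNorm_slice_lt_top (T := T) (ψ := fun _ => 1) (memLp_const 1)
    have := (L.tendsto_pot hT).1 (fun _ _ => 1) aestronglyMeasurable_const h
    simpa only [mul_one] using this
  have h4 : Tendsto (fun n => ∫ z, (1 - (F n).ρ z.1 z.2) * (F n).pot z.1 z.2 ∂cylMeasure T) atTop
      (𝓝 0) := by
    have hz : Tendsto (fun n => (2 * potBound C) ^ 2 / (γ n + 1) * (cylMeasure T).real univ) atTop
        (𝓝 0) := by
      have := (tendsto_const_nhds (x := (2 * potBound C) ^ 2)).div_atTop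
        (tendsto_atTop_add_const_right _ (1 : ℝ) L.tendsto_γ)
      simpa using this.mul_const ((cylMeasure T).real univ)
    refine squeeze_zero_norm (fun n => norm_integral_le_of_norm_le_const ?_) hz
    filter_upwards [ae_cyl_mem T] with z hz
    exact (L.bounded n).abs_switching_le hz.1.1.le z.2
  have e3 : ∫ z, (1 - L.ρ z.1 z.2) * L.π z.1 z.2 ∂cylMeasure T = 0 := by
    refine tendsto_nhds_unique ?_ h4
    have h5 := h3.sub h2
    rw [← e2, ← integral_sub hπ.integrable iρπ] at h5
    simp only [sub_mul, one_mul]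
    refine h5.congr fun n => (integral_sub (integrable_cyl_of_continuous (F n).cpot.cont T)
      (integrable_cyl_of_continuous ((F n).cρ.mul (F n).cpot).cont T)).symm
  have h0 : ∀ z : ℝ × ℝ, 0 ≤ (1 - L.ρ z.1 z.2) * L.π z.1 z.2 := fun z =>
    mul_nonneg (sub_nonneg.2 (L.ρ_le_one _ _)) (L.π_nonneg _ _)
  refine (integral_eq_zero_iff_of_nonneg h0 ?_).1 e3
  exact (hπ.integrable.sub iρπ).congr (Eventually.of_forall fun z => by simp only [Pi.sub_apply]; ring)

end FlowLimit

theorem contDiff_deriv_snd {φ : ℝ → ℝ → ℝ} (h : ContDiff ℝ ∞ (Function.uncurry φ)) :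
    (∀ t x, HasDerivAt (φ t) (deriv (φ t) x) x) ∧
      ContDiff ℝ ∞ (Function.uncurry fun t x => deriv (φ t) x) := by
  have hd : ∀ t x, HasDerivAt (φ t) (fderiv ℝ (Function.uncurry φ) (t, x) (0, 1)) x := fun t x => by
    have h1 := (h.differentiable (by simp) (t, x)).hasFDerivAt
    have h2 : HasDerivAt (fun y : ℝ => (t, y)) ((0 : ℝ), (1 : ℝ)) x :=
      (hasDerivAt_const x t).prodMk (hasDerivAt_id x)
    exact h1.comp_hasDerivAt x h2
  refine ⟨fun t x => (hd t x).differentiableAt.hasDerivAt, ?_⟩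
  have e : (Function.uncurry fun t x => deriv (φ t) x)
      = fun z => fderiv ℝ (Function.uncurry φ) z (0, 1) := funext fun z => (hd z.1 z.2).deriv
  rw [e]
  exact (h.fderiv_right (m := ∞) (by simp)).clm_apply contDiff_const

theorem contDiff_deriv_fst {φ : ℝ → ℝ → ℝ} (h : ContDiff ℝ ∞ (Function.uncurry φ)) :
    (∀ t x, HasDerivAt (fun s => φ s x) (deriv (fun s => φ s x) t) t) ∧
      ContDiff ℝ ∞ (Function.uncurry fun t x => deriv (fun s => φ s x) t) := by
  have h1 : ContDiff ℝ ∞ (Function.uncurry fun x t => φ t x) :=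
    h.comp (contDiff_snd.prodMk contDiff_fst)
  obtain ⟨h2, h3⟩ := contDiff_deriv_snd h1
  exact ⟨fun t x => h2 x t, h3.comp (contDiff_snd.prodMk contDiff_fst)⟩

theorem TendstoWeakL1.comp {F : ℕ → ℝ → ℝ} {f : ℝ → ℝ} (h : TendstoWeakL1 F f) {σ : ℕ → ℕ}
    (hσ : Tendsto σ atTop atTop) : TendstoWeakL1 (fun n => F (σ n)) f :=
  ⟨fun _ => h.1 _, h.2.1, fun ψ hψ => (h.2.2 ψ hψ).comp hσ⟩

/-- Weak limits in `L¹(𝕋)` are unique. -/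
theorem TendstoWeakL1.ae_eq {F : ℕ → ℝ → ℝ} {f g : ℝ → ℝ} (hf : TendstoWeakL1 F f)
    (hg : TendstoWeakL1 F g) : f =ᵐ[torusMeasure] g := by
  refine Integrable.ae_eq_of_forall_setIntegral_eq _ _ hf.2.1 hg.2.1 fun s hs _ => ?_
  have hψ : MemLp (s.indicator fun _ => (1 : ℝ)) ⊤ torusMeasure :=
    (memLp_const 1).indicator hs
  have h := tendsto_nhds_unique (hf.2.2 _ hψ) (hg.2.2 _ hψ)
  have e : ∀ k : ℝ → ℝ, (fun x => k x * s.indicator (fun _ => (1 : ℝ)) x) = s.indicator k :=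
    fun k => funext fun x => by by_cases hx : x ∈ s <;> simp [hx]
  simpa only [e, integral_indicator hs] using h

theorem H1Bounded.h1Norm_le {K : ℝ≥0} {f : ℝ → ℝ} (h : H1Bounded K f) (hf : ∀ x, |f x| ≤ K) :
    h1Norm f ≤ 2 * K := by
  have h1 : ∫ x, f x ^ 2 ∂torusMeasure ≤ (K : ℝ) ^ 2 := by
    have := integral_mono (μ := torusMeasure) (f := fun x => f x ^ 2) (g := fun _ => (K : ℝ) ^ 2)
      (integrable_torus_of_continuous (h.continuous.pow 2)) (integrable_const _) fun x => by
        simp only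
        rw [← sq_abs (f x)]
        exact pow_le_pow_left₀ (abs_nonneg _) (hf x) 2
    simpa using this
  have h2 := h.integral_sq_le
  rw [← integral_torus] at h2
  refine Real.sqrt_le_iff.2 ⟨by positivity, ?_⟩
  have h3 : Integrable (fun x => f x ^ 2) torusMeasure :=
    integrable_torus_of_continuous (h.continuous.pow 2)
  rw [integral_add h3 h.memLp.integrable_sq]
  nlinarith [sq_nonneg (K : ℝ)]

theorem TendstoWeakStarLinftyH1.congr {T : ℝ} {F G : ℕ → ℝ → ℝ → ℝ} {f : ℝ → ℝ → ℝ}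
    (h : TendstoWeakStarLinftyH1 T F f) (e : ∀ n, ∀ t ∈ Ioc 0 T, F n t = G n t) :
    TendstoWeakStarLinftyH1 T G f := by
  obtain ⟨F', f', hF, hf, h1, h2⟩ := h
  have ec : ∀ n, ∀ᵐ z ∂cylMeasure T, F n z.1 z.2 = G n z.1 z.2 := fun n => by
    filter_upwards [ae_cyl_mem T] with z hz
    rw [e n z.1 hz.1]
  have et : ∀ n, ∀ᵐ t ∂timeMeasure T, F n t = G n t := fun n => by
    filter_upwards [ae_restrict_mem measurableSet_Ioc] with t ht using e n t ht
  refine ⟨F', f', fun n => ?_, hf, fun g hg hg' => (h1 g hg hg').congr fun n => ?_, h2⟩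
  · obtain ⟨⟨m1, m2, hd⟩, K, hK⟩ := hF n
    refine ⟨⟨m1.congr (ec n), m2, ?_⟩, K, ?_⟩
    · filter_upwards [hd, et n] with t ht ht'
      rwa [← ht']
    · filter_upwards [hK, et n] with t ht ht'
      rwa [← ht']
  · refine integral_congr_ae ?_
    filter_upwards [ec n] with z hz
    rw [hz]

namespace FlowLimit

variable {γ : ℕ → ℝ} {F : ∀ n, SmoothFlow (γ n)} {C r₀ m : ℝ} (L : FlowLimit F C r₀ m)

include L

theorem tendstoWeakL1_density : TendstoWeakL1 (fun n => (F n).ρ 0) (L.ρ 0) :=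
  ⟨fun n => integrable_torus_of_continuous ((F n).cρ.cont_x 0),
    Integrable.of_bound (L.measurable_ρ_slice 0).aestronglyMeasurable 1
      (Eventually.of_forall fun x => L.abs_ρ_le 0 x),
    fun _ hψ => L.tendsto_integral_density_mul le_rfl (hψ.mono_exponent le_top)⟩

theorem tendstoWeakL1_w : TendstoWeakL1 (fun n => (F n).w 0) (L.w 0) := by
  refine ⟨fun n => integrable_torus_of_continuous ((F n).cw.cont_x 0),
    integrable_torus_of_continuous (L.h1Bounded_w 0).continuous, fun ψ hψ => ?_⟩
  have hi : Integrable ψ torusMeasure := hψ.integrable le_top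
  refine tendsto_integral_of_dominated_convergence (fun x => linftyBound C r₀ 0 * ‖ψ x‖)
    (fun n => ((F n).cw.cont_x 0).aestronglyMeasurable.mul hψ.1) (hi.norm.const_mul _)
    (fun n => Eventually.of_forall fun x => ?_)
    (Eventually.of_forall fun x => (L.tendsto_w le_rfl x).mul_const _)
  rw [norm_mul]
  exact mul_le_mul_of_nonneg_right (((L.bounded n).w_abs_le ⟨le_rfl, le_rfl⟩ x).trans
    (le_linftyBound C r₀ 0).2.1) (norm_nonneg _)

theorem integrable_ρ_mul {T : ℝ} {g : ℝ × ℝ → ℝ} (hg : Continuous g) :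
    Integrable (fun z => L.ρ z.1 z.2 * g z) (cylMeasure T) :=
  (integrable_cyl_of_continuous hg T).bdd_mul (c := 1) L.measurable_ρ.aestronglyMeasurable
    (Eventually.of_forall fun _ => L.abs_ρ_le _ _)

theorem integrable_ρ_slice_mul (t : ℝ) {g : ℝ → ℝ} (hg : Continuous g) :
    Integrable (fun x => L.ρ t x * g x) torusMeasure :=
  (integrable_torus_of_continuous hg).bdd_mul (c := 1) (L.measurable_ρ_slice t).aestronglyMeasurable
    (Eventually.of_forall fun _ => L.abs_ρ_le _ _)

theorem integrable_πx_mul {T : ℝ} {g : ℝ × ℝ → ℝ} (hg : Continuous g) :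
    Integrable (fun z => L.πx z.1 z.2 * g z) (cylMeasure T) :=
  (L.linftyH1_π T).memLp_deriv.integrable_mul (memLp_cyl_of_continuous hg 2 T)

theorem mass_balance {ρ₀ : ℝ → ℝ} (hρ₀ : ρ₀ =ᵐ[torusMeasure] L.ρ 0) {φ : ℝ → ℝ → ℝ}
    (hφ : ContDiff ℝ ∞ (Function.uncurry φ)) (pφ : ∀ t, Function.Periodic (φ t) 1) {t : ℝ}
    (ht : 0 ≤ t) :
    - (∫ s in (0 : ℝ)..t, ∫ x, L.ρ s x * deriv (fun τ => φ τ x) s ∂torusMeasure)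
      + (∫ x, (L.ρ t x * φ t x - ρ₀ x * φ 0 x) ∂torusMeasure)
      - (∫ s in (0 : ℝ)..t, ∫ x, L.π s x * deriv (deriv (φ s)) x ∂torusMeasure)
      = ∫ s in (0 : ℝ)..t, ∫ x, L.ρ s x * L.w s x * deriv (φ s) x ∂torusMeasure := by
  obtain ⟨dt, st⟩ := contDiff_deriv_fst hφ
  obtain ⟨dx, sx⟩ := contDiff_deriv_snd hφ
  obtain ⟨-, sxx⟩ := contDiff_deriv_snd sx
  have cφ : ContPeriodic φ := ⟨hφ.continuous, pφ⟩
  have cφt : ContPeriodic fun t x => deriv (fun s => φ s x) t :=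
    ⟨st.continuous, fun t x => by simp only [pφ _ x]⟩
  have cφx : ContPeriodic fun t x => deriv (φ t) x := ⟨sx.continuous, fun t => periodic_deriv (pφ t)⟩
  have h := L.balance (fun n => (F n).transported_one) (f := fun _ _ => 1) (A := 1) ht (by simp)
    (fun _ _ _ => tendsto_const_nhds) cφ cφt cφx (fun t _ x => dt t x) dx
  simp only [one_mul, mul_one] at h
  have h1 : ∫ z, L.πx z.1 z.2 * deriv (φ z.1) z.2 ∂cylMeasure t
      = - ∫ s in (0 : ℝ)..t, ∫ x, L.π s x * deriv (deriv (φ s)) x ∂torusMeasure := by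
    rw [integral_cyl ht (L.integrable_πx_mul (g := fun z => deriv (φ z.1) z.2) cφx.cont),
      ← intervalIntegral.integral_neg]
    refine intervalIntegral.integral_congr_ae ?_
    filter_upwards [(ae_restrict_iff' measurableSet_Ioc).1 (L.linftyH1_π t).h1,
      (ae_restrict_iff' measurableSet_Ioc).1 (L.linftyH1_π t).deriv_eq] with s g1 g2 hs
    rw [uIoc_of_le ht] at hs
    have hs1 : ContDiff ℝ ∞ (deriv (φ s)) :=
      sx.comp (contDiff_const.prodMk contDiff_id : ContDiff ℝ ∞ fun x : ℝ => (s, x))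
    rw [(g1 hs).isWeakDeriv.parts _ hs1 (periodic_deriv (pφ s)), neg_neg]
    refine integral_congr_ae ?_
    filter_upwards [g2 hs] with x hx
    rw [hx]
  have e0 : ∫ x, (L.ρ t x * φ t x - ρ₀ x * φ 0 x) ∂torusMeasure
      = (∫ x, L.ρ t x * φ t x ∂torusMeasure) - ∫ x, L.ρ 0 x * φ 0 x ∂torusMeasure := by
    rw [← integral_sub (L.integrable_ρ_slice_mul t (cφ.cont_x t))
      (L.integrable_ρ_slice_mul 0 (cφ.cont_x 0))]
    refine integral_congr_ae ?_
    filter_upwards [hρ₀] with x hx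
    rw [hx]
  rw [integral_cyl ht (L.integrable_ρ_mul (g := fun z => deriv (fun s => φ s z.2) z.1) cφt.cont),
    integral_cyl ht (L.integrable_ρ_mul (g := fun z => L.w z.1 z.2 * deriv (φ z.1) z.2)
      (L.cw.mul cφx.cont)), h1] at h
  simp only [mul_assoc]
  rw [e0]
  linarith

theorem momentum_balance {ρ₀ w₀ : ℝ → ℝ} (hρ₀ : ρ₀ =ᵐ[torusMeasure] L.ρ 0)
    (hw₀ : w₀ =ᵐ[torusMeasure] L.w 0) {φ : ℝ → ℝ → ℝ}
    (hφ : ContDiff ℝ ∞ (Function.uncurry φ)) (pφ : ∀ t, Function.Periodic (φ t) 1) {t : ℝ}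
    (ht : 0 ≤ t) :
    - (∫ s in (0 : ℝ)..t, ∫ x, L.ρ s x * L.w s x * deriv (fun τ => φ τ x) s ∂torusMeasure)
      + (∫ x, (L.ρ t x * L.w t x * φ t x - ρ₀ x * w₀ x * φ 0 x) ∂torusMeasure)
      + (∫ s in (0 : ℝ)..t,
          ∫ x, (L.w s x * L.πx s x - L.ρ s x * L.w s x ^ 2) * deriv (φ s) x ∂torusMeasure)
      = 0 := by
  obtain ⟨dt, st⟩ := contDiff_deriv_fst hφ
  obtain ⟨dx, sx⟩ := contDiff_deriv_snd hφ
  have cφ : ContPeriodic φ := ⟨hφ.continuous, pφ⟩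
  have cφt : ContPeriodic fun t x => deriv (fun s => φ s x) t :=
    ⟨st.continuous, fun t x => by simp only [pφ _ x]⟩
  have cφx : ContPeriodic fun t x => deriv (φ t) x := ⟨sx.continuous, fun t => periodic_deriv (pφ t)⟩
  have cw := fun t => (L.h1Bounded_w t).continuous
  have h := L.balance (fun n => (F n).transported_w) (f := L.w) ht
    (fun n s hs x => (L.bounded n).w_abs_le hs x) (fun s hs x => L.tendsto_w hs.1 x) cφ cφt cφx
    (fun t _ x => dt t x) dx
  have i1 : Integrable (fun z : ℝ × ℝ => L.πx z.1 z.2 * (L.w z.1 z.2 * deriv (φ z.1) z.2))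
      (cylMeasure t) := L.integrable_πx_mul (L.cw.mul sx.continuous)
  have i2 : Integrable (fun z : ℝ × ℝ => L.ρ z.1 z.2
      * (L.w z.1 z.2 * L.w z.1 z.2 * deriv (φ z.1) z.2)) (cylMeasure t) :=
    L.integrable_ρ_mul ((L.cw.mul L.cw).mul sx.continuous)
  have i3 : Integrable (fun z : ℝ × ℝ => L.πx z.1 z.2 * (L.w z.1 z.2 * deriv (φ z.1) z.2)
      - L.ρ z.1 z.2 * (L.w z.1 z.2 * L.w z.1 z.2 * deriv (φ z.1) z.2)) (cylMeasure t) := i1.sub i2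
  have e0 : ∫ x, (L.ρ t x * L.w t x * φ t x - ρ₀ x * w₀ x * φ 0 x) ∂torusMeasure
      = (∫ x, L.ρ t x * (L.w t x * φ t x) ∂torusMeasure)
        - ∫ x, L.ρ 0 x * (L.w 0 x * φ 0 x) ∂torusMeasure := by
    rw [← integral_sub (L.integrable_ρ_slice_mul t (g := fun x => L.w t x * φ t x)
      ((cw t).mul (cφ.cont_x t))) (L.integrable_ρ_slice_mul 0 (g := fun x => L.w 0 x * φ 0 x)
      ((cw 0).mul (cφ.cont_x 0)))]
    refine integral_congr_ae ?_
    filter_upwards [hρ₀, hw₀] with x hx hx'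
    rw [hx, hx', mul_assoc, mul_assoc]
  have e1 : ∫ s in (0 : ℝ)..t,
      ∫ x, (L.w s x * L.πx s x - L.ρ s x * L.w s x ^ 2) * deriv (φ s) x ∂torusMeasure
      = (∫ z, L.πx z.1 z.2 * (L.w z.1 z.2 * deriv (φ z.1) z.2) ∂cylMeasure t)
        - ∫ z, L.ρ z.1 z.2 * (L.w z.1 z.2 * L.w z.1 z.2 * deriv (φ z.1) z.2) ∂cylMeasure t := by
    rw [← integral_sub i1 i2, integral_cyl ht i3]
    refine intervalIntegral.integral_congr fun s _ => ?_
    refine integral_congr_ae (Eventually.of_forall fun x => ?_)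
    simp only
    ring
  rw [integral_cyl ht (L.integrable_ρ_mul
    (g := fun z => L.w z.1 z.2 * deriv (fun s => φ s z.2) z.1) (L.cw.mul cφt.cont))] at h
  simp only [mul_assoc] at h e0 e1 ⊢
  rw [e0, e1]
  linarith

theorem isHardCongestionSolution {T : ℝ} (hT : 0 ≤ T) {ρ₀ w₀ : ℝ → ℝ}
    (hρ₀ : ρ₀ =ᵐ[torusMeasure] L.ρ 0) (hw₀ : w₀ =ᵐ[torusMeasure] L.w 0) :
    IsHardCongestionSolution T (densityBound C r₀ T) ρ₀ w₀ L.ρ L.w L.π L.πx where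
  density_periodic := L.periodic_ρ
  potential_periodic := L.periodic_π
  density_reg p _ _ := L.contWeakLp_ρ p T
  density_bdd := MemLp.of_bound L.measurable_ρ.aestronglyMeasurable 1
    (Eventually.of_forall fun _ => L.abs_ρ_le _ _)
  velocity_reg := L.contSobolev_w T
  velocity_cont := L.cw.continuousOn
  potential_reg := (L.linftyH1_π T).memLinftyH1
  mass _ hφ pφ _ ht := L.mass_balance hρ₀ hφ pφ ht.1
  momentum _ hφ pφ _ ht := L.momentum_balance hρ₀ hw₀ hφ pφ ht.1
  lower _ ht := ae_restrict_of_ae (L.le_ρ ht)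
  upper t _ := Eventually.of_forall (L.ρ_le_one t)
  switching := L.switching hT
  nonneg := Eventually.of_forall fun _ => L.π_nonneg _ _

end FlowLimit

end AwRascle

open AwRascle in
theorem theorem1p2 (C r₀ m : ℝ) (hr₀ : 0 < r₀) (hm : m < 1) :
    -- the lower bound `r T` and the bound `K T` on `[0,T]` depend on `C`, `r₀`, `m` and `T` only
    ∃ r K : ℝ → ℝ, (∀ T > 0, 0 < r T) ∧
      ∀ (γ : ℕ → ℝ) (ρ₀ u₀ : ℕ → ℝ → ℝ) (ρ u : ℕ → ℝ → ℝ → ℝ),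
        (∀ n, 0 < γ n) → Tendsto γ atTop atTop →
        (∀ n, AdmissibleData C r₀ m (γ n) (ρ₀ n) (u₀ n)) →
        (∀ n, IsGlobalRegularSolution (γ n) (ρ₀ n) (u₀ n) (ρ n) (u n)) →
        -- uniform bounds
        (∀ T > 0, ∀ᶠ n in atTop, ∀ t ∈ Icc 0 T,
          (∀ x, r T ≤ ρ n t x) ∧
          h1Norm (desiredVelocity (γ n) (ρ n t) (u n t)) ≤ K T ∧
          h1Norm (fun x => potential (γ n) (ρ n t x)) ≤ K T) ∧
        -- convergence of a subsequence to a weak solution of the hard-congestion system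
        ∀ ρ₀lim w₀lim : ℝ → ℝ,
          TendstoWeakL1 ρ₀ ρ₀lim →
          TendstoWeakL1 (fun n => desiredVelocity (γ n) (ρ₀ n) (u₀ n)) w₀lim →
          ∃ (σ : ℕ → ℕ) (ρlim wlim πlim πxlim : ℝ → ℝ → ℝ), StrictMono σ ∧
            ∀ T > 0,
              TendstoWeakStarLinfty T (fun k => ρ (σ k)) ρlim ∧
              TendstoWeakStarLinftyH1 T
                (fun k t => desiredVelocity (γ (σ k)) (ρ (σ k) t) (u (σ k) t)) wlim ∧
              TendstoUniformlyOn
                (fun k z => desiredVelocity (γ (σ k)) (ρ (σ k) z.1) (u (σ k) z.1) z.2)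
                (Function.uncurry wlim) atTop (Icc 0 T ×ˢ univ) ∧
              TendstoWeakStarLinftyH1 T
                (fun k t x => potential (γ (σ k)) (ρ (σ k) t x)) πlim ∧
              IsHardCongestionSolution T (r T) ρ₀lim w₀lim ρlim wlim πlim πxlim := by
  refine ⟨densityBound |C| r₀, fun T => 2 * linftyBound |C| r₀ T, fun T hT => ?_, ?_⟩
  · have := abs_nonneg C
    unfold densityBound
    positivity
  intro γ ρ₀ u₀ ρ u _ hγ hA hS
  obtain ⟨n₀, hn₀⟩ := eventually_atTop.1 (hγ.eventually_ge_atTop 1)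
  have hflow : ∀ n, ∃ F : SmoothFlow (γ (n + n₀)), ∀ t ≥ 0, F.ρ t = ρ (n + n₀) t ∧
      F.u t = u (n + n₀) t ∧ F.w t = desiredVelocity (γ (n + n₀)) (ρ (n + n₀) t) (u (n + n₀) t) :=
    fun n => (hS _).exists_smoothFlow (hn₀ _ (by omega)) hr₀ (hA _).lower
  choose F hF using hflow
  have hb : ∀ n, (F n).Bounded C r₀ m := fun n => by
    obtain ⟨e1, e2, e3⟩ := hF n 0 le_rfl
    rw [(hS _).density_init] at e1 e3
    rw [(hS _).velocity_init] at e2 e3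
    exact (hA _).bounded hr₀ hm e1 e2 e3
  have hpot : ∀ n, ∀ t ≥ 0, (F n).pot t = fun x => potential (γ (n + n₀)) (ρ (n + n₀) t x) :=
    fun n t ht => funext fun x => by rw [SmoothFlow.pot_eq, (hF n t ht).1]
  rw [abs_of_nonneg (hb 0).C_nonneg]
  refine ⟨fun T hT => ?_, fun ρ₀lim w₀lim hρ₀ hw₀ => ?_⟩
  · filter_upwards [eventually_ge_atTop n₀] with n hn t ht
    obtain ⟨k, rfl⟩ := Nat.exists_eq_add_of_le' hn
    obtain ⟨e1, -, e3⟩ := hF k t ht.1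
    have hK := le_linftyBound C r₀ T
    refine ⟨fun x => ?_, ?_, ?_⟩
    · rw [← e1]
      exact (hb k).densityBound_le ht x
    · rw [← e3]
      exact (((hb k).h1Bounded_w ht.1).mono hK.1).h1Norm_le
        fun x => ((hb k).w_abs_le ht x).trans hK.2.1
    · rw [← hpot k t ht.1]
      refine (((hb k).h1Bounded_pot ht.1).mono hK.1).h1Norm_le fun x => ?_
      rw [abs_of_pos ((F k).pot_pos t x)]
      exact ((hb k).pot_le ht.1 x).trans hK.2.2
  · obtain ⟨σ, hσ, ⟨L⟩⟩ := exists_flowLimit F hb (hγ.comp (tendsto_add_atTop_nat n₀))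
    have hτ : StrictMono fun k => σ k + n₀ := fun a b hab => Nat.add_lt_add_right (hσ hab) n₀
    have init : ∀ n, (F (σ n)).ρ 0 = ρ₀ (σ n + n₀) ∧
        (F (σ n)).w 0 = desiredVelocity (γ (σ n + n₀)) (ρ₀ (σ n + n₀)) (u₀ (σ n + n₀)) := fun n => by
      obtain ⟨e1, -, e3⟩ := hF (σ n) 0 le_rfl
      rw [(hS _).density_init] at e1 e3
      rw [(hS _).velocity_init] at e3
      exact ⟨e1, e3⟩
    have eρ : ρ₀lim =ᵐ[torusMeasure] L.ρ 0 := by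
      have h1 := hρ₀.comp hτ.tendsto_atTop
      have h2 := L.tendstoWeakL1_density
      simp only [(init _).1] at h2
      exact h1.ae_eq h2
    have ew : w₀lim =ᵐ[torusMeasure] L.w 0 := by
      have h1 := hw₀.comp hτ.tendsto_atTop
      have h2 := L.tendstoWeakL1_w
      simp only [(init _).2] at h2
      exact h1.ae_eq h2
    refine ⟨fun k => σ k + n₀, L.ρ, L.w, L.π, L.πx, hτ, fun T hT => ⟨fun g hg => ?_, ?_, ?_, ?_,
      L.isHardCongestionSolution hT.le eρ ew⟩⟩
    · refine (L.tendsto_integral_density_mul_cyl hT.le hg).congr fun n => integral_congr_ae ?_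
      filter_upwards [ae_cyl_mem T] with z hz
      rw [(hF (σ n) z.1 hz.1.1.le).1]
    · exact TendstoWeakStarLinftyH1.congr ⟨_, _,
        fun n => ((hb (σ n)).linftyH1_w T).memLinftyH1, (L.linftyH1_w T).memLinftyH1,
        L.tendsto_w_linftyL2 hT.le⟩ fun n t ht => (hF (σ n) t ht.1.le).2.2
    · refine (L.tendstoUniformlyOn_w T).congr (Eventually.of_forall fun n z hz => ?_)
      exact congrFun (hF (σ n) z.1 hz.1.1).2.2 z.2
    · exact TendstoWeakStarLinftyH1.congr ⟨_, _,
        fun n => ((hb (σ n)).linftyH1_pot T).memLinftyH1, (L.linftyH1_π T).memLinftyH1,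
        L.tendsto_pot hT.le⟩ fun n t ht => hpot (σ n) t ht.1.le
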